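/- **Setting.** Let $d\ge 2$, let $S^d\subset\mathbb R^{d+1}$ be the unit sphere with its standard metric $g$ and geodesic distance, $\mathrm{Vol}_g$ its canonical measure, $B(x,r)$ its open geodesic balls, and $T(x)=-x$. Fix $0<\delta_0<\delta_1<1$. For every $h\in\mathbb N$ let $\varepsilon_h,\eta_h>0$ with $\rho_h:=\varepsilon_h\eta_h<1$, where $\eta_h\to0$, $\varepsilon_h\to0$, $\eta_h/\varepsilon_h\to0$. Let $(x_i)_{i\in I_h}$ be a finite $\eta_h$-packing of $S^d$: the balls $B(x_i,\eta_h)$ are pairwise disjoint and $\bigcup_iB(x_i,2\eta_h)=S^d$. Let $\bar x_i=-x_i$, $r_{\varepsilon_h}(t)=\rho_h\bigl(\delta_1t+\delta_0(1-t)\bigr)$, $r_h=\arcsin r_{\varepsilon_h}(0)$, $R_h=\arcsin r_{\varepsilon_h}(1)$, and assume that the closed balls of radius $R_h$ about all the points $x_i,\bar x_i$ ($i\in I_h$) are pairwise disjoint. Put $$E_h=\bigcup_i\bigl(\overline{B(x_i,r_h)}\cup\overline{B(\bar x_i,r_h)}\bigr),\quad U_h=\bigcup_i\bigl(B(x_i,R_h)\cup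 B(\bar x_i,R_h)\bigr),\quad M_h=S^d\setminus E_h .$$ *Handles.* Let $H_h=[-1,1]\times S^{d-1}$ with the metric $\rho_h^2(dy^2+d\omega^2)$, that is, a cylinder of radius $\rho_h$. In orthonormal cylindrical coordinates $(y,r\omega)$ of $\mathbb R^{d+1}$ in which $x_i=(1,0)$, let $$\varphi_{i,h}(y,\omega)=\operatorname{sgn}(y)\Bigl(\sqrt{1-r_{\varepsilon_h}(|y|)^2},\; r_{\varepsilon_h}(|y|)\,\omega\Bigr),\qquad y\ne0 .$$ $N_h$ is the quotient of the disjoint union of $S^d\setminus E_h$ and of one copy of $H_h$ for every $i\in I_h$, in which each point $z$ of the $i$-th handle with $y\ne0$ is identified with $\varphi_{i,h}(z)$; its metric $g^{N_h}$ is $g$ on $S^d\setminus U_h$ and the metric of $H_h$ on the handles. The metric $g_h$ on $\overline M_h$ is $g$ on $S^d\setminus U_h$ and, near $x_i$ and $\bar x_i$ in $U_h$, the pull-back of the metric of $H_h$ under $\varphi_{i,h}^{-1}$. *Conventions.* For a Lipschitz Riemannian manifold $X$, $\mathcal D_X(u)=\int_X g^{ij}D_iu\,D_ju\,d\mathrm{Vol}$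 for Lipschitz $u$; $H^1(X)\subset L^2(X)$ is the closure of the Lipschitz functions in the norm $(\mathcal D_X(u)+\|u\|_{L^2}^2)^{1/2}$; $\mathcal D_X$ is extended by continuity to $H^1(X)$ and by $+\infty$ to $L^2(X)\setminus H^1(X)$. The capacity of $B\subset X$ is the infimum of $\mathcal D_X(u)+\|u\|^2_{L^2}$ over the $u\in H^1(X)$ with $u\ge1$ a.e. in a neighbourhood of $B$; every $u\in H^1(X)$ is identified with its quasi-continuous representative. The measure $\infty_S$ is $0$ on the Borel sets $B$ for which $B\cap S$ has capacity zero and $+\infty$ on the others. A relaxed manifold $(X,T,\nu)$ consists of $X$, an involutive isometry $T$ of $X$ whose fixed-point set is a (possibly empty) submanifold, and a Borel measure $\nu$ vanishing on sets of capacity zero. It represents a manifold $N$ if there is an isometry $I$ of $L^2(N)$ onto $L^2(X)$ such that for all $v\in L^2(N)$, with $u=I(v)$, $$\mathcal D_N(v)=\mathcal D_X(u)+\int_X[u(x)-u(T(x))]^2\,\nu(dx);$$ in particular $v\in H^1(N)$ if and only if $u\in H^1(X)$ and $u-u\circ T\in L^2(\nu)$. **Proposition.** (i) For every $h$, $(\overline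 M_h,g_h,T,\infty_{\partial M_h})$ is a relaxed manifold (and $T$ has no fixed points), and it represents $(N_h,g^{N_h})$. (ii) The sequence $(M_h,g_h)$ satisfies: * (a$_1$) there is $\Lambda_o>0$ such that for all $h$, all $x\in M_h$ and all $\xi\in T_xS^d$: $\;0\le\Lambda_o^{-1}g(\xi,\xi)\le g_h(\xi,\xi)\le\Lambda_o\,g(\xi,\xi)$; * (a$_2$) there are linear extension operators $\pi_h:H^1(M_h,g_h)\to H^1(S^d,g)$ (so $\pi_hu=u$ a.e. on $M_h$) and a constant $c_o$ independent of $h$ with $\|\pi_hu\|_{H^1(S^d,g)}\le c_o\|u\|_{H^1(M_h,g_h)}$ for all $u\in H^1(M_h,g_h)$; * (a$_3$) $1_{M_h}\to1$ in $\mathrm{Vol}_g$-measure on $S^d$; * (a$_4$) $T(M_h)=M_h$; * (a$_5$) $\mathrm{Vol}_{g_h}$ is $T$-invariant, i.e. $\sqrt{\det g_h}(x)=\sqrt{\det g_h}(T(x))\,\bigl|\det\frac{\partial T}{\partial x}(x)\bigr|$ for a.e. $x\in M_h$; * (a$_6$) $g_h$ is $T$-invariant, i.e. $g_h^{ij}(T(x))=\sum_{k,\ell}\frac{\partial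 T^i}{\partial x_\ell}(x)\frac{\partial T^j}{\partial x_k}(x)\,g_h^{\ell k}(x)$ for a.e. $x\in M_h$. -/

import Mathlib

open MeasureTheory Filter Topology Set InnerProductGeometry
open scoped ENNReal NNReal

noncomputable section

/-! ### Lipschitz Riemannian manifolds and their `L²`, `H¹` and capacity theory -/

/-- The data of a Lipschitz Riemannian manifold (with or without boundary) on which its analysis
rests: the underlying space, its Lipschitz functions, the canonical measure of the metric, and the
Dirichlet functional `∫ g^{ij} D_i u D_j u dVol_g` of a Lipschitz function `u`. The manifolds used
below are built from their metric tensors. -/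
structure LipRiem where
  Point : Type
  [top : TopologicalSpace Point]
  [meas : MeasurableSpace Point]
  lip : Set (Point → ℝ)
  vol : Measure Point
  dirichlet : (Point → ℝ) → ℝ≥0∞

attribute [instance] LipRiem.top LipRiem.meas

namespace LipRiem

variable (X : LipRiem)

/-- The space `L²(X, Vol)`. -/
abbrev L2 : Type := Lp ℝ 2 X.vol

/-- `w` is a sequence of Lipschitz functions that is Cauchy for the Dirichlet functional and
converges to `u` in `L²`; that is, `w` converges to `u` in the norm of `H¹`. -/
def IsH1Seq (w : ℕ → X.Point → ℝ) (u : X.L2) : Prop :=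
  (∀ k, w k ∈ X.lip) ∧
  Tendsto (fun k => ∫⁻ p, ENNReal.ofReal ((w k p - u p) ^ 2) ∂X.vol) atTop (𝓝 0) ∧
  Tendsto (fun kl : ℕ × ℕ => X.dirichlet (fun p => w kl.1 p - w kl.2 p)) atTop (𝓝 0)

/-- `u` belongs to `H¹(X)`, the closure of the Lipschitz functions in the norm of `H¹`. -/
def MemH1 (u : X.L2) : Prop := ∃ w, X.IsH1Seq w u

/-- The Dirichlet functional on `L²(X)`: its extension by continuity on `H¹(X)`,
and `+∞` outside `H¹(X)`. -/
def energy (u : X.L2) : ℝ≥0∞ :=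
  ⨅ (w : ℕ → X.Point → ℝ) (_ : X.IsH1Seq w u), limsup (fun k => X.dirichlet (w k)) atTop

/-- The norm of `H¹(X)` (equal to `+∞` outside `H¹(X)`). -/
def h1Norm (u : X.L2) : ℝ≥0∞ :=
  (X.energy u + ENNReal.ofReal (‖u‖ ^ 2)) ^ (1 / 2 : ℝ)

/-- The (Sobolev) capacity of a subset of `X`. -/
def cap (B : Set X.Point) : ℝ≥0∞ :=
  ⨅ (u : X.L2) (_ : ∃ V : Set X.Point, IsOpen V ∧ B ⊆ V ∧ ∀ᵐ p ∂X.vol, p ∈ V → 1 ≤ u p),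
    (X.energy u + ENNReal.ofReal (‖u‖ ^ 2))

/-- `ũ` is a quasi-continuous representative of `u`. For `u` in `H¹(X)` it exists and it is
determined up to a set of capacity zero. -/
def IsQuasiRep (u : X.L2) (ũ : X.Point → ℝ) : Prop :=
  (∀ᵐ p ∂X.vol, ũ p = u p) ∧
  ∀ ε : ℝ≥0∞, 0 < ε → ∃ V : Set X.Point, IsOpen V ∧ X.cap V < ε ∧ ContinuousOn ũ Vᶜ

/-- The class of Borel measures that vanish on the sets of capacity zero. -/
def MemM0 (ν : Measure X.Point) : Prop :=
  ∀ B : Set X.Point, MeasurableSet B → X.cap B = 0 → ν B = 0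

/-- `B` is negligible for the capacity: it is covered by countably many sets of capacity zero.
As the capacity is countably subadditive, this says that `B` has capacity zero. -/
def IsPolar (B : Set X.Point) : Prop :=
  ∃ c : Set (Set X.Point), c.Countable ∧ (∀ C ∈ c, X.cap C = 0) ∧ B ⊆ ⋃₀ c

lemma isPolar_empty : X.IsPolar ∅ := ⟨∅, by simp, by simp, by simp⟩

variable {X} in
lemma IsPolar.mono {A B : Set X.Point} (h : X.IsPolar B) (hAB : A ⊆ B) : X.IsPolar A := by
  obtain ⟨c, h1, h2, h3⟩ := h
  exact ⟨c, h1, h2, hAB.trans h3⟩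

variable {X} in
lemma IsPolar.iUnion {B : ℕ → Set X.Point} (h : ∀ n, X.IsPolar (B n)) :
    X.IsPolar (⋃ n, B n) := by
  choose c h1 h2 h3 using h
  refine ⟨⋃ n, c n, countable_iUnion h1, ?_, ?_⟩
  · intro C hC
    obtain ⟨n, hn⟩ := mem_iUnion.1 hC
    exact h2 n C hn
  · refine iUnion_subset fun n => (h3 n).trans (sUnion_subset_sUnion (subset_iUnion c n))

open scoped Classical in
/-- The outer measure behind `inftyMeasure`. -/
def inftyOuter (S : Set X.Point) : OuterMeasure X.Point where
  measureOf B := if X.IsPolar (B ∩ S) then 0 else ⊤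
  empty := by simp [isPolar_empty]
  mono {A B} hAB := by
    by_cases h : X.IsPolar (B ∩ S)
    · simp [h, h.mono (inter_subset_inter_left S hAB)]
    · simp [h]
  iUnion_nat B _ := by
    by_cases h : ∀ n, X.IsPolar (B n ∩ S)
    · have : X.IsPolar ((⋃ n, B n) ∩ S) := by
        rw [iUnion_inter]; exact IsPolar.iUnion h
      simp [this]
    · push Not at h
      obtain ⟨n, hn⟩ := h
      have : (⊤ : ℝ≥0∞) ≤ ∑' n, if X.IsPolar (B n ∩ S) then 0 else ⊤ := by
        refine le_trans ?_ (ENNReal.le_tsum n)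
        simp [hn]
      exact le_trans le_top this

/-- The measure `∞_S`: it is `0` on the Borel sets `B` such that `B ∩ S` has capacity zero, and
`+∞` on the other ones. -/
def inftyMeasure (S : Set X.Point) : Measure X.Point :=
  (X.inftyOuter S).toMeasure (by
    intro B _
    rw [OuterMeasure.isCaratheodory_iff_le]
    intro A
    by_cases h : X.IsPolar (A ∩ S)
    · have h1 : X.IsPolar (A ∩ B ∩ S) := h.mono (by intro p hp; exact ⟨hp.1.1, hp.2⟩)
      have h2 : X.IsPolar (A \ B ∩ S) := h.mono (by intro p hp; exact ⟨hp.1.1, hp.2⟩)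
      classical
      change (if X.IsPolar (A ∩ B ∩ S) then (0 : ℝ≥0∞) else ⊤) +
        (if X.IsPolar (A \ B ∩ S) then (0 : ℝ≥0∞) else ⊤) ≤ _
      simp [h1, h2]
    · classical
      change _ ≤ (if X.IsPolar (A ∩ S) then (0 : ℝ≥0∞) else ⊤)
      simp [h])

/-- The nonlocal term `∫ [u(x) - u(T x)]² ν(dx)`, computed with the quasi-continuous
representative of `u`; its value does not depend on the representative when `ν` vanishes on the
sets of capacity zero (and it is set to be `+∞` if there is none, so that `u` is not in `H¹`). -/
def nonlocal (T : X.Point → X.Point) (ν : Measure X.Point) (u : X.L2) : ℝ≥0∞ :=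
  ⨅ (ũ : X.Point → ℝ) (_ : X.IsQuasiRep u ũ), ∫⁻ p, ENNReal.ofReal ((ũ p - ũ (T p)) ^ 2) ∂ν

/-- `(X, T, ν)` is a relaxed Lipschitz manifold whose involutive isometry `T` has no fixed points
(so that the fixed-point set is the empty submanifold). The map `T` is an isometry: it is a
homeomorphism which preserves the Lipschitz functions, the canonical measure and
the Dirichlet functional. -/
def IsRelaxedManifold (T : X.Point → X.Point) (ν : Measure X.Point) : Prop :=
  Function.Involutive T ∧ Continuous T ∧ (∀ p, T p ≠ p) ∧
  X.vol.map T = X.vol ∧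
  (∀ u ∈ X.lip, u ∘ T ∈ X.lip ∧ X.dirichlet (u ∘ T) = X.dirichlet u) ∧
  X.MemM0 ν

/-- The manifold `N` is represented by the relaxed manifold `(X, T, ν)`: there is an isometry `I`
of `L²(N)` onto `L²(X)` such that, for `u = I v`,
`D_N(v) = D_X(u) + ∫ [u(x) - u(T x)]² ν(dx)`, where the Dirichlet functionals
are `+∞` outside `H¹`. -/
def IsRepresentedBy (N X : LipRiem) (T : X.Point → X.Point) (ν : Measure X.Point) : Prop :=
  ∃ I : N.L2 ≃ₗᵢ[ℝ] X.L2, ∀ v : N.L2, N.energy v = X.energy (I v) + X.nonlocal T ν (I v)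

end LipRiem

/-! ### Domains of the sphere with a metric tensor -/

/-- The Euclidean space `ℝ^{d+1}` that contains the sphere `S^d`. -/
abbrev Amb (d : ℕ) : Type := EuclideanSpace ℝ (Fin (d + 1))

/-- Cylindrical coordinates `(y, r ω)` on `ℝ^{d+1}`. -/
abbrev Cyl (d : ℕ) : Type := WithLp 2 (ℝ × EuclideanSpace ℝ (Fin d))

/-- The unit sphere `S^d`. -/
abbrev sph (d : ℕ) : Set (Amb d) := Metric.sphere (0 : Amb d) 1

/-- The canonical measure `Vol_g` of the standard metric of `S^d`, as a measure on `ℝ^{d+1}`. -/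
def sphVol (d : ℕ) : Measure (Amb d) :=
  ((volume : Measure (Amb d)).toSphere).map Subtype.val

/-- The open geodesic ball of `S^d`. -/
def openCap {d : ℕ} (x : Amb d) (r : ℝ) : Set (Amb d) := {z | z ∈ sph d ∧ angle z x < r}

/-- The closed geodesic ball of `S^d`. -/
def closedCap {d : ℕ} (x : Amb d) (r : ℝ) : Set (Amb d) := {z | z ∈ sph d ∧ angle z x ≤ r}

/-- A tensor field of type `(0,2)`: `g x ξ ζ` for `ξ`, `ζ` tangent to the sphere at `x`. -/
abbrev Tensor (d : ℕ) : Type := Amb d → Amb d → Amb d → ℝ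

/-- The standard metric of `S^d`. -/
def roundMetric (d : ℕ) : Tensor d := fun _ ξ ζ => inner ℝ ξ ζ

/-- An orthonormal basis (for the standard metric) of the tangent space `x^⊥` of `S^d` at `x`. -/
def tangentFrame {d : ℕ} (x : Amb d) : Fin d → Amb d :=
  haveI : Fact (Module.finrank ℝ (Amb d) = d + 1) := ⟨by simp⟩
  open scoped Classical in
  if hx : x ≠ 0 then fun i => (OrthonormalBasis.fromOrthogonalSpanSingleton (𝕜 := ℝ) d hx i : Amb d)
  else 0

/-- The matrix `g_{ij}(x)` of a metric in the basis `tangentFrame x`. -/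
def metricMatrix {d : ℕ} (g : Tensor d) (x : Amb d) : Matrix (Fin d) (Fin d) ℝ :=
  Matrix.of fun i j => g x (tangentFrame x i) (tangentFrame x j)

/-- The inverse matrix `g^{ij}(x)`. -/
def metricInv {d : ℕ} (g : Tensor d) (x : Amb d) : Matrix (Fin d) (Fin d) ℝ := (metricMatrix g x)⁻¹

/-- The local density `√det g`; as the basis is orthonormal for the standard metric, this is the
density of `Vol_g` with respect to the canonical measure of the standard metric. -/
def volDensity {d : ℕ} (g : Tensor d) (x : Amb d) : ℝ := √(metricMatrix g x).det

/-- `g^{ij} D_i f D_j f` at the point `x`. -/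
def gradSq {d : ℕ} (g : Tensor d) (f : Amb d → ℝ) (x : Amb d) : ℝ :=
  ∑ i, ∑ j, metricInv g x i j * fderiv ℝ f x (tangentFrame x i) * fderiv ℝ f x (tangentFrame x j)

/-- The extension, constant along the rays, of a function on a subset `A` of the sphere;
it is used to differentiate the function. -/
def homExt {d : ℕ} (A : Set (Amb d)) (u : A → ℝ) (z : Amb d) : ℝ :=
  open scoped Classical in if h : ‖z‖⁻¹ • z ∈ A then u ⟨_, h⟩ else 0

/-- The domain `A` of the sphere with the metric `g`. -/
def region {d : ℕ} (A : Set (Amb d)) (g : Tensor d) : LipRiem where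
  Point := A
  lip := {u | ∃ K : ℝ≥0, LipschitzWith K u}
  vol := ((sphVol d).comap Subtype.val).withDensity fun x => ENNReal.ofReal (volDensity g x)
  dirichlet u := ∫⁻ x : A, ENNReal.ofReal (gradSq g (homExt A u) x * volDensity g x)
    ∂((sphVol d).comap Subtype.val)

/-- The sphere `S^d` with its standard metric. -/
def sphereMfd (d : ℕ) : LipRiem := region (sph d) (roundMetric d)

/-- The matrix `∂T/∂x` of the differential of the antipodal map `T` at `x`, in the bases
`tangentFrame x` and `tangentFrame (T x)`. -/
def antipodalJacobian {d : ℕ} (x : Amb d) : Matrix (Fin d) (Fin d) ℝ :=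
  Matrix.of fun i j => inner ℝ (tangentFrame (-x) i)
    (fderiv ℝ (fun z : Amb d => -z) x (tangentFrame x j))

/-! ### Handles -/

/-- Finitely many handles to be attached to `S^d`. The centers `x_i` form an `η`-packing of `S^d`.
The handle is the cylinder `[-1,1] × S^{d-1}` with the metric
`(ε η)² (dy² + dω²)`, and its profile is `r(t) = δ₁ ε η t + δ₀ ε η (1 - t)`. The `i`-th isometry
`frame i` is a choice of cylindrical coordinates in which `x_i = (1, 0)`. The handles are attached
at mutually disjoint places. -/
structure HandleConfig (d : ℕ) (δ₀ δ₁ : ℝ) where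
  m : ℕ
  frame : Fin m → Cyl d ≃ₗᵢ[ℝ] Amb d
  ε : ℝ
  η : ℝ
  ε_pos : 0 < ε
  η_pos : 0 < η
  scale_lt : ε * η < 1
  packing_disjoint : ∀ i j, i ≠ j →
    Disjoint (openCap (frame i (WithLp.toLp 2 (1, 0))) η)
      (openCap (frame j (WithLp.toLp 2 (1, 0))) η)
  packing_cover : ⋃ i, openCap (frame i (WithLp.toLp 2 (1, 0))) (2 * η) = sph d
  caps_disjoint : ∀ i j, i ≠ j →
    Disjoint (closedCap (frame i (WithLp.toLp 2 (1, 0))) (Real.arcsin (δ₁ * (ε * η))))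
      (closedCap (frame j (WithLp.toLp 2 (1, 0))) (Real.arcsin (δ₁ * (ε * η)))) ∧
    Disjoint (closedCap (frame i (WithLp.toLp 2 (1, 0))) (Real.arcsin (δ₁ * (ε * η))))
      (closedCap (-frame j (WithLp.toLp 2 (1, 0))) (Real.arcsin (δ₁ * (ε * η))))

namespace HandleConfig

variable {d : ℕ} {δ₀ δ₁ : ℝ} (C : HandleConfig d δ₀ δ₁)

/-- The center `x_i`; its antipode is `-x_i`. -/
def center (i : Fin C.m) : Amb d := C.frame i (WithLp.toLp 2 (1, 0))

/-- The radius of the handles. -/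
def ρ : ℝ := C.ε * C.η

/-- The profile of the handles. -/
def profile (t : ℝ) : ℝ := δ₁ * C.ρ * t + δ₀ * C.ρ * (1 - t)

/-- The inner radius `r_h`. -/
def rIn : ℝ := Real.arcsin (C.profile 0)

/-- The outer radius `R_h`. -/
def rOut : ℝ := Real.arcsin (C.profile 1)

/-- The holes `E_h`. -/
def E : Set (Amb d) := ⋃ i, (closedCap (C.center i) C.rIn ∪ closedCap (-C.center i) C.rIn)

/-- The open set `U_h`, which contains the holes and the places of attachment. -/
def U : Set (Amb d) := ⋃ i, (openCap (C.center i) C.rOut ∪ openCap (-C.center i) C.rOut)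

/-- The domain `M_h`, the sphere minus the holes. -/
def M : Set (Amb d) := sph d \ C.E

/-- The closure of `M_h` in the sphere. -/
def Mbar : Set (Amb d) :=
  sph d \ ⋃ i, (openCap (C.center i) C.rIn ∪ openCap (-C.center i) C.rIn)

/-- The handle `[-1,1] × S^{d-1}`, without its metric. -/
abbrev Handle (d : ℕ) : Type :=
  Icc (-1 : ℝ) 1 × Metric.sphere (0 : EuclideanSpace ℝ (Fin d)) 1

/-- The attaching map
`φ_i(y, ω) = (sgn(y) √(1 - r(|y|)²), sgn(y) r(|y|) ω)` of the `i`-th handle, used for `y ≠ 0`. -/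
def φ (i : Fin C.m) (p : Handle d) : Amb d :=
  C.frame i (WithLp.toLp 2
    (Real.sign p.1 * √(1 - C.profile |(p.1 : ℝ)| ^ 2),
      (Real.sign p.1 * C.profile |(p.1 : ℝ)|) • (p.2 : EuclideanSpace ℝ (Fin d))))

/-- The inverse of `φ_i` on `U_h \ E_h` near `± x_i`: the point with cylindrical coordinates
`(a, r ω)` is sent to `sgn(a) (t, ω)` where `t` is the solution of `profile t = r`. -/
def φInv (i : Fin C.m) (x : Amb d) : Cyl d :=
  Real.sign ((C.frame i).symm x).fst •
    WithLp.toLp 2 ((‖((C.frame i).symm x).snd‖ - δ₀ * C.ρ) / ((δ₁ - δ₀) * C.ρ),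
      ‖((C.frame i).symm x).snd‖⁻¹ • ((C.frame i).symm x).snd)

/-- The pull-back, by the inverse of the attaching map, of the metric
`ρ² (dy² + dω²)` of the `i`-th handle. -/
def handleMetric (i : Fin C.m) : Tensor d := fun x ξ ζ =>
  C.ρ ^ 2 * inner ℝ (fderiv ℝ (C.φInv i) x ξ) (fderiv ℝ (C.φInv i) x ζ)

open scoped Classical in
/-- The metric `g_h`: the standard metric outside `U_h`, the metric of the `i`-th handle
near `± x_i` (these places are mutually disjoint, so at most one summand is not zero). -/
def gh : Tensor d := fun x ξ ζ =>
  if x ∈ C.U then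
    ∑ i, if x ∈ openCap (C.center i) C.rOut ∪ openCap (-C.center i) C.rOut
      then C.handleMetric i x ξ ζ else 0
  else roundMetric d x ξ ζ

/-- The manifold-with-boundary `(M̄_h, g_h)`. -/
def mfd : LipRiem := region C.Mbar C.gh

/-- The boundary `∂M_h`. -/
def bdry : Set C.mfd.Point := {x : C.Mbar | (x : Amb d) ∉ C.M}

lemma neg_mem_sph {z : Amb d} (h : z ∈ sph d) : -z ∈ sph d := by
  simpa using h

lemma neg_mem_Mbar {z : Amb d} (h : z ∈ C.Mbar) : -z ∈ C.Mbar := by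
  refine ⟨neg_mem_sph h.1, fun hz => h.2 ?_⟩
  obtain ⟨i, hi⟩ := mem_iUnion.1 hz
  refine mem_iUnion.2 ⟨i, ?_⟩
  rcases hi with hi | hi
  · refine Or.inr ⟨h.1, ?_⟩
    have := hi.2
    rwa [← angle_neg_neg, neg_neg] at this
  · refine Or.inl ⟨h.1, ?_⟩
    have := hi.2
    rwa [angle_neg_neg] at this

/-- The antipodal map `T` on `M̄_h`. -/
def T : C.mfd.Point → C.mfd.Point := fun x : C.Mbar => (⟨-x, C.neg_mem_Mbar x.2⟩ : C.Mbar)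

/-- The inclusion of `M̄_h` in the sphere. -/
def incl : C.mfd.Point → (sphereMfd d).Point := fun x : C.Mbar => (⟨x, x.2.1⟩ : sph d)

/-- A point of `S^d \ E_h` or of one of the handles. -/
abbrev PreN : Type := ↥C.M ⊕ (Fin C.m × Handle d)

/-- The identification of the point `z` of a handle, outside the central sphere `y = 0`, with its
image `φ_i(z)` in `S^d \ E_h`. -/
inductive Glue : C.PreN → C.PreN → Prop
  | mk (i : Fin C.m) (p : Handle d) (x : C.M) (hp : (p.1 : ℝ) ≠ 0) (hx : (x : Amb d) = C.φ i p) :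
      Glue (Sum.inr (i, p)) (Sum.inl x)

/-- The space obtained by attaching the handles to the sphere, with the quotient topology. -/
def N : Type := Quot C.Glue

instance : TopologicalSpace C.N := inferInstanceAs (TopologicalSpace (Quot C.Glue))

instance : MeasurableSpace C.N := borel C.N

instance : BorelSpace C.N := ⟨rfl⟩

/-- The canonical map from `S^d \ E_h` to the attached space. -/
def outerMap (x : C.M) : C.N := Quot.mk _ (Sum.inl x)

/-- The canonical map from the `i`-th handle to the attached space. -/
def handleMap (i : Fin C.m) (p : Handle d) : C.N := Quot.mk _ (Sum.inr (i, p))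

/-- The extension of a function on the handle to `ℝ × ℝ^d`, constant along the rays of `ℝ^d`;
it is used to differentiate the function. -/
def handleExt (v : Handle d → ℝ) (z : Cyl d) : ℝ :=
  open scoped Classical in
  if h : ‖z.snd‖⁻¹ • z.snd ∈ Metric.sphere (0 : EuclideanSpace ℝ (Fin d)) 1 then
    v (projIcc (-1) 1 (by norm_num) z.fst, ⟨_, h⟩) else 0

/-- The canonical measure `ρ^d dy dω` of the handle. -/
def handleVol : Measure (Handle d) :=
  ENNReal.ofReal (C.ρ ^ d) • ((volume : Measure ℝ).comap (Subtype.val : Icc (-1 : ℝ) 1 → ℝ)).prod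
    (volume : Measure (EuclideanSpace ℝ (Fin d))).toSphere

/-- The squared norm `ρ⁻² ((∂_y v)² + |∇_ω v|²)` of the gradient of `v` for the metric of
the handle. -/
def handleGradSq (v : Handle d → ℝ) (p : Handle d) : ℝ :=
  (C.ρ ^ 2)⁻¹ * ‖fderiv ℝ (handleExt v) (WithLp.toLp 2 ((p.1 : ℝ),
    (p.2 : EuclideanSpace ℝ (Fin d))))‖ ^ 2

/-- The manifold `(N_h, g^{N_h})` obtained by attaching the handles: its metric is the standard
one on `S^d \ U_h` and that of the handle on each handle. A function is Lipschitz if it is so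
locally, on `S^d \ E_h` and on each handle. -/
def attached : LipRiem where
  Point := C.N
  lip := {v | LocallyLipschitz (v ∘ C.outerMap) ∧ ∀ i, LocallyLipschitz (v ∘ C.handleMap i)}
  vol := Measure.map C.outerMap
      (((sphVol d).comap Subtype.val).restrict {x : C.M | (x : Amb d) ∉ C.U}) +
    ∑ i, Measure.map (C.handleMap i) C.handleVol
  dirichlet v :=
    ∫⁻ x in {x : C.M | (x : Amb d) ∉ C.U},
      ENNReal.ofReal (gradSq (roundMetric d) (homExt C.M (v ∘ C.outerMap)) x)
      ∂((sphVol d).comap Subtype.val) +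
    ∑ i, ∫⁻ p, ENNReal.ofReal (C.handleGradSq (v ∘ C.handleMap i) p) ∂C.handleVol

end HandleConfig

end

noncomputable section

open ENNReal (ofReal ofReal_ne_top ofReal_mul ofReal_pow ofReal_le_ofReal ofReal_one ofReal_ofNat ofReal_pos ofNat_ne_top)
open WithLp (toLp)
open Metric (sphere ball closedBall)
set_option linter.unusedSectionVars false

notation:max "𝔼" d:max => EuclideanSpace ℝ (Fin d)
notation:max "𝕊" d:max => Metric.sphere (0 : EuclideanSpace ℝ (Fin d)) 1

/-! ### Polar coordinates and the canonical measure of the sphere -/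

theorem lintegral_polar {E : Type*} [NormedAddCommGroup E] [NormedSpace ℝ E] [Nontrivial E]
    [FiniteDimensional ℝ E] [MeasurableSpace E] [BorelSpace E] (μ : Measure E) [μ.IsAddHaarMeasure]
    {f : E → ℝ≥0∞} (hf : Measurable f) :
    ∫⁻ x, f x ∂μ = ∫⁻ s in Ioi (0 : ℝ), ofReal (s ^ (Module.finrank ℝ E - 1)) *
      ∫⁻ ω : sphere (0 : E) 1, f (s • (ω : E)) ∂μ.toSphere := by
  have h0 : MeasurableSet ({0}ᶜ : Set E) := (measurableSet_singleton _).compl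
  have h1 := (μ.measurePreserving_homeomorphUnitSphereProd)
  have hm : Measurable fun p : sphere (0 : E) 1 × Ioi (0 : ℝ) => f ((p.2 : ℝ) • (p.1 : E)) :=
    by fun_prop
  have h2 := h1.lintegral_comp hm
  have h3 : ∫⁻ x, f x ∂μ = ∫⁻ x : ({0}ᶜ : Set E), f x ∂(μ.comap (↑)) := by
    rw [lintegral_subtype_comap h0, restrict_compl_singleton]
  rw [h3]
  have h4 : ∀ x : ({0}ᶜ : Set E), f (((homeomorphUnitSphereProd E x).2 : ℝ) •
      ((homeomorphUnitSphereProd E x).1 : E)) = f x := by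
    intro x
    have hx : ‖(x : E)‖ ≠ 0 := norm_ne_zero_iff.2 x.2
    simp [smul_smul, hx]
  simp only [h4] at h2
  rw [h2, lintegral_prod_symm' _ hm, Measure.volumeIoiPow,
    lintegral_withDensity_eq_lintegral_mul _ (by fun_prop)
      (Measurable.lintegral_prod_left' (f := fun p : sphere (0 : E) 1 × Ioi (0 : ℝ) =>
        f ((p.2 : ℝ) • (p.1 : E))) hm)]
  exact lintegral_subtype_comap (μ := volume) measurableSet_Ioi (fun s : ℝ =>
    ofReal (s ^ (Module.finrank ℝ E - 1)) * ∫⁻ ω : sphere (0 : E) 1, f (s • (ω : E)) ∂μ.toSphere)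

lemma lintegral_Ioo_pow (n : ℕ) :
    ∫⁻ s in Ioo (0 : ℝ) 1, ofReal (s ^ n) = ofReal ((n + 1 : ℝ)⁻¹) := by
  rw [← ofReal_integral_eq_lintegral_ofReal]
  · rw [← integral_Ioc_eq_integral_Ioo, ← intervalIntegral.integral_of_le zero_le_one]
    simp
  · exact ((intervalIntegral.intervalIntegrable_pow (μ := volume) (a := 0) (b := 1) n).1).mono_set
      Ioo_subset_Ioc_self
  · filter_upwards [ae_restrict_mem measurableSet_Ioo] with s hs
    exact pow_nonneg hs.1.le _

lemma lintegral_Ioo_pow_ne_zero (n : ℕ) : ∫⁻ s in Ioo (0 : ℝ) 1, ofReal (s ^ n) ≠ 0 := by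
  rw [lintegral_Ioo_pow]
  positivity

lemma lintegral_Ioo_pow_ne_top (n : ℕ) : ∫⁻ s in Ioo (0 : ℝ) 1, ofReal (s ^ n) ≠ ⊤ := by
  rw [lintegral_Ioo_pow]; exact ofReal_ne_top

theorem setLIntegral_ball_eq_toSphere {E : Type*} [NormedAddCommGroup E] [NormedSpace ℝ E]
    [Nontrivial E] [FiniteDimensional ℝ E] [MeasurableSpace E] [BorelSpace E] (μ : Measure E)
    [μ.IsAddHaarMeasure] {k : ℝ → ℝ≥0∞} {n : ℕ} {f : E → ℝ≥0∞} (hf : Measurable f)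
    (hk : Measurable k)
    (hkn : ∀ s ∈ Ioo (0 : ℝ) 1, ofReal (s ^ (Module.finrank ℝ E - 1)) * k s = ofReal (s ^ n)) :
    ∫⁻ x in ball (0 : E) 1, k ‖x‖ * f (‖x‖⁻¹ • x) ∂μ = (∫⁻ s in Ioo (0 : ℝ) 1, ofReal (s ^ n)) *
        ∫⁻ ω : sphere (0 : E) 1, f ω ∂μ.toSphere := by
  have hm : Measurable ((ball (0 : E) 1).indicator fun x => k ‖x‖ * f (‖x‖⁻¹ • x)) := by
    refine Measurable.indicator ?_ measurableSet_ball
    fun_prop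
  rw [← lintegral_indicator measurableSet_ball, lintegral_polar μ hm,
    ← lintegral_mul_const _ (by fun_prop)]
  have hI : Ioo (0 : ℝ) 1 = Ioi 0 ∩ Iio 1 := by ext; simp
  rw [hI, ← lintegral_indicator (measurableSet_Ioi.inter measurableSet_Iio),
    ← lintegral_indicator measurableSet_Ioi]
  congr 1
  ext s
  by_cases hs : 0 < s
  · by_cases hs1 : s < 1
    · have h1 : ∀ ω : sphere (0 : E) 1, (ball (0 : E) 1).indicator
          (fun x => k ‖x‖ * f (‖x‖⁻¹ • x)) (s • (ω : E)) = k s * f ω := by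
        intro ω
        have hn : ‖s • (ω : E)‖ = s := by simp [norm_smul, abs_of_pos hs]
        rw [indicator_of_mem (by simpa [hn] using hs1), hn, smul_smul, inv_mul_cancel₀ hs.ne',
          one_smul]
      rw [indicator_of_mem (show s ∈ Ioi (0 : ℝ) from hs),
        indicator_of_mem (show s ∈ Ioi (0 : ℝ) ∩ Iio 1 from ⟨hs, hs1⟩), ← hkn s ⟨hs, hs1⟩]
      simp only [h1]
      rw [lintegral_const_mul _ (by fun_prop), mul_assoc]
    · have h1 : ∀ ω : sphere (0 : E) 1, (ball (0 : E) 1).indicator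
          (fun x => k ‖x‖ * f (‖x‖⁻¹ • x)) (s • (ω : E)) = 0 := by
        intro ω
        have hn : ‖s • (ω : E)‖ = s := by simp [norm_smul, abs_of_pos hs]
        rw [indicator_of_notMem (by simpa [hn] using hs1)]
      simp [*]
  · simp [*]

theorem setLIntegral_ball_eq_toSphere' {E : Type*} [NormedAddCommGroup E] [NormedSpace ℝ E]
    [Nontrivial E] [FiniteDimensional ℝ E] [MeasurableSpace E] [BorelSpace E] (μ : Measure E)
    [μ.IsAddHaarMeasure] {f : E → ℝ≥0∞} (hf : Measurable f) :
    ∫⁻ x in ball (0 : E) 1, f (‖x‖⁻¹ • x) ∂μ =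
      (∫⁻ s in Ioo (0 : ℝ) 1, ofReal (s ^ (Module.finrank ℝ E - 1))) *
        ∫⁻ ω : sphere (0 : E) 1, f ω ∂μ.toSphere := by
  simpa using setLIntegral_ball_eq_toSphere μ hf (k := fun _ => 1) measurable_const
    (n := Module.finrank ℝ E - 1) (by simp)

theorem lintegral_toSphere_comp_isometry {E F : Type*} [NormedAddCommGroup E]
    [InnerProductSpace ℝ E] [NormedAddCommGroup F] [InnerProductSpace ℝ F] [Nontrivial E]
    [FiniteDimensional ℝ E] [FiniteDimensional ℝ F] [MeasurableSpace E] [BorelSpace E]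
    [MeasurableSpace F] [BorelSpace F] (L : E ≃ₗᵢ[ℝ] F) {f : F → ℝ≥0∞} (hf : Measurable f) :
    ∫⁻ ω : sphere (0 : E) 1, f (L ω) ∂(volume : Measure E).toSphere =
      ∫⁻ ω : sphere (0 : F) 1, f ω ∂(volume : Measure F).toSphere := by
  have : Nontrivial F := L.symm.toEquiv.nontrivial
  have h1 := setLIntegral_ball_eq_toSphere' (volume : Measure F) hf
  have h2 := setLIntegral_ball_eq_toSphere' (volume : Measure E) (f := fun x => f (L x))
    (hf.comp L.continuous.measurable)
  have h3 : ∫⁻ x in ball (0 : E) 1, f (L (‖x‖⁻¹ • x)) = ∫⁻ x in ball (0 : F) 1, f (‖x‖⁻¹ • x) := by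
    have hp := (L.measurePreserving.setLIntegral_comp_preimage (s := ball (0 : F) 1)
      measurableSet_ball (f := fun x => f (‖x‖⁻¹ • x)) (hf.comp (by fun_prop)))
    rw [← hp]
    simp
  have hdim : Module.finrank ℝ E = Module.finrank ℝ F := L.toLinearEquiv.finrank_eq
  rw [h1, h2, hdim] at h3
  exact (ENNReal.mul_right_inj (lintegral_Ioo_pow_ne_zero _) (lintegral_Ioo_pow_ne_top _)).1 h3

theorem lintegral_sphVol {d : ℕ} {f : Amb d → ℝ≥0∞} (hf : Measurable f) :
    ∫⁻ x, f x ∂sphVol d = ∫⁻ ω : sph d, f ω ∂(volume : Measure (Amb d)).toSphere := by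
  rw [sphVol, lintegral_map hf measurable_subtype_coe]

theorem lintegral_sphVol_frame {d : ℕ} (F : Cyl d ≃ₗᵢ[ℝ] Amb d) {f : Amb d → ℝ≥0∞}
    (hf : Measurable f) : ∫⁻ x, f x ∂sphVol d =
      ∫⁻ ω : sphere (0 : Cyl d) 1, f (F ω) ∂(volume : Measure (Cyl d)).toSphere := by
  have : Nontrivial (Cyl d) := F.toEquiv.nontrivial
  rw [lintegral_sphVol hf, lintegral_toSphere_comp_isometry F hf]

theorem sphVol_map_neg (d : ℕ) : (sphVol d).map (fun x => -x) = sphVol d := by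
  refine Measure.ext_of_lintegral _ fun f hf => ?_
  rw [lintegral_map hf measurable_neg, lintegral_sphVol hf, lintegral_sphVol (by fun_prop)]
  exact lintegral_toSphere_comp_isometry (LinearIsometryEquiv.neg ℝ) hf

instance {d : ℕ} : IsFiniteMeasure (sphVol d) := by unfold sphVol; infer_instance

lemma ae_mem_sph (d : ℕ) : ∀ᵐ x ∂sphVol d, x ∈ sph d := by
  have h : MeasurableSet {x : Amb d | x ∈ sph d} := Metric.isClosed_sphere.measurableSet
  exact (ae_map_iff measurable_subtype_coe.aemeasurable h).2 (Eventually.of_forall fun x => x.2)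

/-! ### Charts of annuli around a point of the sphere -/

/-- The point with cylindrical coordinates `(√(1 - r²), r ω)`, where `r = A + (B - A) y`. -/
def chartPt {d : ℕ} (A B y : ℝ) (w : 𝔼 d) : Cyl d :=
  toLp 2 (√(1 - (A + (B - A) * y) ^ 2), (A + (B - A) * y) • w)

/-- The inverse of `chartPt`, extended to a cone. -/
def chartInv {d : ℕ} (A B : ℝ) (x : Cyl d) : Cyl d :=
  toLp 2 ((‖x.snd‖ * ‖x‖⁻¹ - A) / (B - A), (‖x‖ * ‖x.snd‖⁻¹) • x.snd)

/-- The cone over the annulus parametrized by `chartPt`. -/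
def chartCone (d : ℕ) (A B : ℝ) : Set (Cyl d) :=
  {x | 0 < x.fst ∧ x.snd ≠ 0 ∧ (‖x.snd‖ * ‖x‖⁻¹ - A) / (B - A) ∈ Ioo (0 : ℝ) 1}

/-- The measure `dy dω` on `(0,1) × S^{d-1}`. -/
def cylVol (d : ℕ) : Measure (ℝ × 𝕊 d) :=
  (volume.restrict (Ioo (0 : ℝ) 1)).prod (volume : Measure 𝔼 d).toSphere

/-- The point `(y, ω)` of the cylinder. -/
def cylPt {d : ℕ} (p : ℝ × 𝕊 d) : Cyl d := toLp 2 (p.1, (p.2 : 𝔼 d))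

instance {d : ℕ} : IsFiniteMeasure (cylVol d) := by
  have : IsFiniteMeasure ((volume : Measure ℝ).restrict (Ioo (0 : ℝ) 1)) := ⟨by simp⟩
  unfold cylVol; infer_instance

lemma Cyl.norm_sq {d : ℕ} (x : Cyl d) : ‖x‖ ^ 2 = x.fst ^ 2 + ‖x.snd‖ ^ 2 := by
  rw [WithLp.prod_norm_sq_eq_of_L2]; simp

lemma Cyl.inner_eq {d : ℕ} (x y : Cyl d) : inner ℝ x y = x.fst * y.fst + inner ℝ x.snd y.snd := by
  rw [WithLp.prod_inner_apply]; simp [mul_comm]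

lemma Cyl.ext_iff' {d : ℕ} {x y : Cyl d} : x = y ↔ x.fst = y.fst ∧ x.snd = y.snd := by
  constructor
  · rintro rfl; simp
  · rintro ⟨h1, h2⟩
    apply (WithLp.equiv 2 _).injective
    exact Prod.ext h1 h2

lemma Cyl.continuous_fst {d : ℕ} : Continuous fun x : Cyl d => x.fst :=
  (WithLp.fstL 2 ℝ ℝ 𝔼 d).continuous

lemma Cyl.continuous_snd {d : ℕ} : Continuous fun x : Cyl d => x.snd :=
  (WithLp.sndL 2 ℝ ℝ 𝔼 d).continuous

lemma Cyl.contDiff_fst {d : ℕ} {n : WithTop ℕ∞} : ContDiff ℝ n fun x : Cyl d => x.fst :=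
  (WithLp.fstL 2 ℝ ℝ 𝔼 d).contDiff

lemma Cyl.contDiff_snd {d : ℕ} {n : WithTop ℕ∞} : ContDiff ℝ n fun x : Cyl d => x.snd :=
  (WithLp.sndL 2 ℝ ℝ 𝔼 d).contDiff

lemma Cyl.norm_snd_le {d : ℕ} (x : Cyl d) : ‖x.snd‖ ≤ ‖x‖ := by
  have := Cyl.norm_sq x
  refine abs_le_of_sq_le_sq' ?_ (norm_nonneg x) |>.2
  nlinarith [sq_nonneg x.fst]

lemma Cyl.contDiff_toLp {d : ℕ} {n : WithTop ℕ∞} {E : Type*} [NormedAddCommGroup E]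
    [NormedSpace ℝ E] {f : E → ℝ} {g : E → 𝔼 d} {x : E}
    (hf : ContDiffAt ℝ n f x) (hg : ContDiffAt ℝ n g x) :
    ContDiffAt ℝ n (fun x => (toLp 2 (f x, g x) : Cyl d)) x :=
  (WithLp.prodContinuousLinearEquiv 2 ℝ ℝ 𝔼 d).symm.contDiff.contDiffAt.comp x (hf.prodMk hg)

lemma Cyl.continuous_toLp {d : ℕ} {E : Type*} [TopologicalSpace E] {f : E → ℝ}
    {g : E → 𝔼 d} (hf : Continuous f) (hg : Continuous g) :
    Continuous (fun x => (toLp 2 (f x, g x) : Cyl d)) :=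
  (WithLp.prodContinuousLinearEquiv 2 ℝ ℝ 𝔼 d).symm.continuous.comp (hf.prodMk hg)

lemma continuous_chartPt {d : ℕ} (A B : ℝ) : Continuous fun q : ℝ × 𝔼 d => chartPt A B q.1 q.2 := by
  unfold chartPt
  fun_prop

lemma continuous_cylPt {d : ℕ} : Continuous (cylPt (d := d)) :=
  Cyl.continuous_toLp (by fun_prop) (by fun_prop)

section Chart

variable {d : ℕ} {A B : ℝ}

lemma fst_chartPt (y : ℝ) (w : 𝔼 d) : (chartPt A B y w).fst = √(1 - (A + (B - A) * y) ^ 2) := rfl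

lemma snd_chartPt (y : ℝ) (w : 𝔼 d) : (chartPt A B y w).snd = (A + (B - A) * y) • w := rfl

lemma ne_zero_of_snd_ne_zero {x : Cyl d} (h : x.snd ≠ 0) : x ≠ 0 := by rintro rfl; simp at h

lemma profile_mem_Icc (hA : A ∈ Ico (0 : ℝ) 1) (hB : B ∈ Ico (0 : ℝ) 1) {y : ℝ}
    (hy : y ∈ Icc (0 : ℝ) 1) : A + (B - A) * y ∈ Ico (0 : ℝ) 1 := by
  have := (convex_Ico (0 : ℝ) 1).add_smul_sub_mem hA hB hy
  rwa [smul_eq_mul, mul_comm] at this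

lemma profile_mem (hA : A ∈ Ico (0 : ℝ) 1) (hB : B ∈ Ico (0 : ℝ) 1) (hAB : A ≠ B) {y : ℝ}
    (hy : y ∈ Ioo (0 : ℝ) 1) : A + (B - A) * y ∈ Ioo (0 : ℝ) 1 := by
  have h := profile_mem_Icc hA hB (Ioo_subset_Icc_self hy)
  refine ⟨h.1.lt_of_ne fun e => ?_, h.2⟩
  rcases lt_or_gt_of_ne hAB with h | h
  · nlinarith [hA.1, mul_pos (sub_pos.2 h) hy.1]
  · nlinarith [hB.1, mul_pos (sub_pos.2 h) (sub_pos.2 hy.2)]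

lemma norm_chartPt {y : ℝ} (hy : (A + (B - A) * y) ^ 2 ≤ 1) {w : 𝔼 d}
    (hw : ‖w‖ = 1) : ‖chartPt A B y w‖ = 1 := by
  have h := Cyl.norm_sq (chartPt A B y w)
  rw [fst_chartPt, snd_chartPt, Real.sq_sqrt (by linarith), norm_smul, hw, mul_one,
    Real.norm_eq_abs, sq_abs] at h
  have h2 : ‖chartPt A B y w‖ ^ 2 = 1 := by rw [h]; ring
  nlinarith [norm_nonneg (chartPt A B y w)]

/-- `chartPt`, extended to a cone. -/
def chartExt (A B : ℝ) (q : Cyl d) : Cyl d := ‖q.snd‖ • chartPt A B q.fst (‖q.snd‖⁻¹ • q.snd)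

lemma norm_inv_smul_self {E : Type*} [NormedAddCommGroup E] [NormedSpace ℝ E] {z : E}
    (hz : z ≠ 0) : ‖‖z‖⁻¹ • z‖ = 1 := by
  rw [norm_smul]; simp [norm_ne_zero_iff.2 hz]

lemma norm_chartExt {q : Cyl d} (hy : (A + (B - A) * q.fst) ^ 2 ≤ 1) (hq : q.snd ≠ 0) :
    ‖chartExt A B q‖ = ‖q.snd‖ := by
  rw [chartExt, norm_smul, norm_chartPt hy (norm_inv_smul_self hq)]; simp

lemma chartInv_chartExt (hA : A ∈ Ico (0 : ℝ) 1) (hB : B ∈ Ico (0 : ℝ) 1) (hAB : A ≠ B) {q : Cyl d}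
    (hy : q.fst ∈ Ioo (0 : ℝ) 1) (hq : q.snd ≠ 0) :
    chartExt A B q ∈ chartCone d A B ∧ chartInv A B (chartExt A B q) = q := by
  have hp := profile_mem hA hB hAB hy
  have hp1 : (A + (B - A) * q.fst) ^ 2 < 1 := by nlinarith [hp.1, hp.2]
  have hn : 0 < ‖q.snd‖ := norm_pos_iff.2 hq
  have h1 := norm_chartExt hp1.le hq
  have hBA : B - A ≠ 0 := sub_ne_zero.2 hAB.symm
  have h2 : (chartExt A B q).snd = (A + (B - A) * q.fst) • q.snd := by
    show ‖q.snd‖ • ((A + (B - A) * q.fst) • (‖q.snd‖⁻¹ • q.snd)) = _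
    rw [smul_smul, smul_smul]; congr 1; field_simp
  have h3 : (chartExt A B q).fst = ‖q.snd‖ * √(1 - (A + (B - A) * q.fst) ^ 2) := rfl
  have h4 : ‖(chartExt A B q).snd‖ = (A + (B - A) * q.fst) * ‖q.snd‖ := by
    rw [h2, norm_smul, Real.norm_eq_abs, abs_of_pos hp.1]
  have h5 : (‖(chartExt A B q).snd‖ * ‖chartExt A B q‖⁻¹ - A) / (B - A) = q.fst := by simp_all
  refine ⟨⟨?_, ?_, ?_⟩, ?_⟩
  · simp [*]
  · rw [h2]; exact smul_ne_zero hp.1.ne' hq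
  · rw [h5]; exact hy
  · rw [Cyl.ext_iff']
    refine ⟨h5, ?_⟩
    show (‖chartExt A B q‖ * ‖(chartExt A B q).snd‖⁻¹) • (chartExt A B q).snd = _
    rw [h1, h4, h2, smul_smul]
    have := hp.1.ne'
    simp [*]

lemma snd_chartInv (A B : ℝ) (x : Cyl d) : (chartInv A B x).snd = (‖x‖ * ‖x.snd‖⁻¹) • x.snd := rfl

lemma fst_chartInv (A B : ℝ) (x : Cyl d) :
    (chartInv A B x).fst = (‖x.snd‖ * ‖x‖⁻¹ - A) / (B - A) := rfl

lemma norm_snd_chartInv {x : Cyl d} (hx : x.snd ≠ 0) : ‖(chartInv A B x).snd‖ = ‖x‖ := by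
  rw [snd_chartInv, norm_smul, Real.norm_eq_abs, abs_of_nonneg (by positivity), mul_assoc,
    inv_mul_cancel₀ (norm_ne_zero_iff.2 hx), mul_one]

lemma profile_chartInv (hAB : A ≠ B) (x : Cyl d) :
    A + (B - A) * (chartInv A B x).fst = ‖x.snd‖ * ‖x‖⁻¹ := by
  have hBA : B - A ≠ 0 := sub_ne_zero.2 hAB.symm
  rw [fst_chartInv]; field_simp; ring

lemma chartPt_chartInv (hAB : A ≠ B) {x : Cyl d} (hx : x.snd ≠ 0) (h0 : 0 ≤ x.fst) :
    chartPt A B (chartInv A B x).fst (‖(chartInv A B x).snd‖⁻¹ • (chartInv A B x).snd) =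
      ‖x‖⁻¹ • x := by
  have hs : 0 < ‖x.snd‖ := norm_pos_iff.2 hx
  have hn : 0 < ‖x‖ := norm_pos_iff.2 (ne_zero_of_snd_ne_zero hx)
  rw [chartPt, profile_chartInv hAB, norm_snd_chartInv hx, snd_chartInv, Cyl.ext_iff']
  constructor
  · show √(1 - (‖x.snd‖ * ‖x‖⁻¹) ^ 2) = ‖x‖⁻¹ * x.fst
    have h := Cyl.norm_sq x
    rw [show 1 - (‖x.snd‖ * ‖x‖⁻¹) ^ 2 = (‖x‖⁻¹ * x.fst) ^ 2 by field_simp; linarith]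
    simp [*]
  · show (‖x.snd‖ * ‖x‖⁻¹) • ‖x‖⁻¹ • (‖x‖ * ‖x.snd‖⁻¹) • x.snd = ‖x‖⁻¹ • x.snd
    rw [smul_smul, smul_smul]; congr 1; field_simp

lemma chartExt_chartInv (hAB : A ≠ B) {x : Cyl d} (hx : x.snd ≠ 0) (h0 : 0 ≤ x.fst) :
    chartExt A B (chartInv A B x) = x := by
  have hn : ‖x‖ ≠ 0 := norm_ne_zero_iff.2 (ne_zero_of_snd_ne_zero hx)
  rw [chartExt, chartPt_chartInv hAB hx h0, norm_snd_chartInv hx, smul_smul, mul_inv_cancel₀ hn,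
    one_smul]

lemma contDiffAt_chartInv {n : WithTop ℕ∞} {x : Cyl d} (hx : x.snd ≠ 0) :
    ContDiffAt ℝ n (chartInv A B) x := by
  have h0 := ne_zero_of_snd_ne_zero hx
  have h1 : ContDiffAt ℝ n (fun x : Cyl d => ‖x‖) x := contDiffAt_norm ℝ h0
  have h2 : ContDiffAt ℝ n (fun x : Cyl d => ‖x.snd‖) x :=
    (contDiffAt_norm ℝ hx).comp x Cyl.contDiff_snd.contDiffAt
  have h3 := h1.inv (norm_ne_zero_iff.2 h0)
  have h4 := h2.inv (norm_ne_zero_iff.2 hx)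
  exact Cyl.contDiff_toLp (((h2.mul h3).sub contDiffAt_const).div_const _)
    ((h1.mul h4).smul Cyl.contDiff_snd.contDiffAt)

lemma contDiffAt_chartPt {n : WithTop ℕ∞} {q : ℝ × 𝔼 d} (hy : (A + (B - A) * q.1) ^ 2 < 1) :
    ContDiffAt ℝ n (fun q : ℝ × 𝔼 d => chartPt A B q.1 q.2) q := by
  have h1 : ContDiffAt ℝ n (fun q : ℝ × 𝔼 d => A + (B - A) * q.1) q := by fun_prop
  refine Cyl.contDiff_toLp ?_ (h1.smul contDiffAt_snd)
  exact (contDiffAt_const.sub (h1.pow 2)).sqrt (by linarith)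

lemma contDiffAt_normalize {n : WithTop ℕ∞} {q : Cyl d} (hq : q.snd ≠ 0) :
    ContDiffAt ℝ n (fun q : Cyl d => ‖q.snd‖⁻¹ • q.snd) q := by
  have h1 : ContDiffAt ℝ n (fun q : Cyl d => ‖q.snd‖) q :=
    (contDiffAt_norm ℝ hq).comp q Cyl.contDiff_snd.contDiffAt
  exact (h1.inv (norm_ne_zero_iff.2 hq)).smul Cyl.contDiff_snd.contDiffAt

lemma contDiffAt_chartExt {n : WithTop ℕ∞} {q : Cyl d} (hy : (A + (B - A) * q.fst) ^ 2 < 1)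
    (hq : q.snd ≠ 0) : ContDiffAt ℝ n (chartExt A B) q := by
  have h1 : ContDiffAt ℝ n (fun q : Cyl d => ‖q.snd‖) q :=
    (contDiffAt_norm ℝ hq).comp q Cyl.contDiff_snd.contDiffAt
  have h2 : ContDiffAt ℝ n (fun q : Cyl d => (q.fst, ‖q.snd‖⁻¹ • q.snd)) q :=
    Cyl.contDiff_fst.contDiffAt.prodMk (contDiffAt_normalize hq)
  have h3 : ContDiffAt ℝ n (fun p : ℝ × 𝔼 d => chartPt A B p.1 p.2)
      (q.fst, ‖q.snd‖⁻¹ • q.snd) := contDiffAt_chartPt hy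
  have h4 := ContDiffAt.comp (g := fun p : ℝ × 𝔼 d => chartPt A B p.1 p.2)
    (f := fun q : Cyl d => (q.fst, ‖q.snd‖⁻¹ • q.snd)) q h3 h2
  exact h1.smul h4

lemma measurableSet_chartCone : MeasurableSet (chartCone d A B) := by
  have h1 : Measurable fun x : Cyl d => x.fst := Cyl.continuous_fst.measurable
  have h2 : Measurable fun x : Cyl d => x.snd := Cyl.continuous_snd.measurable
  refine (measurableSet_lt measurable_const h1).inter
    ((h2 (measurableSet_singleton _).compl).inter ?_)
  exact ((((h2.norm).mul measurable_norm.inv).sub_const _).div_const _) measurableSet_Ioo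

lemma isOpen_chartCone : IsOpen (chartCone d A B) := by
  rw [isOpen_iff_mem_nhds]
  rintro x ⟨h1, h2, h3⟩
  have hc : ContinuousAt (fun x : Cyl d => (chartInv A B x).fst) x :=
    (Cyl.continuous_fst.continuousAt).comp (contDiffAt_chartInv (n := 1) h2).continuousAt
  filter_upwards [Cyl.continuous_fst.continuousAt.eventually_mem (Ioi_mem_nhds h1),
    Cyl.continuous_snd.continuousAt.eventually_mem (isOpen_compl_singleton.mem_nhds h2),
    hc.eventually_mem (isOpen_Ioo.mem_nhds h3)] with z a b c
  exact ⟨a, b, c⟩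

lemma smul_mem_chartCone {x : Cyl d} {s : ℝ} (hs : 0 < s) (hx : x ∈ chartCone d A B) :
    s • x ∈ chartCone d A B := by
  obtain ⟨h1, h2, h3⟩ := hx
  have hn : 0 < ‖x‖ := norm_pos_iff.2 (ne_zero_of_snd_ne_zero h2)
  refine ⟨mul_pos hs h1, smul_ne_zero hs.ne' h2, ?_⟩
  show (‖s • x.snd‖ * ‖s • x‖⁻¹ - A) / (B - A) ∈ _
  rw [norm_smul, norm_smul, Real.norm_eq_abs, abs_of_pos hs]
  rwa [show s * ‖x.snd‖ * (s * ‖x‖)⁻¹ = ‖x.snd‖ * ‖x‖⁻¹ by field_simp]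

/-- The linear map `(y, z) ↦ (y, s z)`. -/
def scaleSnd (d : ℕ) (s : ℝ) : Cyl d →L[ℝ] Cyl d :=
  (WithLp.prodContinuousLinearEquiv 2 ℝ ℝ 𝔼 d).symm.toContinuousLinearMap ∘L
    ((ContinuousLinearMap.id ℝ ℝ).prodMap (s • ContinuousLinearMap.id ℝ _)) ∘L
    (WithLp.prodContinuousLinearEquiv 2 ℝ ℝ 𝔼 d).toContinuousLinearMap

lemma scaleSnd_apply (s : ℝ) (x : Cyl d) : scaleSnd d s x = toLp 2 (x.fst, s • x.snd) := rfl

lemma det_scaleSnd (s : ℝ) : (scaleSnd d s).det = s ^ d := by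
  have h : ((scaleSnd d s : Cyl d →L[ℝ] Cyl d) : Cyl d →ₗ[ℝ] Cyl d) =
      (WithLp.prodContinuousLinearEquiv 2 ℝ ℝ 𝔼 d).symm.toLinearEquiv ∘ₗ
      ((LinearMap.id : ℝ →ₗ[ℝ] ℝ).prodMap (s • (LinearMap.id : 𝔼 d →ₗ[ℝ] 𝔼 d))) ∘ₗ
      (WithLp.prodContinuousLinearEquiv 2 ℝ ℝ 𝔼 d).symm.toLinearEquiv.symm := rfl
  rw [ContinuousLinearMap.det, h, LinearMap.det_conj, LinearMap.det_prodMap]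
  simp

lemma chartInv_smul {x : Cyl d} {s : ℝ} (hs : 0 < s) :
    chartInv A B (s • x) = scaleSnd d s (chartInv A B x) := by
  rw [scaleSnd_apply, Cyl.ext_iff']
  constructor
  · show (‖s • x.snd‖ * ‖s • x‖⁻¹ - A) / (B - A) = (‖x.snd‖ * ‖x‖⁻¹ - A) / (B - A)
    rw [norm_smul, norm_smul, Real.norm_eq_abs, abs_of_pos hs]
    grind
  · show (‖s • x‖ * ‖s • x.snd‖⁻¹) • (s • x.snd) = s • ((‖x‖ * ‖x.snd‖⁻¹) • x.snd)
    rw [norm_smul, norm_smul, Real.norm_eq_abs, abs_of_pos hs, smul_smul, smul_smul]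
    grind

/-- The Jacobian of `chartInv`. -/
def chartJac (A B : ℝ) (x : Cyl d) : ℝ := |(fderiv ℝ (chartInv (d := d) A B) x).det|

lemma finrank_Cyl (d : ℕ) : Module.finrank ℝ (Cyl d) = d + 1 := by
  rw [(WithLp.linearEquiv 2 ℝ (ℝ × 𝔼 d)).finrank_eq]
  simp [add_comm]

lemma chartJac_smul {x : Cyl d} {s : ℝ} (hs : 0 < s) (hx : x.snd ≠ 0) :
    chartJac A B (s • x) = s⁻¹ * chartJac A B x := by
  have hd : HasFDerivAt (chartInv A B) (fderiv ℝ (chartInv (d := d) A B) x) x :=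
    ((contDiffAt_chartInv (n := 1) hx).differentiableAt one_ne_zero).hasFDerivAt
  have hsx : (s • x).snd ≠ 0 := smul_ne_zero hs.ne' hx
  have hd2 : HasFDerivAt (chartInv A B) (fderiv ℝ (chartInv (d := d) A B) (s • x)) (s • x) :=
    ((contDiffAt_chartInv (n := 1) hsx).differentiableAt one_ne_zero).hasFDerivAt
  have e1 : HasFDerivAt (fun x => chartInv A B (s • x))
      (fderiv ℝ (chartInv (d := d) A B) (s • x) ∘L (s • ContinuousLinearMap.id ℝ (Cyl d))) x :=
    HasFDerivAt.comp x (g := chartInv A B) hd2 ((hasFDerivAt_id x).const_smul s)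
  have e2 : HasFDerivAt (fun x => chartInv A B (s • x))
      (scaleSnd d s ∘L fderiv ℝ (chartInv (d := d) A B) x) x := by
    simp only [chartInv_smul hs]
    exact (scaleSnd d s).hasFDerivAt.comp x hd
  have e3 := e1.unique e2
  have e4 := congrArg (fun L : Cyl d →L[ℝ] Cyl d => |L.det|) e3
  simp only [ContinuousLinearMap.det, ContinuousLinearMap.toLinearMap_comp, LinearMap.det_comp,
    abs_mul] at e4
  have e5 := det_scaleSnd (d := d) s
  rw [ContinuousLinearMap.det] at e5
  have e6 : LinearMap.det ((s • ContinuousLinearMap.id ℝ (Cyl d) : Cyl d →L[ℝ] Cyl d) :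
      Cyl d →ₗ[ℝ] Cyl d) = s ^ (d + 1) := by
    rw [ContinuousLinearMap.toLinearMap_smul, ContinuousLinearMap.coe_id, LinearMap.det_smul]
    simp [finrank_Cyl]
  rw [e5, e6, abs_of_pos (pow_pos hs _), abs_of_pos (pow_pos hs _)] at e4
  show |LinearMap.det _| = s⁻¹ * |LinearMap.det _|
  have : s ≠ 0 := hs.ne'
  have hsd : s ^ d ≠ 0 := pow_ne_zero _ this
  field_simp
  apply mul_left_cancel₀ hsd
  rw [← e4]; ring

lemma measurable_chartJac : Measurable (chartJac (d := d) A B) := by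
  have h1 : Measurable (fderiv ℝ (chartInv (d := d) A B)) := measurable_fderiv ℝ _
  exact (ContinuousLinearMap.continuous_det.measurable.comp h1).abs

instance : Nontrivial (Cyl d) := Module.nontrivial_of_finrank_pos (R := ℝ) (by simp [finrank_Cyl])

lemma chartInv_image : (hA : A ∈ Ico (0 : ℝ) 1) → (hB : B ∈ Ico (0 : ℝ) 1) → (hAB : A ≠ B) →
    chartInv A B '' (chartCone d A B ∩ ball 0 1) =
      {q : Cyl d | q.fst ∈ Ioo (0 : ℝ) 1 ∧ q.snd ∈ ball (0 : 𝔼 d) 1 \ {0}} := by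
  intro hA hB hAB
  ext q
  constructor
  · rintro ⟨x, ⟨hx, hb⟩, rfl⟩
    have hn := norm_snd_chartInv (A := A) (B := B) hx.2.1
    refine ⟨hx.2.2, ?_, ?_⟩
    · simp_all
    · intro h0
      rw [mem_singleton_iff] at h0
      rw [h0, norm_zero] at hn
      exact ne_zero_of_snd_ne_zero hx.2.1 (norm_eq_zero.1 hn.symm)
  · rintro ⟨h1, h2, h3⟩
    obtain ⟨h4, h5⟩ := chartInv_chartExt hA hB hAB h1 h3
    refine ⟨_, ⟨h4, ?_⟩, h5⟩
    have hp := profile_mem hA hB hAB h1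
    rw [mem_ball_zero_iff, norm_chartExt (by nlinarith [hp.1, hp.2]) h3]
    simpa using h2

lemma setLIntegral_Cyl {s : Set (ℝ × 𝔼 d)} (hs : MeasurableSet s)
    {h : ℝ × 𝔼 d → ℝ≥0∞} (hh : Measurable h) :
    ∫⁻ q : Cyl d in WithLp.ofLp ⁻¹' s, h (q.fst, q.snd) = ∫⁻ p in s, h p :=
  (WithLp.volume_preserving_ofLp ℝ 𝔼 d).setLIntegral_comp_preimage hs hh

lemma measurable_comp_sphere {g : ℝ × 𝔼 d → ℝ≥0∞} (hg : Measurable g) :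
    Measurable fun p : ℝ × 𝕊 d => g (p.1, p.2) :=
  hg.comp (by fun_prop)

lemma lintegral_cylVol {g : ℝ × 𝔼 d → ℝ≥0∞} (hg : Measurable g) :
    ∫⁻ p, g (p.1, p.2) ∂cylVol d = ∫⁻ y in Ioo (0 : ℝ) 1, ∫⁻ ω : 𝕊 d, g (y, ω)
        ∂(volume : Measure 𝔼 d).toSphere :=
  lintegral_prod _ (measurable_comp_sphere hg).aemeasurable

lemma setLIntegral_Ioo_prod_ball [NeZero d] {g : ℝ × 𝔼 d → ℝ≥0∞} (hg : Measurable g) :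
    ∫⁻ q in Ioo (0 : ℝ) 1 ×ˢ (ball (0 : 𝔼 d) 1 \ {0}), g (q.1, ‖q.2‖⁻¹ • q.2) =
      (∫⁻ s in Ioo (0 : ℝ) 1, ofReal (s ^ (d - 1))) * ∫⁻ p, g (p.1, p.2) ∂cylVol d := by
  have hmf2 : Measurable fun q : ℝ × 𝔼 d => g (q.1, ‖q.2‖⁻¹ • q.2) := hg.comp (by fun_prop)
  have hb : (volume.restrict (ball (0 : 𝔼 d) 1 \ {0})) = volume.restrict (ball (0 : 𝔼 d) 1) :=
    Measure.restrict_congr_set (sdiff_null_ae_eq_self (measure_singleton _))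
  rw [Measure.volume_eq_prod, ← Measure.prod_restrict, hb, lintegral_prod _ hmf2.aemeasurable,
    lintegral_cylVol hg, ← lintegral_const_mul]
  · refine lintegral_congr fun y => ?_
    have := setLIntegral_ball_eq_toSphere' (volume : Measure 𝔼 d)
      (f := fun z => g (y, z)) (hg.comp (f := fun z => (y, z)) (by fun_prop))
    simp [*]
  · fun_prop

lemma setLIntegral_chartInv_image [NeZero d] (hA : A ∈ Ico (0 : ℝ) 1) (hB : B ∈ Ico (0 : ℝ) 1)
    (hAB : A ≠ B) {f : Cyl d → ℝ≥0∞} (hf : Measurable f) :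
    ∫⁻ q in chartInv A B '' (chartCone d A B ∩ ball (0 : Cyl d) 1),
      f (chartPt A B q.fst (‖q.snd‖⁻¹ • q.snd)) =
      (∫⁻ s in Ioo (0 : ℝ) 1, ofReal (s ^ (d - 1))) *
      ∫⁻ p, f (chartPt A B p.1 p.2) ∂cylVol d := by
  have hmf : Measurable fun q : ℝ × 𝔼 d => f (chartPt A B q.1 q.2) :=
    hf.comp (continuous_chartPt A B).measurable
  have hset : chartInv A B '' (chartCone d A B ∩ ball (0 : Cyl d) 1) =
      WithLp.ofLp ⁻¹' (Ioo (0 : ℝ) 1 ×ˢ (ball (0 : 𝔼 d) 1 \ {0})) := by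
    rw [chartInv_image hA hB hAB]; ext q; exact Iff.rfl
  have hn : Measurable fun q : ℝ × 𝔼 d => (q.1, ‖q.2‖⁻¹ • q.2) := by fun_prop
  have hmf2 : Measurable fun q : ℝ × 𝔼 d => f (chartPt A B q.1 (‖q.2‖⁻¹ • q.2)) := hmf.comp hn
  have h1 := setLIntegral_Ioo_prod_ball hmf
  have h2 := setLIntegral_Cyl (s := Ioo (0 : ℝ) 1 ×ˢ
    (ball (0 : 𝔼 d) 1 \ {0})) (measurableSet_Ioo.prod
    (measurableSet_ball.diff (measurableSet_singleton _))) hmf2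
  rw [hset, ← h1, ← h2]

/-- The change of variables formula for `chartPt`. -/
theorem lintegral_chartPt [NeZero d] (hA : A ∈ Ico (0 : ℝ) 1) (hB : B ∈ Ico (0 : ℝ) 1)
    (hAB : A ≠ B) {f : Cyl d → ℝ≥0∞} (hf : Measurable f) :
    ∫⁻ x : sphere (0 : Cyl d) 1, (chartCone d A B).indicator
        (fun x => f x * ofReal (chartJac A B x)) x ∂(volume : Measure (Cyl d)).toSphere =
      ∫⁻ p, f (chartPt A B p.1 p.2) ∂cylVol d := by
  have hinj : InjOn (chartInv A B) (chartCone d A B ∩ ball (0 : Cyl d) 1) := by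
    intro x hx z hz h
    rw [← chartExt_chartInv hAB hx.1.2.1 hx.1.1.le, h, chartExt_chartInv hAB hz.1.2.1 hz.1.1.le]
  have hm : MeasurableSet (chartCone d A B ∩ ball (0 : Cyl d) 1) :=
    measurableSet_chartCone.inter measurableSet_ball
  have key := lintegral_image_eq_lintegral_abs_det_fderiv_mul (volume : Measure (Cyl d)) hm
    (f := chartInv A B) (f' := fun x => fderiv ℝ (chartInv (d := d) A B) x)
    (fun x hx => ((contDiffAt_chartInv (n := 1) hx.1.2.1).differentiableAt
      one_ne_zero).hasFDerivAt.hasFDerivWithinAt) hinj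
    (fun q => f (chartPt A B q.fst (‖q.snd‖⁻¹ • q.snd)))
  have hmf : Measurable fun q : ℝ × 𝔼 d => f (chartPt A B q.1 q.2) :=
    hf.comp (continuous_chartPt A B).measurable
  have hl : ∫⁻ x in chartCone d A B ∩ ball (0 : Cyl d) 1,
      ofReal |(fderiv ℝ (chartInv (d := d) A B) x).det| * f (chartPt A B (chartInv A B x).fst
          (‖(chartInv A B x).snd‖⁻¹ • (chartInv A B x).snd)) =
      (∫⁻ s in Ioo (0 : ℝ) 1, ofReal (s ^ (d - 1))) *
      ∫⁻ x : sphere (0 : Cyl d) 1, (chartCone d A B).indicator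
        (fun x => f x * ofReal (chartJac A B x)) x ∂(volume : Measure (Cyl d)).toSphere := by
    have hmJ : Measurable ((chartCone d A B).indicator (fun x => f x * ofReal (chartJac A B x))) :=
      (hf.mul measurable_chartJac.ennreal_ofReal).indicator measurableSet_chartCone
    rw [← setLIntegral_ball_eq_toSphere (volume : Measure (Cyl d)) (n := d - 1)
      (k := fun s => ofReal s⁻¹) hmJ (by fun_prop)]
    · rw [← setLIntegral_indicator measurableSet_chartCone]
      refine lintegral_congr fun x => ?_
      by_cases hx : x ∈ chartCone d A B
      · have hn : 0 < ‖x‖ := norm_pos_iff.2 (ne_zero_of_snd_ne_zero hx.2.1)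
        rw [indicator_of_mem hx, indicator_of_mem (smul_mem_chartCone (inv_pos.2 hn) hx),
          chartPt_chartInv hAB hx.2.1 hx.1.le, chartJac_smul (inv_pos.2 hn) hx.2.1, inv_inv,
          ofReal_mul hn.le, mul_left_comm, ← mul_assoc (ofReal ‖x‖⁻¹),
          ← ofReal_mul (inv_nonneg.2 hn.le), inv_mul_cancel₀ hn.ne', ofReal_one,
          one_mul, mul_comm]
        rfl
      · rw [indicator_of_notMem hx]
        by_cases h0 : x = 0
        · simp [*]
        · rw [indicator_of_notMem, mul_zero]
          intro h
          have hn : 0 < ‖x‖ := norm_pos_iff.2 h0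
          have := smul_mem_chartCone hn h
          simp_all
    · intro s hs
      rw [finrank_Cyl, ← ofReal_mul (pow_nonneg hs.1.le _)]
      congr 1
      obtain ⟨k, rfl⟩ : ∃ k, d = k + 1 := Nat.exists_eq_succ_of_ne_zero (NeZero.ne d)
      grind
  have hr := setLIntegral_chartInv_image hA hB hAB hf
  rw [hl, hr] at key
  exact ((ENNReal.mul_right_inj (lintegral_Ioo_pow_ne_zero _)
    (lintegral_Ioo_pow_ne_top _)).1 key).symm

/-- The change of variables formula for `chartPt`, on the sphere of the ambient space. -/
theorem lintegral_chartPt_frame [NeZero d] (hA : A ∈ Ico (0 : ℝ) 1) (hB : B ∈ Ico (0 : ℝ) 1)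
    (hAB : A ≠ B) (F : Cyl d ≃ₗᵢ[ℝ] Amb d) {f : Amb d → ℝ≥0∞} (hf : Measurable f) :
    ∫⁻ x in F.symm ⁻¹' chartCone d A B, f x * ofReal (chartJac A B (F.symm x)) ∂sphVol d =
      ∫⁻ p, f (F (chartPt A B p.1 p.2)) ∂cylVol d := by
  rw [← lintegral_chartPt hA hB hAB (f := fun x => f (F x)) (hf.comp F.continuous.measurable)]
  have hm : MeasurableSet (F.symm ⁻¹' chartCone d A B) :=
    F.symm.continuous.measurable measurableSet_chartCone
  have hmf : Measurable fun x => f x * ofReal (chartJac A B (F.symm x)) :=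
    hf.mul (measurable_chartJac.comp F.symm.continuous.measurable).ennreal_ofReal
  rw [← lintegral_indicator hm, lintegral_sphVol_frame F (hmf.indicator hm)]
  refine lintegral_congr fun x => ?_
  by_cases hx : (x : Cyl d) ∈ chartCone d A B
  all_goals simp [*]

end Chart

/-! ### The derivative of the inverse chart -/

lemma hasFDerivAt_norm_inner {E : Type*} [NormedAddCommGroup E] [InnerProductSpace ℝ E] {x : E}
    (hx : x ≠ 0) : HasFDerivAt (fun x : E => ‖x‖) (‖x‖⁻¹ • innerSL ℝ x) x := by
  have h := ((hasFDerivAt_id x).norm_sq).sqrt (by simpa using hx)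
  simp only [id, Real.sqrt_sq (norm_nonneg _)] at h
  refine h.congr_fderiv ?_
  have : ‖x‖ ≠ 0 := norm_ne_zero_iff.2 hx
  ext v
  simp
  field_simp

lemma Cyl.hasFDerivAt_toLp {d : ℕ} {E : Type*} [NormedAddCommGroup E]
    [NormedSpace ℝ E] {f : E → ℝ} {g : E → 𝔼 d} {f' : E →L[ℝ] ℝ}
    {g' : E →L[ℝ] 𝔼 d} {x : E}
    (hf : HasFDerivAt f f' x) (hg : HasFDerivAt g g' x) :
    HasFDerivAt (fun x => (toLp 2 (f x, g x) : Cyl d))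
      ((WithLp.prodContinuousLinearEquiv 2 ℝ ℝ 𝔼 d).symm ∘L (f'.prod g')) x :=
  (WithLp.prodContinuousLinearEquiv 2 ℝ ℝ 𝔼 d).symm.hasFDerivAt.comp x (hf.prodMk hg)

section Chart

variable {d : ℕ} {A B : ℝ}

lemma Cyl.hasFDerivAt_snd (x : Cyl d) : HasFDerivAt (fun x : Cyl d => x.snd)
    (WithLp.sndL 2 ℝ ℝ 𝔼 d) x :=
  (WithLp.sndL 2 ℝ ℝ 𝔼 d).hasFDerivAt

lemma hasFDerivAt_norm_snd {x : Cyl d} (hx : x.snd ≠ 0) : HasFDerivAt (fun x : Cyl d => ‖x.snd‖)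
      ((‖x.snd‖⁻¹ • innerSL ℝ x.snd) ∘L (WithLp.sndL 2 ℝ ℝ 𝔼 d)) x :=
  HasFDerivAt.comp (g := fun z : 𝔼 d => ‖z‖) x (hasFDerivAt_norm_inner hx) (Cyl.hasFDerivAt_snd x)

lemma fderiv_chartInv_apply {x : Cyl d} (hx : x.snd ≠ 0) (h1 : ‖x‖ = 1) (h : Cyl d) :
    fderiv ℝ (chartInv (d := d) A B) x h = toLp 2
      ((‖x.snd‖⁻¹ * inner ℝ x.snd h.snd - ‖x.snd‖ * inner ℝ x h) / (B - A),
        (inner ℝ x h * ‖x.snd‖⁻¹) • x.snd + (‖x.snd‖⁻¹ • h.snd -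
          (‖x.snd‖⁻¹ ^ 3 * inner ℝ x.snd h.snd) • x.snd)) := by
  have hn : ‖x.snd‖ ≠ 0 := norm_ne_zero_iff.2 hx
  have h0 : x ≠ 0 := ne_zero_of_snd_ne_zero hx
  have e1 := hasFDerivAt_norm_inner h0
  have e2 := hasFDerivAt_norm_snd hx
  have e3 := (hasDerivAt_inv (show ‖x‖ ≠ 0 by simp [h1])).comp_hasFDerivAt x e1
  have e4 := (hasDerivAt_inv hn).comp_hasFDerivAt x e2
  have e5 := Cyl.hasFDerivAt_toLp (((e2.mul e3).sub_const A).mul_const (B - A)⁻¹)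
    ((e1.mul e4).smul (Cyl.hasFDerivAt_snd x))
  have e6 := e5.fderiv
  have e7 : (fun x : Cyl d => (toLp 2 (((‖x.snd‖ * (Inv.inv ∘ fun x : Cyl d => ‖x‖) x) - A) *
      (B - A)⁻¹, (‖x‖ * (Inv.inv ∘ fun x : Cyl d => ‖x.snd‖) x) • x.snd) : Cyl d)) =
      chartInv A B := by
    ext1 x; rfl
  erw [e7] at e6
  rw [e6]
  rw [Cyl.ext_iff']
  constructor
  · simp [h1]
    ring
  · simp [h1]
    match_scalars <;> field_simp
    ring

/-- The inverse of `chartPt` on the unit sphere, as it appears in `HandleConfig.φInv`. -/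
def handleInv (A B : ℝ) (x : Cyl d) : Cyl d := toLp 2 ((‖x.snd‖ - A) / (B - A), ‖x.snd‖⁻¹ • x.snd)

/-- The derivative of `handleInv`. -/
def handleDer (A B : ℝ) (x h : Cyl d) : Cyl d := toLp 2 (‖x.snd‖⁻¹ * inner ℝ x.snd h.snd / (B - A),
    ‖x.snd‖⁻¹ • h.snd - (‖x.snd‖⁻¹ ^ 3 * inner ℝ x.snd h.snd) • x.snd)

lemma differentiableAt_handleInv {x : Cyl d} (hx : x.snd ≠ 0) :
    DifferentiableAt ℝ (handleInv A B) x := by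
  have h2 : ContDiffAt ℝ 1 (fun x : Cyl d => ‖x.snd‖) x :=
    (contDiffAt_norm ℝ hx).comp x Cyl.contDiff_snd.contDiffAt
  exact (Cyl.contDiff_toLp ((h2.sub contDiffAt_const).div_const _)
    (contDiffAt_normalize hx)).differentiableAt one_ne_zero

lemma fderiv_handleInv_apply {x : Cyl d} (hx : x.snd ≠ 0) (h : Cyl d) :
    fderiv ℝ (handleInv (d := d) A B) x h = handleDer A B x h := by
  have hn : ‖x.snd‖ ≠ 0 := norm_ne_zero_iff.2 hx
  have e2 := hasFDerivAt_norm_snd hx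
  have e4 := (hasDerivAt_inv hn).comp_hasFDerivAt x e2
  have e5 := Cyl.hasFDerivAt_toLp ((e2.sub_const A).mul_const (B - A)⁻¹)
    (e4.smul (Cyl.hasFDerivAt_snd x))
  have e6 := e5.fderiv
  have e7 : (fun x : Cyl d => (toLp 2 ((‖x.snd‖ - A) *
      (B - A)⁻¹, ((Inv.inv ∘ fun x : Cyl d => ‖x.snd‖) x) • x.snd) : Cyl d)) =
      handleInv A B := by
    ext1 x; rfl
  erw [e7] at e6
  rw [e6]
  rw [Cyl.ext_iff', handleDer]
  constructor
  · simp
    ring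
  · simp
    match_scalars <;> field_simp

lemma fderiv_chartInv_tangent {x : Cyl d} (hx : x.snd ≠ 0) (h1 : ‖x‖ = 1) {h : Cyl d}
    (hh : inner ℝ x h = 0) : fderiv ℝ (chartInv (d := d) A B) x h = handleDer A B x h := by
  rw [fderiv_chartInv_apply hx h1, hh, handleDer]
  simp

lemma fderiv_chartInv_self {x : Cyl d} (hx : x.snd ≠ 0) (h1 : ‖x‖ = 1) :
    fderiv ℝ (chartInv (d := d) A B) x x = toLp 2 (0, ‖x.snd‖⁻¹ • x.snd) := by
  have hn : ‖x.snd‖ ≠ 0 := norm_ne_zero_iff.2 hx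
  rw [fderiv_chartInv_apply hx h1, Cyl.ext_iff', real_inner_self_eq_norm_sq,
    real_inner_self_eq_norm_sq, h1]
  constructor
  · simp; left; field_simp; simp
  · simp
    grind

lemma norm_handleDer_sq {x : Cyl d} (hx : x.snd ≠ 0) (h : Cyl d) :
    ‖handleDer A B x h‖ ^ 2 = (‖x.snd‖⁻¹ * inner ℝ x.snd h.snd) ^ 2 / (B - A) ^ 2 +
      ‖x.snd‖⁻¹ ^ 2 * (‖h.snd‖ ^ 2 - (‖x.snd‖⁻¹ * inner ℝ x.snd h.snd) ^ 2) := by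
  have hn : ‖x.snd‖ ≠ 0 := norm_ne_zero_iff.2 hx
  rw [Cyl.norm_sq, handleDer]
  simp only [WithLp.toLp_fst, WithLp.toLp_snd]
  rw [norm_sub_sq_real, norm_smul, norm_smul, inner_smul_left, inner_smul_right, real_inner_comm]
  simp only [Real.norm_eq_abs, mul_pow, sq_abs, conj_trivial]
  field_simp
  ring

lemma inner_self_handleDer {x : Cyl d} (hx : x.snd ≠ 0) (h : Cyl d) :
    inner ℝ (handleDer A B x h) (toLp 2 (0, ‖x.snd‖⁻¹ • x.snd) : Cyl d) = 0 := by
  have hn : ‖x.snd‖ ≠ 0 := norm_ne_zero_iff.2 hx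
  rw [Cyl.inner_eq, handleDer]
  simp only [WithLp.toLp_fst, WithLp.toLp_snd, mul_zero, zero_add, inner_sub_left, inner_smul_left,
    inner_smul_right, real_inner_self_eq_norm_sq, conj_trivial]
  rw [real_inner_comm]
  field_simp
  ring

lemma inner_sq_le_snd {x : Cyl d} (hx : x.snd ≠ 0) (h : Cyl d) :
    (‖x.snd‖⁻¹ * inner ℝ x.snd h.snd) ^ 2 ≤ ‖h.snd‖ ^ 2 := by
  have hn : 0 < ‖x.snd‖ := norm_pos_iff.2 hx
  have h1 : |inner ℝ x.snd h.snd| ≤ ‖x.snd‖ * ‖h.snd‖ := abs_real_inner_le_norm _ _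
  rw [sq_le_sq, abs_mul, abs_of_pos (inv_pos.2 hn), abs_norm]
  calc _ ≤ ‖x.snd‖⁻¹ * (‖x.snd‖ * ‖h.snd‖) := by gcongr
    _ = _ := by field_simp

lemma norm_sq_tangent {x : Cyl d} (hx : x.snd ≠ 0) (h1 : ‖x‖ = 1) {h : Cyl d}
    (hh : inner ℝ x h = 0) :
    (‖x.snd‖⁻¹ * inner ℝ x.snd h.snd) ^ 2 = x.fst ^ 2 *
      (‖h‖ ^ 2 - (‖h.snd‖ ^ 2 - (‖x.snd‖⁻¹ * inner ℝ x.snd h.snd) ^ 2)) := by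
  have hn : ‖x.snd‖ ≠ 0 := norm_ne_zero_iff.2 hx
  have e1 := Cyl.norm_sq x
  have e2 := Cyl.norm_sq h
  rw [h1] at e1
  rw [Cyl.inner_eq] at hh
  have e3 : inner ℝ x.snd h.snd = -(x.fst * h.fst) := by linarith
  have e4 : ‖x.snd‖ ^ 2 = 1 - x.fst ^ 2 := by linarith
  rw [e2, e3]
  field_simp
  rw [e4]; ring

lemma handleDer_lower {x : Cyl d} (hx : x.snd ≠ 0) (h1 : ‖x‖ = 1) {h : Cyl d}
    (hh : inner ℝ x h = 0) {L : ℝ} (hAB : A ≠ B) (hL : L * (B - A) ^ 2 ≤ x.fst ^ 2)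
    (hL' : L * ‖x.snd‖ ^ 2 ≤ 1) :
    L * ‖h‖ ^ 2 ≤ ‖handleDer A B x h‖ ^ 2 := by
  have hn : 0 < ‖x.snd‖ := norm_pos_iff.2 hx
  have hBA : 0 < (B - A) ^ 2 := by have := sub_ne_zero.2 hAB.symm; positivity
  have e := norm_sq_tangent hx h1 hh
  have e2 := inner_sq_le_snd hx h
  have e3 : 0 ≤ (‖x.snd‖⁻¹ * inner ℝ x.snd h.snd) ^ 2 := sq_nonneg _
  rw [norm_handleDer_sq hx]
  set P := (‖x.snd‖⁻¹ * inner ℝ x.snd h.snd) ^ 2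
  have hfst : x.fst ^ 2 ≤ 1 := by
    have := Cyl.norm_sq x; rw [h1] at this; nlinarith [sq_nonneg ‖x.snd‖]
  have e4 : 0 ≤ ‖h‖ ^ 2 - (‖h.snd‖ ^ 2 - P) := by have := Cyl.norm_sq h; nlinarith [sq_nonneg h.fst]
  have i1 : L * (‖h‖ ^ 2 - (‖h.snd‖ ^ 2 - P)) ≤ P / (B - A) ^ 2 := by
    rw [le_div_iff₀ hBA, e]
    nlinarith
  have i2 : L * (‖h.snd‖ ^ 2 - P) ≤ ‖x.snd‖⁻¹ ^ 2 * (‖h.snd‖ ^ 2 - P) := by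
    refine mul_le_mul_of_nonneg_right ?_ (by linarith)
    rw [inv_pow, ← one_div, le_div_iff₀ (by positivity)]; exact hL'
  linarith

lemma handleDer_upper {x : Cyl d} (hx : x.snd ≠ 0) (h1 : ‖x‖ = 1) {h : Cyl d}
    (hh : inner ℝ x h = 0) {L : ℝ} (hAB : A ≠ B) (hL : x.fst ^ 2 ≤ L * (B - A) ^ 2)
    (hL' : 1 ≤ L * ‖x.snd‖ ^ 2) :
    ‖handleDer A B x h‖ ^ 2 ≤ L * ‖h‖ ^ 2 := by
  have hn : 0 < ‖x.snd‖ := norm_pos_iff.2 hx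
  have hBA : 0 < (B - A) ^ 2 := by have := sub_ne_zero.2 hAB.symm; positivity
  have e := norm_sq_tangent hx h1 hh
  have e2 := inner_sq_le_snd hx h
  have e3 : 0 ≤ (‖x.snd‖⁻¹ * inner ℝ x.snd h.snd) ^ 2 := sq_nonneg _
  rw [norm_handleDer_sq hx]
  set P := (‖x.snd‖⁻¹ * inner ℝ x.snd h.snd) ^ 2
  have e4 : 0 ≤ ‖h‖ ^ 2 - (‖h.snd‖ ^ 2 - P) := by have := Cyl.norm_sq h; nlinarith [sq_nonneg h.fst]
  have i1 : P / (B - A) ^ 2 ≤ L * (‖h‖ ^ 2 - (‖h.snd‖ ^ 2 - P)) := by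
    rw [div_le_iff₀ hBA, e]
    nlinarith
  have i2 : ‖x.snd‖⁻¹ ^ 2 * (‖h.snd‖ ^ 2 - P) ≤ L * (‖h.snd‖ ^ 2 - P) := by
    refine mul_le_mul_of_nonneg_right ?_ (by linarith)
    rw [inv_pow, ← one_div, div_le_iff₀ (by positivity)]; exact hL'
  linarith

end Chart

/-! ### Gram matrices and the tangent frame -/

lemma det_gram {ι V : Type*} [Fintype ι] [DecidableEq ι] [NormedAddCommGroup V]
    [InnerProductSpace ℝ V] (b : OrthonormalBasis ι ℝ V) (T : V →ₗ[ℝ] V) :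
    (Matrix.of fun i j => inner ℝ (T (b i)) (T (b j))).det = (LinearMap.det T) ^ 2 := by
  have h : (Matrix.of fun i j => inner ℝ (T (b i)) (T (b j)) : Matrix ι ι ℝ) =
      (LinearMap.toMatrix b.toBasis b.toBasis T).transpose *
        LinearMap.toMatrix b.toBasis b.toBasis T := by
    ext i j
    rw [Matrix.mul_apply, Matrix.of_apply, ← b.sum_inner_mul_inner]
    refine Finset.sum_congr rfl fun k _ => ?_
    rw [Matrix.transpose_apply, LinearMap.toMatrix_apply, LinearMap.toMatrix_apply]
    simp [b.repr_apply_apply, real_inner_comm]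
  rw [h, Matrix.det_mul, Matrix.det_transpose, LinearMap.det_toMatrix, sq]

section Frame

variable {d : ℕ}

lemma orthonormal_tangentFrame {x : Amb d} (hx : x ≠ 0) : Orthonormal ℝ (tangentFrame x) := by
  have : Fact (Module.finrank ℝ (Amb d) = d + 1) := ⟨by simp⟩
  rw [tangentFrame, dif_pos hx]
  exact (OrthonormalBasis.fromOrthogonalSpanSingleton (𝕜 := ℝ) d hx).orthonormal.comp_linearIsometry
    (Submodule.subtypeₗᵢ _)

lemma inner_tangentFrame {x : Amb d} (hx : x ≠ 0) (i : Fin d) :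
    inner ℝ x (tangentFrame x i) = 0 := by
  have : Fact (Module.finrank ℝ (Amb d) = d + 1) := ⟨by simp⟩
  rw [tangentFrame, dif_pos hx]
  exact Submodule.mem_orthogonal_singleton_iff_inner_right.1
    (OrthonormalBasis.fromOrthogonalSpanSingleton (𝕜 := ℝ) d hx i).2

/-- A unit vector followed by its tangent frame. -/
def fullFrame (x : Amb d) : Unit ⊕ Fin d → Amb d := Sum.elim (fun _ => x) (tangentFrame x)

lemma orthonormal_fullFrame {x : Amb d} (hx : ‖x‖ = 1) : Orthonormal ℝ (fullFrame x) := by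
  have h0 : x ≠ 0 := by rintro rfl; simp at hx
  have h1 := orthonormal_tangentFrame h0
  rw [orthonormal_iff_ite] at h1 ⊢
  rintro (i | i) (j | j)
  · simp [fullFrame, hx]
  · simp [fullFrame, inner_tangentFrame h0]
  · simp [fullFrame, real_inner_comm, inner_tangentFrame h0]
  · simp [fullFrame, h1]

/-- A unit vector and its tangent frame form an orthonormal basis. -/
def fullBasis {x : Amb d} (hx : ‖x‖ = 1) : OrthonormalBasis (Unit ⊕ Fin d) ℝ (Amb d) :=
  (basisOfOrthonormalOfCardEqFinrank (orthonormal_fullFrame hx)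
    (by simp [add_comm])).toOrthonormalBasis
    (by simpa using orthonormal_fullFrame hx)

lemma fullBasis_apply {x : Amb d} (hx : ‖x‖ = 1) (i : Unit ⊕ Fin d) :
    fullBasis hx i = fullFrame x i := by
  simp [fullBasis]

lemma det_metricMatrix {W : Type*} [NormedAddCommGroup W] [InnerProductSpace ℝ W]
    (F : W ≃ₗᵢ[ℝ] Amb d) (T : W →ₗ[ℝ] W) {x : Amb d} (hx : ‖x‖ = 1) {g : Tensor d} {ρ : ℝ}
    (hg : ∀ ξ ζ, inner ℝ x ξ = 0 → inner ℝ x ζ = 0 →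
      g x ξ ζ = ρ ^ 2 * inner ℝ (T (F.symm ξ)) (T (F.symm ζ)))
    (h1 : ‖T (F.symm x)‖ = 1)
    (h2 : ∀ ξ, inner ℝ x ξ = 0 → inner ℝ (T (F.symm ξ)) (T (F.symm x)) = 0) :
    (metricMatrix g x).det = (ρ ^ d * LinearMap.det T) ^ 2 := by
  have h0 : x ≠ 0 := by rintro rfl; simp at hx
  set N : Matrix (Fin d) (Fin d) ℝ := Matrix.of fun i j =>
    inner ℝ (T (F.symm (tangentFrame x i))) (T (F.symm (tangentFrame x j))) with hN
  have e1 : metricMatrix g x = ρ ^ 2 • N := by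
    ext i j
    simp [metricMatrix, hN, hg _ _ (inner_tangentFrame h0 i) (inner_tangentFrame h0 j)]
  have e2 := det_gram ((fullBasis hx).map F.symm) T
  have e3 : (Matrix.of fun i j => inner ℝ (T ((fullBasis hx).map F.symm i))
      (T ((fullBasis hx).map F.symm j))) = Matrix.fromBlocks (1 : Matrix Unit Unit ℝ) 0 0 N := by
    ext i j
    rcases i with i | i <;> rcases j with j | j
    · simp [fullBasis_apply, fullFrame, h1]
    · have := h2 _ (inner_tangentFrame h0 j)
      rw [real_inner_comm] at this
      simp [fullBasis_apply, fullFrame, this]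
    · simp [fullBasis_apply, fullFrame, h2 _ (inner_tangentFrame h0 i)]
    · simp [fullBasis_apply, fullFrame, hN]
  rw [e3, Matrix.det_fromBlocks_zero₂₁, Matrix.det_one, one_mul] at e2
  rw [e1, Matrix.det_smul, e2, Fintype.card_fin]
  ring

lemma volDensity_eq {W : Type*} [NormedAddCommGroup W] [InnerProductSpace ℝ W]
    (F : W ≃ₗᵢ[ℝ] Amb d) (T : W →ₗ[ℝ] W) {x : Amb d} (hx : ‖x‖ = 1) {g : Tensor d} {ρ : ℝ}
    (hρ : 0 < ρ)
    (hg : ∀ ξ ζ, inner ℝ x ξ = 0 → inner ℝ x ζ = 0 →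
      g x ξ ζ = ρ ^ 2 * inner ℝ (T (F.symm ξ)) (T (F.symm ζ)))
    (h1 : ‖T (F.symm x)‖ = 1)
    (h2 : ∀ ξ, inner ℝ x ξ = 0 → inner ℝ (T (F.symm ξ)) (T (F.symm x)) = 0) :
    volDensity g x = ρ ^ d * |LinearMap.det T| := by
  rw [volDensity, det_metricMatrix F T hx hg h1 h2, Real.sqrt_sq_eq_abs, abs_mul,
    abs_of_pos (pow_pos hρ d)]

lemma exists_tangentFrame_sum {x : Amb d} (hx : ‖x‖ = 1) (v : Amb d) :
    ∃ (c : ℝ) (a : Fin d → ℝ), v = c • x + ∑ j, a j • tangentFrame x j := by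
  refine ⟨(fullBasis hx).repr v (Sum.inl ()), fun j => (fullBasis hx).repr v (Sum.inr j), ?_⟩
  conv_lhs => rw [← (fullBasis hx).sum_repr v]
  simp [fullBasis_apply, fullFrame]

lemma gradSq_eq {W : Type*} [NormedAddCommGroup W] [InnerProductSpace ℝ W] [FiniteDimensional ℝ W]
    (F : W ≃ₗᵢ[ℝ] Amb d) (T : W →ₗ[ℝ] W) {x : Amb d} (hx : ‖x‖ = 1) {g : Tensor d} {ρ : ℝ}
    (hρ : 0 < ρ)
    (hg : ∀ ξ ζ, inner ℝ x ξ = 0 → inner ℝ x ζ = 0 →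
      g x ξ ζ = ρ ^ 2 * inner ℝ (T (F.symm ξ)) (T (F.symm ζ)))
    (h1 : ‖T (F.symm x)‖ = 1)
    (h2 : ∀ ξ, inner ℝ x ξ = 0 → inner ℝ (T (F.symm ξ)) (T (F.symm x)) = 0)
    (hT : LinearMap.det T ≠ 0) {f : Amb d → ℝ} {G : W →L[ℝ] ℝ}
    (hf : ∀ v, fderiv ℝ f x v = G (T (F.symm v))) (hfx : fderiv ℝ f x x = 0) :
    gradSq g f x = (ρ ^ 2)⁻¹ * ‖G‖ ^ 2 := by
  have h0 : x ≠ 0 := by rintro rfl; simp at hx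
  set q : W := (InnerProductSpace.toDual ℝ W).symm G with hq
  have hGq : ∀ v, G v = inner ℝ q v := fun v => by simp [hq]
  have hnorm : ‖G‖ = ‖q‖ := by simp [hq]
  obtain ⟨v, hv⟩ : ∃ v : Amb d, T (F.symm v) = q := by
    have hs : Function.Surjective T := (LinearMap.equivOfDetNeZero T hT).surjective
    obtain ⟨w, hw⟩ := hs q
    exact ⟨F w, by simpa using hw⟩
  obtain ⟨c, a, rfl⟩ := exists_tangentFrame_sum hx v
  have hT1 : ∀ j, inner ℝ (T (F.symm (tangentFrame x j))) (T (F.symm x)) = 0 :=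
    fun j => h2 _ (inner_tangentFrame h0 j)
  have hc : c = 0 := by
    have e : inner ℝ q (T (F.symm x)) = 0 := by rw [← hGq, ← hf, hfx]
    rw [← hv] at e
    simp only [map_add, map_smul, map_sum, inner_add_left, inner_smul_left, sum_inner, hT1,
      real_inner_self_eq_norm_sq, h1] at e
    simpa using e
  subst hc
  set M := metricMatrix g x with hM
  have hMe : ∀ i j, M i j = ρ ^ 2 * inner ℝ (T (F.symm (tangentFrame x i)))
      (T (F.symm (tangentFrame x j))) := fun i j => by
    simp [hM, metricMatrix, hg _ _ (inner_tangentFrame h0 i) (inner_tangentFrame h0 j)]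
  have hdet : IsUnit M.det := by
    rw [hM, det_metricMatrix F T hx hg h1 h2]
    exact (pow_ne_zero 2 (mul_ne_zero (pow_ne_zero _ hρ.ne') hT)).isUnit
  set D : Fin d → ℝ := fun i => fderiv ℝ f x (tangentFrame x i) with hD
  have hqs : q = ∑ j, a j • T (F.symm (tangentFrame x j)) := by rw [← hv]; simp
  have hDM : D = (ρ ^ 2)⁻¹ • M.mulVec a := by
    ext i
    simp only [hD, hf, hGq, Pi.smul_apply, Matrix.mulVec, dotProduct, smul_eq_mul, hMe]
    rw [hqs, sum_inner, Finset.mul_sum]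
    refine Finset.sum_congr rfl fun j _ => ?_
    rw [inner_smul_left, real_inner_comm]
    simp
    field_simp
  have hgs : gradSq g f x = dotProduct D (M⁻¹.mulVec D) := by
    rw [gradSq, dotProduct]
    refine Finset.sum_congr rfl fun i _ => ?_
    rw [Matrix.mulVec, dotProduct, Finset.mul_sum]
    refine Finset.sum_congr rfl fun j _ => ?_
    simp only [metricInv, hD, hM]; ring
  have hinv : M⁻¹.mulVec D = (ρ ^ 2)⁻¹ • a := by
    rw [hDM, Matrix.mulVec_smul, Matrix.mulVec_mulVec, Matrix.nonsing_inv_mul _ hdet,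
      Matrix.one_mulVec]
  have hDa : dotProduct D a = ‖q‖ ^ 2 := by
    rw [← real_inner_self_eq_norm_sq]
    conv_rhs => rw [hqs, inner_sum, ← hqs]
    refine Finset.sum_congr rfl fun i _ => ?_
    simp only [hD, hf, hGq, inner_smul_right]; ring
  rw [hgs, hinv, dotProduct_smul, hDa, hnorm, smul_eq_mul]

/-- Functions constant along the rays. -/
def RayConst (f : Amb d → ℝ) : Prop := ∀ x, f x = f (‖x‖⁻¹ • x)

lemma RayConst.smul {f : Amb d → ℝ} (hf : RayConst f) {s : ℝ} (hs : 0 < s) (x : Amb d) :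
    f (s • x) = f x := by
  rw [hf, hf x, norm_smul, smul_smul, Real.norm_eq_abs, abs_of_pos hs]
  congr 2
  rw [mul_inv]; field_simp

lemma rayConst_homExt (A : Set (Amb d)) (u : A → ℝ) : RayConst (homExt A u) := by
  intro x
  by_cases hx : x = 0
  · subst hx; simp
  · have : ‖‖x‖⁻¹ • x‖⁻¹ • ‖x‖⁻¹ • x = ‖x‖⁻¹ • x := by rw [norm_inv_smul_self hx]; simp
    have e : ∀ z w : Amb d, ‖z‖⁻¹ • z = ‖w‖⁻¹ • w → homExt A u z = homExt A u w := by
      intro z w h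
      let k : Amb d → ℝ := fun w => open scoped Classical in if h : w ∈ A then u ⟨w, h⟩ else 0
      exact congrArg k h
    exact e _ _ this.symm

lemma RayConst.fderiv_self {f : Amb d → ℝ} (hf : RayConst f) (x : Amb d) : fderiv ℝ f x x = 0 := by
  by_cases h : DifferentiableAt ℝ f x
  · have h1 : HasDerivAt (fun s : ℝ => f (s • x)) (fderiv ℝ f x x) 1 := by
      have h2 : HasDerivAt (fun s : ℝ => s • x) x 1 := by
        simpa using (hasDerivAt_id (1 : ℝ)).smul_const x
      have h3 : HasFDerivAt f (fderiv ℝ f x) ((1 : ℝ) • x) := by rw [one_smul]; exact h.hasFDerivAt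
      exact h3.comp_hasDerivAt (1 : ℝ) h2
    have h4 : (fun s : ℝ => f (s • x)) =ᶠ[𝓝 1] fun _ => f x := by
      filter_upwards [lt_mem_nhds (zero_lt_one' ℝ)] with s hs
      exact hf.smul hs x
    exact h1.unique ((hasDerivAt_const (1 : ℝ) (f x)).congr_of_eventuallyEq h4)
  · rw [fderiv_zero_of_not_differentiableAt h]; simp

lemma volDensity_roundMetric {x : Amb d} (hx : ‖x‖ = 1) : volDensity (roundMetric d) x = 1 := by
  simpa using volDensity_eq (LinearIsometryEquiv.refl ℝ (Amb d)) LinearMap.id hx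
    (g := roundMetric d) one_pos (by simp [roundMetric]) (by simpa using hx)
    (by intro ξ h; simpa [real_inner_comm] using h)

lemma gradSq_roundMetric {x : Amb d} (hx : ‖x‖ = 1) {f : Amb d → ℝ} (hf : RayConst f) :
    gradSq (roundMetric d) f x = ‖fderiv ℝ f x‖ ^ 2 := by
  simpa using gradSq_eq (LinearIsometryEquiv.refl ℝ (Amb d)) LinearMap.id hx
    (g := roundMetric d) one_pos (by simp [roundMetric]) (by simpa using hx)
    (by intro ξ h; simpa [real_inner_comm] using h) (by simp) (f := f) (G := fderiv ℝ f x)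
    (fun _ => rfl) (hf.fderiv_self x)

/-! ### Functions in the charts -/

/-- A function on the sphere, in the chart `chartPt`. -/
def chartPull (F : Cyl d ≃ₗᵢ[ℝ] Amb d) (A B : ℝ) (f : Amb d → ℝ) (q : Cyl d) : ℝ :=
  f (F (chartPt A B q.fst (‖q.snd‖⁻¹ • q.snd)))

variable {A B : ℝ} (F : Cyl d ≃ₗᵢ[ℝ] Amb d)

lemma RayConst.eq_chartPull {f : Amb d → ℝ} (hf : RayConst f) (hAB : A ≠ B) {x : Amb d}
    (hx : F.symm x ∈ chartCone d A B) :
    f x = chartPull F A B f (chartInv A B (F.symm x)) := by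
  rw [chartPull, chartPt_chartInv hAB hx.2.1 hx.1.le, hf x]
  simp

lemma RayConst.chartPull_eq {f : Amb d → ℝ} (hf : RayConst f) {q : Cyl d} (hq : q.snd ≠ 0) :
    chartPull F A B f q = f (F (chartExt A B q)) := by
  rw [chartPull, chartExt, map_smul, hf.smul (norm_pos_iff.2 hq)]

lemma RayConst.fderiv_eq_chartPull {f : Amb d → ℝ} (hf : RayConst f) (hA : A ∈ Ico (0 : ℝ) 1)
    (hB : B ∈ Ico (0 : ℝ) 1) (hAB : A ≠ B) {x : Amb d} (hx : F.symm x ∈ chartCone d A B) :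
    fderiv ℝ f x = fderiv ℝ (chartPull F A B f) (chartInv A B (F.symm x)) ∘L
      fderiv ℝ (chartInv A B) (F.symm x) ∘L (F.symm : Amb d →L[ℝ] Cyl d) := by
  have e1 : f =ᶠ[𝓝 x] fun x => chartPull F A B f (chartInv A B (F.symm x)) := by
    filter_upwards [F.symm.continuous.continuousAt.eventually_mem (isOpen_chartCone.mem_nhds hx)]
      with z hz using hf.eq_chartPull F hAB hz
  have hsnd : (chartInv A B (F.symm x)).snd ≠ 0 := by
    rw [← norm_ne_zero_iff, norm_snd_chartInv hx.2.1]
    exact norm_ne_zero_iff.2 (ne_zero_of_snd_ne_zero hx.2.1)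
  have hp := profile_mem hA hB hAB hx.2.2
  have hp1 : (A + (B - A) * (chartInv A B (F.symm x)).fst) ^ 2 < 1 := by
    have h1 : (chartInv A B (F.symm x)).fst = (‖(F.symm x).snd‖ * ‖F.symm x‖⁻¹ - A) / (B - A) := rfl
    rw [h1]; nlinarith [hp.1, hp.2]
  have e2 : chartPull F A B f =ᶠ[𝓝 (chartInv A B (F.symm x))] fun q => f (F (chartExt A B q)) := by
    filter_upwards [Cyl.continuous_snd.continuousAt.eventually_mem
      (isOpen_compl_singleton.mem_nhds hsnd)] with z hz using hf.chartPull_eq F hz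
  have hci : DifferentiableAt ℝ (chartInv A B) (F.symm x) :=
    (contDiffAt_chartInv (n := 1) hx.2.1).differentiableAt one_ne_zero
  have hFs : HasFDerivAt F.symm (F.symm : Amb d →L[ℝ] Cyl d) x :=
    (F.symm : Amb d →L[ℝ] Cyl d).hasFDerivAt
  by_cases h : DifferentiableAt ℝ (chartPull F A B f) (chartInv A B (F.symm x))
  · have h2 := h.hasFDerivAt.comp x (hci.hasFDerivAt.comp x hFs)
    exact (h2.congr_of_eventuallyEq e1).fderiv
  · have h3 : ¬ DifferentiableAt ℝ f x := by
      intro h4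
      apply h
      have hx' : F (chartExt A B (chartInv A B (F.symm x))) = x := by
        rw [chartExt_chartInv hAB hx.2.1 hx.1.le]; simp
      have h5 : DifferentiableAt ℝ (chartExt A B) (chartInv A B (F.symm x)) :=
        (contDiffAt_chartExt (n := 1) hp1 hsnd).differentiableAt one_ne_zero
      have h6 : DifferentiableAt ℝ (fun q => F (chartExt A B q)) (chartInv A B (F.symm x)) :=
        (F : Cyl d →L[ℝ] Amb d).differentiableAt.comp _ h5
      have h7 : DifferentiableAt ℝ (fun q => f (F (chartExt A B q))) (chartInv A B (F.symm x)) :=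
        DifferentiableAt.comp (g := f) _ (by rw [hx']; exact h4) h6
      exact h7.congr_of_eventuallyEq e2
    rw [fderiv_zero_of_not_differentiableAt h3, fderiv_zero_of_not_differentiableAt h]
    simp

lemma det_fderiv_chartInv_ne_zero (hAB : A ≠ B) {x : Cyl d} (h1 : ‖x‖ = 1) (hx : x.snd ≠ 0)
    (h0 : x.fst ≠ 0) :
    LinearMap.det ((fderiv ℝ (chartInv (d := d) A B) x : Cyl d →L[ℝ] Cyl d) :
      Cyl d →ₗ[ℝ] Cyl d) ≠ 0 := by
  have hn : ‖x.snd‖ ≠ 0 := norm_ne_zero_iff.2 hx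
  have hBA : B - A ≠ 0 := sub_ne_zero.2 hAB.symm
  refine fun hdet => (LinearMap.bot_lt_ker_of_det_eq_zero hdet).ne' ?_
  rw [LinearMap.ker_eq_bot']
  intro h hh
  have hh' : fderiv ℝ (chartInv (d := d) A B) x h = 0 := hh
  rw [fderiv_chartInv_apply hx h1, Cyl.ext_iff'] at hh'
  simp only [WithLp.toLp_fst, WithLp.toLp_snd, WithLp.zero_fst, WithLp.zero_snd, div_eq_zero_iff,
    hBA, or_false] at hh'
  obtain ⟨e1, e2⟩ := hh'
  have e3 := congrArg (fun v => inner ℝ x.snd v) e2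
  simp only [inner_add_right, inner_sub_right, inner_smul_right, real_inner_self_eq_norm_sq,
    inner_zero_right] at e3
  have e4 : inner ℝ x h = 0 := by
    field_simp at e3
    simp_all
  have e5 : inner ℝ x.snd h.snd = 0 := by rw [e4] at e1; simpa [hn] using e1
  have e6 : h.snd = 0 := by rw [e4, e5] at e2; simpa [hx] using e2
  have e7 : h.fst = 0 := by simp_all
  rw [Cyl.ext_iff']
  exact ⟨e7, e6⟩

theorem volDensity_gradSq_chart (hA : A ∈ Ico (0 : ℝ) 1) (hB : B ∈ Ico (0 : ℝ) 1) (hAB : A ≠ B)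
    {x : Amb d} (hx1 : ‖x‖ = 1) (hx : F.symm x ∈ chartCone d A B) {g : Tensor d} {ρ : ℝ}
    (hρ : 0 < ρ) (hg : ∀ ξ ζ, inner ℝ x ξ = 0 → inner ℝ x ζ = 0 → g x ξ ζ = ρ ^ 2 *
      inner ℝ (handleDer A B (F.symm x) (F.symm ξ)) (handleDer A B (F.symm x) (F.symm ζ))) :
    volDensity g x = ρ ^ d * chartJac A B (F.symm x) ∧ ∀ f : Amb d → ℝ, RayConst f → gradSq g f x =
        (ρ ^ 2)⁻¹ * ‖fderiv ℝ (chartPull F A B f) (chartInv A B (F.symm x))‖ ^ 2 := by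
  set T : Cyl d →ₗ[ℝ] Cyl d := ((fderiv ℝ (chartInv (d := d) A B) (F.symm x) :
    Cyl d →L[ℝ] Cyl d) : Cyl d →ₗ[ℝ] Cyl d) with hT
  have hx1' : ‖F.symm x‖ = 1 := by simpa using hx1
  have ht : ∀ ξ, inner ℝ x ξ = 0 → T (F.symm ξ) = handleDer A B (F.symm x) (F.symm ξ) := by
    exact fun ξ hξ => fderiv_chartInv_tangent hx.2.1 hx1' (by simpa using hξ)
  have hs : T (F.symm x) = toLp 2 (0, ‖(F.symm x).snd‖⁻¹ • (F.symm x).snd) :=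
    fderiv_chartInv_self hx.2.1 hx1'
  have h1 : ‖T (F.symm x)‖ = 1 := by
    have : ‖T (F.symm x)‖ ^ 2 = 1 := by rw [hs, Cyl.norm_sq]; simp [norm_inv_smul_self hx.2.1]
    nlinarith [norm_nonneg (T (F.symm x))]
  have h2 : ∀ ξ, inner ℝ x ξ = 0 → inner ℝ (T (F.symm ξ)) (T (F.symm x)) = 0 := by
    intro ξ hξ
    rw [hs, ht ξ hξ, inner_self_handleDer hx.2.1]
  have hg' : ∀ ξ ζ, inner ℝ x ξ = 0 → inner ℝ x ζ = 0 →
      g x ξ ζ = ρ ^ 2 * inner ℝ (T (F.symm ξ)) (T (F.symm ζ)) := by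
    intro ξ ζ hξ hζ
    rw [hg ξ ζ hξ hζ, ht ξ hξ, ht ζ hζ]
  refine ⟨volDensity_eq F T hx1 hρ hg' h1 h2, fun f hf => ?_⟩
  refine gradSq_eq F T hx1 hρ hg' h1 h2
    (det_fderiv_chartInv_ne_zero hAB hx1' hx.2.1 hx.1.ne') ?_ (hf.fderiv_self x)
  intro v
  rw [hf.fderiv_eq_chartPull F hA hB hAB hx]
  rfl

end Frame

/-! ### The caps of a configuration in cylindrical coordinates -/

lemma angle_lt_arcsin_iff {d : ℕ} (F : Cyl d ≃ₗᵢ[ℝ] Amb d) {z : Amb d} (hz : z ∈ sph d) {t : ℝ}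
    (ht : t ∈ Ioo (0 : ℝ) 1) : angle z (F (toLp 2 (1, 0))) < Real.arcsin t ↔
      0 < (F.symm z).fst ∧ ‖(F.symm z).snd‖ < t := by
  have hz1 : ‖z‖ = 1 := by simpa using hz
  have he : ‖(toLp 2 (1, 0) : Cyl d)‖ ^ 2 = 1 := by rw [Cyl.norm_sq]; simp
  have he1 : ‖F (toLp 2 (1, 0))‖ = 1 := by simp
  have hi : inner ℝ z (F (toLp 2 (1, 0))) = (F.symm z).fst := by
    rw [← F.symm.inner_map_map, F.symm_apply_apply, Cyl.inner_eq]; simp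
  have hn : (F.symm z).fst ^ 2 + ‖(F.symm z).snd‖ ^ 2 = 1 := by
    rw [← Cyl.norm_sq, F.symm.norm_map, hz1]; norm_num
  have ht2 : 0 < 1 - t ^ 2 := by nlinarith [ht.1, ht.2]
  rw [angle, hi, hz1, he1, mul_one, div_one, Real.arcsin_eq_arccos ht.1.le,
    Real.strictAntiOn_arccos.lt_iff_gt ⟨by nlinarith [sq_nonneg ‖(F.symm z).snd‖],
      by nlinarith [sq_nonneg ‖(F.symm z).snd‖]⟩
      ⟨by linarith [Real.sqrt_nonneg (1 - t ^ 2)], Real.sqrt_le_one.2 (by nlinarith [ht.1])⟩]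
  constructor
  · intro h
    have h0 : 0 < (F.symm z).fst := (Real.sqrt_nonneg _).trans_lt h
    rw [Real.sqrt_lt' h0] at h
    exact ⟨h0, abs_lt_of_sq_lt_sq' (by linarith) ht.1.le |>.2⟩
  · rintro ⟨h0, h1⟩
    rw [Real.sqrt_lt' h0]
    nlinarith [norm_nonneg (F.symm z).snd]

lemma angle_le_arcsin_iff {d : ℕ} (F : Cyl d ≃ₗᵢ[ℝ] Amb d) {z : Amb d} (hz : z ∈ sph d) {t : ℝ}
    (ht : t ∈ Ioo (0 : ℝ) 1) : angle z (F (toLp 2 (1, 0))) ≤ Real.arcsin t ↔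
      0 < (F.symm z).fst ∧ ‖(F.symm z).snd‖ ≤ t := by
  have hz1 : ‖z‖ = 1 := by simpa using hz
  have he : ‖(toLp 2 (1, 0) : Cyl d)‖ ^ 2 = 1 := by rw [Cyl.norm_sq]; simp
  have he1 : ‖F (toLp 2 (1, 0))‖ = 1 := by simp
  have hi : inner ℝ z (F (toLp 2 (1, 0))) = (F.symm z).fst := by
    rw [← F.symm.inner_map_map, F.symm_apply_apply, Cyl.inner_eq]; simp
  have hn : (F.symm z).fst ^ 2 + ‖(F.symm z).snd‖ ^ 2 = 1 := by
    rw [← Cyl.norm_sq, F.symm.norm_map, hz1]; norm_num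
  have ht2 : 0 < 1 - t ^ 2 := by nlinarith [ht.1, ht.2]
  rw [angle, hi, hz1, he1, mul_one, div_one, Real.arcsin_eq_arccos ht.1.le,
    Real.strictAntiOn_arccos.le_iff_ge ⟨by nlinarith [sq_nonneg ‖(F.symm z).snd‖],
      by nlinarith [sq_nonneg ‖(F.symm z).snd‖]⟩
      ⟨by linarith [Real.sqrt_nonneg (1 - t ^ 2)], Real.sqrt_le_one.2 (by nlinarith [ht.1])⟩]
  constructor
  · intro h
    have h0 : 0 < (F.symm z).fst := (Real.sqrt_pos.2 ht2).trans_le h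
    rw [Real.sqrt_le_left h0.le] at h
    exact ⟨h0, abs_le_of_sq_le_sq' (by linarith) ht.1.le |>.2⟩
  · rintro ⟨h0, h1⟩
    rw [Real.sqrt_le_left h0.le]
    nlinarith [norm_nonneg (F.symm z).snd]

/-- The linear isometry `-F`. -/
def negFrame {d : ℕ} (F : Cyl d ≃ₗᵢ[ℝ] Amb d) : Cyl d ≃ₗᵢ[ℝ] Amb d :=
  F.trans (LinearIsometryEquiv.neg ℝ)

@[simp] lemma negFrame_apply {d : ℕ} (F : Cyl d ≃ₗᵢ[ℝ] Amb d) (x : Cyl d) :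
    negFrame F x = -F x := rfl

@[simp] lemma negFrame_symm_apply {d : ℕ} (F : Cyl d ≃ₗᵢ[ℝ] Amb d) (x : Amb d) :
    (negFrame F).symm x = -F.symm x := by
  rw [LinearIsometryEquiv.symm_apply_eq]; simp

namespace HandleConfig

variable {d : ℕ} {δ₀ δ₁ : ℝ} (C : HandleConfig d δ₀ δ₁)

/-- The two halves of the handles. -/
abbrev Side := Fin C.m × Bool

variable (κ : C.Side)

/-- The frames `frame i` and their opposites. -/
def sframe : Cyl d ≃ₗᵢ[ℝ] Amb d := if κ.2 then C.frame κ.1 else negFrame (C.frame κ.1)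

/-- The sine of the distance to the axis of the `i`-th frame. -/
def rad (i : Fin C.m) (x : Amb d) : ℝ := ‖((C.frame i).symm x).snd‖

lemma ρ_pos : 0 < C.ρ := mul_pos C.ε_pos C.η_pos

lemma ρ_lt_one : C.ρ < 1 := C.scale_lt

@[simp] lemma sframe_true (i : Fin C.m) : C.sframe (i, true) = C.frame i := rfl

@[simp] lemma sframe_false (i : Fin C.m) : C.sframe (i, false) = negFrame (C.frame i) := rfl

@[simp] lemma norm_snd_sframe (κ : C.Side) (x : Amb d) :
    ‖((C.sframe κ).symm x).snd‖ = C.rad κ.1 x := by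
  obtain ⟨i, _ | _⟩ := κ
  · simp [rad]
  · rfl

@[simp] lemma rad_neg (i : Fin C.m) (x : Amb d) : C.rad i (-x) = C.rad i x := by
  simp [rad]

lemma sframe_not (i : Fin C.m) (b : Bool) (x : Cyl d) : C.sframe (i, !b) x = -C.sframe (i, b) x := by
  cases b <;> simp

lemma sframe_symm_not (i : Fin C.m) (b : Bool) (x : Amb d) :
    (C.sframe (i, !b)).symm x = -(C.sframe (i, b)).symm x := by
  cases b <;> simp

lemma fst_sq {x : Amb d} (hx : x ∈ sph d) (i : Fin C.m) :
    ((C.frame i).symm x).fst ^ 2 = 1 - C.rad i x ^ 2 := by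
  have h : ‖(C.frame i).symm x‖ = 1 := by simpa using hx
  have := Cyl.norm_sq ((C.frame i).symm x)
  rw [h] at this
  rw [rad]; linarith

lemma exists_sframe_pos {x : Amb d} (hx : x ∈ sph d) {i : Fin C.m} (h : C.rad i x < 1) :
    ∃ b, 0 < ((C.sframe (i, b)).symm x).fst := by
  have h1 := C.fst_sq hx i
  have h2 : 0 ≤ C.rad i x := norm_nonneg _
  have h3 : ((C.frame i).symm x).fst ≠ 0 := by intro h0; rw [h0] at h1; nlinarith
  rcases lt_or_gt_of_ne h3 with h4 | h4
  · simp [*]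
  · simp [*]

lemma center_eq (i : Fin C.m) : C.center i = C.frame i (toLp 2 (1, 0)) := rfl

lemma neg_center_eq (i : Fin C.m) : -C.center i = negFrame (C.frame i) (toLp 2 (1, 0)) := rfl

lemma profile_zero : C.profile 0 = δ₀ * C.ρ := by simp [profile]

lemma profile_one : C.profile 1 = δ₁ * C.ρ := by simp [profile]

lemma profile_eq (t : ℝ) : C.profile t = δ₀ * C.ρ + (δ₁ * C.ρ - δ₀ * C.ρ) * t := by
  simp only [profile]; ring

lemma mem_openCaps_iff {x : Amb d} {t : ℝ} (ht : t ∈ Ioo (0 : ℝ) 1) (i : Fin C.m) :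
    x ∈ openCap (C.center i) (Real.arcsin t) ∪ openCap (-C.center i) (Real.arcsin t) ↔
      x ∈ sph d ∧ C.rad i x < t := by
  rw [center_eq, ← center_eq, neg_center_eq, center_eq]
  constructor
  · rintro (⟨h1, h2⟩ | ⟨h1, h2⟩)
    · exact ⟨h1, ((angle_lt_arcsin_iff _ h1 ht).1 h2).2⟩
    · exact ⟨h1, by simpa [rad] using ((angle_lt_arcsin_iff _ h1 ht).1 h2).2⟩
  · rintro ⟨h1, h2⟩
    obtain ⟨b, hb⟩ := C.exists_sframe_pos h1 (h2.trans ht.2)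
    cases b
    · exact Or.inr ⟨h1, (angle_lt_arcsin_iff _ h1 ht).2 ⟨hb, by simpa [rad] using h2⟩⟩
    · exact Or.inl ⟨h1, (angle_lt_arcsin_iff _ h1 ht).2 ⟨hb, by simpa [rad] using h2⟩⟩

lemma mem_closedCaps_iff {x : Amb d} {t : ℝ} (ht : t ∈ Ioo (0 : ℝ) 1) (i : Fin C.m) :
    x ∈ closedCap (C.center i) (Real.arcsin t) ∪ closedCap (-C.center i) (Real.arcsin t) ↔
      x ∈ sph d ∧ C.rad i x ≤ t := by
  rw [center_eq, ← center_eq, neg_center_eq, center_eq]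
  constructor
  · rintro (⟨h1, h2⟩ | ⟨h1, h2⟩)
    · exact ⟨h1, ((angle_le_arcsin_iff _ h1 ht).1 h2).2⟩
    · exact ⟨h1, by simpa [rad] using ((angle_le_arcsin_iff _ h1 ht).1 h2).2⟩
  · rintro ⟨h1, h2⟩
    obtain ⟨b, hb⟩ := C.exists_sframe_pos h1 (h2.trans_lt ht.2)
    cases b
    · exact Or.inr ⟨h1, (angle_le_arcsin_iff _ h1 ht).2 ⟨hb, by simpa [rad] using h2⟩⟩
    · exact Or.inl ⟨h1, (angle_le_arcsin_iff _ h1 ht).2 ⟨hb, by simpa [rad] using h2⟩⟩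

/-- The conditions on the parameters `δ₀` and `δ₁`. -/
class Admissible (δ₀ δ₁ : ℝ) : Prop where
  pos : 0 < δ₀
  lt : δ₀ < δ₁
  lt_one : δ₁ < 1

variable [hC : Admissible δ₀ δ₁]

lemma inner_mem : δ₀ * C.ρ ∈ Ioo (0 : ℝ) 1 := ⟨mul_pos hC.pos C.ρ_pos, by
    have := C.ρ_pos; have := C.ρ_lt_one; have := hC.pos; have := hC.lt; have := hC.lt_one; nlinarith⟩

lemma outer_mem : δ₁ * C.ρ ∈ Ioo (0 : ℝ) 1 := ⟨mul_pos (hC.pos.trans hC.lt) C.ρ_pos, by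
    have := C.ρ_pos; have := C.ρ_lt_one; have := hC.pos; have := hC.lt; have := hC.lt_one; nlinarith⟩

lemma inner_lt_outer : δ₀ * C.ρ < δ₁ * C.ρ := mul_lt_mul_of_pos_right hC.lt C.ρ_pos

lemma inner_mem' : δ₀ * C.ρ ∈ Ico (0 : ℝ) 1 := Ioo_subset_Ico_self C.inner_mem

lemma outer_mem' : δ₁ * C.ρ ∈ Ico (0 : ℝ) 1 := Ioo_subset_Ico_self C.outer_mem

lemma mem_U {x : Amb d} : x ∈ C.U ↔ x ∈ sph d ∧ ∃ i, C.rad i x < δ₁ * C.ρ := by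
  rw [U, mem_iUnion, rOut, profile_one]
  simp only [C.mem_openCaps_iff C.outer_mem]
  exact exists_and_left

lemma mem_E {x : Amb d} : x ∈ C.E ↔ x ∈ sph d ∧ ∃ i, C.rad i x ≤ δ₀ * C.ρ := by
  rw [E, mem_iUnion, rIn, profile_zero]
  simp only [C.mem_closedCaps_iff C.inner_mem]
  exact exists_and_left

lemma mem_M {x : Amb d} : x ∈ C.M ↔ x ∈ sph d ∧ ∀ i, δ₀ * C.ρ < C.rad i x := by
  rw [M, Set.mem_sdiff, C.mem_E]
  grind

lemma mem_Mbar {x : Amb d} : x ∈ C.Mbar ↔ x ∈ sph d ∧ ∀ i, δ₀ * C.ρ ≤ C.rad i x := by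
  rw [Mbar, Set.mem_sdiff, mem_iUnion, rIn, profile_zero]
  simp only [C.mem_openCaps_iff C.inner_mem]
  grind

lemma lt_rad_of_rad_le {x : Amb d} (hx : x ∈ sph d) {i j : Fin C.m} (hij : i ≠ j)
    (h : C.rad i x ≤ δ₁ * C.ρ) : δ₁ * C.ρ < C.rad j x := by
  by_contra! h'
  have ho := C.outer_mem
  obtain ⟨h1, h2⟩ := C.caps_disjoint i j hij
  have a1 := (C.mem_closedCaps_iff ho i).2 ⟨hx, h⟩
  have a2 := (C.mem_closedCaps_iff ho j).2 ⟨hx, h'⟩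
  have neg : ∀ {z c : Amb d} {r : ℝ}, z ∈ closedCap c r → -z ∈ closedCap (-c) r := by
    exact fun hz => ⟨neg_mem_sph hz.1, by rw [angle_neg_neg]; exact hz.2⟩
  rcases a1 with a1 | a1 <;> rcases a2 with a2 | a2
  · exact Set.disjoint_left.1 h1 a1 a2
  · exact Set.disjoint_left.1 h2 a1 a2
  · have b1 := neg a1; have b2 := neg a2
    rw [neg_neg] at b1
    exact Set.disjoint_left.1 h2 b1 b2
  · have b1 := neg a1; have b2 := neg a2
    rw [neg_neg] at b1 b2
    exact Set.disjoint_left.1 h1 b1 b2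

lemma M_subset_Mbar : C.M ⊆ C.Mbar := fun _ hx =>
  C.mem_Mbar.2 ⟨hx.1, fun i => ((C.mem_M.1 hx).2 i).le⟩

lemma continuous_rad (i : Fin C.m) : Continuous (C.rad i) :=
  (Cyl.continuous_snd.comp (C.frame i).symm.continuous).norm

lemma lipschitz_rad (i : Fin C.m) : LipschitzWith 1 (C.rad i) := by
  refine LipschitzWith.of_dist_le_mul fun x y => ?_
  rw [NNReal.coe_one, one_mul, dist_eq_norm x y, Real.dist_eq, rad, rad]
  refine (abs_norm_sub_norm_le _ _).trans ?_
  have : ((C.frame i).symm x).snd - ((C.frame i).symm y).snd = ((C.frame i).symm (x - y)).snd := by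
    simp
  rw [this, ← (C.frame i).symm.norm_map (x - y)]
  exact Cyl.norm_snd_le _

lemma isClosed_sph (d : ℕ) : IsClosed (sph d) := Metric.isClosed_sphere

lemma isClosed_Mbar : IsClosed C.Mbar := by
  have : C.Mbar = sph d ∩ ⋂ i, {x | δ₀ * C.ρ ≤ C.rad i x} := by ext x; rw [C.mem_Mbar]; simp
  rw [this]
  exact (isClosed_sph d).inter (isClosed_iInter fun i => isClosed_le continuous_const
    (C.continuous_rad i))

lemma isCompact_Mbar : IsCompact C.Mbar :=
  (isCompact_sphere (0 : Amb d) 1).of_isClosed_subset C.isClosed_Mbar fun _ h => h.1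

lemma M_eq : C.M = sph d ∩ ⋂ i, {x | δ₀ * C.ρ < C.rad i x} := by ext x; rw [C.mem_M]; simp

lemma isOpen_lt_rad (t : ℝ) : IsOpen (⋂ i, {x | t < C.rad i x}) :=
  isOpen_iInter_of_finite fun i => isOpen_lt continuous_const (C.continuous_rad i)

lemma measurableSet_M : MeasurableSet C.M := by
  rw [C.M_eq]
  exact (isClosed_sph d).measurableSet.inter (C.isOpen_lt_rad _).measurableSet

lemma measurableSet_Mbar : MeasurableSet C.Mbar := C.isClosed_Mbar.measurableSet

lemma measurableSet_U : MeasurableSet C.U := by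
  have : C.U = sph d ∩ ⋃ i, {x | C.rad i x < δ₁ * C.ρ} := by ext x; rw [C.mem_U]; simp
  rw [this]
  exact (isClosed_sph d).measurableSet.inter (isOpen_iUnion fun i => isOpen_lt
    (C.continuous_rad i) continuous_const).measurableSet

/-- The annulus around the center of the frame `κ`. -/
def ann : Set (Amb d) := (C.sframe κ).symm ⁻¹' chartCone d (δ₀ * C.ρ) (δ₁ * C.ρ)

lemma measurableSet_ann : MeasurableSet (C.ann κ) :=
  (C.sframe κ).symm.continuous.measurable measurableSet_chartCone

lemma mem_ann {x : Amb d} (hx : x ∈ sph d) (κ : C.Side) : x ∈ C.ann κ ↔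
    0 < ((C.sframe κ).symm x).fst ∧ C.rad κ.1 x ∈ Ioo (δ₀ * C.ρ) (δ₁ * C.ρ) := by
  have h1 : ‖(C.sframe κ).symm x‖ = 1 := by simpa using hx
  have h2 := C.inner_lt_outer
  have h3 := C.inner_mem
  rw [ann, mem_preimage, chartCone, mem_ofPred_eq, h1, norm_snd_sframe, inv_one, mul_one, mem_Ioo,
    mem_Ioo, lt_div_iff₀ (by linarith), div_lt_iff₀ (by linarith)]
  constructor
  · grind
  · rintro ⟨h, h4, h5⟩
    refine ⟨h, ?_, by linarith, by linarith⟩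
    rw [← norm_ne_zero_iff, norm_snd_sframe]; linarith [h3.1]

lemma norm_symm {x : Amb d} (hx : x ∈ sph d) (κ : C.Side) :
    ‖(C.sframe κ).symm x‖ = 1 := by simpa using hx

/-! ### The metric `g_h` in the charts -/

lemma fderiv_φInv {i : Fin C.m} {x : Amb d} (hw : ((C.frame i).symm x).snd ≠ 0)
    (ha : ((C.frame i).symm x).fst ≠ 0) (ξ : Amb d) :
    fderiv ℝ (C.φInv i) x ξ = Real.sign ((C.frame i).symm x).fst •
      handleDer (δ₀ * C.ρ) (δ₁ * C.ρ) ((C.frame i).symm x) ((C.frame i).symm ξ) := by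
  set s := Real.sign ((C.frame i).symm x).fst with hs
  have e1 : C.φInv i =ᶠ[𝓝 x] fun z => s • handleInv (δ₀ * C.ρ) (δ₁ * C.ρ) ((C.frame i).symm z) := by
    have hc : ContinuousAt (fun z => ((C.frame i).symm z).fst) x :=
      (Cyl.continuous_fst.comp (C.frame i).symm.continuous).continuousAt
    have hsgn : ∀ᶠ z in 𝓝 x, Real.sign ((C.frame i).symm z).fst = s := by
      rcases lt_or_gt_of_ne ha with h | h
      · filter_upwards [hc.eventually_mem (Iio_mem_nhds h)] with z hz
        rw [hs, Real.sign_of_neg hz, Real.sign_of_neg h]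
      · filter_upwards [hc.eventually_mem (Ioi_mem_nhds h)] with z hz
        rw [hs, Real.sign_of_pos hz, Real.sign_of_pos h]
    filter_upwards [hsgn] with z hz
    rw [φInv, handleInv, hz, sub_mul]
  have hd : HasFDerivAt (fun z => handleInv (δ₀ * C.ρ) (δ₁ * C.ρ) ((C.frame i).symm z))
      (fderiv ℝ (handleInv (δ₀ * C.ρ) (δ₁ * C.ρ)) ((C.frame i).symm x) ∘L
        ((C.frame i).symm : Amb d →L[ℝ] Cyl d)) x :=
    (differentiableAt_handleInv hw).hasFDerivAt.comp x
      ((C.frame i).symm : Amb d →L[ℝ] Cyl d).hasFDerivAt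
  have h2 : HasFDerivAt (fun z => s • handleInv (δ₀ * C.ρ) (δ₁ * C.ρ) ((C.frame i).symm z))
      (s • (fderiv ℝ (handleInv (δ₀ * C.ρ) (δ₁ * C.ρ)) ((C.frame i).symm x) ∘L
        ((C.frame i).symm : Amb d →L[ℝ] Cyl d))) x := hd.const_smul s
  rw [e1.fderiv_eq, h2.fderiv, ← fderiv_handleInv_apply hw]
  rfl

lemma handleMetric_eq {i : Fin C.m} {x : Amb d} (hw : ((C.frame i).symm x).snd ≠ 0)
    (ha : ((C.frame i).symm x).fst ≠ 0) (ξ ζ : Amb d) :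
    C.handleMetric i x ξ ζ = C.ρ ^ 2 * inner ℝ
      (handleDer (δ₀ * C.ρ) (δ₁ * C.ρ) ((C.frame i).symm x) ((C.frame i).symm ξ))
      (handleDer (δ₀ * C.ρ) (δ₁ * C.ρ) ((C.frame i).symm x) ((C.frame i).symm ζ)) := by
  rw [handleMetric, C.fderiv_φInv hw ha, C.fderiv_φInv hw ha, inner_smul_left, inner_smul_right]
  have : Real.sign ((C.frame i).symm x).fst * Real.sign ((C.frame i).symm x).fst = 1 := by
    rcases lt_or_gt_of_ne ha with h | h
    · rw [Real.sign_of_neg h]; norm_num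
    · rw [Real.sign_of_pos h]; norm_num
  rw [conj_trivial, ← mul_assoc (Real.sign _), this, one_mul]

lemma inner_handleDer_neg (A B : ℝ) (x h k : Cyl d) :
    inner ℝ (handleDer A B (-x) (-h)) (handleDer A B (-x) (-k)) =
      inner ℝ (handleDer A B x h) (handleDer A B x k) := by
  have e : ∀ h, handleDer A B (-x) (-h) =
      toLp 2 ((handleDer A B x h).fst, -(handleDer A B x h).snd) := by
    intro h
    rw [handleDer, handleDer, Cyl.ext_iff']
    simp
    abel
  rw [e, e, Cyl.inner_eq, Cyl.inner_eq]
  simp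

lemma gh_of_rad_lt {i : Fin C.m} {x : Amb d} (hx : x ∈ sph d) (h : C.rad i x < δ₁ * C.ρ)
    (ξ ζ : Amb d) : C.gh x ξ ζ = C.handleMetric i x ξ ζ := by
  have hU : x ∈ C.U := C.mem_U.2 ⟨hx, i, h⟩
  have hiff : ∀ j, x ∈ openCap (C.center j) C.rOut ∪ openCap (-C.center j) C.rOut ↔ j = i := by
    intro j
    rw [rOut, profile_one, C.mem_openCaps_iff C.outer_mem]
    constructor
    · rintro ⟨_, h'⟩
      by_contra hji
      exact (C.lt_rad_of_rad_le hx (Ne.symm hji) h.le).not_gt h'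
    simp_all
  rw [gh, if_pos hU]
  simp only [hiff]
  simp

lemma gh_eq_handleDer {κ : C.Side} {x : Amb d} (hx : x ∈ sph d)
    (h0 : 0 < C.rad κ.1 x) (h : C.rad κ.1 x < δ₁ * C.ρ) (ξ ζ : Amb d) :
    C.gh x ξ ζ = C.ρ ^ 2 * inner ℝ
      (handleDer (δ₀ * C.ρ) (δ₁ * C.ρ) ((C.sframe κ).symm x) ((C.sframe κ).symm ξ))
      (handleDer (δ₀ * C.ρ) (δ₁ * C.ρ) ((C.sframe κ).symm x) ((C.sframe κ).symm ζ)) := by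
  obtain ⟨i, b⟩ := κ
  have hw : ((C.frame i).symm x).snd ≠ 0 := norm_pos_iff.1 h0
  have ha : ((C.frame i).symm x).fst ≠ 0 := by
    intro h1
    have := C.fst_sq hx i
    have h2 := C.outer_mem.2
    simp only at h h0
    rw [h1] at this; nlinarith
  rw [C.gh_of_rad_lt hx h, C.handleMetric_eq hw ha]
  cases b
  · simp only [sframe_false, negFrame_symm_apply, inner_handleDer_neg]
  · rfl

lemma gh_of_notMem_U {x : Amb d} (hx : x ∉ C.U) (ξ ζ : Amb d) : C.gh x ξ ζ = inner ℝ ξ ζ := by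
  rw [gh, if_neg hx]; rfl

lemma gh_neg {x : Amb d} (hx : x ∈ C.Mbar) (ξ ζ : Amb d) : C.gh (-x) ξ ζ = C.gh x ξ ζ := by
  have hx' : -x ∈ sph d := neg_mem_sph hx.1
  by_cases hU : x ∈ C.U
  · obtain ⟨_, i, hi⟩ := C.mem_U.1 hU
    have h0 : 0 < C.rad i x := C.inner_mem.1.trans_le ((C.mem_Mbar.1 hx).2 i)
    rw [C.gh_eq_handleDer (κ := (i, true)) hx.1 h0 hi,
      C.gh_eq_handleDer (κ := (i, false)) hx' (by simpa using h0) (by simpa using hi)]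
    have e := inner_handleDer_neg (δ₀ * C.ρ) (δ₁ * C.ρ) ((C.frame i).symm x)
      ((C.frame i).symm ξ) ((C.frame i).symm ζ)
    have e2 := inner_handleDer_neg (δ₀ * C.ρ) (δ₁ * C.ρ) (-(C.frame i).symm x)
      ((C.frame i).symm ξ) ((C.frame i).symm ζ)
    simp only [sframe_false, sframe_true, negFrame_symm_apply, map_neg, neg_neg] at e2 ⊢
    have e3 : ∀ x h : Cyl d, handleDer (δ₀ * C.ρ) (δ₁ * C.ρ) x (-h) =
        -handleDer (δ₀ * C.ρ) (δ₁ * C.ρ) x h := by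
      intro x h
      rw [handleDer, handleDer, Cyl.ext_iff']
      simp
      constructor
      · ring
      · abel
    simp [*]
  · have hU' : -x ∉ C.U := by
      rw [C.mem_U] at hU ⊢
      simpa using hU
    rw [C.gh_of_notMem_U hU, C.gh_of_notMem_U hU']

/-- The constant in the comparison of the metrics. -/
def compConst (δ₀ δ₁ : ℝ) : ℝ := 1 + (δ₁ - δ₀) ^ 2 / (1 - δ₁ ^ 2) + δ₁ ^ 2 +
  ((δ₁ - δ₀) ^ 2)⁻¹ + (δ₀ ^ 2)⁻¹

omit C in
lemma compConst_props : 1 ≤ compConst δ₀ δ₁ ∧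
    (δ₁ - δ₀) ^ 2 ≤ compConst δ₀ δ₁ * (1 - δ₁ ^ 2) ∧ δ₁ ^ 2 ≤ compConst δ₀ δ₁ ∧
    1 ≤ compConst δ₀ δ₁ * (δ₁ - δ₀) ^ 2 ∧ 1 ≤ compConst δ₀ δ₁ * δ₀ ^ 2 := by
  have h0 := hC.pos
  have h1 := hC.lt
  have h2 := hC.lt_one
  have p1 : 0 < 1 - δ₁ ^ 2 := by nlinarith
  have p2 : 0 < (δ₁ - δ₀) ^ 2 := pow_pos (by linarith) 2
  have p3 : 0 < δ₀ ^ 2 := by positivity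
  have p4 : 0 ≤ (δ₁ - δ₀) ^ 2 / (1 - δ₁ ^ 2) := by positivity
  have p5 : 0 ≤ ((δ₁ - δ₀) ^ 2)⁻¹ := by positivity
  have p6 : 0 ≤ (δ₀ ^ 2)⁻¹ := by positivity
  have p7 : 0 ≤ δ₁ ^ 2 := sq_nonneg _
  refine ⟨by unfold compConst; linarith, ?_, by unfold compConst; linarith, ?_, ?_⟩
  · rw [← div_le_iff₀ p1]; unfold compConst; linarith
  · rw [← div_le_iff₀ p2, one_div]; unfold compConst; linarith
  · rw [← div_le_iff₀ p3, one_div]; unfold compConst; linarith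

/-- The metrics `g_h` are uniformly comparable with the standard metric. -/
theorem gh_comparison {x : Amb d} (hx : x ∈ C.Mbar) {ξ : Amb d} (hξ : inner ℝ x ξ = 0) :
    (compConst δ₀ δ₁)⁻¹ * ‖ξ‖ ^ 2 ≤ C.gh x ξ ξ ∧ C.gh x ξ ξ ≤ compConst δ₀ δ₁ * ‖ξ‖ ^ 2 := by
  obtain ⟨c1, c2, c3, c4, c5⟩ := compConst_props (δ₀ := δ₀) (δ₁ := δ₁)
  set Λ := compConst δ₀ δ₁
  have hΛ : 0 < Λ := by linarith
  have hΛ1 : Λ⁻¹ ≤ 1 := inv_le_one_of_one_le₀ c1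
  by_cases hU : x ∈ C.U
  · obtain ⟨_, i, hi⟩ := C.mem_U.1 hU
    have hr := (C.mem_Mbar.1 hx).2 i
    have h0 : 0 < C.rad i x := C.inner_mem.1.trans_le hr
    rw [C.gh_eq_handleDer (κ := (i, true)) hx.1 h0 hi, real_inner_self_eq_norm_sq]
    have hn := C.norm_symm hx.1 (i, true)
    have hw : ((C.sframe (i, true)).symm x).snd ≠ 0 := norm_pos_iff.1 h0
    have hin : inner ℝ ((C.sframe (i, true)).symm x) ((C.sframe (i, true)).symm ξ) = 0 := by
      simpa using hξ
    have hf : ((C.sframe (i, true)).symm x).fst ^ 2 = 1 - C.rad i x ^ 2 := C.fst_sq hx.1 i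
    have hw' : ‖((C.sframe (i, true)).symm x).snd‖ = C.rad i x := C.norm_snd_sframe _ _
    have hρ := C.ρ_pos
    have hρ1 := C.ρ_lt_one
    have hρ2 : 0 < C.ρ ^ 2 := by positivity
    have hAB := C.inner_lt_outer.ne
    have d0 := hC.pos
    have d1 := hC.lt
    have d2 := hC.lt_one
    have k0 : (C.ρ * δ₀) ^ 2 ≤ C.rad i x ^ 2 := by
      refine pow_le_pow_left₀ (by positivity) ?_ 2; linarith
    have k1 : C.rad i x ^ 2 ≤ (C.ρ * δ₁) ^ 2 := by refine pow_le_pow_left₀ h0.le ?_ 2; linarith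
    have k2 : (C.ρ * δ₁) ^ 2 ≤ δ₁ ^ 2 := by refine pow_le_pow_left₀ (by nlinarith) ?_ 2; nlinarith
    have hξn : ‖(C.sframe (i, true)).symm ξ‖ = ‖ξ‖ := by simp
    have lo := handleDer_lower hw hn hin (L := Λ⁻¹ * (C.ρ ^ 2)⁻¹) hAB (by
        rw [hf]
        have : Λ⁻¹ * (C.ρ ^ 2)⁻¹ * (δ₁ * C.ρ - δ₀ * C.ρ) ^ 2 = (δ₁ - δ₀) ^ 2 / Λ := by field_simp
        rw [this, div_le_iff₀ hΛ]
        nlinarith) (by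
        rw [hw']
        have : Λ⁻¹ * (C.ρ ^ 2)⁻¹ * C.rad i x ^ 2 = C.rad i x ^ 2 / (C.ρ ^ 2 * Λ) := by field_simp
        rw [this, div_le_one (by positivity)]
        nlinarith)
    have up := handleDer_upper hw hn hin (L := Λ * (C.ρ ^ 2)⁻¹) hAB (by
        rw [hf]
        have : Λ * (C.ρ ^ 2)⁻¹ * (δ₁ * C.ρ - δ₀ * C.ρ) ^ 2 = Λ * (δ₁ - δ₀) ^ 2 := by field_simp
        rw [this]
        nlinarith [sq_nonneg (C.rad i x)]) (by
        rw [hw', mul_assoc, ← div_eq_inv_mul]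
        have : δ₀ ^ 2 ≤ C.rad i x ^ 2 / C.ρ ^ 2 := by
          rw [le_div_iff₀ hρ2]; linarith [mul_pow C.ρ δ₀ 2]
        nlinarith)
    rw [hξn] at lo up
    constructor
    · calc Λ⁻¹ * ‖ξ‖ ^ 2 = C.ρ ^ 2 * (Λ⁻¹ * (C.ρ ^ 2)⁻¹ * ‖ξ‖ ^ 2) := by field_simp
        _ ≤ _ := by gcongr
    · calc _ ≤ C.ρ ^ 2 * (Λ * (C.ρ ^ 2)⁻¹ * ‖ξ‖ ^ 2) := by gcongr
        _ = _ := by field_simp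
  · rw [C.gh_of_notMem_U hU, real_inner_self_eq_norm_sq]
    have := sq_nonneg ‖ξ‖
    constructor <;> nlinarith

end HandleConfig

/-! ### Null sets and integrals in the charts -/

section Null

variable {d : ℕ} {A B : ℝ}

lemma chartInv_chartPt (hA : A ∈ Ico (0 : ℝ) 1) (hB : B ∈ Ico (0 : ℝ) 1) (hAB : A ≠ B)
    {p : ℝ × 𝕊 d} (hp : p.1 ∈ Ioo (0 : ℝ) 1) :
    chartPt A B p.1 p.2 ∈ chartCone d A B ∧ chartInv A B (chartPt A B p.1 p.2) = cylPt p := by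
  have hn : ‖(p.2 : 𝔼 d)‖ = 1 := by simp
  have h0 : (cylPt p).snd ≠ 0 := by
    rw [← norm_ne_zero_iff]
    positivity
  have := chartInv_chartExt hA hB hAB (q := cylPt p) hp h0
  have e : chartExt A B (cylPt p) = chartPt A B p.1 p.2 := by
    change ‖(p.2 : 𝔼 d)‖ • chartPt A B p.1 (‖(p.2 : 𝔼 d)‖⁻¹ • (p.2 : 𝔼 d)) = _
    rw [hn]; simp
  rwa [e] at this

lemma ae_cylVol_mem : ∀ᵐ p ∂cylVol d, p.1 ∈ Ioo (0 : ℝ) 1 := by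
  have h : ∀ᵐ y ∂(volume : Measure ℝ).restrict (Ioo (0 : ℝ) 1), y ∈ Ioo (0 : ℝ) 1 :=
    ae_restrict_mem measurableSet_Ioo
  exact Measure.quasiMeasurePreserving_fst.ae h

lemma continuous_frame_chartPt (A B : ℝ) (F : Cyl d ≃ₗᵢ[ℝ] Amb d) : Continuous fun p : ℝ × 𝕊 d =>
      F (chartPt A B p.1 p.2) := by
  unfold chartPt
  exact F.continuous.comp (Cyl.continuous_toLp (by fun_prop) (by fun_prop))

lemma ae_cylVol_of_ae [NeZero d] (hA : A ∈ Ico (0 : ℝ) 1) (hB : B ∈ Ico (0 : ℝ) 1) (hAB : A ≠ B)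
    (F : Cyl d ≃ₗᵢ[ℝ] Amb d) {P : Amb d → Prop}
    (h : ∀ᵐ x ∂(sphVol d).restrict (F.symm ⁻¹' chartCone d A B), P x) :
    ∀ᵐ p ∂cylVol d, P (F (chartPt A B p.1 p.2)) := by
  obtain ⟨s, hs, hms, hs0⟩ := exists_measurable_superset_of_null (ae_iff.1 h)
  have e := lintegral_chartPt_frame hA hB hAB F (f := s.indicator 1)
    (measurable_const.indicator hms)
  have e0 : ∫⁻ x in F.symm ⁻¹' chartCone d A B, s.indicator 1 x *
      ofReal (chartJac A B (F.symm x)) ∂sphVol d = 0 := by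
    have : ∀ᵐ x ∂(sphVol d).restrict (F.symm ⁻¹' chartCone d A B), x ∉ s :=
      measure_eq_zero_iff_ae_notMem.1 hs0
    rw [lintegral_congr_ae (g := fun _ => 0)]
    · simp
    · filter_upwards [this] with x hx
      simp [hx]
  have hmp := (continuous_frame_chartPt A B F).measurable
  have hmi : Measurable (s.indicator (1 : Amb d → ℝ≥0∞)) := measurable_const.indicator hms
  have hm2 : Measurable fun p : ℝ × 𝕊 d =>
      s.indicator (1 : Amb d → ℝ≥0∞) (F (chartPt A B p.1 p.2)) := hmi.comp hmp
  rw [e0] at e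
  have e := (lintegral_eq_zero_iff hm2).1 e.symm
  filter_upwards [e] with p hp
  by_contra hP
  have : F (chartPt A B p.1 p.2) ∈ s := hs hP
  simp [this] at hp

lemma ae_norm_snd_ne [NeZero d] (F : Cyl d ≃ₗᵢ[ℝ] Amb d) {t : ℝ} (ht : t ∈ Ico (0 : ℝ) 1) :
    ∀ᵐ x ∂sphVol d, ‖(F.symm x).snd‖ ≠ t := by
  set a := t / √(1 - t ^ 2) with ha
  have hp : 0 < 1 - t ^ 2 := by nlinarith [ht.1, ht.2]
  have hm : MeasurableSet {p : ℝ × 𝔼 d | ‖p.2‖ = a * |p.1|} :=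
    measurableSet_eq_fun (by fun_prop) (by fun_prop)
  have hN : (volume : Measure (Cyl d)) {x | ‖x.snd‖ = a * |x.fst|} = 0 := by
    refine ((WithLp.volume_preserving_ofLp ℝ 𝔼 d).measure_preimage hm.nullMeasurableSet).trans ?_
    rw [Measure.volume_eq_prod, Measure.measure_prod_null hm]
    refine Eventually.of_forall fun y => ?_
    convert Measure.addHaar_sphere (volume : Measure 𝔼 d) 0 (a * |y|) using 2
    · ext z
      simp
    · rfl
  have hs : MeasurableSet {x : Amb d | ‖(F.symm x).snd‖ = t} :=
    (Cyl.continuous_snd.comp F.symm.continuous).norm.measurable (measurableSet_singleton t)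
  have hs' : MeasurableSet {x : sphere (0 : Cyl d) 1 | ‖(x : Cyl d).snd‖ = t} :=
    (Cyl.continuous_snd.comp continuous_subtype_val).norm.measurable (measurableSet_singleton t)
  have e := lintegral_sphVol_frame F (f := indicator {x | ‖(F.symm x).snd‖ = t} 1)
    (measurable_const.indicator hs)
  rw [lintegral_indicator_one hs] at e
  refine ae_iff.2 ?_
  simp only [not_not]
  rw [e]
  refine (lintegral_congr (g := indicator {x : sphere (0 : Cyl d) 1 | ‖(x : Cyl d).snd‖ = t} 1)
    fun x => ?_).trans ?_
  · simp [indicator]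
  rw [lintegral_indicator_one hs', Measure.toSphere_apply' _ hs', measure_mono_null _ hN, mul_zero]
  rintro _ ⟨r, hr, _, ⟨x, hx, rfl⟩, rfl⟩
  replace hx : ‖(x : Cyl d).snd‖ = t := hx
  have h1 := Cyl.norm_sq (x : Cyl d)
  rw [norm_eq_of_mem_sphere, hx] at h1
  have h2 : |(x : Cyl d).fst| = √(1 - t ^ 2) := by
    rw [← Real.sqrt_sq_eq_abs]
    congr 1
    linarith
  change ‖r • (x : Cyl d).snd‖ = a * |r * (x : Cyl d).fst|
  rw [norm_smul, abs_mul, h2, hx, Real.norm_eq_abs, ha]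
  field_simp

lemma ae_snd_ne_zero [NeZero d] (F : Cyl d ≃ₗᵢ[ℝ] Amb d) : ∀ᵐ x ∂sphVol d, (F.symm x).snd ≠ 0 := by
  simpa using ae_norm_snd_ne F (t := 0) (by simp)

end Null

namespace HandleConfig

variable {d : ℕ} {δ₀ δ₁ : ℝ} (C : HandleConfig d δ₀ δ₁) [hC : Admissible δ₀ δ₁] [NeZero d] (κ : C.Side)

lemma mem_Mbar_of_notMem_U {x : Amb d} (hx : x ∈ sph d) (hU : x ∉ C.U) : x ∈ C.Mbar := by
  refine C.mem_Mbar.2 ⟨hx, fun i => ?_⟩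
  by_contra! h
  exact hU (C.mem_U.2 ⟨hx, i, h.trans C.inner_lt_outer⟩)

lemma mem_M_of_notMem_U {x : Amb d} (hx : x ∈ sph d) (hU : x ∉ C.U) : x ∈ C.M := by
  refine C.mem_M.2 ⟨hx, fun i => ?_⟩
  by_contra! h
  exact hU (C.mem_U.2 ⟨hx, i, h.trans_lt C.inner_lt_outer⟩)

lemma mem_M_of_mem_ann {x : Amb d} (hx : x ∈ sph d) {κ : C.Side} (h : x ∈ C.ann κ) : x ∈ C.M := by
  refine C.mem_M.2 ⟨hx, fun i => ?_⟩
  have h2 := ((C.mem_ann hx κ).1 h).2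
  by_cases hi : κ.1 = i
  · rw [← hi]; exact h2.1
  · exact C.inner_lt_outer.trans (C.lt_rad_of_rad_le hx hi h2.2.le)

lemma mem_U_of_mem_ann {x : Amb d} (hx : x ∈ sph d) {κ : C.Side} (h : x ∈ C.ann κ) :
    x ∈ C.U := C.mem_U.2 ⟨hx, κ.1, ((C.mem_ann hx κ).1 h).2.2⟩

lemma eq_of_fst_pos {x : Amb d} (hx : x ∈ sph d) {κ κ' : C.Side}
    (h : 0 < ((C.sframe κ).symm x).fst) (h' : 0 < ((C.sframe κ').symm x).fst)
    (hr : C.rad κ.1 x ≤ δ₁ * C.ρ) (hr' : C.rad κ'.1 x ≤ δ₁ * C.ρ) : κ = κ' := by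
  have e : κ.1 = κ'.1 := by
    by_contra hne
    exact (C.lt_rad_of_rad_le hx hne hr).not_ge hr'
  obtain ⟨i, b⟩ := κ
  obtain ⟨j, c⟩ := κ'
  obtain rfl : i = j := e
  congr 1
  by_contra hbc
  have hc : c = !b := by cases b <;> cases c <;> simp_all
  rw [hc, C.sframe_symm_not] at h'
  have : (-(C.sframe (i, b)).symm x).fst = -((C.sframe (i, b)).symm x).fst := rfl
  rw [this] at h'
  linarith

lemma eq_of_mem_ann {x : Amb d} (hx : x ∈ sph d) {κ κ' : C.Side} (h : x ∈ C.ann κ)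
    (h' : x ∈ C.ann κ') : κ = κ' := by
  have h1 := (C.mem_ann hx κ).1 h
  have h2 := (C.mem_ann hx κ').1 h'
  exact C.eq_of_fst_pos hx h1.1 h2.1 h1.2.2.le h2.2.2.le

lemma ae_rad_ne (i : Fin C.m) {t : ℝ} (ht : t ∈ Ioo (0 : ℝ) 1) : ∀ᵐ x ∂sphVol d, C.rad i x ≠ t :=
  ae_norm_snd_ne (C.frame i) (Ioo_subset_Ico_self ht)

theorem restrict_Mbar : (sphVol d).restrict C.Mbar =
    (sphVol d).restrict C.Uᶜ + ∑ κ, (sphVol d).restrict (C.ann κ) := by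
  have h1 : ∀ᵐ x ∂sphVol d, x ∈ C.Mbar ↔ x ∈ C.Uᶜ ∪ ⋃ κ, C.ann κ := by
    have : ∀ᵐ x ∂sphVol d, ∀ i, C.rad i x ≠ δ₀ * C.ρ :=
      ae_all_iff.2 fun i => C.ae_rad_ne i C.inner_mem
    filter_upwards [ae_mem_sph d, this] with x hx hr
    constructor
    · intro h
      by_cases hU : x ∈ C.U
      · right
        obtain ⟨_, i, hi⟩ := C.mem_U.1 hU
        obtain ⟨b, hb⟩ := C.exists_sframe_pos hx (hi.trans C.outer_mem.2)
        refine mem_iUnion.2 ⟨(i, b), (C.mem_ann hx _).2 ⟨hb, ?_, hi⟩⟩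
        exact lt_of_le_of_ne ((C.mem_Mbar.1 h).2 i) (hr i).symm
      · exact Or.inl hU
    · rintro (h | h)
      · exact C.mem_Mbar_of_notMem_U hx h
      · obtain ⟨κ, hκ⟩ := mem_iUnion.1 h
        exact C.M_subset_Mbar (C.mem_M_of_mem_ann hx hκ)
  have hm := fun κ => C.measurableSet_ann κ
  rw [Measure.restrict_congr_set (eventuallyEq_set.2 h1), Measure.restrict_union₀,
    Measure.restrict_iUnion_ae, Measure.sum_fintype]
  · intro κ κ' hne
    rw [Function.onFun, AEDisjoint, measure_eq_zero_iff_ae_notMem]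
    filter_upwards [ae_mem_sph d] with x hx h
    exact hne (C.eq_of_mem_ann hx h.1 h.2)
  · simp [*]
  · rw [AEDisjoint, measure_eq_zero_iff_ae_notMem]
    filter_upwards [ae_mem_sph d] with x hx h
    obtain ⟨κ, hκ⟩ := mem_iUnion.1 h.2
    exact h.1 (C.mem_U_of_mem_ann hx hκ)
  · exact (MeasurableSet.iUnion hm).nullMeasurableSet

lemma volDensity_of_notMem_U {x : Amb d} (hx : x ∈ sph d) (hU : x ∉ C.U) :
    volDensity C.gh x = 1 ∧ ∀ f, gradSq C.gh f x = gradSq (roundMetric d) f x := by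
  have e : metricMatrix C.gh x = metricMatrix (roundMetric d) x := by
    ext i j
    simp only [metricMatrix, Matrix.of_apply, C.gh_of_notMem_U hU, roundMetric]
  constructor
  · rw [volDensity, e]; exact volDensity_roundMetric (by simpa using hx)
  · intro f
    simp only [gradSq, metricInv, e]

/-- The pull-back of a function on `M̄_h` to the half-handle `κ`. -/
def pull (u : C.Mbar → ℝ) : Cyl d → ℝ :=
  chartPull (C.sframe κ) (δ₀ * C.ρ) (δ₁ * C.ρ) (homExt C.Mbar u)

lemma volDensity_of_mem_ann {x : Amb d} (hx : x ∈ sph d) {κ : C.Side} (h : x ∈ C.ann κ) :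
    volDensity C.gh x = C.ρ ^ d * chartJac (δ₀ * C.ρ) (δ₁ * C.ρ) ((C.sframe κ).symm x) ∧
      ∀ f, RayConst f → gradSq C.gh f x = (C.ρ ^ 2)⁻¹ * ‖fderiv ℝ (chartPull (C.sframe κ) (δ₀ * C.ρ)
        (δ₁ * C.ρ) f) (chartInv (δ₀ * C.ρ) (δ₁ * C.ρ) ((C.sframe κ).symm x))‖ ^ 2 := by
  have h2 := (C.mem_ann hx κ).1 h
  refine volDensity_gradSq_chart (C.sframe κ) C.inner_mem' C.outer_mem'
    C.inner_lt_outer.ne (by simpa using hx) h C.ρ_pos fun ξ ζ _ _ => ?_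
  exact C.gh_eq_handleDer hx (C.inner_mem.1.trans h2.2.1) h2.2.2 ξ ζ

lemma measurable_jac : Measurable fun x => ofReal
    (C.ρ ^ d * chartJac (δ₀ * C.ρ) (δ₁ * C.ρ) ((C.sframe κ).symm x)) :=
  ((measurable_chartJac.comp (C.sframe κ).symm.continuous.measurable).const_mul _).ennreal_ofReal

/-- The density of the canonical measure, almost everywhere. -/
def dens (x : Amb d) : ℝ≥0∞ := C.Uᶜ.indicator 1 x + ∑ κ, (C.ann κ).indicator (fun x => ofReal
    (C.ρ ^ d * chartJac (δ₀ * C.ρ) (δ₁ * C.ρ) ((C.sframe κ).symm x))) x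

lemma measurable_dens : Measurable C.dens := by
  have h1 : Measurable (C.Uᶜ.indicator (1 : Amb d → ℝ≥0∞)) :=
    measurable_const.indicator C.measurableSet_U.compl
  refine h1.add (Finset.measurable_sum _ fun κ _ => ?_)
  exact (C.measurable_jac κ).indicator (C.measurableSet_ann κ)

lemma dens_of_notMem_U {x : Amb d} (hx : x ∈ sph d) (hU : x ∉ C.U) : C.dens x = 1 := by
  have : ∀ κ, x ∉ C.ann κ := fun κ h => hU (C.mem_U_of_mem_ann hx h)
  simp [dens, hU, this]

lemma dens_of_mem_ann {x : Amb d} (hx : x ∈ sph d) {κ : C.Side} (h : x ∈ C.ann κ) :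
    C.dens x = ofReal (C.ρ ^ d * chartJac (δ₀ * C.ρ) (δ₁ * C.ρ) ((C.sframe κ).symm x)) := by
  have hU := C.mem_U_of_mem_ann hx h
  rw [dens, Finset.sum_eq_single κ]
  · simp [hU, h]
  · intro κ' _ hne
    rw [indicator_of_notMem]
    exact fun h' => hne (C.eq_of_mem_ann hx h' h)
  · simp

lemma ae_dens : ∀ᵐ x ∂(sphVol d).restrict C.Mbar, ofReal (volDensity C.gh x) = C.dens x := by
  rw [C.restrict_Mbar, ae_add_measure_iff]
  constructor
  · filter_upwards [ae_restrict_mem C.measurableSet_U.compl,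
      ae_restrict_of_ae (ae_mem_sph d)] with x hU hx
    rw [C.dens_of_notMem_U hx hU, (C.volDensity_of_notMem_U hx hU).1]; simp
  · rw [← Measure.sum_fintype, Measure.ae_sum_iff]
    intro κ
    filter_upwards [ae_restrict_mem (C.measurableSet_ann κ),
      ae_restrict_of_ae (ae_mem_sph d)] with x hU hx
    rw [C.dens_of_mem_ann hx hU, (C.volDensity_of_mem_ann hx hU).1]

lemma vol_eq : C.mfd.vol =
    ((sphVol d).comap (Subtype.val : C.Mbar → Amb d)).withDensity fun x => C.dens x := by
  refine withDensity_congr_ae ?_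
  have h := C.ae_dens
  rw [ae_restrict_iff' C.measurableSet_Mbar] at h
  exact (MeasurableEmbedding.subtype_coe C.measurableSet_Mbar).ae_map_iff.1 (by
    rw [(MeasurableEmbedding.subtype_coe C.measurableSet_Mbar).map_comap]
    simpa using C.ae_dens)

theorem lintegral_vol {f : Amb d → ℝ≥0∞} (hf : Measurable f) :
    ∫⁻ x : C.Mbar, f x ∂C.mfd.vol = ∫⁻ x in C.Uᶜ, f x ∂sphVol d +
      ∑ κ, ofReal (C.ρ ^ d) * ∫⁻ p, f (C.sframe κ (chartPt (δ₀ * C.ρ) (δ₁ * C.ρ) p.1 p.2))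
        ∂cylVol d := by
  have hA := C.inner_mem'
  have hB := C.outer_mem'
  have hAB := C.inner_lt_outer.ne
  have e1 := C.vol_eq
  have e2 := lintegral_withDensity_eq_lintegral_mul
    ((sphVol d).comap (Subtype.val : C.Mbar → Amb d)) (f := fun x => C.dens x)
    (C.measurable_dens.comp measurable_subtype_coe) (g := fun x : C.Mbar => f x)
    (hf.comp measurable_subtype_coe)
  rw [e1]
  refine e2.trans ?_
  refine (lintegral_subtype_comap C.measurableSet_Mbar (fun x => C.dens x * f x)).trans ?_
  rw [C.restrict_Mbar, lintegral_add_measure, lintegral_finsetSum_measure]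
  congr 1
  · refine lintegral_congr_ae ?_
    filter_upwards [ae_restrict_mem C.measurableSet_U.compl,
      ae_restrict_of_ae (ae_mem_sph d)] with x hU hx
    rw [C.dens_of_notMem_U hx hU, one_mul]
  · refine Finset.sum_congr rfl fun κ _ => ?_
    rw [← lintegral_chartPt_frame hA hB hAB _ hf, ← lintegral_const_mul]
    · refine lintegral_congr_ae ?_
      filter_upwards [ae_restrict_mem (C.measurableSet_ann κ),
        ae_restrict_of_ae (ae_mem_sph d)] with x hU hx
      rw [C.dens_of_mem_ann hx hU, ofReal_mul (pow_nonneg C.ρ_pos.le _)]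
      ring
    · exact hf.mul (measurable_chartJac.comp (C.sframe κ).symm.continuous.measurable).ennreal_ofReal

/-- The Dirichlet functional of `g_h` in the charts. -/
theorem dirichlet_eq (u : C.Mbar → ℝ) :
    C.mfd.dirichlet u = ∫⁻ x in C.Uᶜ, ‖fderiv ℝ (homExt C.Mbar u) x‖ₑ ^ 2 ∂sphVol d +
      ∑ κ, ofReal ((C.ρ ^ 2)⁻¹ * C.ρ ^ d) * ∫⁻ p, ‖fderiv ℝ (C.pull κ u) (cylPt p)‖ₑ ^ 2
        ∂cylVol d := by
  have hA := C.inner_mem'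
  have hB := C.outer_mem'
  have hAB := C.inner_lt_outer.ne
  refine (lintegral_subtype_comap C.measurableSet_Mbar (fun x => ofReal
    (gradSq C.gh (homExt C.Mbar u) x * volDensity C.gh x))).trans ?_
  rw [C.restrict_Mbar, lintegral_add_measure, lintegral_finsetSum_measure]
  have hray := rayConst_homExt C.Mbar u
  congr 1
  · refine lintegral_congr_ae ?_
    filter_upwards [ae_restrict_mem C.measurableSet_U.compl,
      ae_restrict_of_ae (ae_mem_sph d)] with x hU hx
    rw [(C.volDensity_of_notMem_U hx hU).1, (C.volDensity_of_notMem_U hx hU).2,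
      gradSq_roundMetric (by simpa using hx) hray, mul_one, ofReal_pow (norm_nonneg _),
      ofReal_norm]
  · refine Finset.sum_congr rfl fun κ _ => ?_
    have hmg : Measurable fun x : Amb d => ‖fderiv ℝ (C.pull κ u) (chartInv (δ₀ * C.ρ) (δ₁ * C.ρ)
        ((C.sframe κ).symm x))‖ₑ ^ 2 := by
      have h1 : Measurable (chartInv (d := d) (δ₀ * C.ρ) (δ₁ * C.ρ)) := by
        have a1 : Measurable fun x : Cyl d => x.snd := Cyl.continuous_snd.measurable
        have a2 := (((a1.norm).mul measurable_norm.inv).sub_const (δ₀ * C.ρ)).div_const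
          (δ₁ * C.ρ - δ₀ * C.ρ)
        have a3 := (measurable_norm.mul a1.norm.inv).smul a1
        exact (WithLp.prodContinuousLinearEquiv 2 ℝ ℝ
          𝔼 d).symm.continuous.measurable.comp (a2.prodMk a3)
      have h2 := (measurable_fderiv ℝ (C.pull κ u)).comp
        (h1.comp (C.sframe κ).symm.continuous.measurable)
      exact h2.enorm.pow_const 2
    have e := lintegral_chartPt_frame hA hB hAB (C.sframe κ) hmg
    have e2 : ∫⁻ p, ‖fderiv ℝ (C.pull κ u) (cylPt p)‖ₑ ^ 2 ∂cylVol d =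
        ∫⁻ p, ‖fderiv ℝ (C.pull κ u) (chartInv (δ₀ * C.ρ) (δ₁ * C.ρ) ((C.sframe κ).symm
          (C.sframe κ (chartPt (δ₀ * C.ρ) (δ₁ * C.ρ) p.1 p.2))))‖ₑ ^ 2 ∂cylVol d := by
      refine lintegral_congr_ae ?_
      filter_upwards [ae_cylVol_mem] with p hp
      rw [LinearIsometryEquiv.symm_apply_apply, (chartInv_chartPt hA hB hAB hp).2]
    rw [e2, ← e, ← lintegral_const_mul]
    · refine lintegral_congr_ae ?_
      filter_upwards [ae_restrict_mem (C.measurableSet_ann κ),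
        ae_restrict_of_ae (ae_mem_sph d)] with x hU hx
      have hv := C.volDensity_of_mem_ann hx hU
      rw [hv.1, hv.2 _ hray]
      have p1 : 0 ≤ (C.ρ ^ 2)⁻¹ := inv_nonneg.2 (sq_nonneg _)
      have p2 : 0 ≤ C.ρ ^ d := pow_nonneg C.ρ_pos.le _
      rw [ofReal_mul (by positivity), ofReal_mul p1, ofReal_mul p1,
        ofReal_mul p2, ofReal_pow (norm_nonneg _), ofReal_norm]
      change _ = ofReal (C.ρ ^ 2)⁻¹ * ofReal (C.ρ ^ d) * (‖fderiv ℝ (C.pull κ u) _‖ₑ ^ 2 * _)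
      rw [pull]
      ring
    · exact hmg.mul
        (measurable_chartJac.comp (C.sframe κ).symm.continuous.measurable).ennreal_ofReal

end HandleConfig

/-! ### Differentiability of Lipschitz functions on the sphere -/

section Rademacher

variable {d : ℕ}

lemma norm_normalize_sub_le {E : Type*} [NormedAddCommGroup E] [NormedSpace ℝ E] {x y : E}
    (hx : x ≠ 0) (hy : y ≠ 0) : ‖‖x‖⁻¹ • x - ‖y‖⁻¹ • y‖ ≤ 2 * ‖x‖⁻¹ * ‖x - y‖ := by
  have h1 : 0 < ‖x‖ := norm_pos_iff.2 hx
  have h2 : 0 < ‖y‖ := norm_pos_iff.2 hy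
  have e : ‖x‖⁻¹ • x - ‖y‖⁻¹ • y = ‖x‖⁻¹ • (x - y) + (‖x‖⁻¹ - ‖y‖⁻¹) • y := by
    rw [smul_sub, sub_smul]; abel
  have e2 : |‖x‖⁻¹ - ‖y‖⁻¹| * ‖y‖ = ‖x‖⁻¹ * |‖x‖ - ‖y‖| := by
    have : ‖x‖⁻¹ - ‖y‖⁻¹ = -(‖x‖⁻¹ * ‖y‖⁻¹ * (‖x‖ - ‖y‖)) := by field_simp; ring
    rw [this, abs_neg, abs_mul, abs_mul, abs_inv, abs_inv, abs_norm, abs_norm]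
    field_simp
  calc _ ≤ ‖‖x‖⁻¹ • (x - y)‖ + ‖(‖x‖⁻¹ - ‖y‖⁻¹) • y‖ := by rw [e]; exact norm_add_le _ _
    _ = ‖x‖⁻¹ * ‖x - y‖ + ‖x‖⁻¹ * |‖x‖ - ‖y‖| := by
        rw [norm_smul, norm_smul, Real.norm_eq_abs (‖x‖⁻¹ - ‖y‖⁻¹), e2, norm_inv, norm_norm]
    _ ≤ ‖x‖⁻¹ * ‖x - y‖ + ‖x‖⁻¹ * ‖x - y‖ := by gcongr; exact abs_norm_sub_norm_le x y
    _ = _ := by ring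

lemma RayConst.differentiableAt_smul {f : Amb d → ℝ} (hf : RayConst f) {x : Amb d} {s : ℝ}
    (hs : 0 < s) (h : DifferentiableAt ℝ f x) : DifferentiableAt ℝ f (s • x) := by
  have e : f = fun z => f (s⁻¹ • z) := by funext z; rw [hf.smul (inv_pos.2 hs)]
  rw [e]
  refine DifferentiableAt.comp (g := f) (s • x) ?_ (by fun_prop)
  rw [smul_smul, inv_mul_cancel₀ hs.ne', one_smul]
  exact h

theorem ae_differentiableAt_normalize {g : Amb d → ℝ} {K : ℝ≥0} (hg : LipschitzWith K g) :
    ∀ᵐ x ∂sphVol d, DifferentiableAt ℝ (fun x : Amb d => g (‖x‖⁻¹ • x)) x := by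
  set f : Amb d → ℝ := fun x => g (‖x‖⁻¹ • x) with hf
  have hray : RayConst f := by
    intro x
    by_cases hx : x = 0
    · subst hx; simp [hf]
    · simp only [hf]
      rw [norm_inv_smul_self hx]; simp
  have h1 : ∀ n : ℕ, ∀ᵐ x ∂(volume : Measure (Amb d)), 1 / (n + 1 : ℝ) < ‖x‖ →
      DifferentiableAt ℝ f x := by
    intro n
    have hn : (0 : ℝ) < 1 / (n + 1 : ℝ) := by positivity
    have hL : LipschitzOnWith (K * (2 * (n + 1))) f {x | 1 / (n + 1 : ℝ) < ‖x‖} := by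
      refine LipschitzOnWith.of_dist_le_mul fun x hx y hy => ?_
      have hx' : 1 / (n + 1 : ℝ) < ‖x‖ := hx
      have hy' : 1 / (n + 1 : ℝ) < ‖y‖ := hy
      have hx0 : x ≠ 0 := norm_pos_iff.1 (hn.trans hx')
      have hy0 : y ≠ 0 := norm_pos_iff.1 (hn.trans hy')
      have hi : ‖x‖⁻¹ ≤ n + 1 := by
        rw [inv_le_comm₀ (hn.trans hx') (by positivity)]
        grind
      calc dist (f x) (f y) ≤ K * dist (‖x‖⁻¹ • x) (‖y‖⁻¹ • y) := hg.dist_le_mul _ _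
        _ ≤ K * (2 * ‖x‖⁻¹ * ‖x - y‖) := by
            rw [dist_eq_norm]; gcongr; exact norm_normalize_sub_le hx0 hy0
        _ ≤ K * (2 * (n + 1) * ‖x - y‖) := by gcongr
        _ = _ := by rw [dist_eq_norm]; push_cast; ring
    have hop : IsOpen {x : Amb d | 1 / (n + 1 : ℝ) < ‖x‖} := isOpen_lt continuous_const continuous_norm
    filter_upwards [hL.ae_differentiableWithinAt_of_mem] with x hx hxn
    exact (hx hxn).differentiableAt (hop.mem_nhds hxn)
  have h2 : ∀ᵐ x ∂(volume : Measure (Amb d)), DifferentiableAt ℝ f x := by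
    filter_upwards [ae_all_iff.2 h1, Measure.ae_ne volume (0 : Amb d)] with x hx hx0
    obtain ⟨n, hn⟩ := exists_nat_one_div_lt (norm_pos_iff.2 hx0)
    exact hx n hn
  set s : Set (Amb d) := {x | ¬DifferentiableAt ℝ f x} with hs
  have hms : MeasurableSet s := (measurableSet_of_differentiableAt ℝ f).compl
  have hmi : Measurable (s.indicator (1 : Amb d → ℝ≥0∞)) := measurable_const.indicator hms
  have e := setLIntegral_ball_eq_toSphere' (volume : Measure (Amb d)) hmi
  have e0 : ∫⁻ x in ball (0 : Amb d) 1, s.indicator (1 : Amb d → ℝ≥0∞) (‖x‖⁻¹ • x) = 0 := by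
    rw [lintegral_congr_ae (g := fun _ => 0)]
    · simp
    · refine ae_restrict_of_ae ?_
      filter_upwards [h2, Measure.ae_ne volume (0 : Amb d)] with x hx hx0
      have : ‖x‖⁻¹ • x ∉ s := fun h =>
        h (hray.differentiableAt_smul (inv_pos.2 (norm_pos_iff.2 hx0)) hx)
      simp [this]
  rw [e0, eq_comm, mul_eq_zero] at e
  have e1 := e.resolve_left (lintegral_Ioo_pow_ne_zero _)
  rw [← lintegral_sphVol hmi, lintegral_indicator_one hms] at e1
  filter_upwards [measure_eq_zero_iff_ae_notMem.1 e1] with x hx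
  exact not_not.1 hx

end Rademacher

section HomExt

variable {d : ℕ} {A : Set (Amb d)}

lemma homExt_of_mem (hA : A ⊆ sph d) (u : A → ℝ) {x : Amb d} (hx : x ∈ A) :
    homExt A u x = u ⟨x, hx⟩ := by
  have hn : ‖x‖⁻¹ • x = x := by
    have : ‖x‖ = 1 := by simpa using hA hx
    simp [this]
  have h : ‖x‖⁻¹ • x ∈ A := by rwa [hn]
  rw [homExt, dif_pos h]
  congr

lemma homExt_map₂ (h : ℝ → ℝ → ℝ) (h0 : h 0 0 = 0) (u v : A → ℝ) (x : Amb d) :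
    homExt A (fun p => h (u p) (v p)) x = h (homExt A u x) (homExt A v x) := by
  by_cases hx : ‖x‖⁻¹ • x ∈ A <;> simp [homExt, hx, h0]

lemma homExt_add (u v : A → ℝ) : homExt A (fun p => u p + v p) =
    fun x => homExt A u x + homExt A v x :=
  funext fun x => homExt_map₂ (fun a b => a + b) (by simp) u v x

lemma homExt_sub (u v : A → ℝ) : homExt A (fun p => u p - v p) =
    fun x => homExt A u x - homExt A v x :=
  funext fun x => homExt_map₂ (fun a b => a - b) (by simp) u v x

lemma homExt_const_mul (c : ℝ) (u : A → ℝ) : homExt A (fun p => c * u p) =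
    fun x => c * homExt A u x :=
  funext fun x => homExt_map₂ (fun a _ => c * a) (by simp) u u x

lemma homExt_abs (u : A → ℝ) : homExt A (fun p => |u p|) = fun x => |homExt A u x| :=
  funext fun x => homExt_map₂ (fun a _ => |a|) (by simp) u u x

end HomExt

section FDeriv

variable {E : Type*} [NormedAddCommGroup E] [NormedSpace ℝ E]

lemma norm_fderiv_abs_le (f : E → ℝ) {x : E} (hf : DifferentiableAt ℝ f x) :
    ‖fderiv ℝ (fun z => |f z|) x‖ ≤ ‖fderiv ℝ f x‖ := by
  rcases lt_trichotomy (f x) 0 with h | h | h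
  · have e : (fun z => |f z|) =ᶠ[𝓝 x] fun z => -f z := by
      filter_upwards [hf.continuousAt.eventually_mem (Iio_mem_nhds h)] with z hz
      exact abs_of_neg hz
    rw [e.fderiv_eq, fderiv_fun_neg, norm_neg]
  · have : IsLocalMin (fun z => |f z|) x := by
      filter_upwards with z
      simp [h]
    rw [this.fderiv_eq_zero]; simp
  · have e : (fun z => |f z|) =ᶠ[𝓝 x] f := by
      filter_upwards [hf.continuousAt.eventually_mem (Ioi_mem_nhds h)] with z hz
      exact abs_of_pos hz
    rw [e.fderiv_eq]

lemma enorm_add_sq_le {F : Type*} [NormedAddCommGroup F] (a b : F) {t : ℝ} (ht : 0 < t) :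
    ‖a + b‖ₑ ^ 2 ≤ ofReal (1 + t) * ‖a‖ₑ ^ 2 + ofReal (1 + t⁻¹) * ‖b‖ₑ ^ 2 := by
  simp only [← ofReal_norm, ← ofReal_pow (norm_nonneg _)]
  rw [← ofReal_mul (by positivity), ← ofReal_mul (by positivity),
    ← ENNReal.ofReal_add (by positivity) (by positivity)]
  refine ofReal_le_ofReal ?_
  have h1 : ‖a + b‖ ^ 2 ≤ (‖a‖ + ‖b‖) ^ 2 := by gcongr; exact norm_add_le a b
  have h2 : 0 ≤ t⁻¹ * (t * ‖a‖ - ‖b‖) ^ 2 := by positivity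
  have h3 : t⁻¹ * (t * ‖a‖ - ‖b‖) ^ 2 = t * ‖a‖ ^ 2 - 2 * ‖a‖ * ‖b‖ + t⁻¹ * ‖b‖ ^ 2 := by
    field_simp
    ring
  nlinarith

end FDeriv

namespace HandleConfig

variable {d : ℕ} {δ₀ δ₁ : ℝ} (C : HandleConfig d δ₀ δ₁) (κ : C.Side)

lemma Mbar_subset_sph : C.Mbar ⊆ sph d := fun _ h => h.1

/-- The opposite half-handle. -/
def opp : C.Side := (κ.1, !κ.2)

@[simp] lemma opp_opp (κ : C.Side) : C.opp (C.opp κ) = κ := by simp [opp]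

/-- `opp` as a permutation. -/
def oppEquiv : C.Side ≃ C.Side := ⟨C.opp, C.opp, C.opp_opp, C.opp_opp⟩

lemma sframe_opp (x : Cyl d) : C.sframe (C.opp κ) x = -C.sframe κ x := C.sframe_not κ.1 κ.2 x

/-- The point of `M̄_h` that corresponds to the point `(t, ω)` of the half-handle `κ`. -/
def Φ (p : ℝ × 𝕊 d) : Amb d := C.sframe κ (chartPt (δ₀ * C.ρ) (δ₁ * C.ρ) p.1 p.2)

lemma continuous_Φ : Continuous (C.Φ κ) := continuous_frame_chartPt _ _ _

lemma Φ_opp (p : ℝ × 𝕊 d) : C.Φ (C.opp κ) p = -C.Φ κ p := C.sframe_opp κ _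

lemma homExt_comp_T (u : C.Mbar → ℝ) (x : Amb d) :
    homExt C.Mbar (fun p : C.Mbar => u (C.T p)) x = homExt C.Mbar u (-x) := by
  have e : ‖-x‖⁻¹ • (-x) = -(‖x‖⁻¹ • x) := by rw [norm_neg, smul_neg]
  by_cases hx : ‖x‖⁻¹ • x ∈ C.Mbar
  · have hx' : ‖-x‖⁻¹ • (-x) ∈ C.Mbar := by rw [e]; exact C.neg_mem_Mbar hx
    rw [homExt, homExt, dif_pos hx, dif_pos hx']
    congr 1
    exact Subtype.ext e.symm
  · have hx' : ‖-x‖⁻¹ • (-x) ∉ C.Mbar := by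
      rw [e]; intro h; have := C.neg_mem_Mbar h; rw [neg_neg] at this; exact hx this
    rw [homExt, homExt, dif_neg hx, dif_neg hx']

lemma pull_comp_T (u : C.Mbar → ℝ) :
    C.pull κ (fun p : C.Mbar => u (C.T p)) = C.pull (C.opp κ) u := by
  funext q
  rw [pull, pull, chartPull, chartPull, homExt_comp_T, sframe_opp]

lemma pull_cylPt (u : C.Mbar → ℝ) (p : ℝ × 𝕊 d) :
    C.pull κ u (cylPt p) = homExt C.Mbar u (C.Φ κ p) := by
  have hn : ‖(p.2 : 𝔼 d)‖ = 1 := by simp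
  change homExt C.Mbar u (C.sframe κ (chartPt _ _ p.1 (‖(p.2 : 𝔼 d)‖⁻¹ • (p.2 : 𝔼 d)))) = _
  rw [hn, inv_one, one_smul, Φ]

variable [hC : Admissible δ₀ δ₁] [NeZero d]

lemma rad_Φ {p : ℝ × 𝕊 d} (hp : p.1 ∈ Icc (0 : ℝ) 1) :
    C.rad κ.1 (C.Φ κ p) = δ₀ * C.ρ + (δ₁ * C.ρ - δ₀ * C.ρ) * p.1 := by
  have h := profile_mem_Icc C.inner_mem' C.outer_mem' hp
  rw [← norm_snd_sframe, Φ, LinearIsometryEquiv.symm_apply_apply, snd_chartPt, norm_smul,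
    Real.norm_eq_abs, abs_of_nonneg h.1]
  simp

lemma Φ_mem_sph {p : ℝ × 𝕊 d} (hp : p.1 ∈ Icc (0 : ℝ) 1) : C.Φ κ p ∈ sph d := by
  have h := profile_mem_Icc C.inner_mem' C.outer_mem' hp
  rw [mem_sphere_zero_iff_norm, Φ, LinearIsometryEquiv.norm_map]
  exact norm_chartPt (by nlinarith [h.1, h.2]) (by simp)

lemma Φ_mem_Mbar {p : ℝ × 𝕊 d} (hp : p.1 ∈ Icc (0 : ℝ) 1) : C.Φ κ p ∈ C.Mbar := by
  have hlt := C.inner_lt_outer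
  refine C.mem_Mbar.2 ⟨C.Φ_mem_sph κ hp, fun i => ?_⟩
  by_cases hi : κ.1 = i
  · rw [← hi, C.rad_Φ κ hp]; nlinarith [hp.1]
  · refine hlt.le.trans (C.lt_rad_of_rad_le (C.Φ_mem_sph κ hp) hi ?_).le
    rw [C.rad_Φ κ hp]; nlinarith [hp.2]

lemma Φ_mem_M {p : ℝ × 𝕊 d} (hp : p.1 ∈ Ioc (0 : ℝ) 1) : C.Φ κ p ∈ C.M := by
  have hp' : p.1 ∈ Icc (0 : ℝ) 1 := ⟨hp.1.le, hp.2⟩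
  have hlt := C.inner_lt_outer
  refine C.mem_M.2 ⟨C.Φ_mem_sph κ hp', fun i => ?_⟩
  by_cases hi : κ.1 = i
  · rw [← hi, C.rad_Φ κ hp']; nlinarith [hp.1]
  · refine hlt.trans (C.lt_rad_of_rad_le (C.Φ_mem_sph κ hp') hi ?_)
    rw [C.rad_Φ κ hp']; nlinarith [hp.2]

lemma Φ_zero_notMem_M (ω : 𝕊 d) : C.Φ κ (0, ω) ∉ C.M := by
  intro h
  have := (C.mem_M.1 h).2 κ.1
  rw [C.rad_Φ κ (by simp)] at this
  simp at this

/-- Every point near the center of the frame `κ` lies on the half-handle `κ`. -/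
lemma exists_Φ_eq {x : Amb d} (hx : x ∈ C.Mbar) {i : Fin C.m} (h : C.rad i x ≤ δ₁ * C.ρ) :
    ∃ b, ∃ p : ℝ × 𝕊 d, p.1 ∈ Icc (0 : ℝ) 1 ∧ C.Φ (i, b) p = x := by
  obtain ⟨b, hb⟩ := C.exists_sframe_pos hx.1 (h.trans_lt C.outer_mem.2)
  have hlt := C.inner_lt_outer
  have h0 := (C.mem_Mbar.1 hx).2 i
  have hn := C.norm_symm hx.1 (i, b)
  have hr : ‖((C.sframe (i, b)).symm x).snd‖ = C.rad i x := C.norm_snd_sframe (i, b) x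
  have hs : ((C.sframe (i, b)).symm x).snd ≠ 0 := by
    rw [← norm_ne_zero_iff, hr]; linarith [C.inner_mem.1]
  have e := chartPt_chartInv hlt.ne hs hb.le
  have hsn : ‖‖((C.sframe (i, b)).symm x).snd‖⁻¹ • ((C.sframe (i, b)).symm x).snd‖ = 1 :=
    norm_inv_smul_self hs
  refine ⟨b, ((C.rad i x - δ₀ * C.ρ) / (δ₁ * C.ρ - δ₀ * C.ρ),
    ⟨‖((C.sframe (i, b)).symm x).snd‖⁻¹ • ((C.sframe (i, b)).symm x).snd, by simpa using hsn⟩),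
    ⟨?_, ?_⟩, ?_⟩
  · positivity
  · rw [div_le_one (by linarith)]; linarith
  · rw [norm_snd_chartInv hs, fst_chartInv, snd_chartInv, hn, hr] at e
    simp only [inv_one, mul_one, one_mul, one_smul] at e
    change C.sframe (i, b) (chartPt (δ₀ * C.ρ) (δ₁ * C.ρ) _ _) = x
    simp [*]

lemma exists_Φ_zero_eq {x : Amb d} (hx : x ∈ C.Mbar) (h : x ∉ C.M) :
    ∃ κ, ∃ ω : 𝕊 d, C.Φ κ (0, ω) = x := by
  rw [C.mem_M] at h
  push Not at h
  obtain ⟨i, hi⟩ := h hx.1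
  have hlt := C.inner_lt_outer
  obtain ⟨b, p, hp, rfl⟩ := C.exists_Φ_eq hx (hi.trans hlt.le)
  have := C.rad_Φ (i, b) hp
  simp only at this
  rw [this] at hi
  have h0 : p.1 = 0 := le_antisymm (by nlinarith) hp.1
  exact ⟨(i, b), p.2, by rw [← h0]⟩

lemma eventually_mem_M {x : Amb d} (hx : x ∈ C.M) : ∀ᶠ z in 𝓝 x, ‖z‖⁻¹ • z ∈ C.M := by
  have hn : ‖x‖ = 1 := by simpa using hx.1
  have hx0 : x ≠ 0 := by rintro rfl; simp at hn
  have hc : ContinuousAt (fun z : Amb d => ‖z‖⁻¹ • z) x :=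
    (continuous_norm.continuousAt.inv₀ (norm_ne_zero_iff.2 hx0)).smul continuousAt_id
  have e : ‖x‖⁻¹ • x = x := by simp [hn]
  have hop := (C.isOpen_lt_rad (δ₀ * C.ρ)).mem_nhds (x := ‖x‖⁻¹ • x)
    (by rw [e]; rw [C.M_eq] at hx; exact hx.2)
  filter_upwards [hc.eventually_mem hop, isOpen_compl_singleton.mem_nhds hx0] with z hz hz0
  rw [C.M_eq]
  exact ⟨by simpa using norm_inv_smul_self (show z ≠ 0 from hz0), hz⟩

lemma ae_differentiableAt_homExt {u : C.Mbar → ℝ} {K : ℝ≥0} (hu : LipschitzWith K u) :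
    ∀ᵐ x ∂sphVol d, x ∈ C.M → DifferentiableAt ℝ (homExt C.Mbar u) x := by
  have hL : LipschitzOnWith K (homExt C.Mbar u) C.Mbar := by
    refine LipschitzOnWith.of_dist_le_mul fun x hx y hy => ?_
    rw [homExt_of_mem C.Mbar_subset_sph u hx, homExt_of_mem C.Mbar_subset_sph u hy]
    exact hu.dist_le_mul ⟨x, hx⟩ ⟨y, hy⟩
  obtain ⟨g, hg, hgu⟩ := hL.extend_real
  filter_upwards [ae_differentiableAt_normalize hg] with x hx hxM
  refine hx.congr_of_eventuallyEq ?_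
  filter_upwards [C.eventually_mem_M hxM] with z hz
  rw [← hgu (C.M_subset_Mbar hz)]
  exact rayConst_homExt _ _ z

lemma differentiableAt_pull {κ : C.Side} {u : C.Mbar → ℝ} {p : ℝ × 𝕊 d} (hp : p.1 ∈ Ioo (0 : ℝ) 1)
    (h : DifferentiableAt ℝ (homExt C.Mbar u) (C.Φ κ p)) :
    DifferentiableAt ℝ (C.pull κ u) (cylPt p) := by
  have hn : ‖(p.2 : 𝔼 d)‖ = 1 := by simp
  have h0 : (cylPt p).snd ≠ 0 := by
    rw [← norm_ne_zero_iff]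
    positivity
  have e : chartExt (δ₀ * C.ρ) (δ₁ * C.ρ) (cylPt p) = chartPt (δ₀ * C.ρ) (δ₁ * C.ρ) p.1 p.2 := by
    change ‖(p.2 : 𝔼 d)‖ • chartPt _ _ p.1 (‖(p.2 : 𝔼 d)‖⁻¹ • (p.2 : 𝔼 d)) = _
    rw [hn]; simp
  have e1 : C.pull κ u =ᶠ[𝓝 (cylPt p)]
      fun q => homExt C.Mbar u (C.sframe κ (chartExt (δ₀ * C.ρ) (δ₁ * C.ρ) q)) := by
    filter_upwards [Cyl.continuous_snd.continuousAt.eventually_mem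
      (isOpen_compl_singleton.mem_nhds h0)] with q hq
    exact (rayConst_homExt C.Mbar u).chartPull_eq (C.sframe κ) hq
  have hpr := profile_mem C.inner_mem' C.outer_mem' C.inner_lt_outer.ne hp
  have hc : DifferentiableAt ℝ (chartExt (d := d) (δ₀ * C.ρ) (δ₁ * C.ρ)) (cylPt p) :=
    (contDiffAt_chartExt (n := 1) (by change (_ + _ * p.1) ^ 2 < 1; nlinarith [hpr.1, hpr.2])
      h0).differentiableAt one_ne_zero
  refine DifferentiableAt.congr_of_eventuallyEq ?_ e1
  refine DifferentiableAt.comp (g := homExt C.Mbar u) _ ?_ ((C.sframe κ).differentiableAt.comp _ hc)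
  simp only [e]
  exact h

lemma ae_differentiableAt_pull {u : C.Mbar → ℝ} {K : ℝ≥0}
    (hu : LipschitzWith K u) : ∀ᵐ p ∂cylVol d, DifferentiableAt ℝ (C.pull κ u) (cylPt p) := by
  have h := ae_cylVol_of_ae C.inner_mem' C.outer_mem' C.inner_lt_outer.ne
    (C.sframe κ) (ae_restrict_of_ae (C.ae_differentiableAt_homExt hu))
  filter_upwards [h, ae_cylVol_mem] with p hp hp1
  exact C.differentiableAt_pull hp1 (hp (C.Φ_mem_M κ ⟨hp1.1, hp1.2.le⟩))

lemma ae_differentiableAt_compl_U {u : C.Mbar → ℝ} {K : ℝ≥0} (hu : LipschitzWith K u) :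
    ∀ᵐ x ∂(sphVol d).restrict C.Uᶜ, DifferentiableAt ℝ (homExt C.Mbar u) x := by
  filter_upwards [ae_restrict_of_ae (C.ae_differentiableAt_homExt hu),
    ae_restrict_of_ae (ae_mem_sph d), ae_restrict_mem C.measurableSet_U.compl] with x h1 h2 h3
  exact h1 (C.mem_M_of_notMem_U h2 h3)

/-- Pointwise estimates of the gradients imply estimates of the Dirichlet functional. -/
lemma dirichlet_le_of_ae {u f g : C.Mbar → ℝ} {a b : ℝ≥0∞}
    (h1 : ∀ᵐ x ∂(sphVol d).restrict C.Uᶜ, ‖fderiv ℝ (homExt C.Mbar u) x‖ₑ ^ 2 ≤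
      a * ‖fderiv ℝ (homExt C.Mbar f) x‖ₑ ^ 2 + b * ‖fderiv ℝ (homExt C.Mbar g) x‖ₑ ^ 2)
    (h2 : ∀ κ, ∀ᵐ p ∂cylVol d, ‖fderiv ℝ (C.pull κ u) (cylPt p)‖ₑ ^ 2 ≤
      a * ‖fderiv ℝ (C.pull κ f) (cylPt p)‖ₑ ^ 2 + b * ‖fderiv ℝ (C.pull κ g) (cylPt p)‖ₑ ^ 2) :
    C.mfd.dirichlet u ≤ a * C.mfd.dirichlet f + b * C.mfd.dirichlet g := by
  have m1 : ∀ f : C.Mbar → ℝ, Measurable fun x => ‖fderiv ℝ (homExt C.Mbar f) x‖ₑ ^ 2 :=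
    fun f => (measurable_fderiv ℝ _).enorm.pow_const 2
  have m2 : ∀ (κ) (f : C.Mbar → ℝ), Measurable fun p => ‖fderiv ℝ (C.pull κ f) (cylPt p)‖ₑ ^ 2 :=
    fun κ f => ((measurable_fderiv ℝ _).comp continuous_cylPt.measurable).enorm.pow_const 2
  rw [C.dirichlet_eq, C.dirichlet_eq, C.dirichlet_eq]
  calc _ ≤ (a * ∫⁻ x in C.Uᶜ, ‖fderiv ℝ (homExt C.Mbar f) x‖ₑ ^ 2 ∂sphVol d +
        b * ∫⁻ x in C.Uᶜ, ‖fderiv ℝ (homExt C.Mbar g) x‖ₑ ^ 2 ∂sphVol d) +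
      ∑ κ, ofReal ((C.ρ ^ 2)⁻¹ * C.ρ ^ d) *
        (a * ∫⁻ p, ‖fderiv ℝ (C.pull κ f) (cylPt p)‖ₑ ^ 2 ∂cylVol d +
          b * ∫⁻ p, ‖fderiv ℝ (C.pull κ g) (cylPt p)‖ₑ ^ 2 ∂cylVol d) := by
        gcongr with κ
        · rw [← lintegral_const_mul _ (m1 f), ← lintegral_const_mul _ (m1 g),
            ← lintegral_add_left ((m1 f).const_mul a)]
          exact lintegral_mono_ae h1
        · rw [← lintegral_const_mul _ (m2 κ f), ← lintegral_const_mul _ (m2 κ g),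
            ← lintegral_add_left ((m2 κ f).const_mul a)]
          exact lintegral_mono_ae (h2 κ)
    _ = _ := by
        rw [mul_add, mul_add, Finset.mul_sum, Finset.mul_sum]
        simp only [mul_add, Finset.sum_add_distrib]
        have : ∀ (x y z : ℝ≥0∞), x * (y * z) = y * (x * z) := fun x y z => by ring
        simp only [this]
        ring

lemma dirichlet_add_le {f g : C.Mbar → ℝ} {K L : ℝ≥0} (hf : LipschitzWith K f)
    (hg : LipschitzWith L g) {t : ℝ} (ht : 0 < t) :
    C.mfd.dirichlet (fun p : C.Mbar => f p + g p) ≤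
      ofReal (1 + t) * C.mfd.dirichlet f + ofReal (1 + t⁻¹) * C.mfd.dirichlet g := by
  refine C.dirichlet_le_of_ae ?_ fun κ => ?_
  · filter_upwards [C.ae_differentiableAt_compl_U hf, C.ae_differentiableAt_compl_U hg] with x h1 h2
    rw [homExt_add, fderiv_fun_add h1 h2]
    exact enorm_add_sq_le _ _ ht
  · filter_upwards [C.ae_differentiableAt_pull κ hf, C.ae_differentiableAt_pull κ hg] with p h1 h2
    have e : C.pull κ (fun p : C.Mbar => f p + g p) = fun q => C.pull κ f q + C.pull κ g q := by
      funext q; simp only [pull, chartPull, homExt_add]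
    rw [e, fderiv_fun_add h1 h2]
    exact enorm_add_sq_le _ _ ht

lemma dirichlet_abs_le {f : C.Mbar → ℝ} {K : ℝ≥0} (hf : LipschitzWith K f) :
    C.mfd.dirichlet (fun p : C.Mbar => |f p|) ≤ C.mfd.dirichlet f := by
  have h := C.dirichlet_le_of_ae (u := fun p : C.Mbar => |f p|) (f := f) (g := f) (a := 1) (b := 0) ?_
    fun κ => ?_
  · simpa using h
  · filter_upwards [C.ae_differentiableAt_compl_U hf] with x h1
    rw [homExt_abs, one_mul, zero_mul, add_zero]
    gcongr
    rw [← ofReal_norm, ← ofReal_norm]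
    exact ofReal_le_ofReal (norm_fderiv_abs_le _ h1)
  · filter_upwards [C.ae_differentiableAt_pull κ hf] with x h1
    have e : C.pull κ (fun p : C.Mbar => |f p|) = fun q => |C.pull κ f q| := by
      funext q; simp only [pull, chartPull, homExt_abs]
    rw [e, one_mul, zero_mul, add_zero]
    gcongr
    rw [← ofReal_norm, ← ofReal_norm]
    exact ofReal_le_ofReal (norm_fderiv_abs_le _ h1)

lemma dirichlet_const_mul_le {f : C.Mbar → ℝ} {K : ℝ≥0} (hf : LipschitzWith K f) (c : ℝ) :
    C.mfd.dirichlet (fun p : C.Mbar => c * f p) ≤ ofReal (c ^ 2) * C.mfd.dirichlet f := by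
  have hcc : ofReal (c ^ 2) = ‖c‖ₑ ^ 2 := by
    rw [← ofReal_norm, ← ofReal_pow (norm_nonneg _), Real.norm_eq_abs, sq_abs]
  have h := C.dirichlet_le_of_ae (u := fun p : C.Mbar => c * f p) (f := f) (g := f)
    (a := ofReal (c ^ 2)) (b := 0) ?_ fun κ => ?_
  · simpa using h
  · filter_upwards [C.ae_differentiableAt_compl_U hf] with x h1
    rw [homExt_const_mul, fderiv_const_mul h1, zero_mul, add_zero, enorm_smul, mul_pow, hcc]
  · filter_upwards [C.ae_differentiableAt_pull κ hf] with x h1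
    have e : C.pull κ (fun p : C.Mbar => c * f p) = fun q => c * C.pull κ f q := by
      funext q; simp only [pull, chartPull, homExt_const_mul]
    rw [e, fderiv_const_mul h1, zero_mul, add_zero, enorm_smul, mul_pow, hcc]

/-! ### Invariance under the antipodal map -/

lemma lintegral_compl_U_neg {f : Amb d → ℝ≥0∞} (hf : Measurable f) :
    ∫⁻ x in C.Uᶜ, f (-x) ∂sphVol d = ∫⁻ x in C.Uᶜ, f x ∂sphVol d := by
  have hm := C.measurableSet_U.compl
  rw [← lintegral_indicator hm, ← lintegral_indicator hm]
  conv_rhs => rw [← sphVol_map_neg]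
  rw [lintegral_map (hf.indicator hm) measurable_neg]
  refine lintegral_congr fun x => ?_
  have : x ∈ C.Uᶜ ↔ -x ∈ C.Uᶜ := by rw [mem_compl_iff, mem_compl_iff, C.mem_U, C.mem_U]; simp
  by_cases h : x ∈ C.Uᶜ
  · simp_all
  · simp_all

lemma map_T_vol : C.mfd.vol.map C.T = C.mfd.vol := by
  have hmT : Measurable C.T := (Continuous.subtype_mk (by fun_prop) _ : Continuous fun x : C.Mbar =>
      (⟨-x, C.neg_mem_Mbar x.2⟩ : C.Mbar)).measurable
  refine Measure.ext_of_lintegral _ fun f hf => ?_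
  rw [lintegral_map hf hmT]
  obtain ⟨g, hg, hgf⟩ := (MeasurableEmbedding.subtype_coe
    C.measurableSet_Mbar).exists_measurable_extend hf fun _ => ⟨0⟩
  have e1 : ∀ p : C.Mbar, f p = g p := fun p => (congrFun hgf p).symm
  have e2 : ∀ p : C.Mbar, f (C.T p) = g (-p) := fun p => e1 (C.T p)
  have l1 := C.lintegral_vol hg
  have l2 := C.lintegral_vol (hg.comp measurable_neg)
  calc _ = ∫⁻ p : C.Mbar, g (-p) ∂C.mfd.vol := lintegral_congr e2
    _ = ∫⁻ p : C.Mbar, g p ∂C.mfd.vol := by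
        refine l2.trans (Eq.trans ?_ l1.symm)
        congr 1
        · exact C.lintegral_compl_U_neg hg
        · rw [← C.oppEquiv.sum_comp]
          refine Finset.sum_congr rfl fun κ _ => ?_
          congr 1
          refine lintegral_congr fun p => ?_
          change g (-C.sframe (C.opp κ) _) = _
          rw [sframe_opp, neg_neg]
    _ = _ := (lintegral_congr e1).symm

lemma enorm_fderiv_comp_neg {E F : Type*} [NormedAddCommGroup E] [NormedSpace ℝ E]
    [NormedAddCommGroup F] [NormedSpace ℝ F] (f : E → F) (x : E) :
    ‖fderiv ℝ (fun z => f (-z)) x‖ₑ = ‖fderiv ℝ f (-x)‖ₑ := by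
  have h := fderiv_comp_smul (𝕜 := ℝ) (f := f) (-1) (x := x)
  simp only [neg_smul, one_smul] at h
  rw [h, enorm_neg]

lemma dirichlet_comp_T (u : C.Mbar → ℝ) :
    C.mfd.dirichlet (fun p : C.Mbar => u (C.T p)) = C.mfd.dirichlet u := by
  rw [C.dirichlet_eq, C.dirichlet_eq]
  congr 1
  · rw [← C.lintegral_compl_U_neg ((measurable_fderiv ℝ _).enorm.pow_const 2)]
    refine lintegral_congr fun x => ?_
    have e : homExt C.Mbar (fun p : C.Mbar => u (C.T p)) = fun x => homExt C.Mbar u (-x) :=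
      funext (C.homExt_comp_T u)
    rw [e, enorm_fderiv_comp_neg, neg_neg]
  · rw [← C.oppEquiv.sum_comp]
    refine Finset.sum_congr rfl fun κ _ => ?_
    rw [pull_comp_T]
    change ofReal _ * ∫⁻ p, ‖fderiv ℝ (C.pull (C.opp (C.opp κ)) u) (cylPt p)‖ₑ ^ 2 ∂cylVol d = _
    rw [opp_opp]

lemma neg_image_M : (fun x : Amb d => -x) '' C.M = C.M := by
  have h : ∀ x, x ∈ C.M → -x ∈ C.M := by
    intro x hx
    rw [C.mem_M] at hx ⊢
    simpa using hx
  ext x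
  constructor
  · rintro ⟨y, hy, rfl⟩; exact h y hy
  simp_all

lemma antipodalJacobian_eq (x : Amb d) : antipodalJacobian x =
    -Matrix.of fun i j => inner ℝ (tangentFrame (-x) i) (tangentFrame x j) := by
  ext i j
  have : fderiv ℝ (fun z : Amb d => -z) x = -ContinuousLinearMap.id ℝ _ :=
    (hasFDerivAt_id x).neg.fderiv
  simp [antipodalJacobian, this]

lemma sum_inner_tangentFrame {x : Amb d} (hx : ‖x‖ = 1) {a b : Amb d} (ha : inner ℝ x a = 0) :
    ∑ k, inner ℝ a (tangentFrame x k) * inner ℝ (tangentFrame x k) b = inner ℝ a b := by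
  have := (fullBasis hx).sum_inner_mul_inner a b
  rw [← this]
  simp [fullBasis_apply, fullFrame, real_inner_comm, ha]

lemma antipodalJacobian_mul_transpose {x : Amb d} (hx : ‖x‖ = 1) :
    antipodalJacobian x * (antipodalJacobian x).transpose = 1 := by
  have hx' : ‖-x‖ = 1 := by rwa [norm_neg]
  have h0 : -x ≠ 0 := norm_ne_zero_iff.1 (by rw [hx']; exact one_ne_zero)
  ext i j
  rw [antipodalJacobian_eq, Matrix.mul_apply]
  have h1 := inner_tangentFrame h0 i
  have e := sum_inner_tangentFrame hx (a := tangentFrame (-x) i) (b := tangentFrame (-x) j)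
    (by rw [inner_neg_left, neg_eq_zero] at h1; exact h1)
  have := orthonormal_iff_ite.1 (orthonormal_tangentFrame h0) i j
  rw [Matrix.one_apply, ← this, ← e]
  simp [real_inner_comm]

lemma exists_sum_tangentFrame_neg {x : Amb d} (hx : ‖x‖ = 1) (i : Fin d) :
    tangentFrame (-x) i = -∑ k, antipodalJacobian x i k • tangentFrame x k := by
  have hx' : ‖-x‖ = 1 := by rwa [norm_neg]
  have h0 : -x ≠ 0 := norm_ne_zero_iff.1 (by rw [hx']; exact one_ne_zero)
  have h1 := inner_tangentFrame h0 i
  rw [inner_neg_left, neg_eq_zero] at h1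
  have := (fullBasis hx).sum_repr' (tangentFrame (-x) i)
  rw [antipodalJacobian_eq, ← Finset.sum_neg_distrib]
  conv_lhs => rw [← this]
  simp [fullBasis_apply, fullFrame, h1, real_inner_comm]

/-- The tensor `g` is bilinear at `x`. -/
def BilinAt (g : Tensor d) (x : Amb d) : Prop :=
  ∃ b : Amb d →ₗ[ℝ] Amb d →ₗ[ℝ] ℝ, ∀ ξ ζ, g x ξ ζ = b ξ ζ

lemma metricMatrix_neg {g : Tensor d} {x : Amb d} (hx : ‖x‖ = 1) (hb : BilinAt g x)
    (hg : ∀ ξ ζ, g (-x) ξ ζ = g x ξ ζ) :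
    metricMatrix g (-x) =
      antipodalJacobian x * metricMatrix g x * (antipodalJacobian x).transpose := by
  obtain ⟨b, hb⟩ := hb
  ext i j
  simp only [metricMatrix, Matrix.of_apply, hg, hb, Matrix.mul_apply, Matrix.transpose_apply]
  rw [exists_sum_tangentFrame_neg hx i, exists_sum_tangentFrame_neg hx j]
  simp only [map_neg, LinearMap.neg_apply, map_sum, LinearMap.sum_apply, map_smul,
    LinearMap.smul_apply, smul_eq_mul, Finset.sum_mul]
  rw [← Finset.sum_neg_distrib]
  refine Finset.sum_congr rfl fun k _ => ?_
  rw [mul_neg, neg_neg, Finset.mul_sum]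
  refine Finset.sum_congr rfl fun l _ => ?_
  ring

lemma bilinAt_gh {x : Amb d} (hx : x ∈ C.Mbar) : BilinAt C.gh x := by
  by_cases hU : x ∈ C.U
  · obtain ⟨_, i, hi⟩ := C.mem_U.1 hU
    let L : Amb d →ₗ[ℝ] Cyl d := (fderiv ℝ (C.φInv i) x).toLinearMap
    let b : Amb d →ₗ[ℝ] Amb d →ₗ[ℝ] ℝ := (innerₗ (Cyl d)).compl₁₂ L L
    refine ⟨C.ρ ^ 2 • b, fun ξ ζ => ?_⟩
    rw [C.gh_of_rad_lt hx.1 hi, handleMetric]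
    rfl
  · exact ⟨(innerₗ (Amb d) : Amb d →ₗ[ℝ] Amb d →ₗ[ℝ] ℝ), fun ξ ζ => by
      rw [C.gh_of_notMem_U hU]; rfl⟩

lemma metricMatrix_gh_neg {x : Amb d} (hx : x ∈ C.Mbar) : metricMatrix C.gh (-x) =
    antipodalJacobian x * metricMatrix C.gh x * (antipodalJacobian x).transpose :=
  metricMatrix_neg (by simpa using hx.1) (C.bilinAt_gh hx) fun ξ ζ => C.gh_neg hx ξ ζ

lemma volDensity_gh_neg {x : Amb d} (hx : x ∈ C.Mbar) :
    volDensity C.gh x = volDensity C.gh (-x) * |(antipodalJacobian x).det| := by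
  have hj := antipodalJacobian_mul_transpose (x := x) (by simpa using hx.1)
  have hdet := congrArg Matrix.det hj
  rw [Matrix.det_mul, Matrix.det_transpose, Matrix.det_one] at hdet
  have h1 : |(antipodalJacobian x).det| = 1 := by grind
  rw [h1, mul_one, volDensity, volDensity, C.metricMatrix_gh_neg hx, Matrix.det_mul,
    Matrix.det_mul, Matrix.det_transpose]
  congr 1
  linear_combination -(metricMatrix C.gh x).det * hdet

lemma metricInv_gh_neg {x : Amb d} (hx : x ∈ C.Mbar) (i j : Fin d) :
    metricInv C.gh (-x) i j = ∑ k, ∑ l, antipodalJacobian x i l * antipodalJacobian x j k *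
          metricInv C.gh x l k := by
  have hj := antipodalJacobian_mul_transpose (x := x) (by simpa using hx.1)
  have hj' := mul_eq_one_comm.1 hj
  rw [metricInv, C.metricMatrix_gh_neg hx, Matrix.mul_inv_rev, Matrix.mul_inv_rev,
    Matrix.inv_eq_right_inv hj, Matrix.inv_eq_right_inv hj', ← Matrix.mul_assoc, Matrix.mul_apply]
  refine Finset.sum_congr rfl fun k _ => ?_
  rw [Matrix.mul_apply, Finset.sum_mul]
  refine Finset.sum_congr rfl fun l _ => ?_
  rw [Matrix.transpose_apply, metricInv]
  ring

end HandleConfig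

/-! ### The `L²` calculus of Lipschitz Riemannian manifolds -/

lemma tendsto_zero_of_le {ι : Type*} {l : Filter ι} {f g : ι → ℝ≥0∞} (hg : Tendsto g l (𝓝 0))
    (h : ∀ i, f i ≤ g i) : Tendsto f l (𝓝 0) :=
  tendsto_of_tendsto_of_tendsto_of_le_of_le tendsto_const_nhds hg (fun _ => zero_le) h

lemma tendsto_mul_zero {ι : Type*} {l : Filter ι} {f : ι → ℝ≥0∞} {c : ℝ≥0∞} (hc : c ≠ ⊤)
    (h : Tendsto f l (𝓝 0)) : Tendsto (fun i => c * f i) l (𝓝 0) := by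
  simpa using ENNReal.Tendsto.const_mul h (Or.inr hc)

lemma tendsto_two_mul_add {ι : Type*} {l : Filter ι} {f g : ι → ℝ≥0∞} {c c' : ℝ≥0∞} (hc : c ≠ ⊤)
    (hc' : c' ≠ ⊤) (hf : Tendsto f l (𝓝 0)) (hg : Tendsto g l (𝓝 0)) :
    Tendsto (fun i => 2 * (c * f i) + 2 * (c' * g i)) l (𝓝 0) := by
  simpa using (tendsto_mul_zero ofNat_ne_top (tendsto_mul_zero hc hf)).add
    (tendsto_mul_zero ofNat_ne_top (tendsto_mul_zero hc' hg))

lemma tendsto_mul_four_inv_pow {c : ℝ≥0∞} (hc : c ≠ ⊤) :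
    Tendsto (fun n : ℕ => c * (4⁻¹ : ℝ≥0∞) ^ n) atTop (𝓝 0) :=
  tendsto_mul_zero hc (ENNReal.tendsto_pow_atTop_nhds_zero_of_lt_one (by simp))

section SqInt

variable {α : Type*} [MeasurableSpace α] {μ : Measure α}

/-- The square of the norm of `L²`. -/
def sqInt (μ : Measure α) (f : α → ℝ) : ℝ≥0∞ := ∫⁻ p, ofReal (f p ^ 2) ∂μ

lemma ofReal_sq_eq_enorm (x : ℝ) : ofReal (x ^ 2) = ‖x‖ₑ ^ 2 := by
  rw [← ofReal_norm, ← ofReal_pow (norm_nonneg _), Real.norm_eq_abs, sq_abs]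

lemma sqInt_eq_eLpNorm (f : α → ℝ) : sqInt μ f = eLpNorm f 2 μ ^ 2 := by
  rw [eLpNorm_eq_lintegral_rpow_enorm_toReal (by norm_num) (by norm_num), ← ENNReal.rpow_natCast,
    ← ENNReal.rpow_mul]
  simp [sqInt, ofReal_sq_eq_enorm]

lemma sqInt_congr {f g : α → ℝ} (h : f =ᵐ[μ] g) : sqInt μ f = sqInt μ g := by
  refine lintegral_congr_ae ?_
  filter_upwards [h] with p hp
  rw [hp]

lemma sqInt_coe (u : Lp ℝ 2 μ) : sqInt μ u = ofReal (‖u‖ ^ 2) := by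
  rw [sqInt_eq_eLpNorm, ofReal_pow (norm_nonneg _), Lp.norm_def,
    ENNReal.ofReal_toReal (Lp.eLpNorm_ne_top u)]

lemma sqInt_neg (f : α → ℝ) : sqInt μ (fun p => -f p) = sqInt μ f := by simp [sqInt]

lemma sqInt_sub_comm (f g : α → ℝ) : sqInt μ (fun p => f p - g p) = sqInt μ (fun p => g p - f p) := by
  rw [← sqInt_neg]; simp

lemma sqInt_add_le {f g : α → ℝ} (hf : AEMeasurable f μ) {t : ℝ} (ht : 0 < t) :
    sqInt μ (fun p => f p + g p) ≤ ofReal (1 + t) * sqInt μ f + ofReal (1 + t⁻¹) * sqInt μ g := by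
  have hm : AEMeasurable (fun p => ofReal (1 + t) * ofReal (f p ^ 2)) μ :=
    (hf.pow_const 2).ennreal_ofReal.const_mul _
  rw [sqInt, sqInt, sqInt, ← lintegral_const_mul' _ _ ofReal_ne_top,
    ← lintegral_const_mul' _ _ ofReal_ne_top, ← lintegral_add_left' hm]
  refine lintegral_mono fun p => ?_
  simp only [ofReal_sq_eq_enorm]
  exact enorm_add_sq_le _ _ ht

lemma sqInt_add_le_two {f g : α → ℝ} (hf : AEMeasurable f μ) :
    sqInt μ (fun p => f p + g p) ≤ 2 * sqInt μ f + 2 * sqInt μ g := by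
  have := sqInt_add_le (g := g) hf one_pos
  rwa [inv_one, one_add_one_eq_two, ofReal_ofNat] at this

lemma sqInt_sub_le_two {f g h : α → ℝ} (hf : AEMeasurable f μ) (hg : AEMeasurable g μ) :
    sqInt μ (fun p => f p - h p) ≤
      2 * sqInt μ (fun p => f p - g p) + 2 * sqInt μ (fun p => g p - h p) := by
  simpa using sqInt_add_le_two (f := fun p => f p - g p) (g := fun p => g p - h p) (hf.sub hg)

lemma tendsto_eLpNorm_of_sqInt {ι : Type*} {l : Filter ι} {f : ι → α → ℝ}
    (h : Tendsto (fun i => sqInt μ (f i)) l (𝓝 0)) :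
    Tendsto (fun i => eLpNorm (f i) 2 μ) l (𝓝 0) := by
  have h1 := (ENNReal.continuous_rpow_const (y := (2 : ℝ)⁻¹)).tendsto 0 |>.comp h
  rw [ENNReal.zero_rpow_of_pos (by norm_num)] at h1
  refine h1.congr fun i => ?_
  rw [Function.comp_apply, sqInt_eq_eLpNorm, ← ENNReal.rpow_natCast, ← ENNReal.rpow_mul]
  simp

lemma exists_seq_ae_of_sqInt {w : ℕ → α → ℝ} {u : α → ℝ} (hw : ∀ k, AEStronglyMeasurable (w k) μ)
    (hu : AEStronglyMeasurable u μ)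
    (h : Tendsto (fun k => sqInt μ (fun p => w k p - u p)) atTop (𝓝 0)) :
    ∃ ns : ℕ → ℕ, StrictMono ns ∧ ∀ᵐ p ∂μ, Tendsto (fun k => w (ns k) p) atTop (𝓝 (u p)) :=
  (tendstoInMeasure_of_tendsto_eLpNorm (p := 2) (by norm_num) hw hu
    (tendsto_eLpNorm_of_sqInt h)).exists_seq_tendsto_ae

lemma exists_limit_of_sqInt {w : ℕ → α → ℝ} (hw : ∀ k, MemLp (w k) 2 μ)
    (h : Tendsto (fun kl : ℕ × ℕ => sqInt μ (fun p => w kl.1 p - w kl.2 p)) atTop (𝓝 0)) :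
    ∃ u : Lp ℝ 2 μ, Tendsto (fun k => sqInt μ (fun p => w k p - u p)) atTop (𝓝 0) := by
  have h1 := tendsto_eLpNorm_of_sqInt h
  have hc : CauchySeq fun k => (hw k).toLp (w k) := by
    rw [EMetric.cauchySeq_iff]
    intro ε hε
    obtain ⟨⟨N, M⟩, hN⟩ := eventually_atTop.1 (h1.eventually_lt_const hε)
    refine ⟨max N M, fun m hm n hn => ?_⟩
    rw [Lp.edist_toLp_toLp]
    exact hN (m, n) ⟨(le_max_left _ _).trans hm, (le_max_right _ _).trans hn⟩
  obtain ⟨u, hu⟩ := cauchySeq_tendsto_of_complete hc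
  refine ⟨u, ?_⟩
  rw [Lp.tendsto_Lp_iff_tendsto_eLpNorm'] at hu
  have h2 := (ENNReal.continuous_pow 2).tendsto 0 |>.comp hu
  rw [zero_pow two_ne_zero] at h2
  refine h2.congr fun k => ?_
  rw [Function.comp_apply, sqInt_eq_eLpNorm]
  congr 1
  refine eLpNorm_congr_ae ?_
  filter_upwards [(hw k).coeFn_toLp] with p hp
  rw [Pi.sub_apply, hp]

lemma sqInt_tendsto_sub {w : ℕ → α → ℝ} {u : α → ℝ} (hw : ∀ k, AEMeasurable (w k) μ)
    (hu : AEMeasurable u μ)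
    (h : Tendsto (fun k => sqInt μ (fun p => w k p - u p)) atTop (𝓝 0)) :
    Tendsto (fun kl : ℕ × ℕ => sqInt μ (fun p => w kl.1 p - w kl.2 p)) atTop (𝓝 0) := by
  have h1 : Tendsto (fun kl : ℕ × ℕ => 2 * sqInt μ (fun p => w kl.1 p - u p) +
      2 * sqInt μ (fun p => w kl.2 p - u p)) atTop (𝓝 0) := by
    rw [← prod_atTop_atTop_eq]
    simpa using (tendsto_mul_zero ofNat_ne_top (h.comp tendsto_fst)).add
      (tendsto_mul_zero ofNat_ne_top (h.comp tendsto_snd))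
  refine tendsto_zero_of_le h1 fun kl => ?_
  have := sqInt_sub_le_two (h := w kl.2) (hw kl.1) hu
  rwa [sqInt_sub_comm u] at this

lemma tendsto_sqInt_unique {w : ℕ → α → ℝ} {u v : Lp ℝ 2 μ} (hw : ∀ k, AEMeasurable (w k) μ)
    (h : Tendsto (fun k => sqInt μ (fun p => w k p - u p)) atTop (𝓝 0))
    (h' : Tendsto (fun k => sqInt μ (fun p => w k p - v p)) atTop (𝓝 0)) : u = v := by
  obtain ⟨ns, hns, h1⟩ := exists_seq_ae_of_sqInt (fun k => (hw k).aestronglyMeasurable)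
    (Lp.aestronglyMeasurable u) h
  obtain ⟨ms, hms, h2⟩ := exists_seq_ae_of_sqInt (fun k => (hw (ns k)).aestronglyMeasurable)
    (Lp.aestronglyMeasurable v) (h'.comp hns.tendsto_atTop)
  refine Lp.ext ?_
  filter_upwards [h1, h2] with p hp1 hp2
  exact tendsto_nhds_unique (hp1.comp hms.tendsto_atTop) hp2

end SqInt

namespace LipRiem

/-- The properties of a Lipschitz Riemannian manifold on which its capacity theory rests. -/
structure IsRegular (X : LipRiem) : Prop where
  memLp : ∀ u ∈ X.lip, MemLp u 2 X.vol
  continuous : ∀ u ∈ X.lip, Continuous u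
  add_mem : ∀ u ∈ X.lip, ∀ v ∈ X.lip, (fun p => u p + v p) ∈ X.lip
  const_mul_mem : ∀ (c : ℝ), ∀ u ∈ X.lip, (fun p => c * u p) ∈ X.lip
  abs_mem : ∀ u ∈ X.lip, (fun p => |u p|) ∈ X.lip
  dirichlet_add_le : ∀ u ∈ X.lip, ∀ v ∈ X.lip, ∀ t : ℝ, 0 < t → X.dirichlet (fun p => u p + v p) ≤
    ofReal (1 + t) * X.dirichlet u + ofReal (1 + t⁻¹) * X.dirichlet v
  dirichlet_const_mul_le : ∀ (c : ℝ), ∀ u ∈ X.lip,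
    X.dirichlet (fun p => c * u p) ≤ ofReal (c ^ 2) * X.dirichlet u
  dirichlet_abs_le : ∀ u ∈ X.lip, X.dirichlet (fun p => |u p|) ≤ X.dirichlet u

/-- The square of the norm of `H¹` of a Lipschitz function. -/
def hSq (X : LipRiem) (u : X.Point → ℝ) : ℝ≥0∞ := X.dirichlet u + sqInt X.vol u

variable {X : LipRiem}

lemma energy_le {w : ℕ → X.Point → ℝ} {u : X.L2} (h : X.IsH1Seq w u) :
    X.energy u ≤ limsup (fun k => X.dirichlet (w k)) atTop := iInf₂_le w h

lemma IsH1Seq.comp {w : ℕ → X.Point → ℝ} {u : X.L2} (h : X.IsH1Seq w u) {ns : ℕ → ℕ}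
    (hns : StrictMono ns) : X.IsH1Seq (fun k => w (ns k)) u := by
  refine ⟨fun k => h.1 _, h.2.1.comp hns.tendsto_atTop, ?_⟩
  have : Tendsto (fun kl : ℕ × ℕ => (ns kl.1, ns kl.2)) atTop atTop := by
    rw [← prod_atTop_atTop_eq]
    exact hns.tendsto_atTop.prodMap hns.tendsto_atTop
  exact h.2.2.comp this

/-- The volume is at most the capacity. -/
lemma vol_le_cap (B : Set X.Point) : X.vol B ≤ X.cap B := by
  refine le_iInf₂ fun u ⟨V, _, hBV, hu⟩ => ?_
  refine le_trans ?_ le_add_self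
  rw [← sqInt_coe]
  have hm : AEMeasurable (fun p => ofReal (u p ^ 2)) X.vol :=
    ((Lp.aestronglyMeasurable u).aemeasurable.pow_const 2).ennreal_ofReal
  calc X.vol B ≤ X.vol {p | 1 ≤ ofReal (u p ^ 2)} := by
        refine measure_mono_ae ?_
        filter_upwards [hu] with p hp hpB
        have := hp (hBV hpB)
        change 1 ≤ ofReal (u p ^ 2)
        rw [ENNReal.one_le_ofReal]
        exact one_le_pow₀ this
    _ ≤ _ := by
        have := mul_meas_ge_le_lintegral₀ hm 1
        rwa [one_mul] at this

lemma inftyMeasure_apply {S B : Set X.Point} (hB : MeasurableSet B) :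
    X.inftyMeasure S B = X.inftyOuter S B := toMeasure_apply _ _ hB

lemma inftyMeasure_compl {S : Set X.Point} (hS : MeasurableSet S) : X.inftyMeasure S Sᶜ = 0 := by
  rw [inftyMeasure_apply hS.compl]
  classical
  change (if X.IsPolar (Sᶜ ∩ S) then (0 : ℝ≥0∞) else ⊤) = 0
  rw [if_pos]
  simpa using X.isPolar_empty

lemma isPolar_of_inftyMeasure_ne_top {S B : Set X.Point} (hB : MeasurableSet B)
    (h : X.inftyMeasure S B ≠ ⊤) : X.IsPolar (B ∩ S) := by
  rw [inftyMeasure_apply hB] at h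
  by_contra hp
  apply h
  classical
  change (if X.IsPolar (B ∩ S) then (0 : ℝ≥0∞) else ⊤) = ⊤
  rw [if_neg hp]

lemma memM0_inftyMeasure (S : Set X.Point) : X.MemM0 (X.inftyMeasure S) := by
  intro B hB h0
  rw [inftyMeasure_apply hB]
  classical
  change (if X.IsPolar (B ∩ S) then (0 : ℝ≥0∞) else ⊤) = 0
  rw [if_pos]
  exact IsPolar.mono ⟨{B}, by simp, by simpa using h0, by simp⟩ inter_subset_left

/-- A sequence that converges so fast in `H¹` that it converges quasi-uniformly. -/
def IsFast (X : LipRiem) (w : ℕ → X.Point → ℝ) : Prop :=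
  ∀ j, X.hSq (fun p => w (j + 1) p - w j p) ≤ (16⁻¹ : ℝ≥0∞) ^ j

namespace IsRegular

variable (hX : X.IsRegular)
include hX

lemma aemeasurable {u : X.Point → ℝ} (hu : u ∈ X.lip) : AEMeasurable u X.vol :=
  (hX.memLp u hu).1.aemeasurable

lemma sub_mem {u v : X.Point → ℝ} (hu : u ∈ X.lip) (hv : v ∈ X.lip) :
    (fun p => u p - v p) ∈ X.lip := by
  simpa [sub_eq_add_neg] using hX.add_mem u hu _ (hX.const_mul_mem (-1) v hv)

lemma dirichlet_neg_le {u : X.Point → ℝ} (hu : u ∈ X.lip) :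
    X.dirichlet (fun p => -u p) ≤ X.dirichlet u := by
  simpa using hX.dirichlet_const_mul_le (-1) u hu

lemma dirichlet_sub_comm {u v : X.Point → ℝ} (hu : u ∈ X.lip) (hv : v ∈ X.lip) :
    X.dirichlet (fun p => u p - v p) = X.dirichlet (fun p => v p - u p) := by
  refine le_antisymm ?_ ?_
  · simpa using hX.dirichlet_neg_le (hX.sub_mem hv hu)
  · simpa using hX.dirichlet_neg_le (hX.sub_mem hu hv)

lemma dirichlet_add_le_two {u v : X.Point → ℝ} (hu : u ∈ X.lip) (hv : v ∈ X.lip) :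
    X.dirichlet (fun p => u p + v p) ≤ 2 * X.dirichlet u + 2 * X.dirichlet v := by
  have := hX.dirichlet_add_le u hu v hv 1 one_pos
  rwa [inv_one, one_add_one_eq_two, ofReal_ofNat] at this

lemma hSq_add_le {u v : X.Point → ℝ} (hu : u ∈ X.lip) (hv : v ∈ X.lip) :
    X.hSq (fun p => u p + v p) ≤ 2 * X.hSq u + 2 * X.hSq v := by
  calc _ ≤ (2 * X.dirichlet u + 2 * X.dirichlet v) + (2 * sqInt X.vol u + 2 * sqInt X.vol v) :=
        add_le_add (hX.dirichlet_add_le_two hu hv) (sqInt_add_le_two (hX.aemeasurable hu))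
    _ = _ := by unfold hSq; ring

lemma hSq_const_mul_le (c : ℝ) {u : X.Point → ℝ} (hu : u ∈ X.lip) :
    X.hSq (fun p => c * u p) ≤ ofReal (c ^ 2) * X.hSq u := by
  rw [hSq, hSq, mul_add]
  refine add_le_add (hX.dirichlet_const_mul_le c u hu) (le_of_eq ?_)
  rw [sqInt, sqInt, ← lintegral_const_mul' _ _ ofReal_ne_top]
  simp_rw [mul_pow, ofReal_mul (sq_nonneg c)]

lemma hSq_abs_le {u : X.Point → ℝ} (hu : u ∈ X.lip) : X.hSq (fun p => |u p|) ≤ X.hSq u := by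
  refine add_le_add (hX.dirichlet_abs_le u hu) (le_of_eq ?_)
  simp [sqInt]

lemma hSq_sub_comm {u v : X.Point → ℝ} (hu : u ∈ X.lip) (hv : v ∈ X.lip) :
    X.hSq (fun p => u p - v p) = X.hSq (fun p => v p - u p) := by
  rw [hSq, hSq, hX.dirichlet_sub_comm hu hv, sqInt_sub_comm]

lemma tendsto_hSq {w : ℕ → X.Point → ℝ} {u : X.L2} (h : X.IsH1Seq w u) :
    Tendsto (fun kl : ℕ × ℕ => X.hSq (fun p => w kl.1 p - w kl.2 p)) atTop (𝓝 0) := by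
  have := h.2.2.add (sqInt_tendsto_sub (fun k => hX.aemeasurable (h.1 k))
    (Lp.aestronglyMeasurable u).aemeasurable h.2.1)
  rwa [add_zero] at this

lemma exists_isFast {w : ℕ → X.Point → ℝ} {u : X.L2} (h : X.IsH1Seq w u) :
    ∃ ns : ℕ → ℕ, StrictMono ns ∧ X.IsFast fun k => w (ns k) := by
  have h1 := hX.tendsto_hSq h
  have h2 : ∀ j : ℕ, ∀ᶠ N in atTop, ∀ k ≥ N, ∀ l ≥ N,
      X.hSq (fun p => w k p - w l p) ≤ (16⁻¹ : ℝ≥0∞) ^ j := by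
    intro j
    have hpos : (0 : ℝ≥0∞) < (16⁻¹ : ℝ≥0∞) ^ j := ENNReal.pow_pos (by simp) j
    obtain ⟨⟨a, b⟩, hab⟩ := eventually_atTop.1 (h1.eventually_le_const hpos)
    filter_upwards [eventually_ge_atTop (max a b)] with N hN k hk l hl
    exact hab (k, l) ⟨((le_max_left _ _).trans hN).trans hk, ((le_max_right _ _).trans hN).trans hl⟩
  obtain ⟨ns, hns, h3⟩ := extraction_forall_of_eventually h2
  exact ⟨ns, hns, fun j => h3 j _ (hns (Nat.lt_succ_self j)).le _ le_rfl⟩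

lemma sum_mem {f : ℕ → X.Point → ℝ} (hf : ∀ j, f j ∈ X.lip) (h0 : (fun _ => 0) ∈ X.lip) (N : ℕ) :
    (fun p => ∑ j ∈ Finset.range N, f j p) ∈ X.lip := by
  induction N with
  | zero => simpa using h0
  | succ N ih =>
    simp_rw [Finset.sum_range_succ]
    exact hX.add_mem _ ih _ (hf N)

lemma zero_mem {u : X.Point → ℝ} (hu : u ∈ X.lip) : (fun _ => 0) ∈ X.lip := by
  simpa using hX.const_mul_mem 0 u hu

lemma hSq_zero {u : X.Point → ℝ} (hu : u ∈ X.lip) : X.hSq (fun _ => 0) = 0 := by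
  simpa using hX.hSq_const_mul_le 0 hu

lemma hSq_sum_le {f : ℕ → X.Point → ℝ} (hf : ∀ j, f j ∈ X.lip) {a : ℝ≥0∞}
    (h : ∀ j, X.hSq (f j) ≤ a * (4⁻¹ : ℝ≥0∞) ^ j) (N : ℕ) :
    X.hSq (fun p => ∑ j ∈ Finset.range N, f j p) ≤ 4 * a := by
  have h1 : ∀ (N : ℕ) (f : ℕ → X.Point → ℝ), (∀ j, f j ∈ X.lip) →
      X.hSq (fun p => ∑ j ∈ Finset.range N, f j p) ≤
        ∑ j ∈ Finset.range N, 2 ^ (j + 1) * X.hSq (f j) := by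
    intro N
    induction N with
    | zero => intro f hf; simp [hX.hSq_zero (hf 0)]
    | succ N ih =>
      intro f hf
      simp_rw [Finset.sum_range_succ' _ N]
      calc _ ≤ 2 * X.hSq (fun p => ∑ j ∈ Finset.range N, f (j + 1) p) + 2 * X.hSq (f 0) :=
            hX.hSq_add_le (hX.sum_mem (fun j => hf (j + 1)) (hX.zero_mem (hf 0)) N) (hf 0)
        _ ≤ 2 * (∑ j ∈ Finset.range N, 2 ^ (j + 1) * X.hSq (f (j + 1))) + 2 * X.hSq (f 0) := by
            gcongr; exact ih _ fun j => hf (j + 1)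
        _ = _ := by
            rw [Finset.mul_sum]
            simp only [zero_add, pow_one]
            congr 1
            refine Finset.sum_congr rfl fun j _ => ?_
            ring
  refine (h1 N f hf).trans ?_
  calc _ ≤ ∑ j ∈ Finset.range N, 2 * a * (2⁻¹ : ℝ≥0∞) ^ j := by
        refine Finset.sum_le_sum fun j _ => ?_
        calc _ ≤ 2 ^ (j + 1) * (a * (4⁻¹ : ℝ≥0∞) ^ j) := by gcongr; exact h j
          _ = 2 * a * (2 ^ j * (4⁻¹ : ℝ≥0∞) ^ j) := by ring
          _ = _ := by
            rw [← mul_pow]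
            congr 2
            have : (4 : ℝ≥0∞) = 2 * 2 := by norm_num
            rw [this, ENNReal.mul_inv (by norm_num) (by norm_num), ← mul_assoc,
              ENNReal.mul_inv_cancel (by norm_num) (by norm_num), one_mul]
    _ ≤ ∑' j : ℕ, 2 * a * (2⁻¹ : ℝ≥0∞) ^ j := ENNReal.sum_le_tsum _
    _ = _ := by rw [ENNReal.tsum_mul_left, ENNReal.tsum_geometric_two]; ring

lemma exists_dominating {f : ℕ → X.Point → ℝ} (hf : ∀ j, f j ∈ X.lip) (hpos : ∀ j p, 0 ≤ f j p)
    {a : ℝ≥0∞} (ha : a ≠ ⊤) (h : ∀ j, X.hSq (f j) ≤ a * (4⁻¹ : ℝ≥0∞) ^ j) :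
    ∃ u : X.L2, (∀ᵐ p ∂X.vol, ∀ j, f j p ≤ u p) ∧ X.energy u + ofReal (‖u‖ ^ 2) ≤ 12 * a := by
  have h0 := hX.zero_mem (hf 0)
  set S : ℕ → X.Point → ℝ := fun N p => ∑ j ∈ Finset.range N, f j p with hS
  have hSl : ∀ N, S N ∈ X.lip := fun N => hX.sum_mem hf h0 N
  have htail : ∀ M n, X.hSq (fun p => S (M + n) p - S M p) ≤ 4 * (a * (4⁻¹ : ℝ≥0∞) ^ M) := by
    intro M n
    have e : (fun p => S (M + n) p - S M p) = fun p => ∑ j ∈ Finset.range n, f (M + j) p := by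
      funext p
      simp only [hS]
      rw [Finset.sum_range_add, add_sub_cancel_left]
    rw [e]
    refine hX.hSq_sum_le (f := fun j => f (M + j)) (fun j => hf _) (fun j => ?_) n
    refine (h (M + j)).trans (le_of_eq ?_)
    rw [pow_add, mul_assoc]
  have hlim := tendsto_mul_zero (c := 4) ofNat_ne_top (tendsto_mul_four_inv_pow ha)
  have hpair : ∀ k l, X.hSq (fun p => S k p - S l p) ≤ 4 * (a * (4⁻¹ : ℝ≥0∞) ^ (min k l)) := by
    intro k l
    rcases le_total k l with hkl | hkl
    · obtain ⟨n, rfl⟩ := Nat.exists_eq_add_of_le hkl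
      rw [hX.hSq_sub_comm (hSl _) (hSl _), min_eq_left hkl]
      exact htail _ _
    · obtain ⟨n, rfl⟩ := Nat.exists_eq_add_of_le hkl
      simp_all
  have hmin : Tendsto (fun kl : ℕ × ℕ => min kl.1 kl.2) atTop atTop := by
    rw [← prod_atTop_atTop_eq]
    exact tendsto_atTop.2 fun b => ((tendsto_fst.eventually_ge_atTop b).and
      (tendsto_snd.eventually_ge_atTop b)).mono fun _ h => le_min h.1 h.2
  have hQ : Tendsto (fun kl : ℕ × ℕ => X.hSq (fun p => S kl.1 p - S kl.2 p)) atTop (𝓝 0) :=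
    tendsto_zero_of_le (hlim.comp hmin) fun kl => hpair _ _
  obtain ⟨u, hu⟩ := exists_limit_of_sqInt (fun k => hX.memLp _ (hSl k))
    (tendsto_zero_of_le hQ fun kl => le_add_self)
  have hH : X.IsH1Seq S u := ⟨hSl, hu, tendsto_zero_of_le hQ fun kl => le_self_add⟩
  have hb : ∀ N, X.hSq (S N) ≤ 4 * a := fun N => hX.hSq_sum_le hf h N
  refine ⟨u, ?_, ?_⟩
  · obtain ⟨ns, hns, hae⟩ := exists_seq_ae_of_sqInt (fun k => (hX.memLp _ (hSl k)).1)
      (Lp.aestronglyMeasurable u) hu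
    filter_upwards [hae] with p hp j
    refine ge_of_tendsto hp ?_
    filter_upwards [eventually_ge_atTop (j + 1)] with k hk
    have : j ∈ Finset.range (ns k) := Finset.mem_range.2 (lt_of_lt_of_le hk (hns.le_apply))
    exact Finset.single_le_sum (f := fun j => f j p) (fun i _ => hpos i p) this
  · have e1 : X.energy u ≤ 4 * a := by
      refine (energy_le hH).trans ?_
      refine limsup_le_of_le (by isBoundedDefault) (Eventually.of_forall fun k => ?_)
      exact le_self_add.trans (hb k)
    have e2 : ofReal (‖u‖ ^ 2) ≤ 8 * a := by
      rw [← sqInt_coe]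
      have h3 : Tendsto (fun N => 2 * sqInt X.vol (fun p => S N p - u p) + 8 * a) atTop
          (𝓝 (8 * a)) := by
        simpa using (tendsto_mul_zero (c := 2) ofNat_ne_top hu).add_const (8 * a)
      refine ge_of_tendsto' h3 fun N => ?_
      have h4 := sqInt_add_le_two (μ := X.vol) (f := fun p => u p - S N p) (g := S N)
        ((Lp.aestronglyMeasurable u).aemeasurable.sub (hX.aemeasurable (hSl N)))
      simp only [sub_add_cancel] at h4
      rw [sqInt_sub_comm] at h4
      refine h4.trans (add_le_add le_rfl ?_)
      calc _ ≤ 2 * (4 * a) := by gcongr; exact le_add_self.trans (hb N)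
        _ = _ := by ring
    calc _ ≤ 4 * a + 8 * a := add_le_add e1 e2
      _ = _ := by ring

/-- A fast sequence converges outside open sets of small capacity; its limit is
a quasi-continuous representative. -/
theorem isQuasiRep_limUnder {w : ℕ → X.Point → ℝ} {u : X.L2} (h : X.IsH1Seq w u)
    (hw : X.IsFast w) : X.IsQuasiRep u (fun p => limUnder atTop fun j => w j p) ∧
      ∀ ε : ℝ≥0∞, 0 < ε → ∃ V, IsOpen V ∧ X.cap V < ε ∧
        ∀ p ∉ V, Tendsto (fun j => w j p) atTop (𝓝 (limUnder atTop fun j => w j p)) := by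
  set V : ℕ → Set X.Point := fun n => ⋃ j : ℕ, {p | (1 / 2 : ℝ) ^ (n + j) < |w (n + j + 1) p - w (n + j) p|}
    with hV
  have hsub : ∀ j, (fun p => w (j + 1) p - w j p) ∈ X.lip := fun j => hX.sub_mem (h.1 _) (h.1 _)
  have hVo : ∀ n, IsOpen (V n) := fun n => isOpen_iUnion fun j =>
    isOpen_lt continuous_const (hX.continuous _ (hX.abs_mem _ (hsub (n + j))))
  have hVcap : ∀ n : ℕ, X.cap (V n) ≤ 12 * (4⁻¹ : ℝ≥0∞) ^ n := by
    intro n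
    set f : ℕ → X.Point → ℝ := fun j p => 2 ^ (n + j) * |w (n + j + 1) p - w (n + j) p| with hf
    obtain ⟨g, hg, hgE⟩ := hX.exists_dominating (f := f) (a := (4⁻¹ : ℝ≥0∞) ^ n)
      (fun j => hX.const_mul_mem _ _ (hX.abs_mem _ (hsub (n + j))))
      (fun j p => by simp only [hf]; positivity)
      (ENNReal.pow_ne_top (by simp)) (fun j => by
        have hs := hsub (n + j)
        refine (hX.hSq_const_mul_le _ (hX.abs_mem _ hs)).trans ?_
        have e : ofReal (((2 : ℝ) ^ (n + j)) ^ 2) = 4 ^ (n + j) := by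
          rw [← pow_mul, mul_comm, pow_mul, ofReal_pow (by norm_num)]
          norm_num
        rw [e, ← pow_add]
        calc _ ≤ (4 : ℝ≥0∞) ^ (n + j) * (16⁻¹ : ℝ≥0∞) ^ (n + j) := by
              gcongr; exact (hX.hSq_abs_le hs).trans (hw (n + j))
          _ = _ := by
            rw [← mul_pow]
            congr 1
            have : (16 : ℝ≥0∞) = 4 * 4 := by norm_num
            rw [this, ENNReal.mul_inv (by norm_num) (by norm_num), ← mul_assoc,
              ENNReal.mul_inv_cancel (by norm_num) (by norm_num), one_mul])
    refine (iInf₂_le g ⟨V n, hVo n, subset_rfl, ?_⟩).trans hgE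
    filter_upwards [hg] with p hp hpV
    obtain ⟨j, hj⟩ := mem_iUnion.1 hpV
    refine le_trans ?_ (hp j)
    have hj' : (1 / 2 : ℝ) ^ (n + j) < |w (n + j + 1) p - w (n + j) p| := hj
    simp only [hf]
    calc (1 : ℝ) = 2 ^ (n + j) * (1 / 2) ^ (n + j) := by rw [← mul_pow]; norm_num
      _ ≤ _ := by gcongr
  have hlim := tendsto_mul_four_inv_pow (c := 12) ofNat_ne_top
  have hstep : ∀ n, ∀ p ∉ V n, ∀ j, dist (w (n + j) p) (w (n + (j + 1)) p) ≤
      (1 / 2 : ℝ) ^ n * (1 / 2) ^ j := by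
    intro n p hp j
    have : p ∉ {p | (1 / 2 : ℝ) ^ (n + j) < |w (n + j + 1) p - w (n + j) p|} :=
      fun h' => hp (mem_iUnion.2 ⟨j, h'⟩)
    rw [dist_comm, Real.dist_eq, ← pow_add]
    exact not_lt.1 this
  have hconv : ∀ n, ∀ p ∉ V n, Tendsto (fun j => w j p) atTop (𝓝 (limUnder atTop fun j => w j p)) := by
    intro n p hp
    have hc : CauchySeq fun j => w (n + j) p :=
      cauchySeq_of_le_geometric (1 / 2) ((1 / 2) ^ n) (by norm_num) (hstep n p hp)
    obtain ⟨a, ha⟩ := cauchySeq_tendsto_of_complete hc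
    have ha' : Tendsto (fun j => w j p) atTop (𝓝 a) := by
      rw [← tendsto_add_atTop_iff_nat n]
      grind
    exact tendsto_nhds_limUnder ⟨a, ha'⟩
  have hae : ∀ᵐ p ∂X.vol, ∃ n, p ∉ V n := by
    rw [ae_iff]
    refine le_antisymm (ge_of_tendsto' hlim fun n => ?_) zero_le
    refine le_trans (measure_mono fun p hp => ?_) ((vol_le_cap (V n)).trans (hVcap n))
    exact (by simpa using hp : ∀ n, p ∈ V n) n
  refine ⟨⟨?_, fun ε hε => ?_⟩, fun ε hε => ?_⟩
  · obtain ⟨ns, hns, hns2⟩ := exists_seq_ae_of_sqInt (fun k => (hX.memLp _ (h.1 k)).1)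
      (Lp.aestronglyMeasurable u) h.2.1
    filter_upwards [hae, hns2] with p ⟨n, hn⟩ hp
    exact tendsto_nhds_unique ((hconv n p hn).comp hns.tendsto_atTop) hp
  · obtain ⟨n, hn⟩ := (hlim.eventually_lt_const hε).exists
    refine ⟨V n, hVo n, (hVcap n).trans_lt hn, ?_⟩
    have hu : TendstoUniformlyOn (fun j p => w (n + j) p) (fun p => limUnder atTop fun j => w j p)
        atTop (V n)ᶜ := by
      rw [Metric.tendstoUniformlyOn_iff]
      intro ε hε
      have h2 : Tendsto (fun j : ℕ => (1 / 2 : ℝ) ^ n * (1 / 2) ^ j / (1 - 1 / 2)) atTop (𝓝 0) := by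
        simpa using ((tendsto_pow_atTop_nhds_zero_of_lt_one (r := (1 / 2 : ℝ)) (by norm_num)
          (by norm_num)).const_mul ((1 / 2 : ℝ) ^ n)).div_const (1 - 1 / 2)
      filter_upwards [h2.eventually_lt_const hε] with j hj p hp
      rw [dist_comm]
      refine lt_of_le_of_lt ?_ hj
      refine dist_le_of_le_geometric_of_tendsto (1 / 2) ((1 / 2 : ℝ) ^ n) (by norm_num)
        (hstep n p hp) ?_ j
      have := hconv n p hp
      rw [← tendsto_add_atTop_iff_nat n] at this
      simpa [add_comm] using this
    exact hu.continuousOn (Eventually.of_forall fun j => (hX.continuous _ (h.1 _)).continuousOn).frequently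
  · obtain ⟨n, hn⟩ := (hlim.eventually_lt_const hε).exists
    exact ⟨V n, hVo n, (hVcap n).trans_lt hn, hconv n⟩

theorem nonlocal_eq_zero {w : ℕ → X.Point → ℝ} {u : X.L2} (h : X.IsH1Seq w u)
    {T : X.Point → X.Point} {S : Set X.Point} (hS : MeasurableSet S)
    (hT : ∀ k, ∀ p ∈ S, w k p = w k (T p)) : X.nonlocal T (X.inftyMeasure S) u = 0 := by
  obtain ⟨ns, hns, hf⟩ := hX.exists_isFast h
  have hq := (hX.isQuasiRep_limUnder (h.comp hns) hf).1
  refine le_antisymm ((iInf₂_le _ hq).trans (le_of_eq ?_)) zero_le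
  rw [lintegral_congr_ae (g := fun _ => 0)]
  · simp
  · have : ∀ᵐ p ∂X.inftyMeasure S, p ∈ S := by rw [ae_iff]; exact inftyMeasure_compl hS
    filter_upwards [this] with p hp
    simp [*]

end IsRegular

end LipRiem

/-! ### One-dimensional estimates -/

lemma sq_lintegral_le {α : Type*} [MeasurableSpace α] (μ : Measure α) {f : α → ℝ≥0∞}
    (hf : AEMeasurable f μ) : (∫⁻ a, f a ∂μ) ^ 2 ≤ μ univ * ∫⁻ a, f a ^ 2 ∂μ := by
  have h := ENNReal.lintegral_mul_le_Lp_mul_Lq μ Real.HolderConjugate.two_two hf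
    (aemeasurable_const (b := (1 : ℝ≥0∞)))
  have h2 := pow_le_pow_left₀ zero_le h 2
  simp only [Pi.mul_apply, mul_one, ENNReal.one_rpow, lintegral_const, one_mul, mul_pow,
    ← ENNReal.rpow_natCast, ← ENNReal.rpow_mul] at h2
  norm_num at h2
  simpa [mul_comm] using h2

lemma enorm_sub_sq_le_of_lipschitz {g : ℝ → ℝ} {K : ℝ≥0} {r : ℝ} (hr : 0 ≤ r)
    (hg : LipschitzOnWith K g (Icc 0 r)) {s t : ℝ} (hs : s ∈ Icc 0 r) (ht : t ∈ Icc 0 r) :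
    ‖g t - g s‖ₑ ^ 2 ≤ ofReal r * ∫⁻ y in Ioo 0 r, ‖deriv g y‖ₑ ^ 2 := by
  have hsub : uIcc s t ⊆ Icc 0 r := uIcc_subset_Icc hs ht
  have hac : AbsolutelyContinuousOnInterval g s t := (hg.mono hsub).absolutelyContinuousOnInterval
  have hm : AEMeasurable (fun y => ‖deriv g y‖ₑ) (volume.restrict (Ioo 0 r)) :=
    (measurable_deriv g).enorm.aemeasurable
  have h1 : ‖g t - g s‖ₑ ≤ ∫⁻ y in Ioo 0 r, ‖deriv g y‖ₑ := by
    rw [← hac.integral_deriv_eq_sub, Measure.restrict_congr_set Ioo_ae_eq_Icc]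
    calc ‖∫ y in s..t, deriv g y‖ₑ ≤ ∫⁻ y in uIoc s t, ‖deriv g y‖ₑ := by
          rcases le_total s t with h | h
          · rw [intervalIntegral.integral_of_le h, uIoc_of_le h]
            exact enorm_integral_le_lintegral_enorm _
          · rw [intervalIntegral.integral_of_ge h, uIoc_of_ge h, enorm_neg]
            exact enorm_integral_le_lintegral_enorm _
      _ ≤ _ := lintegral_mono_set (uIoc_subset_uIcc.trans hsub)
  calc _ ≤ (∫⁻ y in Ioo 0 r, ‖deriv g y‖ₑ) ^ 2 := by gcongr
    _ ≤ _ := by simpa using sq_lintegral_le _ hm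

/-! ### Traces -/

section Fubini

variable {d : ℕ}

/-- The canonical measure of the sphere of `ℝ^d`. -/
abbrev sphMeas (d : ℕ) : Measure (𝕊 d) := (volume : Measure 𝔼 d).toSphere

lemma ae_ae_cylVol {P : ℝ × 𝕊 d → Prop} (h : ∀ᵐ p ∂cylVol d, P p) :
    ∀ᵐ ω ∂sphMeas d, ∀ᵐ y ∂(volume : Measure ℝ).restrict (Ioo 0 1), P (y, ω) := by
  have h1 : ∀ᵐ q ∂(sphMeas d).prod ((volume : Measure ℝ).restrict (Ioo 0 1)), P q.swap := by
    rw [cylVol, ← Measure.prod_swap] at h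
    exact ae_of_ae_map measurable_swap.aemeasurable h
  exact Measure.ae_ae_of_ae_prod h1

lemma lintegral_cylVol_symm {f : ℝ × 𝕊 d → ℝ≥0∞} (hf : Measurable f) :
    ∫⁻ p, f p ∂cylVol d = ∫⁻ ω, (∫⁻ y in Ioo (0 : ℝ) 1, f (y, ω)) ∂sphMeas d :=
  lintegral_prod_symm' _ hf

end Fubini

lemma exists_lipschitzOnWith_chartPt {d : ℕ} {A B : ℝ} (hA : A ∈ Ico (0 : ℝ) 1)
    (hB : B ∈ Ico (0 : ℝ) 1) (F : Cyl d ≃ₗᵢ[ℝ] Amb d) :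
    ∃ K, LipschitzOnWith K (fun p : ℝ × 𝕊 d => F (chartPt A B p.1 p.2)) (Icc 0 1 ×ˢ univ) := by
  have h1 : LocallyLipschitzOn (Icc (0 : ℝ) 1 ×ˢ 𝕊 d) (fun q : ℝ × 𝔼 d => chartPt A B q.1 q.2) := by
    rintro q ⟨hq, -⟩
    have hp := profile_mem_Icc hA hB hq
    obtain ⟨K, t, ht, hK⟩ := (contDiffAt_chartPt (n := 1) (A := A) (B := B) (q := q)
      (by nlinarith [hp.1, hp.2])).exists_lipschitzOnWith
    exact ⟨K, t, mem_nhdsWithin_of_mem_nhds ht, hK⟩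
  obtain ⟨K, hK⟩ := h1.exists_lipschitzOnWith_of_compact (isCompact_Icc.prod (isCompact_sphere _ _))
  refine ⟨K, LipschitzOnWith.of_dist_le_mul fun p hp q hq => ?_⟩
  rw [F.dist_map]
  exact hK.dist_le_mul (p.1, p.2) ⟨hp.1, p.2.2⟩ (q.1, q.2) ⟨hq.1, q.2.2⟩

lemma measurable_homExt_of_measurableSet {d : ℕ} {A : Set (Amb d)} (hA : MeasurableSet A)
    {u : A → ℝ} (hu : Continuous u) : Measurable (homExt A u) := by
  classical
  have hm : Measurable fun z : Amb d => ‖z‖⁻¹ • z := measurable_norm.inv.smul measurable_id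
  obtain ⟨g, hg, hgu⟩ := (MeasurableEmbedding.subtype_coe hA).exists_measurable_extend
    hu.measurable fun _ => ⟨0⟩
  have e : homExt A u = ((fun z : Amb d => ‖z‖⁻¹ • z) ⁻¹' A).indicator fun z => g (‖z‖⁻¹ • z) := by
    funext z
    by_cases h : ‖z‖⁻¹ • z ∈ A
    · have h' : z ∈ (fun z : Amb d => ‖z‖⁻¹ • z) ⁻¹' A := h
      rw [indicator_of_mem h', homExt, dif_pos h]
      exact (congrFun hgu ⟨_, h⟩).symm
    · have h' : z ∉ (fun z : Amb d => ‖z‖⁻¹ • z) ⁻¹' A := h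
      rw [indicator_of_notMem h', homExt, dif_neg h]
  rw [e]
  exact (hg.comp hm).indicator (hm hA)

namespace HandleConfig

variable {d : ℕ} {δ₀ δ₁ : ℝ} (C : HandleConfig d δ₀ δ₁) (κ : C.Side)

/-- The values of a function on the half-handle `κ`. -/
def val (u : C.Mbar → ℝ) (p : ℝ × 𝕊 d) : ℝ := homExt C.Mbar u (C.Φ κ p)

/-- The square of the norm of the gradient on the half-handle `κ`. -/
def grd (u : C.Mbar → ℝ) (p : ℝ × 𝕊 d) : ℝ≥0∞ := ‖fderiv ℝ (C.pull κ u) (cylPt p)‖ₑ ^ 2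

lemma measurable_grd (u : C.Mbar → ℝ) : Measurable (C.grd κ u) :=
  ((measurable_fderiv ℝ _).comp continuous_cylPt.measurable).enorm.pow_const 2

variable [hC : Admissible δ₀ δ₁] [NeZero d]

lemma val_eq (u : C.Mbar → ℝ) {p : ℝ × 𝕊 d} (hp : p.1 ∈ Icc (0 : ℝ) 1) :
    C.val κ u p = u ⟨C.Φ κ p, C.Φ_mem_Mbar κ hp⟩ :=
  homExt_of_mem C.Mbar_subset_sph _ _

lemma measurable_homExt {u : C.Mbar → ℝ} (hu : Continuous u) : Measurable (homExt C.Mbar u) :=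
  measurable_homExt_of_measurableSet C.measurableSet_Mbar hu

lemma measurable_val {u : C.Mbar → ℝ} (hu : Continuous u) : Measurable (C.val κ u) :=
  (C.measurable_homExt hu).comp (C.continuous_Φ κ).measurable

lemma exists_lipschitzOnWith_val {u : C.Mbar → ℝ} {K : ℝ≥0}
    (hu : LipschitzWith K u) : ∃ L, LipschitzOnWith L (C.val κ u) (Icc 0 1 ×ˢ univ) := by
  obtain ⟨L, hL⟩ := exists_lipschitzOnWith_chartPt C.inner_mem' C.outer_mem' (C.sframe κ)
  refine ⟨K * L, LipschitzOnWith.of_dist_le_mul fun p hp q hq => ?_⟩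
  rw [C.val_eq κ u hp.1, C.val_eq κ u hq.1]
  refine (hu.dist_le_mul _ _).trans ?_
  rw [NNReal.coe_mul, mul_assoc]
  gcongr
  exact hL.dist_le_mul p hp q hq

lemma exists_lipschitzOnWith_pull {u : C.Mbar → ℝ} {K : ℝ≥0}
    (hu : LipschitzWith K u) {a : ℝ} (ha : 0 < a) :
    ∃ L, LipschitzOnWith L (C.pull κ u) {q | q.fst ∈ Icc (0 : ℝ) 1 ∧ a ≤ ‖q.snd‖} := by
  obtain ⟨L, hL⟩ := C.exists_lipschitzOnWith_val κ hu
  refine ⟨L * (1 + 2 * a⁻¹).toNNReal, LipschitzOnWith.of_dist_le_mul ?_⟩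
  rintro q ⟨hq1, hq2⟩ q' ⟨hq1', hq2'⟩
  have h0 : q.snd ≠ 0 := norm_pos_iff.1 (by linarith)
  have h0' : q'.snd ≠ 0 := norm_pos_iff.1 (by linarith)
  have hm : ∀ q : Cyl d, q.snd ≠ 0 → ‖q.snd‖⁻¹ • q.snd ∈ sphere
    (0 : 𝔼 d) 1 := fun q h => by simpa using norm_inv_smul_self h
  have := hL.dist_le_mul (q.fst, ⟨_, hm q h0⟩) ⟨hq1, mem_univ _⟩
    (q'.fst, ⟨_, hm q' h0'⟩) ⟨hq1', mem_univ _⟩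
  refine this.trans ?_
  rw [NNReal.coe_mul, mul_assoc, Real.coe_toNNReal _ (by positivity)]
  gcongr
  rw [Prod.dist_eq]
  have e1 : ‖q.snd - q'.snd‖ ≤ dist q q' := by rw [dist_eq_norm]; exact Cyl.norm_snd_le (q - q')
  have e2 : dist q.fst q'.fst ≤ dist q q' := by
    rw [dist_eq_norm, Real.norm_eq_abs, dist_eq_norm]
    have := Cyl.norm_sq (q - q')
    have e : (q - q').fst = q.fst - q'.fst := rfl
    rw [e] at this
    exact abs_le_of_sq_le_sq (by nlinarith [sq_nonneg ‖(q - q').snd‖]) (norm_nonneg _)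
  have e3 : 2 * a⁻¹ * dist q q' ≤ (1 + 2 * a⁻¹) * dist q q' := by gcongr; linarith
  refine max_le (e2.trans ?_) (le_trans ?_ e3)
  · exact le_mul_of_one_le_left dist_nonneg (by linarith [inv_pos.2 ha])
  · change dist (‖q.snd‖⁻¹ • q.snd) (‖q'.snd‖⁻¹ • q'.snd) ≤ _
    rw [dist_eq_norm]
    exact (norm_normalize_sub_le h0 h0').trans (by gcongr)

lemma exists_grd_le {u : C.Mbar → ℝ} {K : ℝ≥0} (hu : LipschitzWith K u) :
    ∃ L : ℝ≥0, ∀ p, p.1 ∈ Ioo (0 : ℝ) 1 → C.grd κ u p ≤ L := by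
  obtain ⟨L, hL⟩ := C.exists_lipschitzOnWith_pull κ hu one_half_pos
  refine ⟨L ^ 2, fun p hp => ?_⟩
  have hs : {q : Cyl d | q.fst ∈ Icc (0 : ℝ) 1 ∧ 1 / 2 ≤ ‖q.snd‖} ∈ 𝓝 (cylPt p) := by
    have h1 := Cyl.continuous_fst.continuousAt.eventually_mem (x := cylPt p)
      (Icc_mem_nhds hp.1 hp.2)
    have h2 := Cyl.continuous_snd.norm.continuousAt.eventually_mem (x := cylPt p)
      (Ici_mem_nhds (show 1 / 2 < ‖(p.2 : 𝔼 d)‖ by simp; norm_num))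
    filter_upwards [h1, h2] with q a b using ⟨a, b⟩
  rw [grd, ← ofReal_norm, ENNReal.coe_pow]
  gcongr
  rw [← ENNReal.ofReal_coe_nnreal]
  exact ofReal_le_ofReal (norm_fderiv_le_of_lipschitzOn ℝ hs hL)

lemma ae_val_sub_sq_le {u : C.Mbar → ℝ} {K : ℝ≥0} (hu : LipschitzWith K u) :
    ∀ᵐ ω ∂sphMeas d, ∀ r ∈ Icc (0 : ℝ) 1, ∀ s ∈ Icc 0 r, ∀ t ∈ Icc 0 r,
      ‖C.val κ u (t, ω) - C.val κ u (s, ω)‖ₑ ^ 2 ≤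
        ofReal r * ∫⁻ y in Ioo 0 r, C.grd κ u (y, ω) := by
  obtain ⟨L, hL⟩ := C.exists_lipschitzOnWith_val κ hu
  filter_upwards [ae_ae_cylVol (C.ae_differentiableAt_pull κ hu)] with ω hω r hr s hs t ht
  have hg : LipschitzOnWith L (fun y => C.val κ u (y, ω)) (Icc 0 r) := by
    refine LipschitzOnWith.of_dist_le_mul fun x hx y hy => ?_
    have := hL.dist_le_mul (x, ω) ⟨⟨hx.1, hx.2.trans hr.2⟩, mem_univ _⟩ (y, ω)
      ⟨⟨hy.1, hy.2.trans hr.2⟩, mem_univ _⟩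
    simp_all
  refine (enorm_sub_sq_le_of_lipschitz hr.1 hg hs ht).trans ?_
  refine mul_le_mul' le_rfl ?_
  have hω' : ∀ᵐ y ∂(volume : Measure ℝ).restrict (Ioo 0 r),
      DifferentiableAt ℝ (C.pull κ u) (cylPt (y, ω)) :=
    ae_restrict_of_ae_restrict_of_subset (Ioo_subset_Ioo_right hr.2) hω
  refine lintegral_mono_ae ?_
  filter_upwards [hω'] with y hy
  have h1 : HasDerivAt (fun y : ℝ => cylPt (d := d) (y, ω)) (toLp 2 (1, 0)) y := by
    have h2 : HasDerivAt (fun y : ℝ => (y, (ω : 𝔼 d))) (1, 0) y :=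
      (hasDerivAt_id y).prodMk (hasDerivAt_const _ _)
    exact (WithLp.prodContinuousLinearEquiv 2 ℝ ℝ 𝔼 d).symm.hasFDerivAt.comp_hasDerivAt y h2
  have h2 := hy.hasFDerivAt.comp_hasDerivAt y h1
  have e : (fun y => C.val κ u (y, ω)) = C.pull κ u ∘ fun y => cylPt (y, ω) := by
    funext y; exact (C.pull_cylPt κ u (y, ω)).symm
  rw [e, h2.deriv, grd]
  gcongr
  refine (ContinuousLinearMap.le_opENorm _ _).trans ?_
  have hn : ‖(toLp 2 ((1 : ℝ), (0 : 𝔼 d)) : Cyl d)‖ₑ = 1 := by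
    have h3 : ‖(toLp 2 ((1 : ℝ), (0 : 𝔼 d)) : Cyl d)‖ ^ 2 = 1 := by rw [Cyl.norm_sq]; simp
    have h4 : ‖(toLp 2 ((1 : ℝ), (0 : 𝔼 d)) : Cyl d)‖ = 1 := by simp
    rw [← ofReal_norm, h4, ofReal_one]
  rw [hn, mul_one]

/-- The bound for the values on the ray of direction `ω`. -/
def rayBound (u : C.Mbar → ℝ) (ω : 𝕊 d) : ℝ≥0∞ :=
  ∫⁻ y in Ioo (0 : ℝ) 1, (2 * ‖C.val κ u (y, ω)‖ₑ ^ 2 + 2 * C.grd κ u (y, ω))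

lemma enorm_sq_le_two (a b : ℝ) : ‖a‖ₑ ^ 2 ≤ 2 * ‖b‖ₑ ^ 2 + 2 * ‖a - b‖ₑ ^ 2 := by
  have h := enorm_add_sq_le b (a - b) one_pos
  rw [add_sub_cancel] at h
  refine h.trans (le_of_eq ?_)
  norm_num

lemma ae_val_sq_le {u : C.Mbar → ℝ} {K : ℝ≥0} (hu : LipschitzWith K u) :
    ∀ᵐ ω ∂sphMeas d, ∀ t ∈ Icc (0 : ℝ) 1, ‖C.val κ u (t, ω)‖ₑ ^ 2 ≤ C.rayBound κ u ω := by
  have hm1 := C.measurable_val κ hu.continuous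
  have hm2 := C.measurable_grd κ u
  filter_upwards [C.ae_val_sub_sq_le κ hu] with ω hω t ht
  have h1 : ∀ s ∈ Ioo (0 : ℝ) 1, ‖C.val κ u (t, ω)‖ₑ ^ 2 ≤
      2 * ‖C.val κ u (s, ω)‖ₑ ^ 2 + 2 * ∫⁻ y in Ioo 0 1, C.grd κ u (y, ω) := by
    refine fun s hs => (enorm_sq_le_two _ (C.val κ u (s, ω))).trans ?_
    gcongr
    simpa using hω 1 (by simp) s (Ioo_subset_Icc_self hs) t ht
  have m1 : Measurable fun s => ‖C.val κ u (s, ω)‖ₑ ^ 2 :=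
    (hm1.comp measurable_prodMk_right).enorm.pow_const 2
  calc ‖C.val κ u (t, ω)‖ₑ ^ 2 = ∫⁻ s in Ioo (0 : ℝ) 1, ‖C.val κ u (t, ω)‖ₑ ^ 2 := by simp
    _ ≤ ∫⁻ s in Ioo (0 : ℝ) 1, (2 * ‖C.val κ u (s, ω)‖ₑ ^ 2 +
        2 * ∫⁻ y in Ioo 0 1, C.grd κ u (y, ω)) := setLIntegral_mono' measurableSet_Ioo h1
    _ = _ := by
      have m2 : Measurable fun y => C.grd κ u (y, ω) := hm2.comp measurable_prodMk_right
      rw [lintegral_add_left (m1.const_mul 2), lintegral_const, rayBound,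
        lintegral_add_left (m1.const_mul 2), lintegral_const_mul 2 m2]
      simp

lemma measurable_rayBound {u : C.Mbar → ℝ} (hu : Continuous u) : Measurable (C.rayBound κ u) :=
  (((C.measurable_val κ hu).enorm.pow_const 2).const_mul 2 |>.add
    ((C.measurable_grd κ u).const_mul 2)).lintegral_prod_left'

/-- The constant in the trace estimates. -/
def traceConst : ℝ≥0∞ := 2 * (ofReal (C.ρ ^ d))⁻¹ + 2 * (ofReal ((C.ρ ^ 2)⁻¹ * C.ρ ^ d))⁻¹

lemma traceConst_ne_top : C.traceConst ≠ ⊤ := by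
  have h := C.ρ_pos
  have h1 : (0 : ℝ) < C.ρ ^ d := by positivity
  have h2 : 0 < (C.ρ ^ 2)⁻¹ * C.ρ ^ d := by positivity
  refine ENNReal.add_ne_top.2 ⟨ENNReal.mul_ne_top (by norm_num) ?_,
    ENNReal.mul_ne_top (by norm_num) ?_⟩
  · simp [*]
  simp [*]

lemma sqInt_eq {u : C.Mbar → ℝ} (hu : Continuous u) : sqInt C.mfd.vol u =
    ∫⁻ x in C.Uᶜ, ‖homExt C.Mbar u x‖ₑ ^ 2 ∂sphVol d +
      ∑ κ, ofReal (C.ρ ^ d) * ∫⁻ p, ‖C.val κ u p‖ₑ ^ 2 ∂cylVol d := by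
  refine Eq.trans (lintegral_congr fun p : C.Mbar => ?_)
    (C.lintegral_vol (f := fun x => ‖homExt C.Mbar u x‖ₑ ^ 2)
      ((C.measurable_homExt hu).enorm.pow_const 2))
  rw [ofReal_sq_eq_enorm, homExt_of_mem C.Mbar_subset_sph u p.2]

lemma lintegral_val_le {u : C.Mbar → ℝ} (hu : Continuous u) :
    ofReal (C.ρ ^ d) * ∫⁻ p, ‖C.val κ u p‖ₑ ^ 2 ∂cylVol d ≤ sqInt C.mfd.vol u := by
  rw [C.sqInt_eq hu]
  refine le_trans ?_ le_add_self
  exact Finset.single_le_sum (f := fun κ => ofReal (C.ρ ^ d) *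
    ∫⁻ p, ‖C.val κ u p‖ₑ ^ 2 ∂cylVol d) (fun _ _ => zero_le) (Finset.mem_univ κ)

lemma lintegral_grd_le (u : C.Mbar → ℝ) :
    ofReal ((C.ρ ^ 2)⁻¹ * C.ρ ^ d) * ∫⁻ p, C.grd κ u p ∂cylVol d ≤ C.mfd.dirichlet u := by
  rw [C.dirichlet_eq]
  refine le_trans ?_ le_add_self
  exact Finset.single_le_sum (f := fun κ => ofReal ((C.ρ ^ 2)⁻¹ * C.ρ ^ d) *
    ∫⁻ p, C.grd κ u p ∂cylVol d) (fun _ _ => zero_le) (Finset.mem_univ κ)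

lemma lintegral_grd_le' (u : C.Mbar → ℝ) :
    ∫⁻ p, C.grd κ u p ∂cylVol d ≤ C.traceConst * C.mfd.hSq u := by
  have h2 : 0 < (C.ρ ^ 2)⁻¹ * C.ρ ^ d := by have := C.ρ_pos; positivity
  calc _ ≤ (ofReal ((C.ρ ^ 2)⁻¹ * C.ρ ^ d))⁻¹ * C.mfd.dirichlet u := by
        rw [← ENNReal.div_eq_inv_mul, ENNReal.le_div_iff_mul_le
          (Or.inl (ofReal_pos.2 h2).ne') (Or.inl ofReal_ne_top), mul_comm]
        exact C.lintegral_grd_le κ u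
    _ ≤ _ := by
        gcongr
        · refine le_trans ?_ le_add_self
          refine le_mul_of_one_le_left zero_le (by norm_num)
        · exact le_self_add

lemma lintegral_rayBound_le {u : C.Mbar → ℝ} (hu : Continuous u) :
    ∫⁻ ω, C.rayBound κ u ω ∂sphMeas d ≤ C.traceConst * C.mfd.hSq u := by
  have hm1 := ((C.measurable_val κ hu).enorm.pow_const 2).const_mul (2 : ℝ≥0∞)
  have hm2 := (C.measurable_grd κ u).const_mul (2 : ℝ≥0∞)
  have h1 : (0 : ℝ) < C.ρ ^ d := by have := C.ρ_pos; positivity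
  have h2 : 0 < (C.ρ ^ 2)⁻¹ * C.ρ ^ d := by have := C.ρ_pos; positivity
  have e := lintegral_cylVol_symm (hm1.add hm2)
  have e2 : ∫⁻ ω, C.rayBound κ u ω ∂sphMeas d =
      ∫⁻ p, (2 * ‖C.val κ u p‖ₑ ^ 2 + 2 * C.grd κ u p) ∂cylVol d := e.symm
  rw [e2, lintegral_add_left hm1, lintegral_const_mul _ ((C.measurable_val κ hu).enorm.pow_const 2),
    lintegral_const_mul _ (C.measurable_grd κ u)]
  have a1 : ∫⁻ p, ‖C.val κ u p‖ₑ ^ 2 ∂cylVol d ≤ (ofReal (C.ρ ^ d))⁻¹ * C.mfd.hSq u := by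
    rw [← ENNReal.div_eq_inv_mul, ENNReal.le_div_iff_mul_le
      (Or.inl (ofReal_pos.2 h1).ne') (Or.inl ofReal_ne_top), mul_comm]
    exact (C.lintegral_val_le κ hu).trans le_add_self
  have a2 : ∫⁻ p, C.grd κ u p ∂cylVol d ≤ (ofReal ((C.ρ ^ 2)⁻¹ * C.ρ ^ d))⁻¹ * C.mfd.hSq u := by
    rw [← ENNReal.div_eq_inv_mul, ENNReal.le_div_iff_mul_le
      (Or.inl (ofReal_pos.2 h2).ne') (Or.inl ofReal_ne_top), mul_comm]
    exact (C.lintegral_grd_le κ u).trans le_self_add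
  calc _ ≤ 2 * ((ofReal (C.ρ ^ d))⁻¹ * C.mfd.hSq u) +
        2 * ((ofReal ((C.ρ ^ 2)⁻¹ * C.ρ ^ d))⁻¹ * C.mfd.hSq u) := by gcongr
    _ = _ := by rw [traceConst]; ring

lemma isRegular_mfd : C.mfd.IsRegular where
  memLp u hu := by
    obtain ⟨K, hK⟩ := hu
    have : CompactSpace C.Mbar := isCompact_iff_compactSpace.1 C.isCompact_Mbar
    have hK' : LipschitzWith (α := C.Mbar) K u := hK
    have hfin : IsFiniteMeasure C.mfd.vol := by
      refine ⟨?_⟩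
      have h := C.lintegral_vol (measurable_const (a := (1 : ℝ≥0∞)))
      have h' : C.mfd.vol univ = ∫⁻ _x : C.Mbar, 1 ∂C.mfd.vol := lintegral_one.symm
      refine (le_of_eq (h'.trans h)).trans_lt ?_
      simp only [lintegral_const, one_mul]
      refine ENNReal.add_lt_top.2 ⟨measure_lt_top _ _, ENNReal.sum_lt_top.2 fun κ _ =>
        ENNReal.mul_lt_top ENNReal.ofReal_lt_top (measure_lt_top _ _)⟩
    obtain ⟨b, hb⟩ := isCompact_univ.exists_bound_of_continuousOn hK'.continuous.continuousOn
    have hm : Measurable (α := C.Mbar) u := hK'.continuous.measurable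
    exact MemLp.of_bound hm.aestronglyMeasurable b (Eventually.of_forall fun p => hb p (mem_univ p))
  continuous u hu := by
    obtain ⟨K, hK⟩ := hu
    exact LipschitzWith.continuous (α := C.Mbar) hK
  add_mem u hu v hv := by
    obtain ⟨K, hK⟩ := hu
    obtain ⟨L, hL⟩ := hv
    exact ⟨K + L, LipschitzWith.add (α := C.Mbar) hK hL⟩
  const_mul_mem c u hu := by
    obtain ⟨K, hK⟩ := hu
    have hK' : LipschitzWith (α := C.Mbar) K u := hK
    refine ⟨‖c‖₊ * K, LipschitzWith.of_dist_le_mul fun x y : C.Mbar => ?_⟩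
    have := hK'.dist_le_mul x y
    rw [Real.dist_eq] at this ⊢
    rw [← mul_sub, abs_mul, NNReal.coe_mul, coe_nnnorm, Real.norm_eq_abs, mul_assoc]
    gcongr
  abs_mem u hu := by
    obtain ⟨K, hK⟩ := hu
    have hK' : LipschitzWith (α := C.Mbar) K u := hK
    refine ⟨K, LipschitzWith.of_dist_le_mul fun x y : C.Mbar => ?_⟩
    refine le_trans ?_ (hK'.dist_le_mul x y)
    rw [Real.dist_eq, Real.dist_eq]
    grind
  dirichlet_add_le u hu v hv t ht := by
    obtain ⟨K, hK⟩ := hu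
    obtain ⟨L, hL⟩ := hv
    exact C.dirichlet_add_le hK hL ht
  dirichlet_const_mul_le c u hu := by
    obtain ⟨K, hK⟩ := hu
    exact C.dirichlet_const_mul_le hK c
  dirichlet_abs_le u hu := by
    obtain ⟨K, hK⟩ := hu
    exact C.dirichlet_abs_le hK

end HandleConfig

/-! ### Traces and capacity -/

lemma LipRiem.IsRegular.limsup_hSq_le {X : LipRiem} (hX : X.IsRegular) {w : ℕ → X.Point → ℝ}
    {u : X.L2} (h : X.IsH1Seq w u) : limsup (fun k => X.hSq (w k)) atTop ≤
      2 * (limsup (fun k => X.dirichlet (w k)) atTop + ofReal (‖u‖ ^ 2)) := by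
  have h1 : ∀ k, X.hSq (w k) ≤ X.dirichlet (w k) + (2 * sqInt X.vol (fun p => w k p - u p) +
      2 * ofReal (‖u‖ ^ 2)) := by
    intro k
    have := sqInt_add_le_two (μ := X.vol) (f := fun p => w k p - u p) (g := u)
      ((hX.aemeasurable (h.1 k)).sub (Lp.aestronglyMeasurable u).aemeasurable)
    simp only [sub_add_cancel, sqInt_coe] at this
    exact add_le_add le_rfl this
  refine ENNReal.le_of_forall_pos_le_add fun ε hε _ => ?_
  have h2 : Tendsto (fun k => 2 * sqInt X.vol (fun p => w k p - u p)) atTop (𝓝 0) := by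
    have := ENNReal.Tendsto.const_mul (a := 2) h.2.1 (Or.inr (by norm_num))
    rwa [mul_zero] at this
  have h3 : ∀ᶠ k in atTop, X.hSq (w k) ≤ X.dirichlet (w k) + (2 * ofReal (‖u‖ ^ 2) + ε) := by
    filter_upwards [h2.eventually_le_const (ENNReal.coe_pos.2 hε)] with k hk
    refine (h1 k).trans (add_le_add le_rfl ?_)
    rw [add_comm]
    gcongr
  refine (limsup_le_limsup h3).trans ?_
  rw [limsup_add_const atTop (fun k => X.dirichlet (w k)) _ (by isBoundedDefault)
    (by isBoundedDefault), mul_add, ← add_assoc]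
  gcongr
  exact le_mul_of_one_le_left zero_le (by norm_num)

namespace HandleConfig

variable {d : ℕ} {δ₀ δ₁ : ℝ} (C : HandleConfig d δ₀ δ₁) [hC : Admissible δ₀ δ₁] [NeZero d] (κ : C.Side)

/-- The points of the boundary. -/
def edge (ω : 𝕊 d) : C.Mbar := ⟨C.Φ κ (0, ω), C.Φ_mem_Mbar κ (by simp)⟩

lemma T_edge (ω : 𝕊 d) : C.T (C.edge κ ω) = C.edge (C.opp κ) ω :=
  Subtype.ext (C.Φ_opp κ (0, ω)).symm

lemma edge_mem_bdry (ω : 𝕊 d) : C.edge κ ω ∈ C.bdry := C.Φ_zero_notMem_M κ ω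

lemma val_zero (u : C.Mbar → ℝ) (ω : 𝕊 d) :
    C.val κ u (0, ω) = u (C.edge κ ω) := C.val_eq κ u (by simp)

lemma isClosed_bdry : IsClosed C.bdry := by
  have h := C.isOpen_lt_rad (δ₀ * C.ρ)
  have e : C.bdry = (Subtype.val : C.Mbar → Amb d) ⁻¹' (⋂ i, {x | δ₀ * C.ρ < C.rad i x})ᶜ := by
    ext p
    obtain ⟨p, hp⟩ : C.Mbar := p
    change p ∉ C.M ↔ p ∉ ⋂ i, {x | δ₀ * C.ρ < C.rad i x}
    rw [C.mem_M]
    simp only [C.Mbar_subset_sph hp, true_and, mem_iInter, mem_ofPred_eq]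
  rw [e]
  exact h.isClosed_compl.preimage continuous_subtype_val

lemma ae_cylVol_of_ae_vol {P : C.mfd.Point → Prop} (h : ∀ᵐ p ∂C.mfd.vol, P p) :
    ∀ᵐ p ∂cylVol d, ∀ hp : p.1 ∈ Icc (0 : ℝ) 1, P (⟨C.Φ κ p, C.Φ_mem_Mbar κ hp⟩ : C.Mbar) := by
  obtain ⟨N, hN, hNm, hN0⟩ := exists_measurable_superset_of_null (ae_iff.1 h)
  have hS : MeasurableSet ((Subtype.val : C.Mbar → Amb d) '' N) :=
    (MeasurableEmbedding.subtype_coe C.measurableSet_Mbar).measurableSet_image' hNm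
  set S := (Subtype.val : C.Mbar → Amb d) '' N with hSdef
  have h1 := C.lintegral_vol (f := S.indicator 1) (measurable_one.indicator hS)
  have h2 : ∫⁻ x : C.Mbar, S.indicator (1 : Amb d → ℝ≥0∞) x ∂C.mfd.vol = 0 := by
    have h' : ∀ᵐ x : C.Mbar ∂C.mfd.vol, x ∉ N := measure_eq_zero_iff_ae_notMem.1 hN0
    refine (lintegral_congr_ae (g := fun _ => 0) ?_).trans lintegral_zero
    filter_upwards [h'] with x hx
    exact indicator_of_notMem (fun h => hx (Subtype.val_injective.mem_set_image.1 h)) _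
  rw [h2] at h1
  have h3 := (add_eq_zero.1 h1.symm).2
  have h4 := (Finset.sum_eq_zero_iff.1 h3) κ (Finset.mem_univ κ)
  have hρ : (0 : ℝ) < C.ρ ^ d := by have := C.ρ_pos; positivity
  have h5 := (mul_eq_zero.1 h4).resolve_left (ofReal_pos.2 hρ).ne'
  have hm : Measurable fun p => S.indicator (1 : Amb d → ℝ≥0∞) (C.Φ κ p) :=
    (measurable_one.indicator hS).comp (C.continuous_Φ κ).measurable
  have h5 := (lintegral_eq_zero_iff hm).1 h5
  filter_upwards [h5] with p hp hp1
  by_contra hcon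
  have hN' : (⟨C.Φ κ p, C.Φ_mem_Mbar κ hp1⟩ : C.Mbar) ∈ N := hN hcon
  have : C.Φ κ p ∈ S := ⟨_, hN', rfl⟩
  rw [indicator_of_mem this] at hp
  exact one_ne_zero hp

/-- The directions of the rays that meet `V` in a set of positive length. -/
def rays (V : Set C.mfd.Point) : Set (𝕊 d) :=
  {ω | ∃ᵐ y ∂(volume : Measure ℝ).restrict (Ioo 0 1), ∃ hp : y ∈ Icc (0 : ℝ) 1,
    (⟨C.Φ κ (y, ω), C.Φ_mem_Mbar κ hp⟩ : C.Mbar) ∈ V}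

/-- The size of a set on almost every ray is controlled by its capacity. -/
theorem sphMeas_rays_le_cap (V : Set C.mfd.Point) :
    (2 * C.traceConst)⁻¹ * sphMeas d (C.rays κ V) ≤ C.mfd.cap V := by
  have hX := C.isRegular_mfd
  refine le_iInf₂ fun u ⟨W, hWo, hVW, hu⟩ => ?_
  rw [← tsub_le_iff_right]
  refine le_iInf₂ fun w hw => ?_
  rw [tsub_le_iff_right]
  have hc0 : 2 * C.traceConst ≠ 0 := by
    refine mul_ne_zero (by norm_num) ?_
    have : (ofReal (C.ρ ^ d))⁻¹ ≠ 0 := ENNReal.inv_ne_zero.2 ofReal_ne_top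
    simp [traceConst]
  have hct : 2 * C.traceConst ≠ ⊤ := ENNReal.mul_ne_top (by norm_num) C.traceConst_ne_top
  rw [mul_comm, ← div_eq_mul_inv, ENNReal.div_le_iff hc0 hct]
  obtain ⟨ns, hns, hae⟩ := exists_seq_ae_of_sqInt (fun k => (hX.memLp _ (hw.1 k)).1)
    (Lp.aestronglyMeasurable u) hw.2.1
  have hlip : ∀ k, ∃ K : ℝ≥0, LipschitzWith (α := C.Mbar) K (w k) := hw.1
  choose K hK using hlip
  have hpt : ∀ᵐ ω ∂sphMeas d, ω ∈ C.rays κ V →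
      1 ≤ liminf (fun k => C.rayBound κ (w (ns k)) ω) atTop := by
    have a1 := ae_ae_cylVol (C.ae_cylVol_of_ae_vol κ (hae.and hu))
    have a2 := ae_all_iff.2 fun k => C.ae_val_sq_le κ (hK k)
    filter_upwards [a1, a2] with ω h1 h2 hω
    obtain ⟨y, ⟨hyI, hyV⟩, hy⟩ := (hω.and_eventually h1).exists
    obtain ⟨b1, b2⟩ := hy hyI
    have b3 := b2 (hVW hyV)
    have b4 : Tendsto (fun k => ‖w (ns k) (⟨C.Φ κ (y, ω), C.Φ_mem_Mbar κ hyI⟩ : C.Mbar)‖ₑ ^ 2)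
        atTop (𝓝 (‖u (⟨C.Φ κ (y, ω), C.Φ_mem_Mbar κ hyI⟩ : C.Mbar)‖ₑ ^ 2)) :=
      ((ENNReal.continuous_pow 2).tendsto _).comp b1.enorm
    calc (1 : ℝ≥0∞) ≤ ‖u (⟨C.Φ κ (y, ω), C.Φ_mem_Mbar κ hyI⟩ : C.Mbar)‖ₑ ^ 2 := by
          rw [← ofReal_sq_eq_enorm, ENNReal.one_le_ofReal]
          exact one_le_pow₀ b3
      _ = _ := b4.liminf_eq.symm
      _ ≤ _ := liminf_le_liminf (Eventually.of_forall fun k => by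
          have := h2 (ns k) y hyI
          rwa [C.val_eq κ (w (ns k)) (p := (y, ω)) hyI] at this)
  calc sphMeas d (C.rays κ V)
      ≤ sphMeas d {ω | 1 ≤ liminf (fun k => C.rayBound κ (w (ns k)) ω) atTop} := measure_mono_ae hpt
    _ ≤ ∫⁻ ω, liminf (fun k => C.rayBound κ (w (ns k)) ω) atTop ∂sphMeas d := by
        have := mul_meas_ge_le_lintegral (μ := sphMeas d) (Measurable.liminf fun k =>
          C.measurable_rayBound κ (hK (ns k)).continuous) 1
        rwa [one_mul] at this
    _ ≤ liminf (fun k => ∫⁻ ω, C.rayBound κ (w (ns k)) ω ∂sphMeas d) atTop :=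
        lintegral_liminf_le fun k => C.measurable_rayBound κ (hK (ns k)).continuous
    _ ≤ limsup (fun k => ∫⁻ ω, C.rayBound κ (w (ns k)) ω ∂sphMeas d) atTop := liminf_le_limsup
    _ ≤ limsup (fun k => C.traceConst * C.mfd.hSq (w (ns k))) atTop :=
        limsup_le_limsup (Eventually.of_forall fun k =>
          C.lintegral_rayBound_le κ (hK (ns k)).continuous)
    _ = C.traceConst * limsup (fun k => C.mfd.hSq (w (ns k))) atTop :=
        ENNReal.limsup_const_mul_of_ne_top C.traceConst_ne_top
    _ ≤ C.traceConst * limsup (fun k => C.mfd.hSq (w k)) atTop := by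
        gcongr
        exact limsup_le_limsup_of_le (f := map ns atTop) hns.tendsto_atTop
          (u := fun k => C.mfd.hSq (w k))
    _ ≤ C.traceConst * (2 * (limsup (fun k => C.mfd.dirichlet (w k)) atTop +
        ofReal (‖u‖ ^ 2))) := by gcongr; exact hX.limsup_hSq_le hw
    _ = _ := by ring

lemma ae_notMem_rays {V : Set C.mfd.Point} (h : C.mfd.vol V = 0) :
    ∀ᵐ ω ∂sphMeas d, ω ∉ C.rays κ V := by
  have h' : ∀ᵐ p ∂C.mfd.vol, p ∉ V := by rw [ae_iff]; simpa using h
  filter_upwards [ae_ae_cylVol (C.ae_cylVol_of_ae_vol κ h')] with ω hω hcon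
  obtain ⟨y, ⟨hyI, hyV⟩, hy⟩ := (hcon.and_eventually hω).exists
  exact hy hyI hyV

lemma rays_union (V W : Set C.mfd.Point) : C.rays κ (V ∪ W) = C.rays κ V ∪ C.rays κ W := by
  ext ω
  change (∃ᵐ y ∂_, _) ↔ (∃ᵐ y ∂_, _) ∨ (∃ᵐ y ∂_, _)
  rw [← frequently_or_distrib]
  refine frequently_congr (Eventually.of_forall fun y => ?_)
  rw [← exists_or]
  rfl

lemma mem_rays_of_edge_mem {V : Set C.mfd.Point} (hV : IsOpen V) {ω : 𝕊 d} (hω : C.edge κ ω ∈ V) :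
    ω ∈ C.rays κ V := by
  have hcont : Continuous fun t : Icc (0 : ℝ) 1 => (⟨C.Φ κ (t, ω), C.Φ_mem_Mbar κ t.2⟩ : C.Mbar) :=
    Continuous.subtype_mk ((C.continuous_Φ κ).comp (by fun_prop)) _
  have hev : ∀ᶠ t : Icc (0 : ℝ) 1 in 𝓝 ⟨0, by simp⟩,
      (⟨C.Φ κ (t, ω), C.Φ_mem_Mbar κ t.2⟩ : C.Mbar) ∈ V :=
    hcont.continuousAt.eventually_mem (hV.mem_nhds hω)
  obtain ⟨δ, hδ, hball⟩ := Metric.eventually_nhds_iff.1 hev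
  intro hcon
  have h1 := (ae_restrict_iff' measurableSet_Ioo).1 hcon
  have h2 : volume (Ioo (0 : ℝ) (min δ 1)) = 0 := by
    refine measure_mono_null ?_ (ae_iff.1 h1)
    intro y hy hcon
    have hyI : y ∈ Ioo (0 : ℝ) 1 := ⟨hy.1, hy.2.trans_le (min_le_right _ _)⟩
    refine hcon hyI ⟨Ioo_subset_Icc_self hyI, hball (y := ⟨y, Ioo_subset_Icc_self hyI⟩) ?_⟩
    rw [Subtype.dist_eq, Real.dist_eq, sub_zero, abs_of_pos hy.1]
    grind
  rw [Real.volume_Ioo] at h2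
  have : 0 < min δ 1 := lt_min hδ one_pos
  simp at h2
  linarith

/-- The trace of a set on the boundary is negligible if, up to a null set, its capacity is
arbitrarily small. -/
lemma ae_edge_notMem {B : Set C.mfd.Point}
    (h : ∀ ε : ℝ≥0∞, 0 < ε → ∃ V W G, C.mfd.cap V < ε ∧ C.mfd.cap W < ε ∧ C.mfd.vol G = 0 ∧
      IsOpen (V ∪ W ∪ G) ∧ B ⊆ V ∪ W ∪ G) :
    ∀ᵐ ω ∂sphMeas d, C.edge κ ω ∉ B := by
  have hct : (2 * C.traceConst)⁻¹ ≠ 0 :=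
    ENNReal.inv_ne_zero.2 (ENNReal.mul_ne_top (by norm_num) C.traceConst_ne_top)
  have key : (2 * C.traceConst)⁻¹ * sphMeas d {ω | C.edge κ ω ∈ B} ≤ 0 := by
    refine le_of_forall_gt fun ε hε => ?_
    obtain ⟨V, W, G, hV, hW, hG, ho, hB⟩ := h (ε / 2) (ENNReal.half_pos hε.ne')
    have hsub : {ω | C.edge κ ω ∈ B} ⊆ C.rays κ V ∪ C.rays κ W ∪ C.rays κ G := by
      intro ω hω
      have := C.mem_rays_of_edge_mem κ ho (hB hω)
      rwa [rays_union, rays_union] at this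
    have hG0 : sphMeas d (C.rays κ G) = 0 := by simpa using ae_iff.1 (C.ae_notMem_rays κ hG)
    calc _ ≤ (2 * C.traceConst)⁻¹ * (sphMeas d (C.rays κ V) + sphMeas d (C.rays κ W)) := by
          gcongr
          refine (measure_mono hsub).trans ((measure_union_le _ _).trans ?_)
          rw [hG0, add_zero]
          exact measure_union_le _ _
      _ ≤ C.mfd.cap V + C.mfd.cap W := by
          rw [mul_add]
          exact add_le_add (C.sphMeas_rays_le_cap κ V) (C.sphMeas_rays_le_cap κ W)
      _ < ε / 2 + ε / 2 := ENNReal.add_lt_add hV hW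
      _ = ε := ENNReal.add_halves ε
  have h2 := (mul_eq_zero.1 (le_antisymm key zero_le)).resolve_left hct
  rw [ae_iff]
  simpa using h2

lemma ae_edge_notMem_of_isPolar {B : Set C.mfd.Point} (h : C.mfd.IsPolar B) :
    ∀ᵐ ω ∂sphMeas d, C.edge κ ω ∉ B := by
  obtain ⟨c, hc, h0, hB⟩ := h
  have : ∀ᵐ ω ∂sphMeas d, ∀ D ∈ c, C.edge κ ω ∉ D := by
    refine (ae_ball_iff hc).2 fun D hD => C.ae_edge_notMem κ fun ε hε => ?_
    have h1 : C.mfd.cap D < ε := by rwa [h0 D hD]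
    obtain ⟨u, hu⟩ := iInf_lt_iff.1 h1
    obtain ⟨⟨W, hW, hDW, hu1⟩, hu2⟩ := iInf_lt_iff.1 hu
    have hcW : C.mfd.cap W < ε := lt_of_le_of_lt (iInf₂_le u ⟨W, hW, subset_rfl, hu1⟩) hu2
    exact ⟨W, W, ∅, hcW, hcW, by simp, by simpa using hW, by simpa using hDW⟩
  filter_upwards [this] with ω hω hmem
  obtain ⟨D, hD, hDω⟩ := hB hmem
  exact hω D hD hDω

/-- The traces of two quasi-continuous representatives coincide. -/
lemma ae_edge_eq {u : C.mfd.L2} {f g : C.mfd.Point → ℝ}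
    (hf : C.mfd.IsQuasiRep u f) (hg : C.mfd.IsQuasiRep u g) :
    ∀ᵐ ω ∂sphMeas d, f (C.edge κ ω) = g (C.edge κ ω) := by
  have := C.ae_edge_notMem κ (B := {p | f p ≠ g p}) fun ε hε => by
    obtain ⟨V, hV, hVc, hVf⟩ := hf.2 ε hε
    obtain ⟨W, hW, hWc, hWg⟩ := hg.2 ε hε
    refine ⟨V, W, {p | f p ≠ g p}, hVc, hWc, ?_, ?_, subset_union_right⟩
    · have h : ∀ᵐ p ∂C.mfd.vol, f p = g p := by
        filter_upwards [hf.1, hg.1] with p h1 h2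
        rw [h1, h2]
      exact ae_iff.1 h
    · have hK : IsClosed (V ∪ W)ᶜ := (hV.union hW).isClosed_compl
      have hfg : ContinuousOn (fun p => f p - g p) (V ∪ W)ᶜ :=
        (hVf.mono (compl_subset_compl.2 subset_union_left)).sub
          (hWg.mono (compl_subset_compl.2 subset_union_right))
      have h := hfg.preimage_isClosed_of_isClosed hK (isClosed_singleton (x := (0 : ℝ)))
      convert h.isOpen_compl using 1
      grind
  filter_upwards [this] with ω hω
  by_contra h
  exact hω h

lemma continuous_T : Continuous C.T :=
  (Continuous.subtype_mk (by fun_prop) _ : Continuous fun x : C.Mbar =>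
    (⟨-x, C.neg_mem_Mbar x.2⟩ : C.Mbar))

lemma ae_edge_symm {f : C.mfd.Point → ℝ}
    (hf : ∀ ε : ℝ≥0∞, 0 < ε → ∃ V : Set C.mfd.Point, IsOpen V ∧ C.mfd.cap V < ε ∧ ContinuousOn f Vᶜ)
    (hfin : ∫⁻ p, ofReal ((f p - f (C.T p)) ^ 2) ∂C.mfd.inftyMeasure C.bdry ≠ ⊤) :
    ∀ᵐ ω ∂sphMeas d, f (C.edge κ ω) = f (C.edge (C.opp κ) ω) := by
  have hT := C.continuous_T
  have hpos : ∀ n : ℕ, (0 : ℝ≥0∞) < (n : ℝ≥0∞)⁻¹ := fun n => by simp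
  choose V hVo hVc hVf using fun n : ℕ => hf _ (hpos n)
  set A : ℕ × ℕ × ℕ → Set C.mfd.Point := fun n => (V n.1 ∪ C.T ⁻¹' V n.2.1)ᶜ ∩
    (fun p => f p - f (C.T p)) ⁻¹' {r | ((n.2.2 : ℝ) + 1)⁻¹ ≤ |r|} with hA
  have hAm : ∀ n, MeasurableSet (A n) := fun n => by
    have hK := ((hVo n.1).union ((hVo n.2.1).preimage hT)).isClosed_compl
    have : ContinuousOn (fun p => f p - f (C.T p)) (V n.1 ∪ C.T ⁻¹' V n.2.1)ᶜ :=
      ((hVf n.1).mono (compl_subset_compl.2 subset_union_left)).sub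
        ((hVf n.2.1).comp hT.continuousOn fun p hp h => hp (Or.inr h))
    exact IsClosed.measurableSet (α := C.Mbar)
      (this.preimage_isClosed_of_isClosed hK (isClosed_le continuous_const continuous_abs))
  have hpol : ∀ n, C.mfd.IsPolar (A n ∩ C.bdry) := by
    intro n
    refine LipRiem.isPolar_of_inftyMeasure_ne_top (hAm n) fun htop => hfin ?_
    have hm0 : (0 : ℝ) < (((n.2.2 : ℝ) + 1)⁻¹) ^ 2 := by positivity
    refine top_le_iff.1 ?_
    calc (⊤ : ℝ≥0∞) = ofReal ((((n.2.2 : ℝ) + 1)⁻¹) ^ 2) * C.mfd.inftyMeasure C.bdry (A n) := by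
          rw [htop, ENNReal.mul_top (ofReal_pos.2 hm0).ne']
      _ = ∫⁻ p, (A n).indicator (fun _ => ofReal ((((n.2.2 : ℝ) + 1)⁻¹) ^ 2)) p
            ∂C.mfd.inftyMeasure C.bdry := by rw [lintegral_indicator_const (hAm n)]
      _ ≤ _ := by
          refine lintegral_mono (indicator_le fun p hp => ofReal_le_ofReal ?_)
          rw [← sq_abs (f p - f (C.T p))]
          have : ((n.2.2 : ℝ) + 1)⁻¹ ≤ |f p - f (C.T p)| := hp.2
          gcongr
  have hout : ∀ κ, ∀ᵐ ω ∂sphMeas d, ∃ n, C.edge κ ω ∉ V n := fun κ => by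
    have := C.ae_edge_notMem κ (B := ⋂ n, V n) fun ε hε => by
      obtain ⟨n, hn⟩ := ENNReal.exists_inv_nat_lt hε.ne'
      exact ⟨V n, V n, ∅, (hVc n).trans hn, (hVc n).trans hn, by simp, by simpa using hVo n,
        by simpa using iInter_subset V n⟩
    filter_upwards [this] with ω hω
    by_contra! h
    exact hω (mem_iInter.2 h)
  filter_upwards [hout κ, hout (C.opp κ), ae_all_iff.2 fun n => C.ae_edge_notMem_of_isPolar κ (hpol n)]
    with ω ⟨n, hn⟩ ⟨k, hk⟩ hA
  by_contra hne
  obtain ⟨m, hm⟩ := exists_nat_one_div_lt (abs_pos.2 (sub_ne_zero.2 hne))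
  refine hA (n, k, m) ⟨⟨?_, ?_⟩, C.edge_mem_bdry κ ω⟩
  · rintro (h | h)
    · exact hn h
    · exact hk (by rw [← C.T_edge]; exact h)
  · change ((m : ℝ) + 1)⁻¹ ≤ |f (C.edge κ ω) - f (C.T (C.edge κ ω))|
    rw [C.T_edge, ← one_div]
    exact hm.le

/-- The square of the norm of `L²` of the trace on the boundary component `κ`. -/
def trace (u : C.Mbar → ℝ) : ℝ≥0∞ := ∫⁻ ω, ‖C.val κ u (0, ω)‖ₑ ^ 2 ∂sphMeas d

lemma measurable_val_zero {u : C.Mbar → ℝ} (hu : Continuous u) :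
    Measurable fun ω => C.val κ u (0, ω) :=
  (C.measurable_val κ hu).comp measurable_prodMk_left

lemma trace_le {u : C.Mbar → ℝ} {K : ℝ≥0} (hu : LipschitzWith K u) :
    C.trace κ u ≤ C.traceConst * C.mfd.hSq u := by
  refine le_trans (lintegral_mono_ae ?_) (C.lintegral_rayBound_le κ hu.continuous)
  filter_upwards [C.ae_val_sq_le κ hu] with ω hω
  exact hω 0 (by simp)

lemma lip_comp_T {v : C.mfd.Point → ℝ} (hv : v ∈ C.mfd.lip) : (fun p => v (C.T p)) ∈ C.mfd.lip := by
  obtain ⟨K, hK⟩ := hv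
  have hK' : LipschitzWith (α := C.Mbar) K v := hK
  refine ⟨K, LipschitzWith.of_dist_le_mul fun p q : C.Mbar => (hK'.dist_le_mul _ _).trans ?_⟩
  have : dist (α := C.Mbar) (C.T p) (C.T q) = dist p q := dist_neg_neg (p : Amb d) q
  simp [*]

lemma hSq_comp_T {v : C.mfd.Point → ℝ} (hv : v ∈ C.mfd.lip) :
    C.mfd.hSq (fun p => v (C.T p)) = C.mfd.hSq v := by
  have h1 : sqInt C.mfd.vol (fun p => v (C.T p)) = sqInt C.mfd.vol v := by
    have hT : Measurable C.T := by
      have := C.continuous_T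
      exact Continuous.measurable (α := C.Mbar) (γ := C.Mbar) this
    obtain ⟨K, hK⟩ := hv
    have hm : Measurable (α := C.Mbar) v := (LipschitzWith.continuous (α := C.Mbar) hK).measurable
    have hm' : Measurable fun p => ofReal (v p ^ 2) := (hm.pow_const 2).ennreal_ofReal
    have := lintegral_map (μ := C.mfd.vol) hm' hT
    rw [C.map_T_vol] at this
    exact this.symm
  rw [LipRiem.hSq, LipRiem.hSq, h1]
  congr 1
  exact C.dirichlet_comp_T v

/-- The antisymmetric part of a function (up to the factor `1/2`). -/
abbrev anti (v : C.mfd.Point → ℝ) (p : C.mfd.Point) : ℝ := v p - v (C.T p)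

lemma anti_mem {v : C.mfd.Point → ℝ} (hv : v ∈ C.mfd.lip) : C.anti v ∈ C.mfd.lip :=
  C.isRegular_mfd.sub_mem hv (C.lip_comp_T hv)

lemma hSq_anti_sub_le {v w : C.mfd.Point → ℝ} (hv : v ∈ C.mfd.lip) (hw : w ∈ C.mfd.lip) :
    C.mfd.hSq (fun p => C.anti v p - C.anti w p) ≤ 4 * C.mfd.hSq (fun p => v p - w p) := by
  have hX := C.isRegular_mfd
  have h := hX.sub_mem hv hw
  have hT := C.lip_comp_T h
  have h1 := hX.hSq_add_le h (hX.const_mul_mem (-1) _ hT)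
  have h2 := hX.hSq_const_mul_le (-1) hT
  rw [C.hSq_comp_T h] at h2
  norm_num at h2
  have e : (fun p => C.anti v p - C.anti w p) =
      fun p => (v p - w p) + -1 * (v (C.T p) - w (C.T p)) := by
    funext p; simp only [anti]; ring
  rw [e]
  calc _ ≤ _ := h1
    _ ≤ 2 * C.mfd.hSq (fun p => v p - w p) + 2 * C.mfd.hSq (fun p => v p - w p) := by
        gcongr
        simpa using h2
    _ = _ := by ring

theorem tendsto_trace {w : ℕ → C.mfd.Point → ℝ} {u : C.mfd.L2} (hw : C.mfd.IsH1Seq w u)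
    (hf : C.mfd.IsFast w) (hu : C.mfd.nonlocal C.T (C.mfd.inftyMeasure C.bdry) u ≠ ⊤)
    (κ : C.Side) : Tendsto (fun k => C.trace κ (C.anti (w k))) atTop (𝓝 0) := by
  have hX := C.isRegular_mfd
  obtain ⟨f, hf'⟩ := iInf_lt_iff.1 (lt_top_iff_ne_top.2 hu)
  obtain ⟨hfq, hfin⟩ := iInf_lt_iff.1 hf'
  obtain ⟨hq, hconv⟩ := hX.isQuasiRep_limUnder hw hf
  have h1 : ∀ κ, ∀ᵐ ω ∂sphMeas d, Tendsto (fun k => w k (C.edge κ ω)) atTop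
      (𝓝 (f (C.edge κ ω))) := by
    intro κ
    have := C.ae_edge_notMem κ (B := {p | ¬ Tendsto (fun j => w j p) atTop
        (𝓝 (limUnder atTop fun j => w j p))}) fun ε hε => by
      obtain ⟨V, hV, hVc, hVt⟩ := hconv ε hε
      refine ⟨V, V, ∅, hVc, hVc, by simp, by simpa using hV, fun p hp => ?_⟩
      by_contra hcon
      exact hp (hVt p fun h => hcon (by simp [h]))
    filter_upwards [this, C.ae_edge_eq κ hfq hq] with ω h2 h3
    rw [h3]
    by_contra hcon
    exact h2 hcon
  have h2 : ∀ᵐ ω ∂sphMeas d, Tendsto (fun k => C.val κ (C.anti (w k)) (0, ω)) atTop (𝓝 0) := by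
    filter_upwards [h1 κ, h1 (C.opp κ), C.ae_edge_symm κ hfq.2 hfin.ne] with ω a b c
    rw [← c] at b
    have := a.sub b
    rw [sub_self] at this
    refine this.congr fun k => ?_
    rw [C.val_zero κ (C.anti (w k)) ω]
    change _ = w k (C.edge κ ω) - w k (C.T (C.edge κ ω))
    rw [C.T_edge]
  have hol : ∀ k, ∃ K : ℝ≥0, LipschitzWith (α := C.Mbar) K (C.anti (w k)) :=
    fun k => C.anti_mem (hw.1 k)
  choose K hK using hol
  have hb : ∀ k l, C.trace κ (fun p => C.anti (w k) p - C.anti (w l) p) ≤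
      C.traceConst * (4 * C.mfd.hSq (fun p => w k p - w l p)) := by
    intro k l
    obtain ⟨L, hL⟩ := hX.sub_mem (C.anti_mem (hw.1 k)) (C.anti_mem (hw.1 l))
    have hL' : LipschitzWith (α := C.Mbar) L fun p => C.anti (w k) p - C.anti (w l) p := hL
    refine (C.trace_le κ hL').trans ?_
    gcongr
    exact C.hSq_anti_sub_le (hw.1 k) (hw.1 l)
  have hlim := tendsto_mul_zero C.traceConst_ne_top (tendsto_mul_zero (c := 4) ofNat_ne_top
    (hX.tendsto_hSq hw))
  refine ENNReal.tendsto_nhds_zero.2 fun ε hε => ?_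
  obtain ⟨⟨a, b⟩, hab⟩ := eventually_atTop.1 (hlim.eventually_le_const hε)
  filter_upwards [eventually_ge_atTop a] with k hk
  have hm : ∀ l, Measurable fun ω => C.val κ (fun p => C.anti (w k) p - C.anti (w l) p) (0, ω) :=
    fun l => C.measurable_val_zero κ ((hK k).continuous.sub (hK l).continuous)
  calc C.trace κ (C.anti (w k)) ≤ ∫⁻ ω, liminf (fun l =>
          ‖C.val κ (fun p => C.anti (w k) p - C.anti (w l) p) (0, ω)‖ₑ ^ 2) atTop ∂sphMeas d := by
        refine lintegral_mono_ae ?_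
        filter_upwards [h2] with ω hω
        have h3 : Tendsto (fun l => ‖C.val κ (fun p => C.anti (w k) p - C.anti (w l) p) (0, ω)‖ₑ ^ 2)
            atTop (𝓝 (‖C.val κ (C.anti (w k)) (0, ω)‖ₑ ^ 2)) := by
          refine ((ENNReal.continuous_pow 2).tendsto _).comp (Tendsto.enorm ?_)
          have := hω.const_sub (C.val κ (C.anti (w k)) (0, ω))
          rw [sub_zero] at this
          refine this.congr fun l => ?_
          rw [C.val_zero κ (C.anti (w k)) ω, C.val_zero κ (C.anti (w l)) ω,
            C.val_zero κ (fun p => C.anti (w k) p - C.anti (w l) p) ω]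
        exact h3.liminf_eq.ge
    _ ≤ liminf (fun l => C.trace κ fun p => C.anti (w k) p - C.anti (w l) p) atTop :=
        lintegral_liminf_le fun l => (hm l).enorm.pow_const 2
    _ ≤ ε := by
        refine liminf_le_of_le (by isBoundedDefault) fun x hx => ?_
        obtain ⟨l, hl1, hl2⟩ := (hx.and (eventually_ge_atTop b)).exists
        exact hl1.trans ((hb k l).trans (hab (k, l) ⟨hk, hl2⟩))

end HandleConfig

/-! ### Symmetric approximations -/

namespace LipRiem.IsRegular

variable {X : LipRiem} (hX : X.IsRegular)
include hX

theorem isH1Seq_of_tendsto_hSq {w w' : ℕ → X.Point → ℝ} {u : X.L2} (hw : X.IsH1Seq w u)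
    (hw' : ∀ k, w' k ∈ X.lip)
    (h : Tendsto (fun k => X.hSq (fun p => w' k p - w k p)) atTop (𝓝 0)) :
    X.IsH1Seq w' u ∧
      limsup (fun k => X.dirichlet (w' k)) atTop ≤ limsup (fun k => X.dirichlet (w k)) atTop := by
  have hD : Tendsto (fun k => X.dirichlet (fun p => w' k p - w k p)) atTop (𝓝 0) :=
    tendsto_zero_of_le h fun k => le_self_add
  have hS : Tendsto (fun k => sqInt X.vol (fun p => w' k p - w k p)) atTop (𝓝 0) :=
    tendsto_zero_of_le h fun k => le_add_self
  refine ⟨⟨hw', ?_, ?_⟩, ?_⟩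
  · have h1 := (tendsto_mul_zero (c := 2) ofNat_ne_top hS).add
      (tendsto_mul_zero (c := 2) ofNat_ne_top hw.2.1)
    rw [add_zero] at h1
    exact tendsto_zero_of_le h1
      fun k => sqInt_sub_le_two (hX.aemeasurable (hw' k)) (hX.aemeasurable (hw.1 k))
  · have hc := hw.2.2
    rw [← prod_atTop_atTop_eq] at hc ⊢
    have h := (tendsto_mul_zero (c := 2) ofNat_ne_top hc).add
      (tendsto_mul_zero (c := 2) ofNat_ne_top (hD.comp tendsto_snd))
    rw [add_zero] at h
    have h1 := (tendsto_mul_zero (c := 2) ofNat_ne_top (hD.comp tendsto_fst)).add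
      (tendsto_mul_zero (c := 2) ofNat_ne_top h)
    rw [add_zero] at h1
    refine tendsto_zero_of_le h1 fun kl => ?_
    have d1 := hX.sub_mem (hw' kl.1) (hw.1 kl.1)
    have d2 := hX.sub_mem (hw.1 kl.1) (hw.1 kl.2)
    have d3 := hX.sub_mem (hw.1 kl.2) (hw' kl.2)
    have e1 := hX.dirichlet_add_le_two d1 (hX.add_mem _ d2 _ d3)
    have e2 := hX.dirichlet_add_le_two d2 d3
    rw [hX.dirichlet_sub_comm (hw.1 kl.2) (hw' kl.2)] at e2
    have e : (fun p => w' kl.1 p - w' kl.2 p) = fun p => (w' kl.1 p - w kl.1 p) +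
        ((w kl.1 p - w kl.2 p) + (w kl.2 p - w' kl.2 p)) := by funext p; ring
    rw [e]
    exact e1.trans (add_le_add le_rfl (mul_le_mul' le_rfl e2))
  · set L := limsup (fun k => X.dirichlet (w k)) atTop with hL
    have key : ∀ t : ℝ, 0 < t → limsup (fun k => X.dirichlet (w' k)) atTop ≤
        ofReal (1 + t) * L := by
      refine fun t ht => ENNReal.le_of_forall_pos_le_add fun ε hε _ => ?_
      have h2 := tendsto_mul_zero (c := ofReal (1 + t⁻¹)) ofReal_ne_top hD
      have h3 : ∀ᶠ k in atTop, X.dirichlet (w' k) ≤ ofReal (1 + t) * X.dirichlet (w k) + ε := by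
        filter_upwards [h2.eventually_le_const (ENNReal.coe_pos.2 hε)] with k hk
        have := hX.dirichlet_add_le _ (hw.1 k) _ (hX.sub_mem (hw' k) (hw.1 k)) t ht
        simp only [add_sub_cancel] at this
        exact this.trans (add_le_add le_rfl hk)
      refine (limsup_le_limsup h3).trans (le_of_eq ?_)
      rw [limsup_add_const atTop (fun k => ofReal (1 + t) * X.dirichlet (w k)) _
        (by isBoundedDefault) (by isBoundedDefault),
        ENNReal.limsup_const_mul_of_ne_top ofReal_ne_top]
    rcases eq_or_ne L ⊤ with hT | hT
    · rw [hT]; exact le_top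
    · have h4 : Tendsto (fun t : ℝ => ofReal (1 + t) * L) (𝓝[>] 0) (𝓝 L) := by
        have h5 : Tendsto (fun t : ℝ => ofReal (1 + t)) (𝓝 0) (𝓝 1) := by
          have : Continuous fun t : ℝ => ofReal (1 + t) :=
            ENNReal.continuous_ofReal.comp (by fun_prop)
          simpa using this.tendsto 0
        have := ENNReal.Tendsto.mul_const (b := L) h5 (Or.inr hT)
        rw [one_mul] at this
        exact this.mono_left nhdsWithin_le_nhds
      exact ge_of_tendsto h4 (eventually_mem_nhdsWithin.mono fun t ht => key t ht)

end LipRiem.IsRegular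

section Slab

variable {d : ℕ}

/-- The part `y < s` of the half-handle. -/
def slab (d : ℕ) (s : ℝ) : Set (ℝ × 𝕊 d) := {p | p.1 < s}

lemma measurableSet_slab (s : ℝ) : MeasurableSet (slab d s) := measurable_fst measurableSet_Iio

lemma lintegral_slab {f : ℝ × 𝕊 d → ℝ≥0∞} (hf : Measurable f) {s : ℝ} (hs : s ≤ 1) :
    ∫⁻ p in slab d s, f p ∂cylVol d = ∫⁻ ω, (∫⁻ y in Ioo (0 : ℝ) s, f (y, ω)) ∂sphMeas d := by
  rw [← lintegral_indicator (measurableSet_slab s),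
    lintegral_cylVol_symm (hf.indicator (measurableSet_slab s))]
  refine lintegral_congr fun ω => ?_
  have e : ∀ y, (slab d s).indicator f (y, ω) = (Iio s).indicator (fun y => f (y, ω)) y := by
    intro y
    by_cases h : y < s
    · rw [indicator_of_mem (show (y, ω) ∈ slab d s from h), indicator_of_mem (show y ∈ Iio s from h)]
    · rw [indicator_of_notMem (show (y, ω) ∉ slab d s from h),
        indicator_of_notMem (show y ∉ Iio s from h)]
  simp_rw [e]
  rw [lintegral_indicator measurableSet_Iio, Measure.restrict_restrict measurableSet_Iio]
  congr 2
  ext y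
  simp only [mem_inter_iff, mem_Iio, mem_Ioo]
  constructor
  · grind
  · grind

lemma ae_cylVol_fst_ne (s : ℝ) : ∀ᵐ p ∂cylVol d, p.1 ≠ s := by
  have : cylVol d ({s} ×ˢ univ) = 0 := by
    rw [cylVol, Measure.prod_prod]
    simp
  filter_upwards [measure_eq_zero_iff_ae_notMem.1 this] with p hp h
  simp_all

lemma enorm_fderiv_linear_mul_sq_le {g : Cyl d → ℝ} {s : ℝ} (hs : 0 < s) {z : Cyl d}
    (hz : z.fst ∈ Icc 0 s) (hg : DifferentiableAt ℝ g z) :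
    ‖fderiv ℝ (fun z : Cyl d => (1 - z.fst / s) * g z) z‖ₑ ^ 2 ≤
      2 * ‖fderiv ℝ g z‖ₑ ^ 2 + 2 * (ofReal (s⁻¹ ^ 2) * ‖g z‖ₑ ^ 2) := by
  have hf : HasFDerivAt (fun z : Cyl d => 1 - z.fst / s) (-(s⁻¹ • WithLp.fstL 2 ℝ ℝ 𝔼 d)) z := by
    have := ((WithLp.fstL 2 ℝ ℝ 𝔼 d).hasFDerivAt (x := z)).const_smul s⁻¹
    refine (this.const_sub 1).congr_of_eventuallyEq (Eventually.of_forall fun z => ?_)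
    change 1 - z.fst / s = 1 - s⁻¹ * z.fst
    rw [div_eq_inv_mul]
  have hg' : fderiv ℝ (fun z => (1 - z.fst / s) * g z) z = _ := (hf.mul hg.hasFDerivAt).fderiv
  have hfl : ‖WithLp.fstL 2 ℝ ℝ 𝔼 d‖ₑ ≤ 1 := by
    rw [← ofReal_norm]
    refine ENNReal.ofReal_le_one.2 (ContinuousLinearMap.opNorm_le_bound _ zero_le_one fun z => ?_)
    rw [one_mul]
    have hz := Cyl.norm_sq z
    change |z.fst| ≤ ‖z‖
    exact abs_le_of_sq_le_sq (by nlinarith [sq_nonneg ‖z.snd‖]) (norm_nonneg _)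
  have ha : ‖1 - z.fst / s‖ₑ ≤ 1 := by
    have h1 : 0 ≤ z.fst / s := div_nonneg hz.1 hs.le
    have h2 : z.fst / s ≤ 1 := (div_le_one hs).2 hz.2
    rw [← ofReal_norm, ENNReal.ofReal_le_one, Real.norm_eq_abs, abs_le]
    constructor <;> linarith
  have h2 := enorm_add_sq_le ((1 - z.fst / s) • fderiv ℝ g z)
    (g z • -(s⁻¹ • WithLp.fstL 2 ℝ ℝ 𝔼 d)) one_pos
  rw [inv_one, one_add_one_eq_two, ofReal_ofNat, enorm_smul, enorm_smul, enorm_neg,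
    enorm_smul] at h2
  rw [hg']
  refine h2.trans ?_
  rw [ofReal_sq_eq_enorm, ← mul_pow]
  gcongr 2 * ?_ ^ 2 + 2 * ?_ ^ 2
  · exact mul_le_of_le_one_left zero_le ha
  · rw [mul_comm]
    exact mul_le_mul' (mul_le_of_le_one_right zero_le hfl) le_rfl

end Slab

namespace HandleConfig

variable {d : ℕ} {δ₀ δ₁ : ℝ} (C : HandleConfig d δ₀ δ₁) [hC : Admissible δ₀ δ₁] [NeZero d] (κ : C.Side)

/-- The cut-off function that is `1` on the boundary and `0` outside a collar of size `s`. -/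
def cutoff (s : ℝ) (x : C.Mbar) : ℝ :=
  ∑ i, max 0 (1 - (C.rad i x - δ₀ * C.ρ) / ((δ₁ * C.ρ - δ₀ * C.ρ) * s))

lemma cutoff_edge {s : ℝ} (hs : s ∈ Ioc (0 : ℝ) 1) (κ : C.Side)
    {p : ℝ × 𝕊 d} (hp : p.1 ∈ Icc (0 : ℝ) 1) :
    C.cutoff s ⟨C.Φ κ p, C.Φ_mem_Mbar κ hp⟩ = max 0 (1 - p.1 / s) := by
  have hlt := C.inner_lt_outer
  have hr := C.rad_Φ κ hp
  have hpos : 0 < δ₁ * C.ρ - δ₀ * C.ρ := sub_pos.2 hlt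
  rw [cutoff, Finset.sum_eq_single κ.1]
  · simp only [hr, add_sub_cancel_left]
    rw [mul_div_mul_left _ _ hpos.ne']
  · intro j _ hj
    have := C.lt_rad_of_rad_le (C.Φ_mem_sph κ hp) hj.symm (by rw [hr]; nlinarith [hp.2])
    refine max_eq_left ?_
    rw [sub_nonpos, one_le_div (by have := hs.1; positivity)]
    nlinarith [hs.2]
  · simp

lemma cutoff_eq_zero {s : ℝ} (hs : s ∈ Ioc (0 : ℝ) 1) {x : C.Mbar}
    (hx : ∀ i, δ₀ * C.ρ + (δ₁ * C.ρ - δ₀ * C.ρ) * s ≤ C.rad i x) : C.cutoff s x = 0 := by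
  have hpos : 0 < δ₁ * C.ρ - δ₀ * C.ρ := sub_pos.2 C.inner_lt_outer
  refine Finset.sum_eq_zero fun i _ => max_eq_left ?_
  rw [sub_nonpos, one_le_div (by have := hs.1; positivity)]
  linarith [hx i]

lemma exists_lipschitz_cutoff_mul (s : ℝ) {u : C.Mbar → ℝ} {K : ℝ≥0} (hu : LipschitzWith K u) :
    ∃ L : ℝ≥0, LipschitzWith L fun x => C.cutoff s x * u x := by
  have hcs : CompactSpace C.Mbar := isCompact_iff_compactSpace.1 C.isCompact_Mbar
  have h1 : ∃ L : ℝ≥0, LipschitzWith L (C.cutoff s) := by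
    have : ∀ S : Finset (Fin C.m), ∃ L : ℝ≥0, LipschitzWith L fun x : C.Mbar =>
        ∑ i ∈ S, max 0 (1 - (C.rad i x - δ₀ * C.ρ) / ((δ₁ * C.ρ - δ₀ * C.ρ) * s)) := by
      intro S
      induction S using Finset.induction_on with
      | empty => exact ⟨0, by simp⟩
      | insert a S ha ih =>
        obtain ⟨L, hL⟩ := ih
        simp_rw [Finset.sum_insert ha]
        refine ⟨‖((δ₁ * C.ρ - δ₀ * C.ρ) * s)⁻¹‖₊ + L, LipschitzWith.add ?_ hL⟩
        refine LipschitzWith.const_max (LipschitzWith.of_dist_le_mul fun x y => ?_) 0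
        have := (C.lipschitz_rad a).dist_le_mul x y
        rw [NNReal.coe_one, one_mul, Real.dist_eq] at this
        rw [Real.dist_eq, coe_nnnorm, Real.norm_eq_abs]
        have e : (1 - (C.rad a x - δ₀ * C.ρ) / ((δ₁ * C.ρ - δ₀ * C.ρ) * s)) -
            (1 - (C.rad a y - δ₀ * C.ρ) / ((δ₁ * C.ρ - δ₀ * C.ρ) * s)) =
            -(((δ₁ * C.ρ - δ₀ * C.ρ) * s)⁻¹ * (C.rad a x - C.rad a y)) := by
          rw [div_eq_inv_mul, div_eq_inv_mul]; ring
        rw [e, abs_neg, abs_mul]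
        gcongr
        exact this
    exact this Finset.univ
  obtain ⟨L, hL⟩ := h1
  obtain ⟨a, ha⟩ := isCompact_univ.exists_bound_of_continuousOn hL.continuous.continuousOn
  obtain ⟨b, hb⟩ := isCompact_univ.exists_bound_of_continuousOn hu.continuous.continuousOn
  refine ⟨a.toNNReal * K + b.toNNReal * L, LipschitzWith.of_dist_le_mul fun x y => ?_⟩
  have e1 := hL.dist_le_mul x y
  have e2 := hu.dist_le_mul x y
  have e3 := (ha x (mem_univ x)).trans (Real.le_coe_toNNReal a)
  have e4 := (hb y (mem_univ y)).trans (Real.le_coe_toNNReal b)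
  rw [Real.dist_eq] at e1 e2 ⊢
  rw [Real.norm_eq_abs] at e3 e4
  have e : C.cutoff s x * u x - C.cutoff s y * u y =
      C.cutoff s x * (u x - u y) + u y * (C.cutoff s x - C.cutoff s y) := by ring
  rw [e]
  refine (abs_add_le _ _).trans ?_
  rw [abs_mul, abs_mul]
  push_cast
  calc _ ≤ (a.toNNReal : ℝ) * (K * dist x y) + b.toNNReal * (L * dist x y) := by gcongr
    _ = _ := by ring

lemma homExt_cutoff_mul_eventuallyEq {s : ℝ} (hs : s ∈ Ioo (0 : ℝ) 1) (u : C.Mbar → ℝ) {x : Amb d}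
    (hx : x ∈ sph d) (hxU : x ∉ C.U) :
    homExt C.Mbar (fun p => C.cutoff s p * u p) =ᶠ[𝓝 x] fun _ => 0 := by
  have hn : ‖x‖ = 1 := by simpa using hx
  have hx0 : x ≠ 0 := by rintro rfl; simp at hn
  have hpos : 0 < δ₁ * C.ρ - δ₀ * C.ρ := sub_pos.2 C.inner_lt_outer
  have hc : ContinuousAt (fun z : Amb d => ‖z‖⁻¹ • z) x :=
    (continuousAt_id.norm.inv₀ (by simpa using hx0)).smul continuousAt_id
  have h1 : ∀ i, ∀ᶠ z in 𝓝 x, δ₀ * C.ρ + (δ₁ * C.ρ - δ₀ * C.ρ) * s < C.rad i (‖z‖⁻¹ • z) := by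
    intro i
    have hr : δ₁ * C.ρ ≤ C.rad i x := by
      by_contra! h
      exact hxU (C.mem_U.2 ⟨hx, i, h⟩)
    have hc2 : ContinuousAt (fun z : Amb d => C.rad i (‖z‖⁻¹ • z)) x :=
      ContinuousAt.comp (g := C.rad i) (C.continuous_rad i).continuousAt hc
    refine hc2.eventually (lt_mem_nhds ?_)
    simp only [hn, inv_one, one_smul]
    nlinarith [hs.2]
  filter_upwards [eventually_all.2 h1] with z hz
  by_cases h : ‖z‖⁻¹ • z ∈ C.Mbar
  · rw [homExt, dif_pos h]
    have := C.cutoff_eq_zero ⟨hs.1, hs.2.le⟩ (x := ⟨_, h⟩) fun i => (hz i).le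
    rw [this, zero_mul]
  · rw [homExt, dif_neg h]

lemma pull_eq_val (u : C.Mbar → ℝ) {z : Cyl d} (hz : z.snd ≠ 0) :
    C.pull κ u z = C.val κ u (z.fst, ⟨‖z.snd‖⁻¹ • z.snd, by
      simpa using norm_inv_smul_self hz⟩) := rfl

lemma val_cutoff_mul {s : ℝ} (hs : s ∈ Ioc (0 : ℝ) 1) (κ : C.Side) (u : C.Mbar → ℝ)
    {p : ℝ × 𝕊 d} (hp : p.1 ∈ Icc (0 : ℝ) 1) :
    C.val κ (fun x => C.cutoff s x * u x) p = max 0 (1 - p.1 / s) * C.val κ u p := by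
  rw [C.val_eq κ _ hp, C.val_eq κ _ hp, C.cutoff_edge hs κ hp]

lemma grd_cutoff_mul_le {s : ℝ} (hs : s ∈ Ioo (0 : ℝ) 1) (κ : C.Side) {u : C.Mbar → ℝ}
    {p : ℝ × 𝕊 d} (hp : p.1 ∈ Ioo (0 : ℝ) 1)
    (hps : p.1 ≠ s) (hu : DifferentiableAt ℝ (C.pull κ u) (cylPt p)) :
    C.grd κ (fun x => C.cutoff s x * u x) p ≤ (slab d s).indicator (fun p => 2 * C.grd κ u p +
      2 * (ofReal (s⁻¹ ^ 2) * ‖C.val κ u p‖ₑ ^ 2)) p := by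
  have hs' : s ∈ Ioc (0 : ℝ) 1 := ⟨hs.1, hs.2.le⟩
  have hn : ‖(cylPt p).snd‖ = 1 := by
    change ‖(p.2 : 𝔼 d)‖ = 1
    simp
  have h0 : (cylPt p).snd ≠ 0 := by rw [← norm_ne_zero_iff, hn]; exact one_ne_zero
  have hev : ∀ᶠ z in 𝓝 (cylPt p), z.snd ≠ 0 :=
    Cyl.continuous_snd.continuousAt.eventually_mem (isOpen_compl_singleton.mem_nhds h0)
  have hfst : ∀ {I : Set ℝ}, IsOpen I → p.1 ∈ I → ∀ᶠ z : Cyl d in 𝓝 (cylPt p), z.fst ∈ I :=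
    fun hI hpI => Cyl.continuous_fst.continuousAt.eventually_mem (x := cylPt p) (hI.mem_nhds hpI)
  rcases lt_or_gt_of_ne hps with h | h
  · rw [indicator_of_mem (show p ∈ slab d s from h)]
    have e : C.pull κ (fun x => C.cutoff s x * u x) =ᶠ[𝓝 (cylPt p)]
        fun z => (1 - z.fst / s) * C.pull κ u z := by
      filter_upwards [hev, hfst isOpen_Ioo ⟨hp.1, h⟩] with z hz hz1
      rw [C.pull_eq_val κ _ hz, C.pull_eq_val κ _ hz, C.val_cutoff_mul hs' κ u
        ⟨hz1.1.le, hz1.2.le.trans hs.2.le⟩, max_eq_right]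
      rw [sub_nonneg, div_le_one hs.1]
      exact hz1.2.le
    rw [grd, e.fderiv_eq]
    refine (enorm_fderiv_linear_mul_sq_le hs.1 (z := cylPt p) ⟨hp.1.le, h.le⟩ hu).trans_eq ?_
    rw [C.pull_cylPt, grd, val]
  · rw [indicator_of_notMem (show p ∉ slab d s from not_lt.2 h.le)]
    have e : C.pull κ (fun x => C.cutoff s x * u x) =ᶠ[𝓝 (cylPt p)] fun _ => 0 := by
      filter_upwards [hev, hfst isOpen_Ioo ⟨h, hp.2⟩] with z hz hz1
      rw [C.pull_eq_val κ _ hz, C.val_cutoff_mul hs' κ u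
        ⟨hs.1.le.trans hz1.1.le, hz1.2.le⟩, max_eq_left, zero_mul]
      rw [sub_nonpos, one_le_div hs.1]
      exact hz1.1.le
    have h0 : ‖fderiv ℝ (fun _ : Cyl d => (0 : ℝ)) (cylPt p)‖ₑ = 0 := by
      rw [fderiv_fun_const, Pi.zero_apply, ← ofReal_norm, norm_zero, ENNReal.ofReal_zero]
    rw [grd, e.fderiv_eq, h0]
    simp

/-- Hardy's inequality on the collar. -/
lemma lintegral_slab_val_le {s : ℝ} (hs : s ∈ Ioo (0 : ℝ) 1) (κ : C.Side) {u : C.Mbar → ℝ}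
    {K : ℝ≥0} (hu : LipschitzWith K u) :
    ofReal (s⁻¹ ^ 2) * ∫⁻ p in slab d s, ‖C.val κ u p‖ₑ ^ 2 ∂cylVol d ≤
      2 * (ofReal s⁻¹ * C.trace κ u) + 2 * ∫⁻ p in slab d s, C.grd κ u p ∂cylVol d := by
  have hm := (C.measurable_val κ hu.continuous).enorm.pow_const 2
  have hmg := C.measurable_grd κ u
  have hm0 := (C.measurable_val_zero κ hu.continuous).enorm.pow_const 2
  have hG : Measurable fun ω => ∫⁻ y in Ioo (0 : ℝ) s, C.grd κ u (y, ω) := hmg.lintegral_prod_left'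
  have e1 : ofReal (s⁻¹ ^ 2) * ofReal s = ofReal s⁻¹ := by
    rw [← ofReal_mul (by positivity)]
    grind
  have e2 : ofReal s⁻¹ * ofReal s = 1 := by
    rw [← ofReal_mul (by have := hs.1; positivity), inv_mul_cancel₀ hs.1.ne', ofReal_one]
  rw [lintegral_slab hm hs.2.le, lintegral_slab hmg hs.2.le]
  calc _ ≤ ofReal (s⁻¹ ^ 2) * ∫⁻ ω, ofReal s * (2 * ‖C.val κ u (0, ω)‖ₑ ^ 2 +
        2 * (ofReal s * ∫⁻ y in Ioo (0 : ℝ) s, C.grd κ u (y, ω))) ∂sphMeas d := by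
        refine mul_le_mul' le_rfl (lintegral_mono_ae ?_)
        filter_upwards [C.ae_val_sub_sq_le κ hu] with ω hω
        calc ∫⁻ y in Ioo (0 : ℝ) s, ‖C.val κ u (y, ω)‖ₑ ^ 2
            ≤ ∫⁻ y in Ioo (0 : ℝ) s, (2 * ‖C.val κ u (0, ω)‖ₑ ^ 2 +
              2 * (ofReal s * ∫⁻ y in Ioo (0 : ℝ) s, C.grd κ u (y, ω))) := by
              refine setLIntegral_mono' measurableSet_Ioo fun y hy => ?_
              refine (enorm_sq_le_two _ (C.val κ u (0, ω))).trans ?_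
              gcongr
              exact hω s ⟨hs.1.le, hs.2.le⟩ 0 ⟨le_rfl, hs.1.le⟩ y ⟨hy.1.le, hy.2.le⟩
          _ = _ := by rw [setLIntegral_const, Real.volume_Ioo, sub_zero, mul_comm]
    _ = _ := by
        rw [lintegral_const_mul' _ _ ofReal_ne_top, lintegral_add_left (hm0.const_mul 2),
          lintegral_const_mul _ hm0, lintegral_const_mul _ (hG.const_mul _),
          lintegral_const_mul _ hG, ← mul_assoc, e1, mul_add]
        change _ * (2 * C.trace κ u) + _ = _
        rw [← mul_assoc, mul_comm _ (2 : ℝ≥0∞), mul_assoc]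
        congr 1
        rw [mul_left_comm, ← mul_assoc _ (ofReal s), e2, one_mul]

/-- The constant in the estimate of the cut-off. -/
def cutoffConst : ℝ≥0∞ := 6 * ofReal ((C.ρ ^ 2)⁻¹ * C.ρ ^ d) + 2 * ofReal (C.ρ ^ d)

lemma hSq_cutoff_mul_le {s : ℝ} (hs : s ∈ Ioo (0 : ℝ) 1) {u : C.Mbar → ℝ} {K : ℝ≥0}
    (hu : LipschitzWith K u) : C.mfd.hSq (fun x : C.Mbar => C.cutoff s x * u x) ≤
      C.cutoffConst * ∑ κ, (ofReal s⁻¹ * C.trace κ u +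
        ∫⁻ p in slab d s, C.grd κ u p ∂cylVol d) := by
  obtain ⟨L, hL⟩ := C.exists_lipschitz_cutoff_mul s hu
  have hz : ∀ᵐ x ∂(sphVol d).restrict C.Uᶜ,
      homExt C.Mbar (fun p => C.cutoff s p * u p) =ᶠ[𝓝 x] fun _ => 0 := by
    filter_upwards [ae_restrict_of_ae (ae_mem_sph d),
      ae_restrict_mem C.measurableSet_U.compl] with x h1 h2
    exact C.homExt_cutoff_mul_eventuallyEq hs u h1 h2
  have z1 : ∫⁻ x in C.Uᶜ, ‖fderiv ℝ (homExt C.Mbar (fun p => C.cutoff s p * u p)) x‖ₑ ^ 2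
      ∂sphVol d = 0 := by
    refine (lintegral_congr_ae (g := fun _ => 0) ?_).trans lintegral_zero
    filter_upwards [hz] with x hx
    have h0 : ‖fderiv ℝ (fun _ : Amb d => (0 : ℝ)) x‖ₑ = 0 := by
      rw [fderiv_fun_const, Pi.zero_apply, ← ofReal_norm, norm_zero, ENNReal.ofReal_zero]
    rw [hx.fderiv_eq, h0, zero_pow two_ne_zero]
  have z2 : ∫⁻ x in C.Uᶜ, ‖homExt C.Mbar (fun p => C.cutoff s p * u p) x‖ₑ ^ 2 ∂sphVol d = 0 := by
    refine (lintegral_congr_ae (g := fun _ => 0) ?_).trans lintegral_zero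
    filter_upwards [hz] with x hx
    rw [hx.eq_of_nhds, enorm_zero, zero_pow two_ne_zero]
  have hmv : ∀ κ, Measurable fun p => ‖C.val κ u p‖ₑ ^ 2 := fun κ =>
    (C.measurable_val κ hu.continuous).enorm.pow_const 2
  refine (add_le_add (C.dirichlet_eq _).le (C.sqInt_eq hL.continuous).le).trans ?_
  rw [z1, z2, zero_add, zero_add, ← Finset.sum_add_distrib, Finset.mul_sum]
  refine Finset.sum_le_sum fun κ _ => ?_
  have b1 : ∫⁻ p, C.grd κ (fun x => C.cutoff s x * u x) p ∂cylVol d ≤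
      2 * (∫⁻ p in slab d s, C.grd κ u p ∂cylVol d) +
        2 * (ofReal (s⁻¹ ^ 2) * ∫⁻ p in slab d s, ‖C.val κ u p‖ₑ ^ 2 ∂cylVol d) := by
    rw [← lintegral_const_mul _ (C.measurable_grd κ u), ← lintegral_const_mul _ (hmv κ),
      ← lintegral_const_mul _ ((hmv κ).const_mul _),
      ← lintegral_add_left ((C.measurable_grd κ u).const_mul 2),
      ← lintegral_indicator (measurableSet_slab s)]
    refine lintegral_mono_ae ?_
    filter_upwards [ae_cylVol_mem, ae_cylVol_fst_ne s, C.ae_differentiableAt_pull κ hu]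
      with p h1 h2 h3
    exact C.grd_cutoff_mul_le hs κ h1 h2 h3
  have b2 : ∫⁻ p, ‖C.val κ (fun x => C.cutoff s x * u x) p‖ₑ ^ 2 ∂cylVol d ≤
      ofReal (s⁻¹ ^ 2) * ∫⁻ p in slab d s, ‖C.val κ u p‖ₑ ^ 2 ∂cylVol d := by
    rw [← lintegral_const_mul _ (hmv κ), ← lintegral_indicator (measurableSet_slab s)]
    refine lintegral_mono_ae ?_
    filter_upwards [ae_cylVol_mem] with p h1
    rw [C.val_cutoff_mul ⟨hs.1, hs.2.le⟩ κ u ⟨h1.1.le, h1.2.le⟩, enorm_mul, mul_pow]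
    by_cases h : p.1 < s
    · rw [indicator_of_mem (show p ∈ slab d s from h)]
      refine mul_le_mul' ?_ le_rfl
      rw [← ofReal_sq_eq_enorm]
      refine ofReal_le_ofReal ?_
      have h2 : 0 ≤ p.1 / s := div_nonneg h1.1.le hs.1.le
      have h3 : max 0 (1 - p.1 / s) ≤ s⁻¹ := max_le (by have := hs.1; positivity) (by
          have : 1 ≤ s⁻¹ := (one_le_inv₀ hs.1).2 hs.2.le
          linarith)
      gcongr
    · rw [max_eq_left, enorm_zero]
      · simp
      · rw [sub_nonpos, one_le_div hs.1]
        exact not_lt.1 h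
  have b3 := C.lintegral_slab_val_le hs κ hu
  set T := ofReal s⁻¹ * C.trace κ u
  set G := ∫⁻ p in slab d s, C.grd κ u p ∂cylVol d
  calc _ ≤ ofReal ((C.ρ ^ 2)⁻¹ * C.ρ ^ d) * (2 * G + 2 * (2 * T + 2 * G)) +
        ofReal (C.ρ ^ d) * (2 * T + 2 * G) := by
        gcongr
        · exact b1.trans (by gcongr)
        · exact b2.trans b3
    _ = ofReal ((C.ρ ^ 2)⁻¹ * C.ρ ^ d) * (4 * T + 6 * G) +
        ofReal (C.ρ ^ d) * (2 * T + 2 * G) := by ring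
    _ ≤ ofReal ((C.ρ ^ 2)⁻¹ * C.ρ ^ d) * (6 * T + 6 * G) +
        ofReal (C.ρ ^ d) * (2 * T + 2 * G) := by gcongr; norm_num
    _ = _ := by rw [cutoffConst]; ring

lemma lintegral_slab_grd_le (s : ℝ) {u v : C.Mbar → ℝ} {K L : ℝ≥0}
    (hu : LipschitzWith K u) (hv : LipschitzWith L v) :
    ∫⁻ p in slab d s, C.grd κ u p ∂cylVol d ≤ 2 * (∫⁻ p in slab d s, C.grd κ v p ∂cylVol d) +
      2 * ∫⁻ p, C.grd κ (fun x => u x - v x) p ∂cylVol d := by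
  calc _ ≤ ∫⁻ p in slab d s, (2 * C.grd κ v p + 2 * C.grd κ (fun x => u x - v x) p) ∂cylVol d := by
        refine lintegral_mono_ae (ae_restrict_of_ae ?_)
        filter_upwards [C.ae_differentiableAt_pull κ hu, C.ae_differentiableAt_pull κ hv]
          with p h1 h2
        have e : C.pull κ (fun x => u x - v x) = fun q => C.pull κ u q - C.pull κ v q := by
          funext q; simp only [pull, chartPull, homExt_sub]
        have h3 := enorm_add_sq_le (fderiv ℝ (C.pull κ v) (cylPt p))
          (fderiv ℝ (C.pull κ u) (cylPt p) - fderiv ℝ (C.pull κ v) (cylPt p)) one_pos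
        rw [inv_one, one_add_one_eq_two, ofReal_ofNat, add_sub_cancel] at h3
        have h4 : fderiv ℝ (fun q => C.pull κ u q - C.pull κ v q) (cylPt p) = _ := fderiv_sub h1 h2
        rw [grd, grd, grd, e, h4]
        exact h3
    _ ≤ _ := by
        rw [lintegral_add_left ((C.measurable_grd κ v).const_mul 2),
          lintegral_const_mul _ (C.measurable_grd κ v), lintegral_const_mul _ (C.measurable_grd κ _)]
        gcongr
        exact Measure.restrict_le_self

lemma tendsto_slab_grd {u : C.Mbar → ℝ} {K : ℝ≥0} (hu : LipschitzWith K u) :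
    Tendsto (fun s => ∫⁻ p in slab d s, C.grd κ u p ∂cylVol d) (𝓝[>] 0) (𝓝 0) := by
  obtain ⟨L, hL⟩ := C.exists_grd_le κ hu
  have h1 : ∀ s ∈ Ioo (0 : ℝ) 1, ∫⁻ p in slab d s, C.grd κ u p ∂cylVol d ≤
      L * (ofReal s * sphMeas d univ) := by
    intro s hs
    rw [lintegral_slab (C.measurable_grd κ u) hs.2.le]
    calc _ ≤ ∫⁻ _ω, (L * ofReal s : ℝ≥0∞) ∂sphMeas d := by
          refine lintegral_mono fun ω => ?_
          calc _ ≤ ∫⁻ _y in Ioo (0 : ℝ) s, (L : ℝ≥0∞) := setLIntegral_mono' measurableSet_Ioo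
                fun y hy => hL (y, ω) ⟨hy.1, hy.2.trans hs.2⟩
            _ = _ := by rw [setLIntegral_const, Real.volume_Ioo, sub_zero]
      _ = _ := by rw [lintegral_const, mul_assoc]
  have h2 : Tendsto (fun s : ℝ => L * (ofReal s * sphMeas d univ)) (𝓝[>] 0) (𝓝 0) := by
    have h3 : Continuous fun s : ℝ => ofReal s * sphMeas d univ :=
      (ENNReal.continuous_mul_const (measure_ne_top _ _)).comp ENNReal.continuous_ofReal
    exact (tendsto_mul_zero ENNReal.coe_ne_top (by simpa using h3.tendsto 0)).mono_left
      nhdsWithin_le_nhds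
  refine tendsto_of_tendsto_of_tendsto_of_le_of_le' tendsto_const_nhds h2
    (Eventually.of_forall fun _ => zero_le) ?_
  filter_upwards [Ioo_mem_nhdsGT (zero_lt_one (α := ℝ))] with s hs using h1 s hs

/-- A function of `H¹` with finite nonlocal term is the limit of Lipschitz functions that are
symmetric on the boundary. -/
theorem exists_symmetric {w : ℕ → C.mfd.Point → ℝ} {u : C.mfd.L2} (hw : C.mfd.IsH1Seq w u)
    (hu : C.mfd.nonlocal C.T (C.mfd.inftyMeasure C.bdry) u ≠ ⊤) :
    ∃ w', C.mfd.IsH1Seq w' u ∧ (∀ k, ∀ p ∈ C.bdry, w' k p = w' k (C.T p)) ∧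
      limsup (fun k => C.mfd.dirichlet (w' k)) atTop ≤
        limsup (fun k => C.mfd.dirichlet (w k)) atTop := by
  have hX := C.isRegular_mfd
  obtain ⟨ns, hns, hfast⟩ := hX.exists_isFast hw
  set v := fun k => w (ns k) with hv
  have hvH : C.mfd.IsH1Seq v u := hw.comp hns
  have htr := fun κ => C.tendsto_trace hvH hfast hu κ
  have hol : ∀ k, ∃ K : ℝ≥0, LipschitzWith (α := C.Mbar) K (C.anti (v k)) :=
    fun k => C.anti_mem (hvH.1 k)
  choose K hK using hol
  have hsmall : ∀ ε : ℝ≥0∞, 0 < ε → ∃ s ∈ Ioo (0 : ℝ) 1, ∀ᶠ l in atTop, ∀ κ,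
      ofReal s⁻¹ * C.trace κ (C.anti (v l)) +
        ∫⁻ p in slab d s, C.grd κ (C.anti (v l)) p ∂cylVol d ≤ ε := by
    intro ε hε
    have hε3 : 0 < ε / 3 := ENNReal.div_pos hε.ne' (by norm_num)
    have h1 := tendsto_mul_zero (c := 2) ofNat_ne_top (tendsto_mul_zero C.traceConst_ne_top
      (tendsto_mul_zero (c := 4) ofNat_ne_top (hX.tendsto_hSq hvH)))
    obtain ⟨⟨a, b⟩, hab⟩ := eventually_atTop.1 (h1.eventually_le_const hε3)
    have h2 : ∀ᶠ s : ℝ in 𝓝[>] 0, ∀ κ,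
        2 * ∫⁻ p in slab d s, C.grd κ (C.anti (v b)) p ∂cylVol d ≤ ε / 3 := by
      exact eventually_all.2 fun κ =>
        (tendsto_mul_zero ofNat_ne_top (C.tendsto_slab_grd κ (hK b))).eventually_le_const hε3
    obtain ⟨s, hs2, hs⟩ := (h2.and (Ioo_mem_nhdsGT (zero_lt_one (α := ℝ)))).exists
    refine ⟨s, hs, ?_⟩
    have h3 : ∀ κ, ∀ᶠ l in atTop, ofReal s⁻¹ * C.trace κ (C.anti (v l)) ≤ ε / 3 := fun κ =>
      (tendsto_mul_zero ofReal_ne_top (htr κ)).eventually_le_const hε3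
    filter_upwards [eventually_all.2 h3, eventually_ge_atTop a] with l hl hla κ
    have h4 := C.lintegral_slab_grd_le κ s (hK l) (hK b)
    have h5 : 2 * ∫⁻ p, C.grd κ (fun x : C.Mbar => C.anti (v l) x - C.anti (v b) x) p ∂cylVol d ≤
        ε / 3 := by
      refine le_trans ?_ (hab (l, b) ⟨hla, le_rfl⟩)
      gcongr
      refine (C.lintegral_grd_le' κ _).trans ?_
      gcongr
      exact C.hSq_anti_sub_le (hvH.1 l) (hvH.1 b)
    calc _ ≤ ε / 3 + (ε / 3 + ε / 3) := add_le_add (hl κ) (h4.trans (add_le_add (hs2 κ) h5))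
      _ = ε := by rw [← add_assoc, ENNReal.add_thirds]
  have hcc : C.cutoffConst ≠ ⊤ := by
    refine ENNReal.add_ne_top.2 ⟨?_, ?_⟩ <;> exact ENNReal.mul_ne_top (by norm_num) ofReal_ne_top
  have hstep : ∀ n : ℕ, ∀ᶠ l in atTop, ∃ s ∈ Ioo (0 : ℝ) 1,
      C.mfd.hSq (fun x : C.Mbar => C.cutoff s x * C.anti (v l) x) ≤ ((n : ℝ≥0∞) + 1)⁻¹ := by
    intro n
    obtain ⟨ε, hε, hlt⟩ := ENNReal.exists_nnreal_pos_mul_lt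
      (a := C.cutoffConst * (Fintype.card (C.Side) : ℝ≥0∞)) (b := ((n : ℝ≥0∞) + 1)⁻¹)
      (ENNReal.mul_ne_top hcc (ENNReal.natCast_ne_top _))
      (ENNReal.inv_ne_zero.2 (by finiteness))
    obtain ⟨s, hs, hl⟩ := hsmall ε (ENNReal.coe_pos.2 hε)
    filter_upwards [hl] with l hl
    refine ⟨s, hs, (C.hSq_cutoff_mul_le hs (hK l)).trans (le_trans ?_ hlt.le)⟩
    calc _ ≤ C.cutoffConst * ∑ _κ : C.Side, (ε : ℝ≥0∞) := by
          gcongr with κ _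
          exact hl κ
      _ = _ := by rw [Finset.sum_const, Finset.card_univ, nsmul_eq_mul]; ring
  obtain ⟨ms, hms, hms2⟩ := extraction_forall_of_eventually hstep
  choose s hs hsb using hms2
  have hcl : ∀ n, (fun x : C.Mbar => C.cutoff (s n) x * C.anti (v (ms n)) x) ∈ C.mfd.lip :=
    fun n => C.exists_lipschitz_cutoff_mul (s n) (hK (ms n))
  set w' : ℕ → C.mfd.Point → ℝ := fun n x =>
    v (ms n) x + -(1 / 2) * (C.cutoff (s n) x * C.anti (v (ms n)) x) with hw'
  have hw'l : ∀ n, w' n ∈ C.mfd.lip := fun n =>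
    hX.add_mem _ (hvH.1 _) _ (hX.const_mul_mem _ _ (hcl n))
  have hconv : Tendsto (fun n => C.mfd.hSq (fun p => w' n p - v (ms n) p)) atTop (𝓝 0) := by
    have h1 : Tendsto (fun n : ℕ => ((n : ℝ≥0∞) + 1)⁻¹) atTop (𝓝 0) := by
      simpa using (tendsto_add_atTop_iff_nat 1).2 ENNReal.tendsto_inv_nat_nhds_zero
    refine tendsto_zero_of_le h1 fun n => ?_
    have e : (fun p => w' n p - v (ms n) p) =
        fun p => -(1 / 2) * (C.cutoff (s n) p * C.anti (v (ms n)) p) := by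
      funext p; simp only [hw', add_sub_cancel_left]
    rw [e]
    refine (hX.hSq_const_mul_le _ (hcl n)).trans (le_trans ?_ (hsb n))
    refine mul_le_of_le_one_left zero_le ?_
    norm_num
  obtain ⟨r1, r2⟩ := hX.isH1Seq_of_tendsto_hSq (hvH.comp hms) hw'l hconv
  refine ⟨w', r1, fun n p hp => ?_, r2.trans ?_⟩
  · obtain ⟨κ, ω, hω⟩ := C.exists_Φ_zero_eq (Subtype.property (p := (· ∈ C.Mbar)) p) hp
    have hpe : p = C.edge κ ω := Subtype.ext hω.symm
    have hc : ∀ κ, C.cutoff (s n) (C.edge κ ω) = 1 := fun κ => by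
      have := C.cutoff_edge ⟨(hs n).1, (hs n).2.le⟩ κ (p := ((0 : ℝ), ω)) (by simp)
      refine Eq.trans this ?_
      simp
    rw [hpe]
    simp only [hw', anti, C.T_edge, C.opp_opp, hc]
    ring
  · exact limsup_le_limsup_of_le (f := map ns atTop) hns.tendsto_atTop
      (u := fun k => C.mfd.dirichlet (w k)) |>.trans' (limsup_le_limsup_of_le (f := map ms atTop)
        hms.tendsto_atTop (u := fun k => C.mfd.dirichlet (v k)))

end HandleConfig

/-! ### The attached manifold -/

lemma Cyl.dist_snd_le {d : ℕ} (x y : Cyl d) : dist x.snd y.snd ≤ dist x y := by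
  rw [dist_eq_norm, dist_eq_norm]
  exact Cyl.norm_snd_le (x - y)

namespace HandleConfig

variable {d : ℕ} {δ₀ δ₁ : ℝ} (C : HandleConfig d δ₀ δ₁) [hC : Admissible δ₀ δ₁] [NeZero d] (κ : C.Side)

/-- The point of the handle with coordinates `(± y, ω)`. -/
def hPt (p : ℝ × 𝕊 d) : Handle d := (projIcc (-1) 1 (by norm_num) (if κ.2 then p.1 else -p.1), p.2)

/-- The half-handle of a point of the handle. -/
def half (i : Fin C.m) (y : ℝ) : C.Side := (i, decide (0 ≤ y))

lemma fst_hPt {p : ℝ × 𝕊 d} (hp : p.1 ∈ Icc (0 : ℝ) 1) :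
    ((C.hPt κ p).1 : ℝ) = if κ.2 then p.1 else -p.1 := by
  rw [hPt, projIcc_of_mem]
  split_ifs
  · grind
  · grind

lemma φ_eq (i : Fin C.m) {p : Handle d} (hp : (p.1 : ℝ) ≠ 0) :
    C.φ i p = C.Φ (C.half i p.1) (|(p.1 : ℝ)|, p.2) := by
  rw [φ, Φ, half, sframe]
  rcases lt_or_gt_of_ne hp with h | h
  · simp only [decide_eq_false (not_le.2 h), Bool.false_eq_true, if_false, Real.sign_of_neg h]
    change _ = -(C.frame i (chartPt _ _ _ _))
    rw [← map_neg, chartPt, ← C.profile_eq]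
    congr 1
    refine Cyl.ext_iff'.2 ⟨?_, ?_⟩
    · exact neg_one_mul _
    simp
  · simp only [decide_eq_true h.le, if_true, Real.sign_of_pos h, one_mul]
    rw [chartPt, ← C.profile_eq]

lemma φ_hPt {p : ℝ × 𝕊 d} (hp : p.1 ∈ Ioc (0 : ℝ) 1) :
    C.φ κ.1 (C.hPt κ p) = C.Φ κ p ∧ ((C.hPt κ p).1 : ℝ) ≠ 0 := by
  have h1 := C.fst_hPt κ (p := p) ⟨hp.1.le, hp.2⟩
  obtain ⟨i, b⟩ := κ
  have h0 : ((C.hPt (i, b) p).1 : ℝ) ≠ 0 := by grind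
  refine ⟨?_, h0⟩
  rw [C.φ_eq i h0, h1, half]
  cases b
  · simp only [Bool.false_eq_true, if_false, abs_neg, abs_of_pos hp.1]
    rw [decide_eq_false (by linarith [hp.1])]
    rfl
  · simp only [if_true, abs_of_pos hp.1]
    rw [decide_eq_true hp.1.le]
    rfl

lemma fst_symm_Φ_pos {p : ℝ × 𝕊 d} (hp : p.1 ∈ Icc (0 : ℝ) 1) :
    0 < ((C.sframe κ).symm (C.Φ κ p)).fst := by
  have h := profile_mem_Icc C.inner_mem' C.outer_mem' hp
  rw [Φ, LinearIsometryEquiv.symm_apply_apply]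
  change 0 < √(1 - _ ^ 2)
  exact Real.sqrt_pos.2 (by nlinarith [h.1, h.2])

lemma Φ_index {κ κ' : C.Side} {p q : ℝ × 𝕊 d} (hp : p.1 ∈ Icc (0 : ℝ) 1)
    (hq : q.1 ∈ Icc (0 : ℝ) 1) (h : C.Φ κ p = C.Φ κ' q) : κ = κ' := by
  have hlt := C.inner_lt_outer
  have h1 : κ.1 = κ'.1 := by
    by_contra hne
    have h2 := C.lt_rad_of_rad_le (C.Φ_mem_sph κ hp) hne (by rw [C.rad_Φ κ hp]; nlinarith [hp.2])
    rw [h, C.rad_Φ κ' hq] at h2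
    nlinarith [hq.2]
  by_contra hne
  have h2 : κ' = C.opp κ := by
    refine Prod.ext h1.symm ?_
    have : κ.2 ≠ κ'.2 := fun h' => hne (Prod.ext h1 h')
    revert this
    change _ → κ'.2 = !κ.2
    grind
  have a1 := C.fst_symm_Φ_pos κ hp
  have a2 := C.fst_symm_Φ_pos κ hq
  rw [h, h2, C.Φ_opp, map_neg] at a1
  have : (-(C.sframe κ).symm (C.Φ κ q)).fst = -((C.sframe κ).symm (C.Φ κ q)).fst := rfl
  linarith

lemma exists_dist_le_Φ : ∃ K : ℝ≥0, ∀ p q : ℝ × 𝕊 d, p.1 ∈ Icc (0 : ℝ) 1 →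
    q.1 ∈ Icc (0 : ℝ) 1 → dist p q ≤ K * dist (C.Φ κ p) (C.Φ κ q) := by
  set A := δ₀ * C.ρ with hA
  set B := δ₁ * C.ρ with hB
  have hA0 : 0 < A := C.inner_mem.1
  have hAB : 0 < B - A := sub_pos.2 C.inner_lt_outer
  refine ⟨((B - A)⁻¹ + 2 * A⁻¹).toNNReal, fun p q hp hq => ?_⟩
  rw [Real.coe_toNNReal _ (by positivity), Φ, Φ, (C.sframe κ).dist_map]
  set P := A + (B - A) * p.1 with hP
  set Q := A + (B - A) * q.1 with hQ
  have hP0 : A ≤ P := by have := hp.1; rw [hP]; nlinarith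
  have hQ0 : A ≤ Q := by have := hq.1; rw [hQ]; nlinarith
  have hn : ∀ ω : 𝕊 d, ‖(ω : 𝔼 d)‖ = 1 := fun ω => mem_sphere_zero_iff_norm.1 ω.2
  set D := dist (chartPt A B p.1 (p.2 : 𝔼 d)) (chartPt A B q.1 q.2) with hD
  have e : ‖P • (p.2 : 𝔼 d) - Q • (q.2 : 𝔼 d)‖ ≤ D := by
    rw [← dist_eq_norm]
    exact Cyl.dist_snd_le (chartPt A B p.1 (p.2 : 𝔼 d)) (chartPt A B q.1 q.2)
  have nP : ‖P • (p.2 : 𝔼 d)‖ = P := by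
    rw [norm_smul, hn, mul_one, Real.norm_of_nonneg (hA0.le.trans hP0)]
  have nQ : ‖Q • (q.2 : 𝔼 d)‖ = Q := by
    rw [norm_smul, hn, mul_one, Real.norm_of_nonneg (hA0.le.trans hQ0)]
  have d1 : dist p.1 q.1 ≤ (B - A)⁻¹ * D := by
    have h1 := (abs_norm_sub_norm_le (P • (p.2 : 𝔼 d)) (Q • q.2.1)).trans e
    rw [nP, nQ, show P - Q = (B - A) * (p.1 - q.1) by rw [hP, hQ]; ring, abs_mul, abs_of_pos hAB] at h1
    rw [Real.dist_eq, inv_mul_eq_div, le_div_iff₀ hAB, mul_comm]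
    exact h1
  have d2 : dist p.2 q.2 ≤ 2 * A⁻¹ * D := by
    have h1 := norm_normalize_sub_le (x := P • (p.2 : 𝔼 d)) (y := Q • (q.2 : 𝔼 d))
      (norm_pos_iff.1 (by rw [nP]; linarith)) (norm_pos_iff.1 (by rw [nQ]; linarith))
    rw [nP, nQ, smul_smul, smul_smul, inv_mul_cancel₀ (by linarith), inv_mul_cancel₀ (by linarith),
      one_smul, one_smul, ← dist_eq_norm] at h1
    refine h1.trans ?_
    gcongr
  have hD0 : 0 ≤ D := dist_nonneg
  rw [Prod.dist_eq]
  refine max_le (d1.trans ?_) (d2.trans ?_)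
  · gcongr; have : 0 ≤ 2 * A⁻¹ := by positivity
    linarith
  · gcongr; have : 0 ≤ (B - A)⁻¹ := by positivity
    linarith

lemma exists_Φ_eq_of_pos {x : Amb d} (hx : x ∈ C.Mbar) {κ : C.Side}
    (h : C.rad κ.1 x ≤ δ₁ * C.ρ) (h0 : 0 < ((C.sframe κ).symm x).fst) :
    ∃ p : ℝ × 𝕊 d, p.1 ∈ Icc (0 : ℝ) 1 ∧ C.Φ κ p = x := by
  obtain ⟨b, p, hp, rfl⟩ := C.exists_Φ_eq hx h
  by_cases hb : b = κ.2
  · grind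
  · exfalso
    have e : (κ.1, b) = C.opp κ := by
      refine Prod.ext rfl ?_
      change b = !κ.2
      revert hb
      cases b <;> cases κ.2 <;> simp
    rw [e, C.Φ_opp, map_neg] at h0
    have a := C.fst_symm_Φ_pos κ hp
    have : (-(C.sframe κ).symm (C.Φ κ p)).fst = -((C.sframe κ).symm (C.Φ κ p)).fst := rfl
    linarith

lemma exists_edge (x : C.Mbar) (h : (x : Amb d) ∉ C.M) :
    ∃ q : (C.Side) × 𝕊 d, C.edge q.1 q.2 = x := by
  obtain ⟨κ, ω, h⟩ := C.exists_Φ_zero_eq x.2 h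
  exact ⟨(κ, ω), Subtype.ext h⟩

open scoped Classical in
/-- The canonical map from `M̄_h` to the attached space. -/
def toN (x : C.Mbar) : C.N := if h : (x : Amb d) ∈ C.M then C.outerMap ⟨x, h⟩
  else C.handleMap (C.exists_edge x h).choose.1.1
    (C.hPt (C.exists_edge x h).choose.1 (0, (C.exists_edge x h).choose.2))

lemma toN_of_mem {x : C.Mbar} (h : (x : Amb d) ∈ C.M) : C.toN x = C.outerMap ⟨x, h⟩ := dif_pos h

lemma toN_Φ {p : ℝ × 𝕊 d} (hp : p.1 ∈ Icc (0 : ℝ) 1) :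
    C.toN ⟨C.Φ κ p, C.Φ_mem_Mbar κ hp⟩ = C.handleMap κ.1 (C.hPt κ p) := by
  rcases hp.1.eq_or_lt with h0 | h0
  · obtain ⟨y, ω⟩ := p
    obtain rfl : 0 = y := h0
    have hx := C.Φ_zero_notMem_M κ ω
    rw [toN, dif_neg hx]
    obtain ⟨q, hq, e⟩ : ∃ q : (C.Side) × 𝕊 d, C.edge q.1 q.2 = C.edge κ ω ∧
        (C.exists_edge ⟨C.Φ κ (0, ω), C.Φ_mem_Mbar κ hp⟩ hx).choose = q :=
      ⟨_, (C.exists_edge ⟨C.Φ κ (0, ω), C.Φ_mem_Mbar κ hp⟩ hx).choose_spec, rfl⟩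
    rw [e]
    have hq' : C.Φ q.1 (0, q.2) = C.Φ κ (0, ω) := congrArg Subtype.val hq
    have h1 : q.1 = κ := C.Φ_index (p := (0, q.2)) (q := (0, ω)) (by simp) (by simp) hq'
    obtain ⟨κ', ω'⟩ := q
    obtain rfl : κ' = κ := h1
    obtain ⟨K, hK⟩ := C.exists_dist_le_Φ κ'
    have h2 := hK (0, ω') (0, ω) (by simp) (by simp)
    rw [hq', dist_self, mul_zero, Prod.dist_eq, dist_self] at h2
    have h3 : ω' = ω := dist_le_zero.1 ((le_max_right _ _).trans h2)
    rw [h3]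
  · have hM := C.Φ_mem_M κ (p := p) ⟨h0, hp.2⟩
    rw [C.toN_of_mem (x := ⟨C.Φ κ p, C.Φ_mem_Mbar κ hp⟩) hM]
    obtain ⟨e1, e2⟩ := C.φ_hPt κ (p := p) ⟨h0, hp.2⟩
    have hg : C.Glue (Sum.inr (κ.1, C.hPt κ p)) (Sum.inl ⟨C.Φ κ p, hM⟩) :=
      Glue.mk κ.1 (C.hPt κ p) ⟨C.Φ κ p, hM⟩ e2 e1.symm
    exact (Quot.sound hg).symm

lemma abs_fst_mem (p : Handle d) : |(p.1 : ℝ)| ∈ Icc (0 : ℝ) 1 := ⟨abs_nonneg _, abs_le.2 p.1.2⟩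

/-- The map from the attached space to `M̄_h`, which sends the central sphere of each handle
to one of the two boundary components. -/
def ofPre : C.PreN → C.Mbar := Sum.elim (fun x => ⟨x, C.M_subset_Mbar x.2⟩) fun q =>
    ⟨C.Φ (C.half q.1 q.2.1) (|(q.2.1 : ℝ)|, q.2.2), C.Φ_mem_Mbar _ (abs_fst_mem q.2)⟩

/-- The map from the attached space to `M̄_h`. -/
def ofN : C.N → C.Mbar := Quot.lift C.ofPre (by
    rintro _ _ ⟨i, p, x, hp, hx⟩
    refine Subtype.ext ?_
    change C.Φ _ _ = (x : Amb d)
    rw [hx, C.φ_eq i hp])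

lemma ofN_outerMap (x : C.M) : C.ofN (C.outerMap x) = ⟨x, C.M_subset_Mbar x.2⟩ := rfl

lemma ofN_handleMap (i : Fin C.m) (p : Handle d) : C.ofN (C.handleMap i p) =
    ⟨C.Φ (C.half i p.1) (|(p.1 : ℝ)|, p.2), C.Φ_mem_Mbar _ (abs_fst_mem p)⟩ := rfl

lemma exists_rep (n : C.N) : (∃ x, C.outerMap x = n) ∨ ∃ i p, C.handleMap i p = n := by
  obtain ⟨x | ⟨i, p⟩, rfl⟩ := Quot.exists_rep n
  · exact Or.inl ⟨x, rfl⟩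
  · exact Or.inr ⟨i, p, rfl⟩

lemma hPt_half (i : Fin C.m) (p : Handle d) : C.hPt (C.half i p.1) (|(p.1 : ℝ)|, p.2) = p := by
  refine Prod.ext (Subtype.ext ?_) rfl
  rw [C.fst_hPt _ (abs_fst_mem p), half]
  grind

lemma toN_ofN (n : C.N) : C.toN (C.ofN n) = n := by
  obtain ⟨x, rfl⟩ | ⟨i, p, rfl⟩ := C.exists_rep n
  · rw [C.ofN_outerMap]
    exact C.toN_of_mem (x := ⟨x, C.M_subset_Mbar x.2⟩) x.2
  · rw [C.ofN_handleMap, C.toN_Φ (C.half i p.1) (abs_fst_mem p), C.hPt_half]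
    rfl

lemma ofN_toN {x : C.Mbar} (h : (x : Amb d) ∈ C.M) : C.ofN (C.toN x) = x := by
  rw [C.toN_of_mem h]; rfl

lemma ofN_toN_edge (ω : 𝕊 d) : C.ofN (C.toN (C.edge κ ω)) = C.edge (κ.1, true) ω := by
  rw [edge, C.toN_Φ κ (p := (0, ω)) (by simp)]
  refine Subtype.ext ?_
  change C.Φ (C.half κ.1 _) (|_|, _) = _
  have : ((C.hPt κ (0, ω)).1 : ℝ) = 0 := by rw [C.fst_hPt κ (by simp)]; simp
  rw [this]
  simp [half, hPt, edge]

lemma eq_ofN_toN {u : C.Mbar → ℝ} (hu : ∀ p ∈ C.bdry, u p = u (C.T p)) (x : C.Mbar) :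
    u (C.ofN (C.toN x)) = u x := by
  by_cases h : (x : Amb d) ∈ C.M
  · rw [C.ofN_toN h]
  · obtain ⟨⟨⟨i, b⟩, ω⟩, rfl⟩ := C.exists_edge x h
    rw [C.ofN_toN_edge]
    cases b
    · have := hu _ (C.edge_mem_bdry (i, true) ω)
      rwa [C.T_edge] at this
    · rfl

lemma toN_symm {x : C.Mbar} (h : x ∈ C.bdry) : C.toN x = C.toN (C.T x) := by
  obtain ⟨⟨κ, ω⟩, rfl⟩ := C.exists_edge x h
  rw [C.T_edge, edge, edge, C.toN_Φ κ (p := (0, ω)) (by simp),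
    C.toN_Φ (C.opp κ) (p := (0, ω)) (by simp)]
  refine congrArg (C.handleMap κ.1) (Prod.ext (Subtype.ext ?_) rfl)
  rw [C.fst_hPt _ (by simp), C.fst_hPt _ (by simp)]
  simp

/-! ### Lipschitz functions on the attached manifold -/

lemma exists_lipschitzWith_of_locallyLipschitz {α : Type*} [PseudoMetricSpace α] [CompactSpace α]
    {f : α → ℝ} (hf : LocallyLipschitz f) : ∃ K, LipschitzWith K f := by
  obtain ⟨K, hK⟩ := LocallyLipschitzOn.exists_lipschitzOnWith_of_compact isCompact_univ
    (hf.locallyLipschitzOn (s := univ))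
  exact ⟨K, lipschitzOnWith_univ.1 hK⟩

lemma dist_hPt_le (p q : ℝ × 𝕊 d) : dist (C.hPt κ p) (C.hPt κ q) ≤ dist p q := by
  have h := (LipschitzWith.projIcc (a := (-1 : ℝ)) (b := 1) (by norm_num)).dist_le_mul
    (if κ.2 then p.1 else -p.1) (if κ.2 then q.1 else -q.1)
  rw [Prod.dist_eq, Prod.dist_eq]
  refine max_le_max ?_ le_rfl
  refine h.trans ?_
  rw [NNReal.coe_one, one_mul]
  split_ifs
  · exact le_rfl
  · rw [dist_neg_neg]

lemma lip_comp_toN {v : C.N → ℝ} (hv : v ∈ C.attached.lip) :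
    ∃ K : ℝ≥0, LipschitzWith K fun x => v (C.toN x) := by
  have : CompactSpace C.Mbar := isCompact_iff_compactSpace.1 C.isCompact_Mbar
  obtain ⟨hv1, hv2⟩ := hv
  refine exists_lipschitzWith_of_locallyLipschitz fun x₀ => ?_
  by_cases h : (x₀ : Amb d) ∈ C.M
  · obtain ⟨K, t, ht, hK⟩ := hv1 ⟨x₀, h⟩
    obtain ⟨ε, hε, hb⟩ := Metric.mem_nhds_iff.1 ht
    have ho : {x : C.Mbar | (x : Amb d) ∈ C.M} ∈ 𝓝 x₀ := by
      have := C.isClosed_bdry.isOpen_compl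
      refine Filter.mem_of_superset (IsOpen.mem_nhds (X := C.Mbar) this fun h' => h' h) ?_
      intro x hx
      by_contra h'
      exact hx h'
    refine ⟨K, _, inter_mem ho (Metric.ball_mem_nhds x₀ hε), LipschitzOnWith.of_dist_le_mul ?_⟩
    rintro x ⟨hx, hx'⟩ y ⟨hy, hy'⟩
    rw [C.toN_of_mem hx, C.toN_of_mem hy]
    exact hK.dist_le_mul ⟨x, hx⟩ (hb hx') ⟨y, hy⟩ (hb hy')
  · obtain ⟨⟨κ, ω⟩, rfl⟩ := C.exists_edge x₀ h
    have : CompactSpace 𝕊 d := isCompact_iff_compactSpace.1 (isCompact_sphere _ _)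
    obtain ⟨L, hL⟩ := exists_lipschitzWith_of_locallyLipschitz (hv2 κ.1)
    obtain ⟨K, hK⟩ := C.exists_dist_le_Φ κ
    have n1 : ∀ᶠ x : C.Mbar in 𝓝 (C.edge κ ω), C.rad κ.1 x < δ₁ * C.ρ := by
      have hc : Continuous fun x : C.Mbar => C.rad κ.1 x :=
        (C.continuous_rad κ.1).comp continuous_subtype_val
      refine hc.continuousAt.eventually (gt_mem_nhds ?_)
      change C.rad κ.1 (C.Φ κ (0, ω)) < _
      rw [C.rad_Φ κ (by simp), mul_zero, add_zero]
      exact C.inner_lt_outer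
    have n2 : ∀ᶠ x : C.Mbar in 𝓝 (C.edge κ ω), 0 < ((C.sframe κ).symm x).fst := by
      have hc : Continuous fun x : C.Mbar => ((C.sframe κ).symm x).fst :=
        Cyl.continuous_fst.comp ((C.sframe κ).symm.continuous.comp continuous_subtype_val)
      exact hc.continuousAt.eventually (lt_mem_nhds (C.fst_symm_Φ_pos κ (by simp)))
    refine ⟨L * K, _, n1.and n2, LipschitzOnWith.of_dist_le_mul ?_⟩
    rintro ⟨x, hx⟩ ⟨a1, a2⟩ ⟨y, hy⟩ ⟨b1, b2⟩
    obtain ⟨p, hp, rfl⟩ := C.exists_Φ_eq_of_pos hx (le_of_lt a1) a2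
    obtain ⟨q, hq, rfl⟩ := C.exists_Φ_eq_of_pos hy (le_of_lt b1) b2
    rw [C.toN_Φ κ hp, C.toN_Φ κ hq]
    refine (hL.dist_le_mul (C.hPt κ p) (C.hPt κ q)).trans ?_
    rw [NNReal.coe_mul, mul_assoc]
    gcongr
    exact (C.dist_hPt_le κ p q).trans (hK p q hp hq)

lemma lip_comp_ofN {u : C.Mbar → ℝ} {K : ℝ≥0} (hK : LipschitzWith K u)
    (hu : ∀ p ∈ C.bdry, u p = u (C.T p)) : (fun n => u (C.ofN n)) ∈ C.attached.lip := by
  have h0 : LipschitzWith K ((fun n => u (C.ofN n)) ∘ C.outerMap) :=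
    LipschitzWith.of_dist_le_mul fun x y => hK.dist_le_mul ⟨x, C.M_subset_Mbar x.2⟩
      ⟨y, C.M_subset_Mbar y.2⟩
  refine ⟨h0.locallyLipschitz, fun i => ?_⟩
  obtain ⟨L, hL⟩ := C.exists_lipschitzOnWith_val (i, true) hK
  obtain ⟨L', hL'⟩ := C.exists_lipschitzOnWith_val (i, false) hK
  have key : ∀ (b : Bool) (L : ℝ≥0), LipschitzOnWith L (C.val (i, b) u) (Icc 0 1 ×ˢ univ) →
      ∀ f : ℝ → ℝ, LipschitzWith 1 f → (∀ y ∈ Icc (-1 : ℝ) 1, f y ∈ Icc (0 : ℝ) 1) →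
      LipschitzWith L fun p : Handle d => C.val (i, b) u (f p.1, p.2) := by
    refine fun b L hL f hf hf1 => LipschitzWith.of_dist_le_mul fun p q => ?_
    refine (hL.dist_le_mul _ ⟨hf1 _ p.1.2, mem_univ _⟩ _ ⟨hf1 _ q.1.2, mem_univ _⟩).trans ?_
    gcongr
    rw [Prod.dist_eq, Prod.dist_eq]
    refine max_le_max ?_ le_rfl
    have := hf.dist_le_mul (p.1 : ℝ) q.1
    rwa [NNReal.coe_one, one_mul] at this
  have h1 := key true L hL (fun y => max y 0) (LipschitzWith.id.max_const 0)
    fun y hy => ⟨le_max_right _ _, max_le hy.2 zero_le_one⟩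
  have h2 := key false L' hL' (fun y => max (-y) 0) ((LipschitzWith.id.neg).max_const 0)
    fun y hy => ⟨le_max_right _ _, max_le (by linarith [hy.1]) zero_le_one⟩
  have h3 := key true L hL (fun _ => 0) (LipschitzWith.const' 0) fun y hy => by simp
  have e : (fun n => u (C.ofN n)) ∘ C.handleMap i = fun p : Handle d =>
      C.val (i, true) u (max p.1 0, p.2) + C.val (i, false) u (max (-p.1) 0, p.2) -
        C.val (i, true) u (0, p.2) := by
    funext p
    have hs : C.val (i, false) u (0, p.2) = C.val (i, true) u (0, p.2) := by
      rw [C.val_zero, C.val_zero, hu _ (C.edge_mem_bdry (i, true) p.2), C.T_edge]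
      rfl
    have e1 : u (C.ofN (C.handleMap i p)) = C.val (C.half i p.1) u (|(p.1 : ℝ)|, p.2) :=
      (C.val_eq (C.half i p.1) u (p := (|(p.1 : ℝ)|, p.2)) (abs_fst_mem p)).symm
    rw [Function.comp_apply, e1, half]
    by_cases h : 0 ≤ (p.1 : ℝ)
    · rw [decide_eq_true h, abs_of_nonneg h, max_eq_left h, max_eq_right (by linarith), hs]; ring
    · grind
  rw [e]
  exact ((h1.add h2).sub h3).locallyLipschitz

end HandleConfig

/-! ### The representation of the attached manifold -/

/-- The reflection `(y, z) ↦ (-y, z)`. -/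
def cylFlip (d : ℕ) : Cyl d ≃ₗᵢ[ℝ] Cyl d := LinearIsometryEquiv.mk (LinearEquiv.ofInvolutive
    (⟨⟨fun z => toLp 2 (-z.fst, z.snd), fun x y =>
      Cyl.ext_iff'.2 ⟨neg_add x.fst y.fst, rfl⟩⟩, fun c x =>
      Cyl.ext_iff'.2 ⟨(smul_neg c x.fst).symm, rfl⟩⟩ : Cyl d →ₗ[ℝ] Cyl d)
    fun x => Cyl.ext_iff'.2 ⟨neg_neg x.fst, rfl⟩) fun z => by
      rw [← sq_eq_sq₀ (norm_nonneg _) (norm_nonneg _), Cyl.norm_sq, Cyl.norm_sq]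
      exact congrArg (· + ‖z.snd‖ ^ 2) (neg_sq z.fst)

lemma norm_fderiv_comp_flip {d : ℕ} (f : Cyl d → ℝ) (x : Cyl d) :
    ‖fderiv ℝ (fun z => f (cylFlip d z)) x‖ = ‖fderiv ℝ f (cylFlip d x)‖ := by
  have := (cylFlip d).toContinuousLinearEquiv.comp_right_fderiv (f := f) (x := x)
  have e : fderiv ℝ (fun z => f (cylFlip d z)) x = (fderiv ℝ f (cylFlip d x)).comp
      ((cylFlip d).toContinuousLinearEquiv : Cyl d →L[ℝ] Cyl d) := this
  rw [e]
  exact ContinuousLinearMap.opNorm_comp_linearIsometryEquiv _ _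

namespace HandleConfig

variable {d : ℕ} {δ₀ δ₁ : ℝ} (C : HandleConfig d δ₀ δ₁) [hC : Admissible δ₀ δ₁] [NeZero d] (κ : C.Side)

lemma lintegral_handleVol {f : ℝ × 𝕊 d → ℝ≥0∞} (hf : Measurable f) :
    ∫⁻ p : Handle d, f (p.1, p.2) ∂C.handleVol = ofReal (C.ρ ^ d) *
      (∫⁻ p, f p ∂cylVol d + ∫⁻ p, f (-p.1, p.2) ∂cylVol d) := by
  have hm : Measurable fun p : Handle d => f (p.1, p.2) := hf.comp (by fun_prop)
  have hf' : Measurable fun p : ℝ × 𝕊 d => f (-p.1, p.2) := hf.comp (by fun_prop)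
  have hg : Measurable fun y => ∫⁻ ω, f (y, ω) ∂sphMeas d := hf.lintegral_prod_right'
  rw [handleVol, lintegral_smul_measure, smul_eq_mul, lintegral_prod _ hm.aemeasurable]
  congr 1
  have e1 := lintegral_subtype_comap (μ := volume) (s := Icc (-1 : ℝ) 1) measurableSet_Icc
    fun y => ∫⁻ ω, f (y, ω) ∂sphMeas d
  refine e1.trans ?_
  rw [cylVol, lintegral_prod _ hf.aemeasurable, lintegral_prod _ hf'.aemeasurable,
    ← Measure.restrict_congr_set Ioc_ae_eq_Icc,
    ← Ioc_union_Ioc_eq_Ioc (show (-1 : ℝ) ≤ 0 by norm_num) zero_le_one,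
    lintegral_union measurableSet_Ioc (Ioc_disjoint_Ioc_of_le le_rfl), add_comm,
    ← Measure.restrict_congr_set Ioo_ae_eq_Ioc, ← Measure.restrict_congr_set Ioo_ae_eq_Ioc]
  congr 1
  have e2 := (Measure.measurePreserving_neg (volume : Measure ℝ)).setLIntegral_comp_preimage
    (measurableSet_Ioo (a := (-1 : ℝ)) (b := 0)) hg
  rw [← e2]
  congr 2
  ext y
  simp only [mem_preimage, mem_Ioo]
  constructor <;> rintro ⟨a, b⟩ <;> constructor <;> linarith

lemma continuous_outerMap : Continuous C.outerMap := continuous_quot_mk.comp continuous_inl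

lemma continuous_handleMap (i : Fin C.m) : Continuous (C.handleMap i) :=
  continuous_quot_mk.comp (continuous_inr.comp (by fun_prop))

lemma lintegral_attached {f : C.N → ℝ≥0∞} (hf : Measurable f) :
    ∫⁻ n : C.N, f n ∂C.attached.vol = ∫⁻ x in {x : C.M | (x : Amb d) ∉ C.U}, f (C.outerMap x)
      ∂((sphVol d).comap Subtype.val) + ∑ i, ∫⁻ p, f (C.handleMap i p) ∂C.handleVol := by
  have key : ∀ μ : Measure C.N, μ = Measure.map C.outerMap
      (((sphVol d).comap Subtype.val).restrict {x : C.M | (x : Amb d) ∉ C.U}) +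
      ∑ i, Measure.map (C.handleMap i) C.handleVol →
      ∫⁻ n, f n ∂μ = ∫⁻ x in {x : C.M | (x : Amb d) ∉ C.U}, f (C.outerMap x)
        ∂((sphVol d).comap Subtype.val) + ∑ i, ∫⁻ p, f (C.handleMap i p) ∂C.handleVol := by
    rintro μ rfl
    rw [lintegral_add_measure, lintegral_finsetSum_measure,
      lintegral_map hf C.continuous_outerMap.measurable]
    congr 1
    exact Finset.sum_congr rfl fun i _ => lintegral_map hf (C.continuous_handleMap i).measurable
  exact key C.attached.vol rfl

lemma lintegral_outer (g : Amb d → ℝ≥0∞) :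
    ∫⁻ x in {x : C.M | (x : Amb d) ∉ C.U}, g x ∂((sphVol d).comap Subtype.val) =
      ∫⁻ x in C.Uᶜ, g x ∂sphVol d := by
  have hU := C.measurableSet_U.compl
  have hM := C.measurableSet_M
  have e : {x : C.M | (x : Amb d) ∉ C.U} = Subtype.val ⁻¹' C.Uᶜ := rfl
  rw [e, ← lintegral_indicator (measurable_subtype_coe hU)]
  have e1 := lintegral_subtype_comap (μ := sphVol d) hM (C.Uᶜ.indicator g)
  refine Eq.trans (lintegral_congr fun x => ?_) (e1.trans ?_)
  · rfl
  · rw [lintegral_indicator hU, Measure.restrict_restrict hU]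
    refine lintegral_mono_set' ?_ |>.antisymm (lintegral_mono_set' ?_)
    · exact (inter_subset_left).eventuallyLE
    · filter_upwards [ae_mem_sph d] with x hx hxU
      exact ⟨hxU, C.mem_M_of_notMem_U hx hxU⟩

lemma coe_ofN_handleMap_mem_M_iff (i : Fin C.m) (p : Handle d) :
    (C.ofN (C.handleMap i p) : Amb d) ∈ C.M ↔ (p.1 : ℝ) ≠ 0 := by
  rw [C.ofN_handleMap]
  constructor
  · refine fun h h0 => C.Φ_zero_notMem_M (C.half i p.1) p.2 ?_
    simpa [h0] using h
  · exact fun h => C.Φ_mem_M _ (p := (|(p.1 : ℝ)|, p.2)) ⟨abs_pos.2 h, (abs_fst_mem p).2⟩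

lemma isOpen_N_iff {S : Set C.N} :
    IsOpen S ↔ IsOpen (C.outerMap ⁻¹' S) ∧ ∀ i, IsOpen (C.handleMap i ⁻¹' S) := by
  have hq : Topology.IsQuotientMap (Quot.mk C.Glue) := isQuotientMap_quot_mk
  refine (hq.isOpen_preimage (s := S)).symm.trans (isOpen_sum_iff.trans (and_congr Iff.rfl ?_))
  constructor
  · exact fun h i => h.preimage (f := fun p : Handle d => (i, p)) (by fun_prop)
  · refine fun h => isOpen_iff_mem_nhds.2 fun q hq => ?_
    have h1 := (h q.1).mem_nhds (x := q.2) hq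
    have h2 : {q.1} ×ˢ (C.handleMap q.1 ⁻¹' S) ∈ 𝓝 q := by
      rw [← Prod.mk.eta (p := q), nhds_prod_eq]
      simp [*]
    refine Filter.mem_of_superset h2 ?_
    rintro ⟨i, p⟩ ⟨hi, hp⟩
    obtain rfl : i = q.1 := hi
    exact hp

lemma measurable_ofN : Measurable C.ofN := by
  refine measurable_of_isOpen fun O hO => ?_
  obtain ⟨O', hO', rfl⟩ := isOpen_induced_iff.1 hO
  set G : C.N → Amb d := fun n => C.ofN n with hG
  have hout : ∀ x : C.M, G (C.outerMap x) = x := fun x => rfl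
  have hh : ∀ i (p : Handle d), G (C.handleMap i p) = C.Φ (C.half i p.1) (|(p.1 : ℝ)|, p.2) :=
    fun i p => rfl
  have hM : ∀ i (p : Handle d), G (C.handleMap i p) ∈ C.M ↔ (p.1 : ℝ) ≠ 0 :=
    C.coe_ofN_handleMap_mem_M_iff
  have hc : ∀ i b, Continuous fun p : Handle d => C.Φ (i, b) (|(p.1 : ℝ)|, p.2) := fun i b =>
    (C.continuous_Φ (i, b)).comp (by fun_prop)
  have h1 : IsOpen {n : C.N | G n ∈ C.M ∧ G n ∈ O'} := by
    refine C.isOpen_N_iff.2 ⟨?_, fun i => ?_⟩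
    · convert hO'.preimage (continuous_subtype_val (p := (· ∈ C.M))) using 1
      ext x
      simp [hout]
    · have e : C.handleMap i ⁻¹' {n : C.N | G n ∈ C.M ∧ G n ∈ O'} =
          ({p | 0 < (p.1 : ℝ)} ∩ (fun p : Handle d => C.Φ (i, true) (|(p.1 : ℝ)|, p.2)) ⁻¹' O') ∪
          ({p | (p.1 : ℝ) < 0} ∩ (fun p : Handle d => C.Φ (i, false) (|(p.1 : ℝ)|, p.2)) ⁻¹' O') := by
        ext p
        refine (and_congr_left' (hM i p)).trans ?_
        simp only [hh, half, mem_union, mem_inter_iff, mem_preimage, mem_ofPred_eq]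
        rcases lt_trichotomy (p.1 : ℝ) 0 with h | h | h
        · grind
        · simp [h]
        · grind
      rw [e]
      have c0 : Continuous fun p : Handle d => (p.1 : ℝ) := by fun_prop
      exact ((isOpen_lt continuous_const c0).inter (hO'.preimage (hc i true))).union
        ((isOpen_lt c0 continuous_const).inter (hO'.preimage (hc i false)))
  have h2 : ∀ V : Set (Amb d), IsClosed V → IsClosed {n : C.N | G n ∉ C.M ∧ G n ∈ V} := by
    refine fun V hV => isOpen_compl_iff.1 (C.isOpen_N_iff.2 ⟨?_, fun i => ?_⟩)
    · convert isOpen_univ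
      ext x
      simp [hout]
    · have e : C.handleMap i ⁻¹' {n : C.N | G n ∉ C.M ∧ G n ∈ V} =
          {p | (p.1 : ℝ) = 0} ∩ (fun p : Handle d => C.Φ (i, true) (|(p.1 : ℝ)|, p.2)) ⁻¹' V := by
        ext p
        refine (and_congr_left' ((not_congr (hM i p)).trans not_not)).trans ?_
        refine and_congr_right fun h => ?_
        simp only [hh, half, mem_preimage]
        simp [h]
      rw [preimage_compl, e, isOpen_compl_iff]
      exact (isClosed_eq (by fun_prop) continuous_const).inter (hV.preimage (hc i true))
  have e : C.ofN ⁻¹' (Subtype.val ⁻¹' O') = {n : C.N | G n ∈ C.M ∧ G n ∈ O'} ∪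
      ({n : C.N | G n ∉ C.M ∧ G n ∈ univ} \ {n : C.N | G n ∉ C.M ∧ G n ∈ O'ᶜ}) := by
    ext n
    by_cases h : G n ∈ C.M <;> simp [h, hG] <;> tauto
  rw [e]
  exact h1.measurableSet.union ((h2 _ isClosed_univ).measurableSet.diff
    (h2 _ hO'.isClosed_compl).measurableSet)

end HandleConfig

/-! ### The attached manifold is represented by the relaxed manifold -/

lemma exists_linearIsometryEquiv_comp {α β : Type*} [MeasurableSpace α] [MeasurableSpace β]
    {μ : Measure α} {ν : Measure β} {f : α → β} (hf : MeasurePreserving f μ ν)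
    (h : ∀ g : α → ℝ, Measurable g → ∃ g' : β → ℝ, Measurable g' ∧ g' ∘ f =ᵐ[μ] g) :
    ∃ I : Lp ℝ 2 μ ≃ₗᵢ[ℝ] Lp ℝ 2 ν, ∀ v, (fun x => I v (f x)) =ᵐ[μ] v := by
  set J : Lp ℝ 2 ν →ₗᵢ[ℝ] Lp ℝ 2 μ := Lp.compMeasurePreservingₗᵢ ℝ f hf with hJ
  have hJe : ∀ u, J u =ᵐ[μ] u ∘ f := fun u => Lp.coeFn_compMeasurePreserving u hf
  have hs : Function.Surjective J := by
    intro v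
    obtain ⟨g, hg, hgv⟩ := (Lp.aestronglyMeasurable v).aemeasurable
    obtain ⟨g', hg', hgg'⟩ := h g hg
    have e : g' ∘ f =ᵐ[μ] v := hgg'.trans hgv.symm
    have hL : MemLp g' 2 ν := by
      refine ⟨hg'.aestronglyMeasurable, ?_⟩
      rw [← eLpNorm_comp_measurePreserving hg'.aestronglyMeasurable hf, eLpNorm_congr_ae e]
      exact Lp.eLpNorm_lt_top v
    refine ⟨hL.toLp g', Lp.ext ((hJe _).trans (EventuallyEq.trans ?_ e))⟩
    exact hf.quasiMeasurePreserving.ae_eq_comp hL.coeFn_toLp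
  refine ⟨(LinearIsometryEquiv.ofSurjective J hs).symm, fun v => ?_⟩
  refine (hJe _).symm.trans ?_
  rw [show J ((LinearIsometryEquiv.ofSurjective J hs).symm v) = v from
    (LinearIsometryEquiv.ofSurjective J hs).apply_symm_apply v]

lemma sqInt_comp {α β : Type*} [MeasurableSpace α] [MeasurableSpace β]
    {μ : Measure α} {ν : Measure β} {f : α → β} (hf : MeasurePreserving f μ ν) {g : β → ℝ}
    (hg : AEMeasurable g ν) : sqInt μ (fun x => g (f x)) = sqInt ν g := by
  have := lintegral_map' (μ := μ) (f := fun y => ofReal (g y ^ 2))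
    (by rw [hf.map_eq]; exact (hg.pow_const 2).ennreal_ofReal) hf.aemeasurable
  rw [hf.map_eq] at this
  exact this.symm

namespace HandleConfig

variable {d : ℕ} {δ₀ δ₁ : ℝ} (C : HandleConfig d δ₀ δ₁) [hC : Admissible δ₀ δ₁] [NeZero d] (κ : C.Side)

lemma measurableSet_bdry : MeasurableSet C.bdry :=
  IsClosed.measurableSet (α := C.Mbar) C.isClosed_bdry

lemma measurePreserving_ofN :
    MeasurePreserving (α := C.attached.Point) (β := C.mfd.Point) C.ofN C.attached.vol C.mfd.vol := by
  refine ⟨C.measurable_ofN, Measure.ext_of_lintegral _ fun f hf => ?_⟩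
  refine (lintegral_map hf C.measurable_ofN).trans ?_
  obtain ⟨g, hg, hgf⟩ := (MeasurableEmbedding.subtype_coe
    C.measurableSet_Mbar).exists_measurable_extend hf fun _ => ⟨0⟩
  have e1 : ∀ p : C.Mbar, f p = g p := fun p => (congrFun hgf p).symm
  have hF : Measurable fun n => f (C.ofN n) := hf.comp C.measurable_ofN
  have e2 : ∫⁻ p, f p ∂C.mfd.vol = ∫⁻ p : C.Mbar, g p ∂C.mfd.vol := lintegral_congr e1
  refine (C.lintegral_attached hF).trans (Eq.trans ?_ (e2.trans (C.lintegral_vol hg)).symm)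
  congr 1
  · rw [← C.lintegral_outer]
    exact lintegral_congr fun x => e1 _
  · rw [Fintype.sum_prod_type]
    refine Finset.sum_congr rfl fun i _ => ?_
    rw [Fintype.sum_bool, ← mul_add]
    have hm : Measurable fun q : ℝ × 𝕊 d => if 0 ≤ q.1 then g (C.Φ (i, true) (|q.1|, q.2)) else
        g (C.Φ (i, false) (|q.1|, q.2)) := by
      refine Measurable.ite (measurableSet_le measurable_const measurable_fst) ?_ ?_ <;>
      exact hg.comp ((C.continuous_Φ _).measurable.comp (by fun_prop))
    refine Eq.trans (lintegral_congr fun p => ?_) ((C.lintegral_handleVol hm).trans ?_)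
    · rw [e1, C.ofN_handleMap, half]
      grind
    · congr 2
      · refine lintegral_congr_ae ?_
        filter_upwards [ae_cylVol_mem] with p hp
        simp only [if_pos hp.1.le, abs_of_pos hp.1]
        rfl
      · refine lintegral_congr_ae ?_
        filter_upwards [ae_cylVol_mem] with p hp
        simp only [if_neg (not_le.2 (neg_lt_zero.2 hp.1)), abs_neg, abs_of_pos hp.1]
        rfl

lemma ae_mem_M : ∀ᵐ p : C.Mbar ∂C.mfd.vol, (p : Amb d) ∈ C.M := by
  have hm := C.measurableSet_M.compl
  have h : ∫⁻ x : C.Mbar, C.Mᶜ.indicator (1 : Amb d → ℝ≥0∞) x ∂C.mfd.vol = 0 := by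
    rw [C.lintegral_vol (measurable_one.indicator hm)]
    refine add_eq_zero.2 ⟨?_, Finset.sum_eq_zero fun κ _ => ?_⟩
    · rw [lintegral_congr_ae (g := fun _ => 0), lintegral_zero]
      filter_upwards [ae_restrict_mem C.measurableSet_U.compl,
        ae_restrict_of_ae (ae_mem_sph d)] with x hU hx
      exact indicator_of_notMem (not_not_intro (C.mem_M_of_notMem_U hx hU)) _
    · rw [lintegral_congr_ae (g := fun _ => 0), lintegral_zero, mul_zero]
      filter_upwards [ae_cylVol_mem] with p hp
      exact indicator_of_notMem (not_not_intro (C.Φ_mem_M κ ⟨hp.1, hp.2.le⟩)) _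
  have h' := (lintegral_eq_zero_iff ((measurable_one.indicator hm).comp measurable_subtype_coe)).1 h
  filter_upwards [h'] with p hp
  simp_all

lemma dirichlet_comp_toN (v : C.N → ℝ) :
    C.mfd.dirichlet (fun x : C.Mbar => v (C.toN x)) = C.attached.dirichlet v := by
  have hρ := C.ρ_pos
  rw [C.dirichlet_eq]
  change _ = ∫⁻ x in {x : C.M | (x : Amb d) ∉ C.U},
      ofReal (gradSq (roundMetric d) (homExt C.M (v ∘ C.outerMap)) x)
      ∂((sphVol d).comap Subtype.val) +
    ∑ i, ∫⁻ p, ofReal (C.handleGradSq (v ∘ C.handleMap i) p) ∂C.handleVol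
  congr 1
  · rw [C.lintegral_outer fun x => ofReal (gradSq (roundMetric d) (homExt C.M (v ∘ C.outerMap)) x)]
    refine lintegral_congr_ae ?_
    filter_upwards [ae_restrict_mem C.measurableSet_U.compl,
      ae_restrict_of_ae (ae_mem_sph d)] with x hU hx
    rw [gradSq_roundMetric (mem_sphere_zero_iff_norm.1 hx) (rayConst_homExt _ _),
      ofReal_pow (norm_nonneg _), ofReal_norm]
    congr 2
    refine Filter.EventuallyEq.fderiv_eq ?_
    filter_upwards [C.eventually_mem_M (C.mem_M_of_notMem_U hx hU)] with z hz
    have hz' := C.M_subset_Mbar hz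
    rw [homExt, homExt, dif_pos hz, dif_pos hz', C.toN_of_mem (x := ⟨_, hz'⟩) hz]
    rfl
  · rw [Fintype.sum_prod_type]
    refine Finset.sum_congr rfl fun i _ => ?_
    rw [Fintype.sum_bool, ← mul_add, mul_comm ((C.ρ ^ 2)⁻¹), ofReal_mul (by positivity),
      mul_assoc, mul_add]
    have hm : ∀ f : Cyl d → ℝ, Measurable fun q : ℝ × 𝕊 d =>
        ofReal ((C.ρ ^ 2)⁻¹) * ‖fderiv ℝ f (cylPt q)‖ₑ ^ 2 := fun f =>
      (((measurable_fderiv ℝ _).comp continuous_cylPt.measurable).enorm.pow_const 2).const_mul _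
    refine Eq.trans ?_ (Eq.trans (C.lintegral_handleVol (hm (handleExt (v ∘ C.handleMap i)))).symm
      (lintegral_congr fun p => ?_))
    · rw [← lintegral_const_mul' _ _ ofReal_ne_top, ← lintegral_const_mul' _ _ ofReal_ne_top]
      have key : ∀ p : ℝ × 𝕊 d, p.1 ∈ Ioo (0 : ℝ) 1 →
          ∀ᶠ z in 𝓝 (cylPt p), z.snd ≠ 0 ∧ z.fst ∈ Icc (0 : ℝ) 1 := fun p hp => by
        have hn : (cylPt p).snd ≠ 0 :=
          norm_ne_zero_iff.1 ((mem_sphere_zero_iff_norm.1 p.2.2).trans_ne one_ne_zero)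
        filter_upwards [Cyl.continuous_snd.continuousAt.eventually_ne hn,
          Cyl.continuous_fst.continuousAt.eventually_mem (x := cylPt p)
            (isOpen_Ioo.mem_nhds hp)] with z h1 h2 using ⟨h1, h2.1.le, h2.2.le⟩
      congr 2
      · refine lintegral_congr_ae ?_
        filter_upwards [ae_cylVol_mem] with p hp
        congr 3
        refine Filter.EventuallyEq.fderiv_eq ?_
        filter_upwards [key p hp] with z hz
        have hs := mem_sphere_zero_iff_norm.2 (norm_inv_smul_self hz.1)
        rw [C.pull_eq_val _ _ hz.1, C.val_eq (p := (WithLp.fst z, ⟨_, hs⟩)) _ _ hz.2,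
          C.toN_Φ (p := (WithLp.fst z, ⟨_, hs⟩)) _ hz.2,
          handleExt, dif_pos hs]
        simp only [hPt, if_true]
        rfl
      · refine lintegral_congr_ae ?_
        filter_upwards [ae_cylVol_mem] with p hp
        have e : (cylPt (-p.1, p.2) : Cyl d) = cylFlip d (cylPt p) := rfl
        rw [e, ← ofReal_norm, ← ofReal_norm, ← norm_fderiv_comp_flip]
        congr 4
        refine Filter.EventuallyEq.fderiv_eq ?_
        filter_upwards [key p hp] with z hz
        have hs := mem_sphere_zero_iff_norm.2 (norm_inv_smul_self hz.1)
        have hs' : ‖(cylFlip d z).snd‖⁻¹ • (cylFlip d z).snd ∈ 𝕊 d := hs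
        rw [C.pull_eq_val _ _ hz.1, C.val_eq (p := (WithLp.fst z, ⟨_, hs⟩)) _ _ hz.2,
          C.toN_Φ (p := (WithLp.fst z, ⟨_, hs⟩)) _ hz.2,
          handleExt, dif_pos hs']
        simp only [hPt, Bool.false_eq_true, if_false]
        rfl
    · rw [handleGradSq, ofReal_mul (by positivity), ofReal_pow (norm_nonneg _), ofReal_norm]
      rfl

theorem isRepresentedBy_mfd :
    LipRiem.IsRepresentedBy C.attached C.mfd C.T (C.mfd.inftyMeasure C.bdry) := by
  have hX := C.isRegular_mfd
  have hmp := C.measurePreserving_ofN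
  obtain ⟨I, hI⟩ := exists_linearIsometryEquiv_comp (α := C.attached.Point) (β := C.mfd.Point) hmp
      fun g hg => by
    have hM := MeasurableEmbedding.subtype_coe C.measurableSet_M
    obtain ⟨g', hg', hgg'⟩ := hM.exists_measurable_extend
      (hg.comp C.continuous_outerMap.measurable) fun _ => ⟨0⟩
    refine ⟨fun x : C.Mbar => g' x, hg'.comp measurable_subtype_coe, ?_⟩
    filter_upwards [hmp.quasiMeasurePreserving.ae C.ae_mem_M] with n hn
    refine (congrFun hgg' ⟨_, hn⟩).trans ?_
    have := C.toN_of_mem (x := C.ofN n) hn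
    exact congrArg g (this.symm.trans (C.toN_ofN n))
  refine ⟨I, fun v => ?_⟩
  have hL2 : ∀ w ∈ C.mfd.lip, sqInt C.attached.vol (fun n => w (C.ofN n) - v n) =
      sqInt C.mfd.vol (fun x => w x - I v x) := by
    intro w hw
    have hm : AEMeasurable (fun x => w x - I v x) C.mfd.vol :=
      (hX.aemeasurable hw).sub (Lp.aestronglyMeasurable _).aemeasurable
    refine Eq.trans (sqInt_congr ?_) (sqInt_comp hmp hm)
    filter_upwards [hI v] with n hn
    exact congrArg (w (C.ofN n) - ·) hn.symm
  refine le_antisymm ?_ (le_iInf₂ fun w hw => ?_)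
  · by_cases htop : C.mfd.nonlocal C.T (C.mfd.inftyMeasure C.bdry) (I v) = ⊤
    · simp [*]
    refine le_add_right (le_iInf₂ fun w hw => ?_)
    obtain ⟨w', hw', hsymm, hlim⟩ := C.exists_symmetric hw htop
    have e : ∀ k, (fun x : C.Mbar => w' k (C.ofN (C.toN x))) = w' k := fun k =>
      funext fun x => C.eq_ofN_toN (hsymm k) x
    have hH : C.attached.IsH1Seq (fun k (n : C.N) => w' k (C.ofN n)) v := by
      refine ⟨fun k => ?_, ?_, ?_⟩
      · obtain ⟨K, hK⟩ := hw'.1 k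
        exact C.lip_comp_ofN (K := K) hK (hsymm k)
      · exact hw'.2.1.congr fun k => (hL2 _ (hw'.1 k)).symm
      · refine hw'.2.2.congr fun kl => ?_
        refine Eq.trans ?_ (C.dirichlet_comp_toN fun n => w' kl.1 (C.ofN n) - w' kl.2 (C.ofN n))
        grind
    refine (LipRiem.energy_le hH).trans (le_trans (le_of_eq ?_) hlim)
    congr 1
    funext k
    refine (C.dirichlet_comp_toN _).symm.trans ?_
    rw [e k]
  · have hl : ∀ k, (fun x : C.Mbar => w k (C.toN x)) ∈ C.mfd.lip := fun k => C.lip_comp_toN (hw.1 k)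
    have hH : C.mfd.IsH1Seq (fun k (x : C.Mbar) => w k (C.toN x)) (I v) := by
      refine ⟨hl, ?_, ?_⟩
      · refine hw.2.1.congr fun k => ?_
        refine Eq.trans (congrArg (sqInt C.attached.vol) ?_) (hL2 _ (hl k))
        funext n
        exact congrArg (w k · - v n) (C.toN_ofN n).symm
      · exact hw.2.2.congr fun kl => (C.dirichlet_comp_toN fun n => w kl.1 n - w kl.2 n).symm
    have h0 := hX.nonlocal_eq_zero hH (T := C.T) C.measurableSet_bdry
      fun k p hp => congrArg (w k) (C.toN_symm hp)
    refine ((congrArg (C.mfd.energy (I v) + ·) h0).trans (add_zero _)).trans_le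
      ((LipRiem.energy_le hH).trans (le_of_eq ?_))
    congr 1
    funext k
    exact C.dirichlet_comp_toN (w k)

theorem isRelaxedManifold_mfd : C.mfd.IsRelaxedManifold C.T (C.mfd.inftyMeasure C.bdry) := by
  refine ⟨fun p => Subtype.ext (neg_neg _), C.continuous_T, fun p h => ?_, C.map_T_vol,
    fun u hu => ⟨C.lip_comp_T hu, C.dirichlet_comp_T u⟩, LipRiem.memM0_inftyMeasure _⟩
  have h1 : -(p.1 : Amb d) = p.1 := congrArg Subtype.val h
  have h2 : ‖(p.1 : Amb d)‖ = 1 := mem_sphere_zero_iff_norm.1 (C.Mbar_subset_sph p.2)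
  have h3 : (p.1 : Amb d) = 0 := by
    have := neg_add_cancel (p.1 : Amb d)
    rw [h1, ← two_smul ℝ] at this
    simp_all
  simp_all

end HandleConfig

/-! ### The Poincaré inequality -/

theorem lintegral_lintegral_enorm_sub_sq_le {E : Type*} [NormedAddCommGroup E] [NormedSpace ℝ E]
    [FiniteDimensional ℝ E] [MeasurableSpace E] [BorelSpace E] (μ : Measure E) [μ.IsAddHaarMeasure]
    {f : E → ℝ} (hf : Measurable f) {Ω S T : Set E} (hΩ : IsOpen Ω) (hS : MeasurableSet S)
    (hT : MeasurableSet T) {L : ℝ≥0} (hL : LipschitzOnWith L f Ω)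
    (hST : ∀ p ∈ S, ∀ q ∈ T, segment ℝ p q ⊆ Ω) {R : ℝ} (hR : ∀ p ∈ S, ∀ q ∈ T, ‖q - p‖ ≤ R) :
    ∫⁻ p in S, ∫⁻ q in T, ‖f q - f p‖ₑ ^ 2 ∂μ ∂μ ≤
      μ (closedBall 0 R) * (ofReal R ^ 2 * ∫⁻ x in Ω, ‖fderiv ℝ f x‖ₑ ^ 2 ∂μ) := by
  set D := ∫⁻ x in Ω, ‖fderiv ℝ f x‖ₑ ^ 2 ∂μ with hD
  set F : E → E → ℝ≥0∞ := fun v p => {p | p ∈ S ∧ p + v ∈ T}.indicator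
    (fun p => ‖f (p + v) - f p‖ₑ ^ 2) p with hF
  have hmF : Measurable fun z : E × E => F z.1 z.2 := by
    have h1 : MeasurableSet {z : E × E | z.2 ∈ S ∧ z.2 + z.1 ∈ T} :=
      (hS.preimage measurable_snd).inter (hT.preimage (measurable_snd.add measurable_fst))
    exact (((hf.comp (measurable_snd.add measurable_fst)).sub
      (hf.comp measurable_snd)).enorm.pow_const 2).indicator h1
  have hdiff : ∀ᵐ x ∂μ, x ∈ Ω → DifferentiableAt ℝ f x := by
    filter_upwards [hL.ae_differentiableWithinAt_of_mem (μ := μ)] with x hx hxΩ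
    exact (hx hxΩ).differentiableAt (hΩ.mem_nhds hxΩ)
  have hG : Measurable (Ω.indicator fun x => ‖fderiv ℝ f x‖ₑ ^ 2) :=
    ((measurable_fderiv ℝ f).enorm.pow_const 2).indicator hΩ.measurableSet
  have key : ∀ v, ∫⁻ p, F v p ∂μ ≤ (closedBall 0 R).indicator (fun _ => ofReal R ^ 2 * D) v := by
    intro v
    by_cases hv : v ∈ closedBall (0 : E) R
    swap
    · rw [indicator_of_notMem hv, nonpos_iff_eq_zero, lintegral_congr (g := fun _ => 0)]
      · simp
      · refine fun p => indicator_of_notMem (fun hp => hv ?_) _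
        rw [mem_closedBall_zero_iff]
        simpa using hR p hp.1 _ hp.2
    have hmP : MeasurableSet {z : E × ℝ | z.1 + z.2 • v ∈ Ω →
        DifferentiableAt ℝ f (z.1 + z.2 • v)} := by
      have hm : Measurable fun z : E × ℝ => z.1 + z.2 • v := by fun_prop
      have := (hΩ.measurableSet.compl.union (measurableSet_of_differentiableAt ℝ f)).preimage hm
      refine (congrArg MeasurableSet ?_).mp this
      ext z
      exact (imp_iff_not_or).symm
    have h1 : ∀ᵐ p ∂μ, ∀ᵐ t : ℝ, p + t • v ∈ Ω → DifferentiableAt ℝ f (p + t • v) := by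
      rw [Measure.ae_ae_comm (p := fun p (t : ℝ) => p + t • v ∈ Ω →
        DifferentiableAt ℝ f (p + t • v)) hmP]
      exact Eventually.of_forall fun t =>
        (measurePreserving_add_right μ (t • v)).quasiMeasurePreserving.ae hdiff
    rw [indicator_of_mem hv]
    rw [mem_closedBall_zero_iff] at hv
    calc ∫⁻ p, F v p ∂μ ≤ ∫⁻ p, (∫⁻ t in Ioo (0 : ℝ) 1, ofReal R ^ 2 *
            Ω.indicator (fun x => ‖fderiv ℝ f x‖ₑ ^ 2) (p + t • v)) ∂μ := by
          refine lintegral_mono_ae ?_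
          filter_upwards [h1] with p hp
          by_cases hpS : p ∈ S ∧ p + v ∈ T
          swap
          · simp [*]
          refine (indicator_of_mem (s := {p | p ∈ S ∧ p + v ∈ T}) hpS _).trans_le ?_
          have hseg : ∀ t ∈ Icc (0 : ℝ) 1, p + t • v ∈ Ω := fun t ht => by
            refine hST p hpS.1 _ hpS.2 ?_
            rw [segment_eq_image']
            exact ⟨t, ht, by simp⟩
          have hg : LipschitzOnWith (L * ‖v‖₊) (fun t : ℝ => f (p + t • v)) (Icc 0 1) := by
            refine LipschitzOnWith.of_dist_le_mul fun s hs t ht => ?_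
            refine (hL.dist_le_mul _ (hseg s hs) _ (hseg t ht)).trans (le_of_eq ?_)
            rw [dist_add_left, dist_eq_norm, ← sub_smul, norm_smul, Real.dist_eq, Real.norm_eq_abs]
            push_cast
            ring
          have h2 := enorm_sub_sq_le_of_lipschitz zero_le_one hg
            (left_mem_Icc.2 zero_le_one) (right_mem_Icc.2 zero_le_one)
          simp only [one_smul, zero_smul, add_zero, ofReal_one, one_mul] at h2
          refine h2.trans (lintegral_mono_ae ?_)
          filter_upwards [ae_restrict_mem measurableSet_Ioo, ae_restrict_of_ae hp] with t ht htd
          have htΩ := hseg t (Ioo_subset_Icc_self ht)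
          have hder : HasDerivAt (fun t : ℝ => f (p + t • v)) (fderiv ℝ f (p + t • v) v) t := by
            have h3 : HasDerivAt (fun t : ℝ => p + t • v) v t := by
              simpa using ((hasDerivAt_id t).smul_const v).const_add p
            exact (htd htΩ).hasFDerivAt.comp_hasDerivAt t h3
          rw [indicator_of_mem htΩ, hder.deriv, ← mul_pow]
          gcongr
          rw [mul_comm]
          refine (ContinuousLinearMap.le_opENorm _ _).trans ?_
          gcongr
          rw [← ofReal_norm]
          exact ofReal_le_ofReal hv
      _ = ofReal R ^ 2 * D := by
          rw [lintegral_lintegral_swap]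
          · have : ∀ t : ℝ, ∫⁻ p, ofReal R ^ 2 *
                Ω.indicator (fun x => ‖fderiv ℝ f x‖ₑ ^ 2) (p + t • v) ∂μ =
                ofReal R ^ 2 * D := fun t => by
              have hGt : Measurable fun p => Ω.indicator (fun x => ‖fderiv ℝ f x‖ₑ ^ 2) (p + t • v) :=
                hG.comp (measurable_add_const _)
              rw [lintegral_const_mul _ hGt, lintegral_add_right_eq_self (Ω.indicator fun x => ‖fderiv ℝ f x‖ₑ ^ 2),
                lintegral_indicator hΩ.measurableSet]
            simp [this]
          fun_prop
  calc ∫⁻ p in S, ∫⁻ q in T, ‖f q - f p‖ₑ ^ 2 ∂μ ∂μ = ∫⁻ p, ∫⁻ v, F v p ∂μ ∂μ := by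
        rw [← lintegral_indicator hS]
        refine lintegral_congr fun p => ?_
        by_cases hp : p ∈ S
        · rw [indicator_of_mem hp, ← lintegral_indicator hT, ← lintegral_add_left_eq_self _ p]
          refine lintegral_congr fun v => ?_
          by_cases hq : p + v ∈ T
          · simp [*]
          simp [*]
        simp [*]
    _ = ∫⁻ v, ∫⁻ p, F v p ∂μ ∂μ := lintegral_lintegral_swap (hmF.comp measurable_swap).aemeasurable
    _ ≤ ∫⁻ v, (closedBall 0 R).indicator (fun _ => ofReal R ^ 2 * D) v ∂μ := lintegral_mono key
    _ = _ := by
        rw [lintegral_indicator Metric.isClosed_closedBall.measurableSet, setLIntegral_const,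
          mul_comm]

/-- Jensen's inequality for the square of the distance to a constant. -/
lemma enorm_average_sub_sq_le {α : Type*} [MeasurableSpace α] {μ : Measure α} [IsFiniteMeasure μ]
    (h0 : μ univ ≠ 0) {f : α → ℝ} (hf : Integrable f μ) (a : ℝ) :
    ‖⨍ x, f x ∂μ - a‖ₑ ^ 2 ≤ (μ univ)⁻¹ * ∫⁻ x, ‖f x - a‖ₑ ^ 2 ∂μ := by
  have hne : NeZero μ := ⟨fun h => h0 (by simp [h])⟩
  have hi : Integrable (fun x => f x - a) μ := hf.sub (integrable_const a)
  have e : (⨍ x, f x ∂μ) - a = ⨍ x, (f x - a) ∂μ := by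
    rw [average_eq, average_eq, integral_sub hf (integrable_const a), integral_const, smul_sub,
      smul_smul, inv_mul_cancel₀ ((measureReal_ne_zero_iff (measure_ne_top _ _)).2 h0), one_smul]
  have h1 : ‖⨍ x, (f x - a) ∂μ‖ₑ ≤ (μ univ)⁻¹ * ∫⁻ x, ‖f x - a‖ₑ ∂μ := by
    rw [average_eq, enorm_smul]
    refine mul_le_mul' (le_of_eq ?_) (enorm_integral_le_lintegral_enorm _)
    rw [Real.enorm_of_nonneg (by positivity), measureReal_def,
      ENNReal.ofReal_inv_of_pos (ENNReal.toReal_pos h0 (measure_ne_top _ _)),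
      ENNReal.ofReal_toReal (measure_ne_top _ _)]
  rw [e]
  calc _ ≤ ((μ univ)⁻¹ * ∫⁻ x, ‖f x - a‖ₑ ∂μ) ^ 2 := by gcongr
    _ = (μ univ)⁻¹ ^ 2 * (∫⁻ x, ‖f x - a‖ₑ ∂μ) ^ 2 := mul_pow _ _ _
    _ ≤ (μ univ)⁻¹ ^ 2 * (μ univ * ∫⁻ x, ‖f x - a‖ₑ ^ 2 ∂μ) := by
        gcongr
        exact sq_lintegral_le _ hi.aestronglyMeasurable.aemeasurable.enorm
    _ = _ := by
        rw [pow_two, mul_assoc, ← mul_assoc (μ univ)⁻¹ (μ univ),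
          ENNReal.inv_mul_cancel h0 (measure_ne_top _ _), one_mul]

/-- The part `0 < y < 1` of the cylinder over `Z`. -/
def slabOf {d : ℕ} (Z : Set 𝔼 d) : Set (Cyl d) := WithLp.ofLp ⁻¹' (Ioo (0 : ℝ) 1 ×ˢ Z)

/-- A spherical shell. -/
def shell (d : ℕ) (a : ℝ) : Set 𝔼 d := {z | a < ‖z‖ ∧ ‖z‖ < 1}

section Shell

variable {d : ℕ}

lemma isOpen_shell (a : ℝ) : IsOpen (shell d a) :=
  (isOpen_lt continuous_const continuous_norm).inter (isOpen_lt continuous_norm continuous_const)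

lemma isOpen_slabOf {Z : Set 𝔼 d} (hZ : IsOpen Z) : IsOpen (slabOf Z) :=
  (isOpen_Ioo.prod hZ).preimage (WithLp.prodContinuousLinearEquiv 2 ℝ ℝ _).continuous

lemma measurableSet_slabOf {Z : Set 𝔼 d} (hZ : MeasurableSet Z) : MeasurableSet (slabOf Z) :=
  (measurableSet_Ioo.prod hZ).preimage (WithLp.volume_preserving_ofLp ℝ _).measurable

lemma volume_slabOf {Z : Set 𝔼 d} (hZ : MeasurableSet Z) : volume (slabOf Z) = volume Z := by
  rw [slabOf, (WithLp.volume_preserving_ofLp ℝ _).measure_preimage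
    (measurableSet_Ioo.prod hZ).nullMeasurableSet, Measure.volume_eq_prod, Measure.prod_prod]
  simp

lemma segment_subset_slabOf_shell {p q : Cyl d} (hp : p ∈ slabOf (shell d (1 / 2)))
    (hq : q ∈ slabOf (shell d (1 / 2))) (h : -(1 / 8) ≤ inner ℝ p.snd q.snd) :
    segment ℝ p q ⊆ slabOf (shell d (1 / 8)) := by
  rintro _ ⟨a, b, ha, hb, hab, rfl⟩
  obtain ⟨⟨hp1, hp2⟩, hp3, hp4⟩ := hp
  obtain ⟨⟨hq1, hq2⟩, hq3, hq4⟩ := hq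
  change 0 < p.fst at hp1
  change p.fst < 1 at hp2
  change 0 < q.fst at hq1
  change q.fst < 1 at hq2
  change 1 / 2 < ‖p.snd‖ at hp3
  change ‖p.snd‖ < 1 at hp4
  change 1 / 2 < ‖q.snd‖ at hq3
  change ‖q.snd‖ < 1 at hq4
  have hc := convex_Ioo (0 : ℝ) 1 ⟨hp1, hp2⟩ ⟨hq1, hq2⟩ ha hb hab
  refine ⟨hc, ?_, ?_⟩
  · change 1 / 8 < ‖a • p.snd + b • q.snd‖
    have e := norm_add_sq_real (a • p.snd) (b • q.snd)
    rw [norm_smul, norm_smul, inner_smul_left, inner_smul_right, Real.norm_of_nonneg ha,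
      Real.norm_of_nonneg hb, conj_trivial] at e
    refine lt_of_pow_lt_pow_left₀ 2 (norm_nonneg _) ?_
    rw [e]
    have h1 : (1 / 2 : ℝ) ^ 2 ≤ ‖p.snd‖ ^ 2 := pow_le_pow_left₀ (by norm_num) hp3.le 2
    have h2 : (1 / 2 : ℝ) ^ 2 ≤ ‖q.snd‖ ^ 2 := pow_le_pow_left₀ (by norm_num) hq3.le 2
    have h3 := mul_le_mul_of_nonneg_left h1 (sq_nonneg a)
    have h4 := mul_le_mul_of_nonneg_left h2 (sq_nonneg b)
    have h5 := mul_le_mul_of_nonneg_left h (mul_nonneg ha hb)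
    have hb' : b = 1 - a := by linarith
    subst hb'
    nlinarith [sq_nonneg (2 * a - 1)]
  · change ‖a • p.snd + b • q.snd‖ < 1
    have := convex_ball (0 : 𝔼 d) 1 (mem_ball_zero_iff.2 hp4) (mem_ball_zero_iff.2 hq4) ha hb hab
    simp_all

lemma dist_le_three {p q : Cyl d} (hp : p ∈ slabOf (shell d (1 / 2)))
    (hq : q ∈ slabOf (shell d (1 / 2))) : ‖q - p‖ ≤ 3 := by
  obtain ⟨⟨hp1, hp2⟩, hp3, hp4⟩ := hp
  obtain ⟨⟨hq1, hq2⟩, hq3, hq4⟩ := hq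
  have e := Cyl.norm_sq (q - p)
  have h1 : ‖(q - p).snd‖ ≤ 2 := (norm_sub_le q.snd p.snd).trans (by
    change ‖p.snd‖ < 1 at hp4; change ‖q.snd‖ < 1 at hq4; linarith)
  have h2 : |(q - p).fst| ≤ 1 := by
    change |q.fst - p.fst| ≤ 1
    change 0 < p.fst at hp1; change p.fst < 1 at hp2; change 0 < q.fst at hq1
    change q.fst < 1 at hq2
    grind
  refine le_of_sq_le_sq ?_ (by norm_num)
  rw [e, ← sq_abs (q - p).fst]
  nlinarith [norm_nonneg (q - p).snd, abs_nonneg (q - p).fst]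

/-- The ball around `3/4 v`. -/
abbrev bump (v : 𝔼 d) : Set 𝔼 d := ball ((3 / 4 : ℝ) • v) (1 / 16)

lemma bump_subset {v : 𝔼 d} (hv : ‖v‖ = 1) : bump v ⊆ shell d (1 / 2) := by
  intro z hz
  have h1 : ‖z - (3 / 4 : ℝ) • v‖ < 1 / 16 := mem_ball_iff_norm.1 hz
  have h2 : ‖(3 / 4 : ℝ) • v‖ = 3 / 4 := by rw [norm_smul, hv]; norm_num
  have h3 := abs_norm_sub_norm_le z ((3 / 4 : ℝ) • v)
  rw [h2] at h3
  have h4 := abs_le.1 (h3.trans h1.le)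
  exact ⟨by linarith [h4.1], by linarith [h4.2]⟩

lemma inner_bump {v z w : 𝔼 d} (hw : w ∈ bump v) :
    3 / 4 * inner ℝ z v - 1 / 16 * ‖z‖ ≤ inner ℝ z w := by
  have h1 : ‖w - (3 / 4 : ℝ) • v‖ < 1 / 16 := mem_ball_iff_norm.1 hw
  have h2 := abs_le.1 (abs_real_inner_le_norm z (w - (3 / 4 : ℝ) • v))
  rw [inner_sub_right, inner_smul_right] at h2
  nlinarith [h2.1, norm_nonneg z]

lemma setLIntegral_sub_average_le {f : Cyl d → ℝ} (hf : Measurable f) {L : ℝ≥0}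
    (hL : LipschitzOnWith L f (slabOf (shell d (1 / 8)))) {M : ℝ} (hM : ∀ q, ‖f q‖ ≤ M)
    {Z W : Set 𝔼 d} (hZ : MeasurableSet Z) (hW : MeasurableSet W)
    (hZs : Z ⊆ shell d (1 / 2)) (hWs : W ⊆ shell d (1 / 2)) (hW0 : volume W ≠ 0)
    (hWt : volume W ≠ ⊤) (h : ∀ z ∈ Z, ∀ w ∈ W, -(1 / 8) ≤ inner ℝ z w) :
    ∫⁻ p in slabOf Z, ‖f p - ⨍ q in slabOf W, f q‖ₑ ^ 2 ≤ (volume W)⁻¹ *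
      (volume (closedBall (0 : Cyl d) 3) * (ofReal 3 ^ 2 *
        ∫⁻ x in slabOf (shell d (1 / 8)), ‖fderiv ℝ f x‖ₑ ^ 2)) := by
  have hvol := volume_slabOf hW
  have hfin : IsFiniteMeasure (volume.restrict (slabOf W)) :=
    ⟨by rw [Measure.restrict_apply_univ, hvol]; exact hWt.lt_top⟩
  have hi : IntegrableOn f (slabOf W) :=
    Integrable.of_bound hf.aestronglyMeasurable M (Eventually.of_forall hM)
  have h0 : (volume.restrict (slabOf W)) univ ≠ 0 := by rwa [Measure.restrict_apply_univ, hvol]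
  calc _ ≤ ∫⁻ p in slabOf Z, (volume W)⁻¹ * ∫⁻ q in slabOf W, ‖f q - f p‖ₑ ^ 2 := by
        refine lintegral_mono fun p => ?_
        have := enorm_average_sub_sq_le h0 hi (f p)
        rwa [Measure.restrict_apply_univ, hvol, ← enorm_neg, neg_sub] at this
    _ = (volume W)⁻¹ * ∫⁻ p in slabOf Z, ∫⁻ q in slabOf W, ‖f q - f p‖ₑ ^ 2 :=
        lintegral_const_mul' _ _ (ENNReal.inv_ne_top.2 hW0)
    _ ≤ _ := by
        gcongr
        exact lintegral_lintegral_enorm_sub_sq_le volume hf (isOpen_slabOf (isOpen_shell _))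
          (measurableSet_slabOf hZ) (measurableSet_slabOf hW) hL
          (fun p hp q hq => segment_subset_slabOf_shell ⟨hp.1, hZs hp.2⟩ ⟨hq.1, hWs hq.2⟩
            (h _ hp.2 _ hq.2))
          (fun p hp q hq => dist_le_three ⟨hp.1, hZs hp.2⟩ ⟨hq.1, hWs hq.2⟩)

/-- The Poincaré inequality in a cylinder over a spherical shell. -/
theorem exists_setLIntegral_shell_le (hd : 2 ≤ d) : ∃ K : ℝ≥0∞, K ≠ ⊤ ∧ ∀ f : Cyl d → ℝ,
    Measurable f → (∃ L, LipschitzOnWith L f (slabOf (shell d (1 / 8)))) →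
    (∃ M, ∀ q, ‖f q‖ ≤ M) → ∃ c : ℝ, ∫⁻ p in slabOf (shell d (1 / 2)), ‖f p - c‖ₑ ^ 2 ≤
      K * ∫⁻ x in slabOf (shell d (1 / 8)), ‖fderiv ℝ f x‖ₑ ^ 2 := by
  set e : 𝔼 d := EuclideanSpace.single ⟨0, by omega⟩ 1 with he
  set e' : 𝔼 d := EuclideanSpace.single ⟨1, by omega⟩ 1 with he'
  have hee' : inner ℝ e' e = 0 := by
    rw [he, he', EuclideanSpace.inner_single_left]
    simp
  have hne : ‖e‖ = 1 := by simp [he]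
  have hne' : ‖e'‖ = 1 := by simp [he']
  set b := volume (ball (0 : 𝔼 d) (1 / 16)) with hb
  have hbv : ∀ v : 𝔼 d, volume (bump v) = b := fun v => Measure.addHaar_ball_center _ _ _
  have hb0 : b ≠ 0 := (Metric.measure_ball_pos _ _ (by norm_num)).ne'
  have hbt : b ≠ ⊤ := measure_ball_lt_top.ne
  set V := volume (ball (0 : 𝔼 d) 1) with hV
  have hVt : V ≠ ⊤ := measure_ball_lt_top.ne
  set K₀ := b⁻¹ * (volume (closedBall (0 : Cyl d) 3) * ofReal 3 ^ 2) with hK₀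
  have hK₀t : K₀ ≠ ⊤ := ENNReal.mul_ne_top (ENNReal.inv_ne_top.2 hb0)
    (ENNReal.mul_ne_top measure_closedBall_lt_top.ne (by finiteness))
  set K₁ := 2 * K₀ + 2 * (b⁻¹ * K₀) * V with hK₁
  refine ⟨2 * K₁, ?_, fun f hf ⟨L, hL⟩ ⟨M, hM⟩ => ⟨⨍ q in slabOf (bump e'), f q, ?_⟩⟩
  · have := ENNReal.inv_ne_top.2 hb0
    finiteness
  set D := ∫⁻ x in slabOf (shell d (1 / 8)), ‖fderiv ℝ f x‖ₑ ^ 2 with hD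
  set c' := ⨍ q in slabOf (bump e'), f q with hc'
  set H : 𝔼 d → Set 𝔼 d := fun v => {z | z ∈ shell d (1 / 2) ∧ 0 ≤ inner ℝ z v} with hH
  have hHm : ∀ v, MeasurableSet (H v) := fun v => (isOpen_shell _).measurableSet.inter
    (measurableSet_le (f := fun _ => (0 : ℝ)) (g := fun z => inner ℝ z v) measurable_const
      (Continuous.measurable (by fun_prop)))
  have key : ∀ v, ‖v‖ = 1 → inner ℝ e' v = 0 → ∫⁻ p in slabOf (H v), ‖f p - c'‖ₑ ^ 2 ≤ K₁ * D := by
    intro v hv hv'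
    have hb1 := (hbv v).trans_ne hb0
    have hb2 := (hbv v).trans_ne hbt
    have h1 := setLIntegral_sub_average_le hf hL hM (hHm v) measurableSet_ball (fun z hz => hz.1)
      (bump_subset hv) hb1 hb2 fun z hz w hw => by
        have := inner_bump (z := z) hw
        have h2 : ‖z‖ < 1 := hz.1.2
        have h3 : 0 ≤ inner ℝ z v := hz.2
        linarith
    have h2 := setLIntegral_sub_average_le hf hL hM measurableSet_ball measurableSet_ball
      (bump_subset hne') (bump_subset hv) hb1 hb2 fun z hz w hw => by
        have i1 := inner_bump (z := z) hw
        have i2 : ‖z‖ < 1 := (bump_subset hne' hz).2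
        have i3 := inner_bump (z := v) hz
        rw [real_inner_comm, hv', hv, real_inner_comm] at i3
        linarith
    rw [hbv, ← mul_assoc, ← mul_assoc, mul_assoc b⁻¹, ← hK₀, ← hD] at h1 h2
    set c := ⨍ q in slabOf (bump v), f q
    have hvol := volume_slabOf (d := d) (Z := bump e') measurableSet_ball
    have hfin : IsFiniteMeasure (volume.restrict (slabOf (bump e'))) :=
      ⟨by rw [Measure.restrict_apply_univ, hvol, hbv]; exact hbt.lt_top⟩
    have h3 : ‖c' - c‖ₑ ^ 2 ≤ b⁻¹ * (K₀ * D) := by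
      have := enorm_average_sub_sq_le (μ := volume.restrict (slabOf (bump e')))
        (by rw [Measure.restrict_apply_univ, hvol, hbv]; exact hb0)
        (Integrable.of_bound hf.aestronglyMeasurable M (Eventually.of_forall hM)) c
      rw [Measure.restrict_apply_univ, hvol, hbv] at this
      exact this.trans (by gcongr)
    have hVH : volume (slabOf (H v)) ≤ V := by
      rw [volume_slabOf (hHm v)]
      exact measure_mono fun z hz => mem_ball_zero_iff.2 hz.1.2
    calc _ ≤ ∫⁻ p in slabOf (H v), (2 * ‖f p - c‖ₑ ^ 2 + 2 * (b⁻¹ * (K₀ * D))) := by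
          refine lintegral_mono fun p => ?_
          have := HandleConfig.enorm_sq_le_two (f p - c') (f p - c)
          rw [sub_sub_sub_cancel_left, ← enorm_neg (c - c'), neg_sub] at this
          exact this.trans (by gcongr)
      _ = (2 * ∫⁻ p in slabOf (H v), ‖f p - c‖ₑ ^ 2) + 2 * (b⁻¹ * (K₀ * D)) *
          volume (slabOf (H v)) := by
          rw [lintegral_add_right _ measurable_const, setLIntegral_const,
            lintegral_const_mul' _ _ (by norm_num)]
      _ ≤ 2 * (K₀ * D) + 2 * (b⁻¹ * (K₀ * D)) * V := by gcongr
      _ = K₁ * D := by rw [hK₁]; ring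
  have hcov : slabOf (shell d (1 / 2)) ⊆ slabOf (H e) ∪ slabOf (H (-e)) := by
    intro p hp
    rcases le_total 0 (inner ℝ p.snd e) with h | h
    · exact Or.inl ⟨hp.1, hp.2, h⟩
    · refine Or.inr ⟨hp.1, hp.2, ?_⟩
      simp_all
  calc _ ≤ ∫⁻ p in slabOf (H e) ∪ slabOf (H (-e)), ‖f p - c'‖ₑ ^ 2 := lintegral_mono_set hcov
    _ ≤ _ := lintegral_union_le _ _ _
    _ ≤ K₁ * D + K₁ * D := add_le_add (key e hne hee')
        (key (-e) (by rw [norm_neg, hne]) (by rw [inner_neg_right, hee', neg_zero]))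
    _ = _ := by ring

lemma setLIntegral_shell [NeZero d] {a : ℝ} (ha : 0 ≤ a) {h : 𝔼 d → ℝ≥0∞}
    (hh : Measurable h) : ∫⁻ z in shell d a, h (‖z‖⁻¹ • z) =
      (∫⁻ s in Ioo a 1, ofReal (s ^ (d - 1))) * ∫⁻ ω, h ω ∂sphMeas d := by
  have hm : Measurable fun z : 𝔼 d => h (‖z‖⁻¹ • z) := hh.comp (by fun_prop)
  have hsh := (isOpen_shell (d := d) a).measurableSet
  rw [← lintegral_indicator hsh, lintegral_polar volume (hm.indicator hsh),
    finrank_euclideanSpace_fin,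
    ← lintegral_mul_const _ (Measurable.ennreal_ofReal (by fun_prop)),
    ← lintegral_indicator measurableSet_Ioi, ← lintegral_indicator measurableSet_Ioo]
  refine lintegral_congr fun s => ?_
  by_cases hs : s ∈ Ioi (0 : ℝ)
  · have hs' : 0 < s := hs
    have hn : ∀ ω : 𝕊 d, ‖s • (ω : 𝔼 d)‖ = s := fun ω => by
      rw [norm_smul, mem_sphere_zero_iff_norm.1 ω.2, mul_one, Real.norm_of_nonneg hs'.le]
    rw [indicator_of_mem hs]
    by_cases hsa : s ∈ Ioo a 1
    · rw [indicator_of_mem hsa]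
      congr 1
      refine lintegral_congr fun ω => ?_
      have hmem : s • (ω : 𝔼 d) ∈ shell d a := by
        change a < ‖_‖ ∧ ‖_‖ < 1
        rw [hn]; exact hsa
      rw [indicator_of_mem hmem, hn, smul_smul, inv_mul_cancel₀ hs'.ne', one_smul]
    · rw [indicator_of_notMem hsa, lintegral_congr (g := fun _ => 0), lintegral_zero, mul_zero]
      refine fun ω => indicator_of_notMem (fun hmem => hsa ?_) _
      have hmem' : a < ‖s • (ω : 𝔼 d)‖ ∧ ‖s • (ω : 𝔼 d)‖ < 1 := hmem
      rwa [hn] at hmem'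
  · rw [indicator_of_notMem hs, indicator_of_notMem fun h => hs (ha.trans_lt h.1)]

lemma setLIntegral_slabOf_shell [NeZero d] {a : ℝ} (ha : 0 ≤ a)
    {g : ℝ × 𝔼 d → ℝ≥0∞} (hg : Measurable g) :
    ∫⁻ q in slabOf (shell d a), g (q.fst, ‖q.snd‖⁻¹ • q.snd) =
      (∫⁻ s in Ioo a 1, ofReal (s ^ (d - 1))) * ∫⁻ p, g (p.1, p.2) ∂cylVol d := by
  have hm : Measurable fun q : ℝ × 𝔼 d => g (q.1, ‖q.2‖⁻¹ • q.2) := hg.comp (by fun_prop)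
  refine (setLIntegral_Cyl (measurableSet_Ioo.prod (isOpen_shell a).measurableSet) hm).trans ?_
  rw [Measure.volume_eq_prod, ← Measure.prod_restrict, lintegral_prod _ hm.aemeasurable,
    lintegral_cylVol hg, ← lintegral_const_mul _
      (Measurable.lintegral_prod_right' (measurable_comp_sphere hg))]
  exact lintegral_congr fun y => setLIntegral_shell ha (h := fun z => g (y, z))
    (hg.comp (f := fun z => (y, z)) (by fun_prop))

lemma norm_scaleSnd_le {s : ℝ} (hs : 1 ≤ s) : ‖scaleSnd d s‖ ≤ s := by
  refine ContinuousLinearMap.opNorm_le_bound _ (by linarith) fun q => ?_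
  refine le_of_sq_le_sq ?_ (by positivity)
  rw [mul_pow, Cyl.norm_sq, Cyl.norm_sq]
  change q.fst ^ 2 + ‖s • q.snd‖ ^ 2 ≤ _
  rw [norm_smul, mul_pow, Real.norm_eq_abs, sq_abs]
  have h1 : 1 ≤ s ^ 2 := one_le_pow₀ hs
  nlinarith [mul_le_mul_of_nonneg_right h1 (sq_nonneg q.fst)]

/-- The Poincaré inequality on `(0, 1) × S^{d-1}`. -/
theorem exists_lintegral_sub_average_le (hd : 2 ≤ d) : ∃ K : ℝ≥0∞, K ≠ ⊤ ∧ ∀ f : Cyl d → ℝ,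
    Measurable f → (∀ s > 0, ∀ q, f (scaleSnd d s q) = f q) →
    (∃ L, LipschitzOnWith L f (slabOf (shell d (1 / 8)))) → (∃ M, ∀ q, ‖f q‖ ≤ M) →
    ∫⁻ p, ‖f (cylPt p) - ⨍ q, f (cylPt q) ∂cylVol d‖ₑ ^ 2 ∂cylVol d ≤
      K * ∫⁻ p, ‖fderiv ℝ f (cylPt p)‖ₑ ^ 2 ∂cylVol d := by
  obtain ⟨K, hK, hP⟩ := exists_setLIntegral_shell_le hd
  have : NeZero d := ⟨by omega⟩
  set k₁ := ∫⁻ s in Ioo (1 / 2 : ℝ) 1, ofReal (s ^ (d - 1)) with hk₁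
  set k₂ := ∫⁻ s in Ioo (1 / 8 : ℝ) 1, ofReal (s ^ (d - 1)) with hk₂
  have hk₂t : k₂ ≠ ⊤ := ne_top_of_le_ne_top (lintegral_Ioo_pow_ne_top (d - 1))
    (lintegral_mono_set (Ioo_subset_Ioo_left (by norm_num)))
  have hk₁t : k₁ ≠ ⊤ := ne_top_of_le_ne_top (lintegral_Ioo_pow_ne_top (d - 1))
    (lintegral_mono_set (Ioo_subset_Ioo_left (by norm_num)))
  have hk₁0 : k₁ ≠ 0 := by
    have h1 : ∫⁻ _ in Ioo (1 / 2 : ℝ) 1, ofReal ((1 / 2) ^ (d - 1)) ≤ k₁ := by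
      refine setLIntegral_mono' measurableSet_Ioo fun s hs => ofReal_le_ofReal ?_
      exact pow_le_pow_left₀ (by norm_num) hs.1.le _
    refine (lt_of_lt_of_le ?_ h1).ne'
    rw [setLIntegral_const, Real.volume_Ioo]
    positivity
  have hfin : cylVol d univ ≠ ⊤ := measure_ne_top _ _
  set K' := k₁⁻¹ * (K * (64 * k₂)) with hK'
  have hk₁i := ENNReal.inv_ne_top.2 hk₁0
  refine ⟨4 * K', by rw [hK']; finiteness, fun f hf hhom hL hM => ?_⟩
  obtain ⟨c, hc⟩ := hP f hf hL hM
  obtain ⟨L, hL⟩ := hL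
  obtain ⟨M, hM⟩ := hM
  set D := ∫⁻ p, ‖fderiv ℝ f (cylPt p)‖ₑ ^ 2 ∂cylVol d with hD
  have hnorm : ∀ q ∈ slabOf (shell d (1 / 8)), q.snd ≠ 0 := fun q hq => by
    have : 1 / 8 < ‖q.snd‖ := hq.2.1
    exact norm_pos_iff.1 (by linarith)
  have hLp : Continuous fun z : ℝ × 𝔼 d => (toLp 2 z : Cyl d) :=
    Cyl.continuous_toLp continuous_fst continuous_snd
  have h1 : k₁ * ∫⁻ p, ‖f (cylPt p) - c‖ₑ ^ 2 ∂cylVol d ≤ K * (64 * (k₂ * D)) := by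
    have e1 := setLIntegral_slabOf_shell (a := 1 / 2) (by norm_num)
      (g := fun z => ‖f (toLp 2 z) - c‖ₑ ^ 2)
      (((hf.comp hLp.measurable).sub_const c).enorm.pow_const 2)
    have e2 := setLIntegral_slabOf_shell (a := 1 / 8) (by norm_num)
      (g := fun z => ‖fderiv ℝ f (toLp 2 z)‖ₑ ^ 2)
      (((measurable_fderiv ℝ f).comp hLp.measurable).enorm.pow_const 2)
    refine (e1.symm.trans_le (le_trans (le_of_eq ?_) hc)).trans ?_
    · refine setLIntegral_congr_fun (isOpen_slabOf (isOpen_shell _)).measurableSet fun q hq => ?_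
      have h0 : 1 / 2 < ‖q.snd‖ := hq.2.1
      have := hhom ‖q.snd‖⁻¹ (inv_pos.2 (by linarith)) q
      rw [scaleSnd_apply] at this
      simp only [this]
    · gcongr
      rw [show k₂ * D = _ from e2.symm, ← lintegral_const_mul' _ _ (by norm_num)]
      refine lintegral_mono_ae ?_
      filter_upwards [ae_restrict_mem (isOpen_slabOf (isOpen_shell _)).measurableSet,
        hL.ae_differentiableWithinAt (μ := volume)
          (isOpen_slabOf (isOpen_shell _)).measurableSet] with q hq hqd
      have hqd' := hqd.differentiableAt ((isOpen_slabOf (isOpen_shell _)).mem_nhds hq)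
      have h0 : 1 / 8 < ‖q.snd‖ := hq.2.1
      have h0' : ‖q.snd‖ < 1 := hq.2.2
      have hpos : 0 < ‖q.snd‖ := by linarith
      have hS : scaleSnd d ‖q.snd‖ (scaleSnd d ‖q.snd‖⁻¹ q) = q := by
        rw [scaleSnd_apply, scaleSnd_apply, Cyl.ext_iff']
        exact ⟨rfl, smul_inv_smul₀ hpos.ne' _⟩
      have hdS : DifferentiableAt ℝ f (scaleSnd d ‖q.snd‖⁻¹ q) := by
        have h2 : DifferentiableAt ℝ (fun z => f (scaleSnd d ‖q.snd‖ z)) (scaleSnd d ‖q.snd‖⁻¹ q) :=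
          DifferentiableAt.comp (g := f) _ (by rwa [hS]) (scaleSnd d ‖q.snd‖).differentiableAt
        exact h2.congr_of_eventuallyEq (Eventually.of_forall fun z => (hhom _ hpos z).symm)
      have hder : fderiv ℝ f q = (fderiv ℝ f (scaleSnd d ‖q.snd‖⁻¹ q)).comp
          (scaleSnd d ‖q.snd‖⁻¹) := by
        have h2 := hdS.hasFDerivAt.comp q (scaleSnd d ‖q.snd‖⁻¹).hasFDerivAt
        exact (h2.congr_of_eventuallyEq
          (Eventually.of_forall fun z => (hhom _ (inv_pos.2 hpos) z).symm)).fderiv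
      have hb : ‖fderiv ℝ f q‖ ≤ 8 * ‖fderiv ℝ f (scaleSnd d ‖q.snd‖⁻¹ q)‖ := by
        rw [hder, mul_comm]
        refine (ContinuousLinearMap.opNorm_comp_le _ _).trans ?_
        gcongr
        refine (norm_scaleSnd_le ((one_le_inv₀ hpos).2 h0'.le)).trans ?_
        rw [inv_le_comm₀ hpos (by norm_num)]
        linarith
      change ‖fderiv ℝ f q‖ₑ ^ 2 ≤ 64 * ‖fderiv ℝ f (scaleSnd d ‖q.snd‖⁻¹ q)‖ₑ ^ 2
      have h3 : ‖fderiv ℝ f q‖ₑ ≤ 8 * ‖fderiv ℝ f (scaleSnd d ‖q.snd‖⁻¹ q)‖ₑ := by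
        rw [← ofReal_norm, ← ofReal_norm, ← ofReal_ofNat 8, ← ofReal_mul (by norm_num)]
        gcongr
      calc _ ≤ (8 * ‖fderiv ℝ f (scaleSnd d ‖q.snd‖⁻¹ q)‖ₑ) ^ 2 := by gcongr
        _ = _ := by rw [mul_pow]; norm_num
  have h2 : ∫⁻ p, ‖f (cylPt p) - c‖ₑ ^ 2 ∂cylVol d ≤ K' * D := by
    calc _ = k₁⁻¹ * (k₁ * ∫⁻ p, ‖f (cylPt p) - c‖ₑ ^ 2 ∂cylVol d) := by
          rw [← mul_assoc, ENNReal.inv_mul_cancel hk₁0 hk₁t, one_mul]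
      _ ≤ k₁⁻¹ * (K * (64 * (k₂ * D))) := by gcongr
      _ = _ := by rw [hK']; ring
  by_cases h0 : cylVol d univ = 0
  · rw [Measure.measure_univ_eq_zero.1 h0]; simp
  set m := ⨍ q, f (cylPt q) ∂cylVol d with hm
  have h3 : ‖m - c‖ₑ ^ 2 ≤ (cylVol d univ)⁻¹ * ∫⁻ p, ‖f (cylPt p) - c‖ₑ ^ 2 ∂cylVol d :=
    enorm_average_sub_sq_le h0 (Integrable.of_bound
      (hf.comp continuous_cylPt.measurable).aestronglyMeasurable M
      (Eventually.of_forall fun p => hM _)) c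
  calc _ ≤ ∫⁻ p, (2 * ‖f (cylPt p) - c‖ₑ ^ 2 + 2 * ‖m - c‖ₑ ^ 2) ∂cylVol d := by
        refine lintegral_mono fun p => ?_
        have := HandleConfig.enorm_sq_le_two (f (cylPt p) - m) (f (cylPt p) - c)
        rwa [sub_sub_sub_cancel_left, ← enorm_neg (c - m), neg_sub] at this
    _ = (2 * ∫⁻ p, ‖f (cylPt p) - c‖ₑ ^ 2 ∂cylVol d) + 2 * ‖m - c‖ₑ ^ 2 * cylVol d univ := by
        rw [lintegral_add_right _ measurable_const, lintegral_const,
          lintegral_const_mul' _ _ (by norm_num)]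
    _ ≤ 2 * (K' * D) + 2 * ((cylVol d univ)⁻¹ * (K' * D)) * cylVol d univ := by
        gcongr
        exact h3.trans (by gcongr)
    _ = 2 * (K' * D) + 2 * (K' * D) * ((cylVol d univ)⁻¹ * cylVol d univ) := by ring
    _ = _ := by rw [ENNReal.inv_mul_cancel h0 hfin]; ring

end Shell

/-! ### Uniform bounds for the charts -/

lemma abs_det_le {n : ℕ} {G : Matrix (Fin n) (Fin n) ℝ} {L : ℝ} (h : ∀ i j, |G i j| ≤ L) :
    |G.det| ≤ n.factorial * L ^ n := by
  simpa using Matrix.det_le (A := G) (abv := AbsoluteValue.abs) (x := L) h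

lemma le_abs_det {n : ℕ} {G : Matrix (Fin n) (Fin n) ℝ} {l : ℝ} (hl : 0 < l)
    (h : ∀ v, l * (v ⬝ᵥ v) ≤ v ⬝ᵥ G.mulVec v) : l ^ n / n.factorial ≤ |G.det| := by
  have h0 : ∀ v : Fin n → ℝ, 0 ≤ v ⬝ᵥ v := fun v => Finset.sum_nonneg fun i _ => mul_self_nonneg _
  have hG : G.det ≠ 0 := by
    intro hd
    obtain ⟨v, hv, hGv⟩ := Matrix.exists_mulVec_eq_zero_iff.2 hd
    have := h v
    rw [hGv, dotProduct_zero] at this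
    exact hv (dotProduct_self_eq_zero.1 (le_antisymm (by nlinarith [h0 v]) (h0 v)))
  have hu : IsUnit G.det := isUnit_iff_ne_zero.2 hG
  have hN : ∀ i j, |G⁻¹ i j| ≤ l⁻¹ := by
    intro i j
    set w := G⁻¹.mulVec (Pi.single j 1) with hw
    have hGw : G.mulVec w = Pi.single j 1 := by
      rw [hw, Matrix.mulVec_mulVec, Matrix.mul_nonsing_inv _ hu, Matrix.one_mulVec]
    have h1 := h w
    rw [hGw, dotProduct_single, mul_one] at h1
    have h2 : ∀ k, w k ^ 2 ≤ w ⬝ᵥ w := fun k => by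
      rw [pow_two]
      exact Finset.single_le_sum (f := fun k => w k * w k) (fun k _ => mul_self_nonneg _)
        (Finset.mem_univ k)
    have h3 : w i = G⁻¹ i j := by rw [hw, Matrix.mulVec_single_one]; rfl
    rw [← h3]
    refine abs_le_of_sq_le_sq ?_ (inv_nonneg.2 hl.le)
    refine (h2 i).trans ?_
    have h4 : (l * (w ⬝ᵥ w)) ^ 2 ≤ w ⬝ᵥ w :=
      (pow_le_pow_left₀ (mul_nonneg hl.le (h0 w)) h1 2).trans (h2 j)
    rcases (h0 w).eq_or_lt with h5 | h5
    · rw [← h5]; positivity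
    · rw [inv_pow, ← one_div, le_div_iff₀ (by positivity)]
      nlinarith
  have h5 := abs_det_le hN
  rw [Matrix.det_nonsing_inv, Ring.inverse_eq_inv', abs_inv] at h5
  have hpos : 0 < |G.det| := abs_pos.2 hG
  rw [div_le_iff₀ (by positivity)]
  rw [inv_pow, inv_le_iff_one_le_mul₀ hpos] at h5
  have h6 := mul_le_mul_of_nonneg_left h5 (pow_pos hl n).le
  calc l ^ n = l ^ n * 1 := (mul_one _).symm
    _ ≤ l ^ n * (|G.det| * (n.factorial * (l ^ n)⁻¹)) := by rwa [mul_comm |G.det|] 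
    _ = _ := by field_simp

section ChartBounds

variable {d : ℕ} {A B : ℝ} (F : Cyl d ≃ₗᵢ[ℝ] Amb d)

lemma norm_snd_mem_of_mem_chartCone {a b : ℝ} (hA : A ∈ Icc a b) (hB : B ∈ Icc a b) (hAB : A ≠ B)
    {x : Cyl d} (h1 : ‖x‖ = 1) (hx : x ∈ chartCone d A B) : ‖x.snd‖ ∈ Icc a b := by
  obtain ⟨-, -, h2, h3⟩ := hx
  rw [h1, inv_one, mul_one] at h2 h3
  have e : ‖x.snd‖ = (1 - (‖x.snd‖ - A) / (B - A)) • A + ((‖x.snd‖ - A) / (B - A)) • B := by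
    have := sub_ne_zero.2 hAB.symm
    simp only [smul_eq_mul]
    field_simp
    ring
  rw [e]
  exact convex_Icc a b hA hB (by linarith) h2.le (by ring)

lemma chartJac_bounds {s δ : ℝ} (hs : 0 < s) (hsδ : s ≤ δ) (hδ : δ < 1) (hA : A ∈ Icc 0 s)
    (hB : B ∈ Icc 0 s) (hAB : A ≠ B) {x : Amb d} (hx1 : ‖x‖ = 1)
    (hx : F.symm x ∈ chartCone d A B) :
    √((1 - δ ^ 2) ^ d / d.factorial) ≤ s ^ d * chartJac A B (F.symm x) ∧
    ∀ L, s ^ 2 ≤ L * (B - A) ^ 2 → s ^ 2 ≤ L * ‖(F.symm x).snd‖ ^ 2 →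
      s ^ d * chartJac A B (F.symm x) ≤ √(d.factorial * L ^ d) := by
  have hs1 : s < 1 := hsδ.trans_lt hδ
  have hx1' : ‖F.symm x‖ = 1 := by simpa using hx1
  have h0 : x ≠ 0 := by rintro rfl; simp at hx1
  have hr := norm_snd_mem_of_mem_chartCone hA hB hAB hx1' hx
  have hfst : (F.symm x).fst ^ 2 = 1 - ‖(F.symm x).snd‖ ^ 2 := by
    have := Cyl.norm_sq (F.symm x); rw [hx1'] at this; linarith
  have hr2 : ‖(F.symm x).snd‖ ^ 2 ≤ s ^ 2 := pow_le_pow_left₀ hr.1 hr.2 2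
  have hsδ2 : s ^ 2 ≤ δ ^ 2 := pow_le_pow_left₀ hs.le hsδ 2
  have hδ2 : δ ^ 2 < 1 := pow_lt_one₀ (hs.le.trans hsδ) hδ two_ne_zero
  set T := fderiv ℝ (chartInv (d := d) A B) (F.symm x) with hT
  set g : Tensor d := fun x ξ ζ => s ^ 2 *
    inner ℝ (handleDer A B (F.symm x) (F.symm ξ)) (handleDer A B (F.symm x) (F.symm ζ)) with hg
  have hv := (volDensity_gradSq_chart F ⟨hA.1, hA.2.trans_lt hs1⟩ ⟨hB.1, hB.2.trans_lt hs1⟩ hAB hx1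
    hx hs (g := g) fun _ _ _ _ => rfl).1
  have ht : ∀ ξ, inner ℝ x ξ = 0 → T (F.symm ξ) = handleDer A B (F.symm x) (F.symm ξ) :=
    fun ξ hξ => fderiv_chartInv_tangent hx.2.1 hx1' (by simpa using hξ)
  have hGe : ∀ i j, metricMatrix g x i j = s ^ 2 *
      inner ℝ (T (F.symm (tangentFrame x i))) (T (F.symm (tangentFrame x j))) := fun i j => by
    rw [ht _ (inner_tangentFrame h0 i), ht _ (inner_tangentFrame h0 j)]; rfl
  rw [← hv, volDensity]
  constructor
  · refine Real.sqrt_le_sqrt ?_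
    have hdet : 0 ≤ (metricMatrix g x).det := by
      by_contra! h
      have h2 : volDensity g x = 0 := Real.sqrt_eq_zero_of_nonpos h.le
      rw [hv, mul_eq_zero] at h2
      exact h2.elim (pow_pos hs d).ne'
        (abs_ne_zero.2 (det_fderiv_chartInv_ne_zero hAB hx1' hx.2.1 hx.1.ne'))
    rw [← abs_of_nonneg hdet]
    refine le_abs_det (by linarith) fun v => ?_
    set ξ := ∑ i, v i • tangentFrame x i with hξ
    have hξx : inner ℝ x ξ = 0 := by
      rw [hξ, inner_sum]
      exact Finset.sum_eq_zero fun i _ => by rw [inner_smul_right, inner_tangentFrame h0, mul_zero]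
    have e1 : v ⬝ᵥ (metricMatrix g x).mulVec v = s ^ 2 * ‖T (F.symm ξ)‖ ^ 2 := by
      rw [← real_inner_self_eq_norm_sq, hξ, map_sum, map_sum, sum_inner, Finset.mul_sum]
      refine Finset.sum_congr rfl fun i _ => ?_
      rw [inner_sum, Matrix.mulVec, dotProduct, Finset.mul_sum, Finset.mul_sum]
      refine Finset.sum_congr rfl fun j _ => ?_
      rw [hGe, map_smul, map_smul, map_smul, map_smul, inner_smul_left, inner_smul_right,
        conj_trivial]
      ring
    have e2 : v ⬝ᵥ v = ‖ξ‖ ^ 2 := by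
      rw [← real_inner_self_eq_norm_sq, hξ, (orthonormal_tangentFrame h0).inner_sum]
      simp [dotProduct]
    have hlow := handleDer_lower (A := A) (B := B) hx.2.1 hx1' (h := F.symm ξ)
      (by simpa using hξx) (L := (1 - δ ^ 2) / s ^ 2) hAB
      (by
        have h3 : (B - A) ^ 2 ≤ s ^ 2 := sq_le_sq' (by linarith [hA.2, hB.1]) (by linarith [hA.1, hB.2])
        rw [hfst, div_mul_eq_mul_div, div_le_iff₀ (by positivity)]
        nlinarith [sq_nonneg (B - A), pow_pos hs 2])
      (by
        rw [div_mul_eq_mul_div, div_le_one (by positivity)]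
        nlinarith [sq_nonneg ‖(F.symm x).snd‖, sq_nonneg δ])
    rw [← ht ξ hξx, F.symm.norm_map, div_mul_eq_mul_div, div_le_iff₀ (by positivity)] at hlow
    rw [e1, e2]
    linarith
  · intro L hL hL'
    refine Real.sqrt_le_sqrt ((le_abs_self _).trans (abs_det_le fun i j => ?_))
    have hup : ∀ i, ‖T (F.symm (tangentFrame x i))‖ ^ 2 ≤ L / s ^ 2 := fun i => by
      rw [ht _ (inner_tangentFrame h0 i)]
      have := handleDer_upper (A := A) (B := B) hx.2.1 hx1' (h := F.symm (tangentFrame x i))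
        (by simpa using inner_tangentFrame h0 i) (L := L / s ^ 2) hAB
        (by
          rw [hfst, div_mul_eq_mul_div, le_div_iff₀ (by positivity)]
          nlinarith [sq_nonneg ‖(F.symm x).snd‖, pow_pos hs 2])
        (by rwa [div_mul_eq_mul_div, one_le_div (by positivity)])
      rwa [F.symm.norm_map, (orthonormal_tangentFrame h0).1 i, one_pow, mul_one] at this
    rw [hGe, abs_mul, abs_of_pos (pow_pos hs 2)]
    have h3 := abs_real_inner_le_norm (T (F.symm (tangentFrame x i)))
      (T (F.symm (tangentFrame x j)))
    have h4 := hup i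
    have h5 := hup j
    rw [le_div_iff₀ (by positivity)] at h4 h5
    nlinarith [sq_nonneg (‖T (F.symm (tangentFrame x i))‖ - ‖T (F.symm (tangentFrame x j))‖),
      pow_pos hs 2]

/-- The constant of `setLIntegral_chartCone_le`. -/
def chartConst (d : ℕ) (δ : ℝ) : ℝ≥0∞ := ofReal (√((1 - δ ^ 2) ^ d / d.factorial))⁻¹

lemma setLIntegral_chartCone_le [NeZero d] {s δ : ℝ} (hs : 0 < s) (hsδ : s ≤ δ) (hδ : δ < 1)
    (hA : A ∈ Icc 0 s) (hB : B ∈ Icc 0 s) (hAB : A ≠ B) {f : Amb d → ℝ≥0∞} (hf : Measurable f) :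
    ∫⁻ x in F.symm ⁻¹' chartCone d A B, f x ∂sphVol d ≤ chartConst d δ * (ofReal (s ^ d) *
      ∫⁻ p, f (F (chartPt A B p.1 p.2)) ∂cylVol d) := by
  have hs1 : s < 1 := hsδ.trans_lt hδ
  have hδ2 : δ ^ 2 < 1 := pow_lt_one₀ (hs.le.trans hsδ) hδ two_ne_zero
  have hc : 0 < √((1 - δ ^ 2) ^ d / d.factorial) :=
    Real.sqrt_pos.2 (div_pos (pow_pos (by linarith) d) (by positivity))
  rw [← lintegral_chartPt_frame ⟨hA.1, hA.2.trans_lt hs1⟩ ⟨hB.1, hB.2.trans_lt hs1⟩ hAB F hf,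
    ← lintegral_const_mul' _ _ ofReal_ne_top,
    ← lintegral_const_mul' (chartConst d δ) _ ofReal_ne_top]
  refine lintegral_mono_ae ?_
  filter_upwards [ae_restrict_mem (F.symm.continuous.measurable measurableSet_chartCone),
    ae_restrict_of_ae (ae_mem_sph d)] with x hx hxs
  have h1 := (chartJac_bounds F hs hsδ hδ hA hB hAB (mem_sphere_zero_iff_norm.1 hxs) hx).1
  have h2 : 1 ≤ chartConst d δ * (ofReal (s ^ d) * ofReal (chartJac A B (F.symm x))) := by
    rw [chartConst, ← ofReal_mul (by positivity), ← ofReal_mul (by positivity),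
      ENNReal.one_le_ofReal, inv_mul_eq_div, one_le_div hc]
    exact h1
  calc f x = f x * 1 := (mul_one _).symm
    _ ≤ f x * _ := mul_le_mul' le_rfl h2
    _ = _ := by ring

lemma RayConst.enorm_fderiv_sq_le {f : Amb d → ℝ} (hf : RayConst f) {a b : ℝ} (ha : 0 < a)
    (hb : b < 1) (hA : A ∈ Icc a b) (hB : B ∈ Icc a b) (hAB : a ≤ |B - A|) {x : Amb d}
    (hx1 : ‖x‖ = 1) (hx : F.symm x ∈ chartCone d A B) :
    ‖fderiv ℝ f x‖ₑ ^ 2 ≤ ofReal ((a ^ 2)⁻¹) *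
      ‖fderiv ℝ (chartPull F A B f) (chartInv A B (F.symm x))‖ₑ ^ 2 := by
  have hAB' : A ≠ B := by rintro rfl; simp at hAB; linarith
  have hx1' : ‖F.symm x‖ = 1 := by simpa using hx1
  set G := fderiv ℝ (chartPull F A B f) (chartInv A B (F.symm x)) with hG
  have hr := norm_snd_mem_of_mem_chartCone hA hB hAB' hx1' hx
  have key : ‖fderiv ℝ f x‖ ≤ a⁻¹ * ‖G‖ := by
    refine ContinuousLinearMap.opNorm_le_bound _ (by positivity) fun v => ?_
    set ξ := v - inner ℝ x v • x with hξ
    have hξx : inner ℝ x ξ = 0 := by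
      rw [hξ, inner_sub_right, inner_smul_right, real_inner_self_eq_norm_sq, hx1]; ring
    have hle : ‖ξ‖ ^ 2 ≤ ‖v‖ ^ 2 := by
      have e : v = ξ + inner ℝ x v • x := by rw [hξ]; abel
      have := norm_add_sq_real ξ (inner ℝ x v • x)
      rw [← e, inner_smul_right, real_inner_comm x ξ, hξx] at this
      nlinarith [sq_nonneg ‖inner ℝ x v • x‖]
    have e : fderiv ℝ f x v = G (handleDer A B (F.symm x) (F.symm ξ)) := by
      have e1 : fderiv ℝ f x v = fderiv ℝ f x ξ := by
        rw [hξ, map_sub, map_smul, hf.fderiv_self x, smul_zero, sub_zero]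
      rw [e1, hf.fderiv_eq_chartPull F ⟨ha.le.trans hA.1, hA.2.trans_lt hb⟩
        ⟨ha.le.trans hB.1, hB.2.trans_lt hb⟩ hAB' hx, ← fderiv_chartInv_tangent hx.2.1 hx1'
        (by simpa using hξx)]
      rfl
    have hfst : (F.symm x).fst ^ 2 ≤ 1 := by
      have := Cyl.norm_sq (F.symm x); rw [hx1'] at this; nlinarith [sq_nonneg ‖(F.symm x).snd‖]
    have hup := handleDer_upper (A := A) (B := B) hx.2.1 hx1' (h := F.symm ξ)
      (by simpa using hξx) (L := (a ^ 2)⁻¹) hAB'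
      (by
        refine hfst.trans ?_
        rw [inv_mul_eq_div, one_le_div (by positivity), ← sq_abs (B - A)]
        exact pow_le_pow_left₀ ha.le hAB 2)
      (by
        rw [inv_mul_eq_div, one_le_div (by positivity)]
        exact pow_le_pow_left₀ ha.le hr.1 2)
    rw [F.symm.norm_map] at hup
    rw [e]
    refine (G.le_opNorm _).trans ?_
    have h2 : ‖handleDer A B (F.symm x) (F.symm ξ)‖ ≤ a⁻¹ * ‖v‖ := by
      refine le_of_sq_le_sq (hup.trans ?_) (by positivity)
      rw [mul_pow, inv_pow]
      gcongr
    calc _ ≤ ‖G‖ * (a⁻¹ * ‖v‖) := by gcongr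
      _ = _ := by ring
  rw [← ofReal_norm, ← ofReal_norm, ← ofReal_pow (norm_nonneg _),
    ← ofReal_pow (norm_nonneg _), ← ofReal_mul (by positivity), ← inv_pow, ← mul_pow]
  exact ofReal_le_ofReal (pow_le_pow_left₀ (norm_nonneg _) key 2)

end ChartBounds

lemma tendsto_sqInt_linear {α : Type*} [MeasurableSpace α] {μ : Measure α} (a b : ℝ)
    {f g : ℕ → α → ℝ} {u v : Lp ℝ 2 μ} (hf : ∀ k, AEMeasurable (f k) μ)
    (h : Tendsto (fun k => sqInt μ (fun p => f k p - u p)) atTop (𝓝 0))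
    (h' : Tendsto (fun k => sqInt μ (fun p => g k p - v p)) atTop (𝓝 0)) :
    Tendsto (fun k => sqInt μ (fun p => a * f k p + b * g k p - (a • u + b • v : Lp ℝ 2 μ) p))
      atTop (𝓝 0) := by
  have sq : ∀ (c : ℝ) (f : α → ℝ), sqInt μ (fun p => c * f p) =
      ofReal (c ^ 2) * sqInt μ f := fun c f => by
    rw [sqInt, sqInt, ← lintegral_const_mul' _ _ ofReal_ne_top]
    refine lintegral_congr fun p => ?_
    rw [mul_pow, ofReal_mul (sq_nonneg c)]
  refine tendsto_zero_of_le (tendsto_two_mul_add (ofReal_ne_top (r := a ^ 2))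
    (ofReal_ne_top (r := b ^ 2)) h h') fun k => ?_
  have e : (fun p => a * f k p + b * g k p - (a • u + b • v : Lp ℝ 2 μ) p)
      =ᵐ[μ] fun p => a * (f k p - u p) + b * (g k p - v p) := by
    filter_upwards [Lp.coeFn_add (a • u) (b • v), Lp.coeFn_smul a u, Lp.coeFn_smul b v]
      with p h1 h2 h3
    rw [h1, Pi.add_apply, h2, h3, Pi.smul_apply, Pi.smul_apply, smul_eq_mul, smul_eq_mul]
    ring
  rw [sqInt_congr e, ← sq, ← sq]
  exact sqInt_add_le_two (((hf k).sub (Lp.aestronglyMeasurable u).aemeasurable).const_mul a)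

namespace LipRiem.IsRegular

variable {X Y : LipRiem} (hX : X.IsRegular)
include hX

lemma isH1Seq_linear (a b : ℝ) {w w' : ℕ → X.Point → ℝ} {u v : X.L2} (hw : X.IsH1Seq w u)
    (hw' : X.IsH1Seq w' v) : X.IsH1Seq (fun k p => a * w k p + b * w' k p) (a • u + b • v) := by
  refine ⟨fun k => hX.add_mem _ (hX.const_mul_mem a _ (hw.1 k)) _ (hX.const_mul_mem b _ (hw'.1 k)),
    tendsto_sqInt_linear a b (fun k => hX.aemeasurable (hw.1 k)) hw.2.1 hw'.2.1,
    tendsto_zero_of_le (tendsto_two_mul_add (ofReal_ne_top (r := a ^ 2))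
      (ofReal_ne_top (r := b ^ 2)) hw.2.2 hw'.2.2) fun ⟨k, l⟩ => ?_⟩
  have hm := hX.sub_mem (hw.1 k) (hw.1 l)
  have hm' := hX.sub_mem (hw'.1 k) (hw'.1 l)
  have e : (fun p => a * w k p + b * w' k p - (a * w l p + b * w' l p)) =
      fun p => a * (w k p - w l p) + b * (w' k p - w' l p) := by funext p; ring
  refine (congrArg X.dirichlet e).trans_le ((hX.dirichlet_add_le_two
    (hX.const_mul_mem a _ hm) (hX.const_mul_mem b _ hm')).trans ?_)
  gcongr
  · exact hX.dirichlet_const_mul_le a _ hm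
  · exact hX.dirichlet_const_mul_le b _ hm'

/-- A bounded linear extension operator for Lipschitz functions extends to `H¹`. -/
theorem exists_extension {j : X.Point → Y.Point}
    (hj : Measure.QuasiMeasurePreserving j X.vol Y.vol) (hY : ∀ u ∈ Y.lip, MemLp u 2 Y.vol)
    {E : (X.Point → ℝ) → Y.Point → ℝ} {K : ℝ≥0} (hE : ∀ u ∈ X.lip, E u ∈ Y.lip)
    (hlin : ∀ a b : ℝ, ∀ u ∈ X.lip, ∀ v ∈ X.lip,
      E (fun p => a * u p + b * v p) = fun q => a * E u q + b * E v q)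
    (hres : ∀ u ∈ X.lip, ∀ p, E u (j p) = u p)
    (hs : ∀ u ∈ X.lip, sqInt Y.vol (E u) ≤ K * sqInt X.vol u)
    (hD : ∀ u ∈ X.lip, Y.dirichlet (E u) ≤ K * X.dirichlet u) :
    ∃ π : X.L2 → Y.L2, (∀ u, X.MemH1 u → Y.MemH1 (π u) ∧ (∀ᵐ x ∂X.vol, π u (j x) = u x) ∧
        Y.h1Norm (π u) ≤ ((4 * (1 + K)) ^ (1 / 2 : ℝ) : ℝ≥0) * X.h1Norm u) ∧
      (∀ u v, X.MemH1 u → X.MemH1 v → π (u + v) = π u + π v) ∧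
      (∀ (a : ℝ) u, X.MemH1 u → π (a • u) = a • π u) := by
  classical
  have hEm : ∀ u ∈ X.lip, AEMeasurable (E u) Y.vol :=
    fun u hu => (hY _ (hE u hu)).aestronglyMeasurable.aemeasurable
  have hsub : ∀ u ∈ X.lip, ∀ v ∈ X.lip,
      (fun q => E u q - E v q) = E (fun p => u p - v p) := fun u hu v hv => by
    have := hlin 1 (-1) u hu v hv
    simp only [one_mul, neg_one_mul, ← sub_eq_add_neg] at this
    exact this.symm
  have hKt : ∀ {ι : Type} {l : Filter ι} {f : ι → ℝ≥0∞}, Tendsto f l (𝓝 0) →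
      Tendsto (fun i => (K : ℝ≥0∞) * f i) l (𝓝 0) := tendsto_mul_zero ENNReal.coe_ne_top
  have hseq : ∀ u : X.L2, X.MemH1 u → ∃ v : Y.L2, ∀ w, X.IsH1Seq w u →
      Y.IsH1Seq (fun k => E (w k)) v := by
    rintro u ⟨w, hw⟩
    have hum := (Lp.aestronglyMeasurable u).aemeasurable
    obtain ⟨v, hv⟩ := exists_limit_of_sqInt (fun k => hY _ (hE _ (hw.1 k))) (tendsto_zero_of_le
        (hKt (sqInt_tendsto_sub (fun k => hX.aemeasurable (hw.1 k)) hum hw.2.1))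
        fun ⟨k, l⟩ => by
          simp only [hsub _ (hw.1 k) _ (hw.1 l)]
          exact hs _ (hX.sub_mem (hw.1 k) (hw.1 l)))
    refine ⟨v, fun w' hw' => ⟨fun k => hE _ (hw'.1 k), ?_,
      tendsto_zero_of_le (hKt hw'.2.2) fun ⟨k, l⟩ => ?_⟩⟩
    · refine tendsto_zero_of_le (tendsto_two_mul_add (ENNReal.coe_ne_top (r := K))
        ENNReal.one_ne_top (tendsto_two_mul_add ENNReal.one_ne_top ENNReal.one_ne_top hw'.2.1
          hw.2.1) hv) fun k => (sqInt_sub_le_two (hEm _ (hw'.1 k)) (hEm _ (hw.1 k))).trans ?_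
      rw [one_mul, one_mul, one_mul]
      gcongr
      rw [hsub _ (hw'.1 k) _ (hw.1 k)]
      refine (hs _ (hX.sub_mem (hw'.1 k) (hw.1 k))).trans ?_
      gcongr
      refine (sqInt_sub_le_two (hX.aemeasurable (hw'.1 k)) hum).trans_eq ?_
      rw [sqInt_sub_comm u]
      rfl
    · simp only [hsub _ (hw'.1 k) _ (hw'.1 l)]
      exact hD _ (hX.sub_mem (hw'.1 k) (hw'.1 l))
  choose! π hπ using hseq
  have hlinπ : ∀ (a b : ℝ) u v, X.MemH1 u → X.MemH1 v → π (a • u + b • v) = a • π u + b • π v := by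
    rintro a b u v ⟨w, hw⟩ ⟨w', hw'⟩
    have hl := hX.isH1Seq_linear a b hw hw'
    refine tendsto_sqInt_unique (fun k => hEm _ (hl.1 k)) (hπ _ ⟨_, hl⟩ _ hl).2.1
      ((tendsto_sqInt_linear a b (fun k => hEm _ (hw.1 k)) (hπ _ ⟨_, hw⟩ _ hw).2.1
        (hπ _ ⟨_, hw'⟩ _ hw').2.1).congr fun k => ?_)
    rw [hlin a b _ (hw.1 k) _ (hw'.1 k)]
  refine ⟨π, fun u hu => ?_, fun u v hu hv => by simpa using hlinπ 1 1 u v hu hv,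
    fun a u hu => by simpa using hlinπ a 0 u u hu hu⟩
  obtain ⟨w, hw⟩ := id hu
  have hw' := hπ u hu w hw
  refine ⟨⟨_, hw'⟩, ?_, ?_⟩
  · obtain ⟨ns, hns, h1⟩ := exists_seq_ae_of_sqInt
      (fun k => (hEm _ (hw.1 k)).aestronglyMeasurable) (Lp.aestronglyMeasurable _) hw'.2.1
    obtain ⟨ms, hms, h2⟩ := exists_seq_ae_of_sqInt
      (fun k => (hX.aemeasurable (hw.1 (ns k))).aestronglyMeasurable) (Lp.aestronglyMeasurable _)
      (hw.comp hns).2.1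
    filter_upwards [hj.ae h1, h2] with x h1 h2
    refine tendsto_nhds_unique (h1.comp hms.tendsto_atTop) (h2.congr fun k => ?_)
    exact (hres _ (hw.1 _) x).symm
  · have hK0 : (4 * (1 + K) : ℝ≥0∞) ≠ 0 := by simp
    have hKt : (4 * (1 + K) : ℝ≥0∞) ≠ ⊤ := by finiteness
    have hK : (K : ℝ≥0∞) ≤ 4 * (1 + K) := le_add_self.trans
      (le_mul_of_one_le_left' (by norm_num : (1 : ℝ≥0∞) ≤ 4))
    have h1 : Y.energy (π u) ≤ 4 * (1 + K) * X.energy u := by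
      simp_rw [energy, ENNReal.mul_iInf_of_ne hK0 hKt]
      refine le_iInf₂ fun w hw => (energy_le (hπ u hu w hw)).trans ?_
      rw [← ENNReal.limsup_const_mul_of_ne_top hKt]
      exact limsup_le_limsup (Eventually.of_forall fun k => (hD _ (hw.1 k)).trans
        (mul_le_mul' hK le_rfl))
    have h2 : ofReal (‖π u‖ ^ 2) ≤ 4 * (1 + K) * ofReal (‖u‖ ^ 2) := by
      rw [← sqInt_coe, ← sqInt_coe]
      have hum := (Lp.aestronglyMeasurable u).aemeasurable
      have hb : ∀ k, sqInt Y.vol (π u) ≤ 4 * K * sqInt X.vol u +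
          (2 * (2 * K * sqInt X.vol (fun p => w k p - u p)) +
            2 * (1 * sqInt Y.vol (fun q => E (w k) q - π u q))) := fun k => by
        have e1 : sqInt Y.vol (π u) ≤ 2 * sqInt Y.vol (E (w k)) +
            2 * sqInt Y.vol (fun q => E (w k) q - π u q) := by
          rw [sqInt_sub_comm]
          simpa using sqInt_add_le_two (f := E (w k)) (g := fun q => π u q - E (w k) q)
            (hEm _ (hw.1 k))
        have e2 : sqInt X.vol (w k) ≤ 2 * sqInt X.vol u +
            2 * sqInt X.vol (fun p => w k p - u p) := by
          simpa using sqInt_add_le_two (f := u) (g := fun q => w k q - u q) hum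
        calc _ ≤ 2 * (K * (2 * sqInt X.vol u + 2 * sqInt X.vol (fun p => w k p - u p))) +
            2 * sqInt Y.vol (fun q => E (w k) q - π u q) :=
              e1.trans (by gcongr; exact (hs _ (hw.1 k)).trans (by gcongr))
          _ = _ := by ring
      refine (ge_of_tendsto' (tendsto_const_nhds.add (tendsto_two_mul_add
        (by finiteness) ENNReal.one_ne_top hw.2.1 hw'.2.1)) hb).trans ?_
      rw [add_zero]
      gcongr
      exact le_add_self
    rw [h1Norm, h1Norm, ENNReal.coe_rpow_of_nonneg _ (by norm_num),
      ← ENNReal.mul_rpow_of_nonneg _ _ (by norm_num)]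
    refine ENNReal.rpow_le_rpow ?_ (by norm_num)
    push_cast
    rw [mul_add]
    exact add_le_add h1 h2

end LipRiem.IsRegular

namespace HandleConfig

variable {d : ℕ} {δ₀ δ₁ : ℝ} (C : HandleConfig d δ₀ δ₁) (κ : C.Side)

/-- The cutoff at distance `r` from the axis: `1` outside the hole, `0` for `r ≤ δ₀ρ/2`. -/
def cut (r : ℝ) : ℝ := max 0 (min 1 (2 * (δ₀ * C.ρ)⁻¹ * r - 1))

/-- The coordinate on the handle used at distance `r` from the axis: the hole is
folded over the handle. -/
def fold (r : ℝ) : ℝ := max ((r - δ₀ * C.ρ) / (δ₁ * C.ρ - δ₀ * C.ρ)) (1 - C.cut r)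

/-- The mean value on the half-handle `κ`. -/
def mean (u : C.Mbar → ℝ) : ℝ := ⨍ p, C.val κ u p ∂cylVol d

/-- The extension of `u` to the hole `κ`. -/
def discExt (u : C.Mbar → ℝ) (x : Amb d) : ℝ :=
  C.mean κ u + C.cut (C.rad κ.1 x) * (C.pull κ u (toLp 2 (C.fold (C.rad κ.1 x),
    ((C.sframe κ).symm x).snd)) - C.mean κ u)

open scoped Classical in
/-- The extension of `u` to the sphere. -/
def extend (u : C.Mbar → ℝ) (x : sph d) : ℝ :=
  homExt C.Mbar u x + ∑ κ, if 0 < ((C.sframe κ).symm x).fst ∧ C.rad κ.1 x < δ₀ * C.ρ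
    then C.discExt κ u x else 0

lemma cut_mem (r : ℝ) : C.cut r ∈ Icc (0 : ℝ) 1 :=
  ⟨le_max_left _ _, max_le zero_le_one (min_le_left _ _)⟩

variable [hC : Admissible δ₀ δ₁] [NeZero d]

lemma cut_eq_one {r : ℝ} (hr : δ₀ * C.ρ ≤ r) : C.cut r = 1 := by
  have := C.inner_mem.1
  have h : 1 ≤ (δ₀ * C.ρ)⁻¹ * r := by rwa [inv_mul_eq_div, one_le_div this]
  rw [cut, min_eq_left (by linarith), max_eq_right zero_le_one]

lemma cut_eq_zero {r : ℝ} (hr : r ≤ δ₀ * C.ρ / 2) : C.cut r = 0 := by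
  have := C.inner_mem.1
  have h : (δ₀ * C.ρ)⁻¹ * r ≤ 1 / 2 := by rw [inv_mul_eq_div, div_le_iff₀ this]; linarith
  exact max_eq_left ((min_le_right _ _).trans (by linarith))

lemma cut_half (t : ℝ) (ht : t ∈ Icc (0 : ℝ) 1) :
    C.cut (δ₀ * C.ρ + (δ₀ * C.ρ / 2 - δ₀ * C.ρ) * t) = 1 - t := by
  have := C.inner_mem.1
  have h : 2 * (δ₀ * C.ρ)⁻¹ * (δ₀ * C.ρ + (δ₀ * C.ρ / 2 - δ₀ * C.ρ) * t) - 1 = 1 - t := by grind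
  rw [cut, h, min_eq_right (by linarith [ht.1]), max_eq_right (by linarith [ht.2])]

lemma fold_mem {r : ℝ} (hr : r ≤ δ₁ * C.ρ) : C.fold r ∈ Icc (0 : ℝ) 1 := by
  have h := C.cut_mem r
  refine ⟨le_max_of_le_right (by linarith [h.2]), max_le ?_ (by linarith [h.1])⟩
  rw [div_le_one (by linarith [C.inner_lt_outer])]
  linarith

lemma fold_outer {t : ℝ} (ht : 0 ≤ t) : C.fold (δ₀ * C.ρ + (δ₁ * C.ρ - δ₀ * C.ρ) * t) = t := by
  have h := C.inner_lt_outer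
  rw [fold, C.cut_eq_one (by nlinarith), add_sub_cancel_left,
    mul_div_cancel_left₀ _ (by linarith), sub_self, max_eq_left ht]

lemma fold_inner {r : ℝ} (hr : r ≤ δ₀ * C.ρ) : C.fold r = 1 - C.cut r :=
  max_eq_right ((div_nonpos_of_nonpos_of_nonneg (by linarith)
    (by linarith [C.inner_lt_outer])).trans (by linarith [(C.cut_mem r).2]))

lemma exists_pos_of_rad_le {x : Amb d} (hx : x ∈ sph d) {i : Fin C.m}
    (h : C.rad i x ≤ δ₁ * C.ρ) : ∃ κ : C.Side, κ.1 = i ∧ 0 < ((C.sframe κ).symm x).fst := by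
  obtain ⟨b, hb⟩ := C.exists_sframe_pos hx (h.trans_lt C.outer_mem.2)
  exact ⟨(i, b), rfl, hb⟩

lemma extend_of_mem {u : C.Mbar → ℝ} {x : sph d} (hx : (x : Amb d) ∈ C.Mbar) :
    C.extend u x = u ⟨x, hx⟩ := by
  rw [extend, homExt_of_mem C.Mbar_subset_sph u hx, Finset.sum_eq_zero, add_zero]
  intro κ _
  rw [if_neg fun h => h.2.not_ge ((C.mem_Mbar.1 hx).2 κ.1)]

lemma extend_of_pos {u : C.Mbar → ℝ} {x : sph d} {κ : C.Side}
    (h0 : 0 < ((C.sframe κ).symm x).fst) (h : C.rad κ.1 x < δ₁ * C.ρ) :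
    C.extend u x = C.discExt κ u x := by
  by_cases hx : (x : Amb d) ∈ C.Mbar
  · rw [C.extend_of_mem hx, discExt, C.cut_eq_one ((C.mem_Mbar.1 hx).2 κ.1), one_mul,
      add_sub_cancel]
    obtain ⟨p, hp, hpx⟩ := C.exists_Φ_eq_of_pos hx h.le h0
    have h1 : ((C.sframe κ).symm (C.Φ κ p)).snd ≠ 0 := by
      rw [← norm_ne_zero_iff, norm_snd_sframe, hpx]
      exact (C.inner_mem.1.trans_le ((C.mem_Mbar.1 hx).2 κ.1)).ne'
    have h2 : ((C.sframe κ).symm (C.Φ κ p)).snd =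
        (δ₀ * C.ρ + (δ₁ * C.ρ - δ₀ * C.ρ) * p.1) • (p.2 : 𝔼 d) := by
      rw [Φ, LinearIsometryEquiv.symm_apply_apply]; rfl
    have h3 : 0 < δ₀ * C.ρ + (δ₁ * C.ρ - δ₀ * C.ρ) * p.1 := by
      have := C.inner_mem.1
      nlinarith [C.inner_lt_outer, hp.1]
    have h4 : ‖((C.sframe κ).symm (C.Φ κ p)).snd‖⁻¹ • ((C.sframe κ).symm (C.Φ κ p)).snd = p.2 := by
      rw [h2, norm_smul, mem_sphere_zero_iff_norm.1 p.2.2, mul_one, Real.norm_of_nonneg h3.le,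
        smul_smul, inv_mul_cancel₀ h3.ne', one_smul]
    have h5 : C.fold (C.rad κ.1 x) = p.1 := by rw [← hpx, C.rad_Φ κ hp, C.fold_outer hp.1]
    have h6 := homExt_of_mem C.Mbar_subset_sph u hx
    rw [← h6, h5, ← hpx]
    exact (congrArg (fun w => homExt C.Mbar u (C.sframe κ (chartPt _ _ p.1 w))) h4).symm
  · have hn : ‖(x : Amb d)‖ = 1 := mem_sphere_zero_iff_norm.1 x.2
    rw [extend, homExt, dif_neg (by rwa [hn, inv_one, one_smul]), zero_add, Finset.sum_eq_single κ]
    · have : ∃ i, C.rad i x < δ₀ * C.ρ := by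
        by_contra! h'
        exact hx (C.mem_Mbar.2 ⟨x.2, h'⟩)
      obtain ⟨i, hi⟩ := this
      obtain rfl : κ.1 = i := by
        by_contra hne
        exact (C.lt_rad_of_rad_le x.2 hne h.le).not_gt (hi.trans C.inner_lt_outer)
      rw [if_pos ⟨h0, hi⟩]
    · intro κ' _ hne
      rw [if_neg fun h' => hne (C.eq_of_fst_pos x.2 h'.1 h0
        (h'.2.le.trans C.inner_lt_outer.le) h.le)]
    simp

lemma exists_norm_homExt_le {u : C.Mbar → ℝ} (hu : Continuous u) :
    ∃ M, ∀ x, ‖homExt C.Mbar u x‖ ≤ M := by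
  have hcs : CompactSpace C.Mbar := isCompact_iff_compactSpace.1 C.isCompact_Mbar
  obtain ⟨M, hM⟩ := isCompact_univ.exists_bound_of_continuousOn hu.continuousOn
  refine ⟨max M 0, fun x => ?_⟩
  rw [homExt]
  split_ifs with h
  · simp_all
  · simp

lemma integrable_val {u : C.Mbar → ℝ} (hu : Continuous u) : Integrable (C.val κ u) (cylVol d) := by
  obtain ⟨M, hM⟩ := C.exists_norm_homExt_le hu
  exact Integrable.of_bound (C.measurable_val κ hu).aestronglyMeasurable M
    (Eventually.of_forall fun p => hM _)

lemma extend_linear (a b : ℝ) {u v : C.Mbar → ℝ} (hu : Continuous u) (hv : Continuous v) :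
    C.extend (fun p => a * u p + b * v p) = fun x => a * C.extend u x + b * C.extend v x := by
  have h1 : ∀ z, homExt C.Mbar (fun p => a * u p + b * v p) z =
      a * homExt C.Mbar u z + b * homExt C.Mbar v z := fun z => by
    rw [homExt_add, homExt_const_mul, homExt_const_mul]
  have h2 : ∀ κ, C.mean κ (fun p => a * u p + b * v p) = a * C.mean κ u + b * C.mean κ v := by
    intro κ
    have e : C.val κ (fun p => a * u p + b * v p) = fun p => a * C.val κ u p + b * C.val κ v p :=
      funext fun p => h1 _
    rw [mean, mean, mean, e, average_eq, average_eq, average_eq,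
      integral_add ((C.integrable_val κ hu).const_mul a)
        ((C.integrable_val κ hv).const_mul b), integral_const_mul, integral_const_mul]
    ring
  have h3 : ∀ κ z, C.pull κ (fun p => a * u p + b * v p) z =
      a * C.pull κ u z + b * C.pull κ v z := fun κ z => h1 _
  funext x
  simp only [extend, h1, mul_add, Finset.mul_sum, discExt, h2, h3]
  rw [add_add_add_comm, ← Finset.sum_add_distrib]
  congr 1
  refine Finset.sum_congr rfl fun κ _ => ?_
  split_ifs <;> ring

lemma exists_lipschitzWith_extend {u : C.Mbar → ℝ} {K : ℝ≥0} (hu : LipschitzWith K u) :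
    ∃ L, LipschitzWith L (C.extend u) := by
  have hcs : CompactSpace (sph d) := isCompact_iff_compactSpace.1 (isCompact_sphere 0 1)
  refine exists_lipschitzWith_of_locallyLipschitz fun x => ?_
  have hcv : Continuous ((↑) : sph d → Amb d) := continuous_subtype_val
  by_cases hx : (x : Amb d) ∈ C.M
  · refine ⟨K, {z | (z : Amb d) ∈ C.M}, ?_, LipschitzOnWith.of_dist_le_mul fun y hy z hz => ?_⟩
    · filter_upwards [hcv.continuousAt.eventually (C.eventually_mem_M hx)] with z hz
      simp_all
    · rw [C.extend_of_mem (C.M_subset_Mbar hy), C.extend_of_mem (C.M_subset_Mbar hz)]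
      exact hu.dist_le_mul _ _
  · have h : ∃ i, C.rad i x ≤ δ₀ * C.ρ := by
      by_contra! h'
      exact hx (C.mem_M.2 ⟨x.2, h'⟩)
    obtain ⟨i, hi⟩ := h
    have hA := C.inner_mem.1
    have hAB := C.inner_lt_outer
    obtain ⟨κ, rfl, h0⟩ := C.exists_pos_of_rad_le x.2 (hi.trans hAB.le)
    have hop : ∀ {I : Set ℝ}, IsOpen I → C.rad κ.1 x ∈ I →
        ∀ᶠ z : sph d in 𝓝 x, 0 < ((C.sframe κ).symm z).fst ∧ C.rad κ.1 z ∈ I := fun hI h =>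
      (((Cyl.continuous_fst.comp ((C.sframe κ).symm.continuous.comp hcv)).continuousAt.eventually_mem
        (Ioi_mem_nhds h0))).and
        (((C.continuous_rad κ.1).comp hcv).continuousAt.eventually_mem (hI.mem_nhds h))
    rcases lt_or_ge (C.rad κ.1 x) (δ₀ * C.ρ / 2) with h | h
    · refine ⟨0, _, hop isOpen_Iio h, LipschitzOnWith.of_dist_le_mul fun y hy z hz => ?_⟩
      have e : ∀ y : sph d, 0 < ((C.sframe κ).symm y).fst ∧ C.rad κ.1 y ∈ Iio (δ₀ * C.ρ / 2) →
          C.extend u y = C.mean κ u := fun y hy => by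
        have hy2 : C.rad κ.1 y < δ₀ * C.ρ / 2 := hy.2
        rw [C.extend_of_pos hy.1 (by linarith), discExt, C.cut_eq_zero hy2.le, zero_mul, add_zero]
      rw [e y hy, e z hz]; simp
    · obtain ⟨L, hL⟩ := C.exists_lipschitzOnWith_pull κ hu (show 0 < δ₀ * C.ρ / 4 by linarith)
      obtain ⟨g, hg, hgp⟩ := hL.extend_real
      have hlin : ∀ a b : ℝ, LocallyLipschitz fun r : ℝ => a * r + b := fun a b =>
        (contDiff_const.mul contDiff_id |>.add contDiff_const : ContDiff ℝ 1 _).locallyLipschitz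
      have hr := (C.lipschitz_rad κ.1).locallyLipschitz
      have hcut : LocallyLipschitz C.cut := ((hlin _ _).const_min 1).const_max 0
      have hfold : LocallyLipschitz C.fold := by
        refine LocallyLipschitz.max ?_ ((LocallyLipschitz.const 1).sub hcut)
        convert hlin (δ₁ * C.ρ - δ₀ * C.ρ)⁻¹ (-((δ₁ * C.ρ - δ₀ * C.ρ)⁻¹ * (δ₀ * C.ρ))) using 2
        ring
      have hsnd : LocallyLipschitz fun z : Amb d => ((C.sframe κ).symm z).snd :=
        (LipschitzWith.of_dist_le_mul (K := 1) fun y z => by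
          rw [NNReal.coe_one, one_mul, ← (C.sframe κ).symm.dist_map y z]
          exact Cyl.dist_snd_le _ _).locallyLipschitz
      have hpt := ((WithLp.prodContinuousLinearEquiv 2 ℝ ℝ
        𝔼 d).symm.contDiff (n := 1)).locallyLipschitz.comp
        ((hfold.comp hr).prodMk hsnd)
      have hmul := (contDiff_mul (𝕜 := ℝ) (𝔸 := ℝ) (n := 1)).locallyLipschitz.comp
        ((hcut.comp hr).prodMk ((hg.locallyLipschitz.comp hpt).sub
          (LocallyLipschitz.const (C.mean κ u))))
      obtain ⟨K', t, ht, hK'⟩ := ((LocallyLipschitz.const (C.mean κ u)).add hmul) x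
      refine ⟨K', _, inter_mem (hcv.continuousAt.preimage_mem_nhds ht)
        (hop (isOpen_Ioo (a := δ₀ * C.ρ / 4) (b := δ₁ * C.ρ)) ⟨by linarith, by linarith⟩),
        LipschitzOnWith.of_dist_le_mul fun y hy z hz => ?_⟩
      have e : ∀ y : sph d, 0 < ((C.sframe κ).symm y).fst ∧
          C.rad κ.1 y ∈ Ioo (δ₀ * C.ρ / 4) (δ₁ * C.ρ) → C.extend u y = C.mean κ u +
            C.cut (C.rad κ.1 y) * (g (toLp 2 (C.fold (C.rad κ.1 y),
              ((C.sframe κ).symm y).snd)) - C.mean κ u) := fun y hy => by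
        rw [C.extend_of_pos hy.1 hy.2.2, discExt, hgp]
        exact ⟨C.fold_mem hy.2.2.le, (hy.2.1.trans_eq (C.norm_snd_sframe κ y).symm).le⟩
      rw [e y hy.2, e z hz.2]
      exact hK'.dist_le_mul _ hy.1 _ hz.1

end HandleConfig

section Sphere

variable {d : ℕ}

lemma vol_sphereMfd (d : ℕ) : (sphereMfd d).vol = (sphVol d).comap Subtype.val := by
  have : (fun x : sph d => ofReal (volDensity (roundMetric d) x)) = 1 := funext fun x => by
    rw [volDensity_roundMetric (mem_sphere_zero_iff_norm.1 x.2), ofReal_one]; rfl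
  exact (congrArg _ this).trans withDensity_one

lemma lintegral_sph (f : Amb d → ℝ≥0∞) :
    ∫⁻ x : sph d, f x ∂(sphVol d).comap Subtype.val = ∫⁻ x, f x ∂sphVol d := by
  rw [lintegral_subtype_comap Metric.isClosed_sphere.measurableSet,
    Measure.restrict_eq_self_of_ae_mem (ae_mem_sph d)]

lemma sqInt_sphereMfd (w : sph d → ℝ) :
    sqInt (sphereMfd d).vol w = ∫⁻ x, ‖homExt (sph d) w x‖ₑ ^ 2 ∂sphVol d := by
  rw [vol_sphereMfd, ← lintegral_sph]
  refine lintegral_congr fun x : sph d => ?_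
  rw [homExt_of_mem subset_rfl w x.2, ofReal_sq_eq_enorm]

lemma dirichlet_sphereMfd (w : sph d → ℝ) :
    (sphereMfd d).dirichlet w = ∫⁻ x, ‖fderiv ℝ (homExt (sph d) w) x‖ₑ ^ 2 ∂sphVol d := by
  rw [← lintegral_sph]
  refine lintegral_congr fun x : sph d => ?_
  have hx := mem_sphere_zero_iff_norm.1 x.2
  rw [gradSq_roundMetric hx (rayConst_homExt _ _), volDensity_roundMetric hx, mul_one,
    ofReal_pow (norm_nonneg _), ofReal_norm]

lemma memLp_sphereMfd {w : sph d → ℝ} (hw : Continuous w) : MemLp w 2 (sphereMfd d).vol := by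
  have hcs : CompactSpace (sph d) := isCompact_iff_compactSpace.1 (isCompact_sphere 0 1)
  have : IsFiniteMeasure ((sphVol d).comap (Subtype.val : sph d → Amb d)) := ⟨by
    rw [comap_subtype_coe_apply Metric.isClosed_sphere.measurableSet]
    exact (measure_mono (subset_univ _)).trans_lt (by
      rw [sphVol, Measure.map_apply measurable_subtype_coe .univ]; exact measure_lt_top _ _)⟩
  obtain ⟨M, hM⟩ := isCompact_univ.exists_bound_of_continuousOn hw.continuousOn
  have h : MemLp w 2 ((sphVol d).comap (Subtype.val : sph d → Amb d)) :=
    MemLp.of_bound hw.measurable.aestronglyMeasurable M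
      (Eventually.of_forall fun x => hM x (mem_univ _))
  rw [vol_sphereMfd]
  exact h

lemma measurable_chartInv (A B : ℝ) : Measurable (chartInv (d := d) A B) := by
  unfold chartInv; fun_prop

lemma measurable_chartPull {f : Amb d → ℝ} (hf : Measurable f) (F : Cyl d ≃ₗᵢ[ℝ] Amb d)
    (A B : ℝ) : Measurable (chartPull F A B f) := by
  refine hf.comp (F.continuous.measurable.comp ?_)
  unfold chartPt; fun_prop

end Sphere

namespace HandleConfig

variable {d : ℕ} {δ₀ δ₁ : ℝ} (C : HandleConfig d δ₀ δ₁) (κ : C.Side)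

/-- The image of the chart with radii between `a` and `b`. -/
def cone (a b : ℝ) : Set (Amb d) := (C.sframe κ).symm ⁻¹' chartCone d a b

variable [hC : Admissible δ₀ δ₁] [NeZero d]

lemma quasiMeasurePreserving_incl :
    Measure.QuasiMeasurePreserving C.incl C.mfd.vol (sphereMfd d).vol := by
  have hm : Measurable (fun x : C.Mbar => (⟨x, x.2.1⟩ : sph d)) := by fun_prop
  refine ⟨hm, Measure.AbsolutelyContinuous.mk fun s hs h0 => ?_⟩
  rw [vol_sphereMfd] at h0
  have h0' := (comap_subtype_coe_apply (isClosed_sph d).measurableSet (sphVol d) s).symm.trans h0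
  refine (Measure.map_apply hm hs).trans (withDensity_absolutelyContinuous _ _ ?_)
  refine (comap_subtype_coe_apply C.measurableSet_Mbar (sphVol d) _).trans
    (measure_mono_null ?_ h0')
  rintro _ ⟨x, hx, rfl⟩
  exact ⟨_, hx, rfl⟩

lemma setLIntegral_cone_le {a b : ℝ}
    (ha : a ∈ Icc 0 (δ₁ * C.ρ)) (hb : b ∈ Icc 0 (δ₁ * C.ρ)) (hab : a ≠ b) {f : Amb d → ℝ≥0∞}
    (hf : Measurable f) : ∫⁻ x in C.cone κ a b, f x ∂sphVol d ≤ chartConst d δ₁ *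
      (ofReal (C.ρ ^ d) * ∫⁻ p, f (C.sframe κ (chartPt a b p.1 p.2)) ∂cylVol d) := by
  have h1 : 0 < δ₁ := hC.pos.trans hC.lt
  have h2 := C.ρ_pos
  refine (setLIntegral_chartCone_le (C.sframe κ) C.outer_mem.1
    (mul_le_of_le_one_right h1.le C.ρ_lt_one.le) hC.lt_one ha hb hab hf).trans ?_
  gcongr
  exact mul_le_of_le_one_left h2.le hC.lt_one.le

lemma setLIntegral_fderiv_le {a b c : ℝ} (hc : 0 < c)
    (ha : a ∈ Icc (c * C.ρ) (δ₁ * C.ρ)) (hb : b ∈ Icc (c * C.ρ) (δ₁ * C.ρ))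
    (hab : c * C.ρ ≤ |b - a|) {f : Amb d → ℝ} (hf : RayConst f) :
    ∫⁻ x in C.cone κ a b, ‖fderiv ℝ f x‖ₑ ^ 2 ∂sphVol d ≤
      chartConst d δ₁ * ofReal ((c ^ 2)⁻¹) * (ofReal ((C.ρ ^ 2)⁻¹ * C.ρ ^ d) *
        ∫⁻ p, ‖fderiv ℝ (chartPull (C.sframe κ) a b f) (cylPt p)‖ₑ ^ 2 ∂cylVol d) := by
  have hρ := C.ρ_pos
  have hcρ : 0 < c * C.ρ := mul_pos hc hρ
  have h1 := C.outer_mem.2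
  have hne : a ≠ b := by rintro rfl; simp at hab; linarith
  set g : Amb d → ℝ≥0∞ := fun x => ‖fderiv ℝ (chartPull (C.sframe κ) a b f)
    (chartInv a b ((C.sframe κ).symm x))‖ₑ ^ 2 with hg
  have hgm : Measurable g := (((measurable_fderiv ℝ _).comp ((measurable_chartInv a b).comp
    (C.sframe κ).symm.continuous.measurable)).enorm).pow_const 2
  have e : ∫⁻ p, g (C.sframe κ (chartPt a b p.1 p.2)) ∂cylVol d =
      ∫⁻ p, ‖fderiv ℝ (chartPull (C.sframe κ) a b f) (cylPt p)‖ₑ ^ 2 ∂cylVol d := by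
    refine lintegral_congr_ae ?_
    filter_upwards [ae_cylVol_mem] with p hp
    rw [hg]
    simp only
    rw [LinearIsometryEquiv.symm_apply_apply, (chartInv_chartPt ⟨hcρ.le.trans ha.1,
      ha.2.trans_lt h1⟩ ⟨hcρ.le.trans hb.1, hb.2.trans_lt h1⟩ hne hp).2]
  calc _ ≤ ∫⁻ x in C.cone κ a b, ofReal (((c * C.ρ) ^ 2)⁻¹) * g x ∂sphVol d := by
        refine lintegral_mono_ae ?_
        filter_upwards [ae_restrict_mem ((C.sframe κ).symm.continuous.measurable
          measurableSet_chartCone), ae_restrict_of_ae (ae_mem_sph d)] with x hx hxs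
        exact hf.enorm_fderiv_sq_le (C.sframe κ) hcρ h1 ha hb hab
          (mem_sphere_zero_iff_norm.1 hxs) hx
    _ ≤ ofReal (((c * C.ρ) ^ 2)⁻¹) * (chartConst d δ₁ * (ofReal (C.ρ ^ d) *
        ∫⁻ p, g (C.sframe κ (chartPt a b p.1 p.2)) ∂cylVol d)) := by
        rw [lintegral_const_mul' _ _ ofReal_ne_top]
        exact mul_le_mul' le_rfl (C.setLIntegral_cone_le κ ⟨hcρ.le.trans ha.1, ha.2⟩
          ⟨hcρ.le.trans hb.1, hb.2⟩ hne hgm)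
    _ = _ := by
        rw [e, mul_pow, mul_inv, ofReal_mul (by positivity),
          ofReal_mul (p := (C.ρ ^ 2)⁻¹) (by positivity)]
        ring

lemma lintegral_sphVol_le (f : Amb d → ℝ≥0∞) : ∫⁻ x, f x ∂sphVol d ≤
    ∫⁻ x in C.Uᶜ, f x ∂sphVol d + ∑ κ, (∫⁻ x in C.cone κ (δ₀ * C.ρ) (δ₁ * C.ρ), f x ∂sphVol d +
      (∫⁻ x in C.cone κ (δ₀ * C.ρ) (δ₀ * C.ρ / 2), f x ∂sphVol d +
        ∫⁻ x in C.cone κ (δ₀ * C.ρ / 2) 0, f x ∂sphVol d)) := by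
  have hA := C.inner_mem
  have hAB := C.inner_lt_outer
  have hcov : ∀ᵐ x ∂sphVol d, x ∈ C.Uᶜ ∪ ⋃ κ,
      (C.cone κ (δ₀ * C.ρ) (δ₁ * C.ρ) ∪ (C.cone κ (δ₀ * C.ρ) (δ₀ * C.ρ / 2) ∪
        C.cone κ (δ₀ * C.ρ / 2) 0)) := by
    have h1 := ae_all_iff.2 fun i => C.ae_rad_ne i hA
    have h2 := ae_all_iff.2 fun i => C.ae_rad_ne i
      (t := δ₀ * C.ρ / 2) ⟨by linarith [hA.1], by linarith [hA.1, hA.2]⟩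
    have h3 := ae_all_iff.2 fun κ => ae_snd_ne_zero (C.sframe κ)
    filter_upwards [h1, h2, h3, ae_mem_sph d] with x h1 h2 h3 hx
    by_cases hU : x ∈ C.U
    · obtain ⟨i, hi⟩ := (C.mem_U.1 hU).2
      obtain ⟨κ, rfl, h0⟩ := C.exists_pos_of_rad_le hx hi.le
      refine Or.inr (mem_iUnion.2 ⟨κ, ?_⟩)
      have hcone : ∀ a b, (C.rad κ.1 x - a) / (b - a) ∈ Ioo (0 : ℝ) 1 → x ∈ C.cone κ a b :=
        fun a b h => ⟨h0, h3 κ, by rwa [norm_snd_sframe, C.norm_symm hx, inv_one, mul_one]⟩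
      have hpos : 0 < C.rad κ.1 x := by rw [← norm_snd_sframe]; exact norm_pos_iff.2 (h3 κ)
      rcases lt_or_gt_of_ne (h1 κ.1) with h | h
      · rcases lt_or_gt_of_ne (h2 κ.1) with h' | h'
        · refine Or.inr (Or.inr (hcone _ _ ⟨div_pos_of_neg_of_neg (by linarith) (by linarith), ?_⟩))
          rw [div_lt_one_of_neg (by linarith)]; linarith
        · refine Or.inr (Or.inl (hcone _ _ ⟨div_pos_of_neg_of_neg (by linarith) (by linarith), ?_⟩))
          rw [div_lt_one_of_neg (by linarith)]; linarith
      · refine Or.inl (hcone _ _ ⟨div_pos (by linarith) (by linarith), ?_⟩)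
        rw [div_lt_one (by linarith)]; linarith
    · exact Or.inl hU
  calc _ = _ := congrArg (fun μ => ∫⁻ x, f x ∂μ) (Measure.restrict_eq_self_of_ae_mem hcov).symm
    _ ≤ _ := lintegral_union_le _ _ _
    _ ≤ _ := add_le_add le_rfl ((lintegral_iUnion_le _ _).trans_eq (tsum_fintype _))
    _ ≤ _ := add_le_add le_rfl (Finset.sum_le_sum fun κ _ => (lintegral_union_le _ _ _).trans
      (add_le_add le_rfl (lintegral_union_le _ _ _)))

lemma chartPull_extend (u : C.Mbar → ℝ) (κ : C.Side) (a b : ℝ) {q : Cyl d}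
    (hq : q.snd ≠ 0) (hr : a + (b - a) * q.fst ∈ Ioo 0 (δ₁ * C.ρ)) :
    chartPull (C.sframe κ) a b (homExt (sph d) (C.extend u)) q =
      C.mean κ u + C.cut (a + (b - a) * q.fst) * (C.pull κ u (toLp 2
        (C.fold (a + (b - a) * q.fst), q.snd)) - C.mean κ u) := by
  generalize hr' : a + (b - a) * q.fst = r at hr ⊢
  have hr1 : r ^ 2 < 1 := pow_lt_one₀ hr.1.le (hr.2.trans C.outer_mem.2) two_ne_zero
  have hn := norm_inv_smul_self hq
  obtain ⟨w, hw⟩ : ∃ w, w = ‖q.snd‖⁻¹ • q.snd := ⟨_, rfl⟩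
  obtain ⟨y, hy⟩ : ∃ y, y = C.sframe κ (chartPt a b q.fst w) := ⟨_, rfl⟩
  rw [← hw] at hn
  have hs : (C.sframe κ).symm y = chartPt a b q.fst w := by simp [*]
  have hsnd : ((C.sframe κ).symm y).snd = r • w := by rw [hs, snd_chartPt, hr']
  have hx : y ∈ sph d := by
    rw [mem_sphere_zero_iff_norm, hy, LinearIsometryEquiv.norm_map, norm_chartPt (hr' ▸ hr1.le) hn]
  have hrad : C.rad κ.1 y = r := by
    rw [← norm_snd_sframe, hsnd, norm_smul, hn, mul_one, Real.norm_of_nonneg hr.1.le]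
  have h0 : 0 < ((C.sframe κ).symm y).fst := by
    rw [hs, fst_chartPt, hr']; exact Real.sqrt_pos.2 (by linarith)
  have e : ‖r • w‖⁻¹ • r • w = ‖q.snd‖⁻¹ • q.snd := by
    rw [norm_smul, hn, mul_one, Real.norm_of_nonneg hr.1.le, smul_smul, inv_mul_cancel₀ hr.1.ne',
      one_smul, hw]
  have e' : C.pull κ u (toLp 2 (C.fold r, r • w)) = C.pull κ u (toLp 2 (C.fold r, q.snd)) := by
    rw [pull, chartPull, chartPull]
    change homExt C.Mbar u (C.sframe κ (chartPt _ _ (C.fold r) (‖r • w‖⁻¹ • r • w))) = _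
    rw [e]
    rfl
  have e2 : C.extend u ⟨y, hx⟩ = C.mean κ u + C.cut (C.rad κ.1 y) * (C.pull κ u (toLp 2
      (C.fold (C.rad κ.1 y), ((C.sframe κ).symm y).snd)) - C.mean κ u) :=
    C.extend_of_pos (x := ⟨y, hx⟩) h0 (hrad.trans_lt hr.2)
  rw [hrad, hsnd, e'] at e2
  rw [← e2, ← homExt_of_mem subset_rfl (C.extend u) hx, chartPull, ← hw, ← hy]

end HandleConfig

namespace HandleConfig

variable {d : ℕ} {δ₀ δ₁ : ℝ} (C : HandleConfig d δ₀ δ₁) [hC : Admissible δ₀ δ₁] [NeZero d] (κ : C.Side)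

lemma chartPull_cylPt (F : Cyl d ≃ₗᵢ[ℝ] Amb d) (a b : ℝ) (f : Amb d → ℝ) (p : ℝ × 𝕊 d) :
    chartPull F a b f (cylPt p) = f (F (chartPt a b p.1 p.2)) := by
  have hn : ‖(p.2 : 𝔼 d)‖ = 1 := by simp
  change f (F (chartPt a b p.1 (‖(p.2 : 𝔼 d)‖⁻¹ • _))) = _
  rw [hn, inv_one, one_smul]
  rfl

lemma cylPt_snd_ne_zero (p : ℝ × 𝕊 d) : (cylPt p).snd ≠ 0 := by
  change (p.2 : 𝔼 d) ≠ 0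
  exact ne_zero_of_mem_unit_sphere p.2

lemma eventually_cylPt {p : ℝ × 𝕊 d}
    (hp : p.1 ∈ Ioo (0 : ℝ) 1) : ∀ᶠ z in 𝓝 (cylPt p), z.snd ≠ 0 ∧ z.fst ∈ Ioo (0 : ℝ) 1 :=
  (Cyl.continuous_snd.continuousAt.eventually_mem
    (isOpen_compl_singleton.mem_nhds (cylPt_snd_ne_zero p))).and
    (Cyl.continuous_fst.continuousAt.eventually_mem (x := cylPt p) (isOpen_Ioo.mem_nhds hp))

lemma chartPull_extend_outer (u : C.Mbar → ℝ) (κ : C.Side) {q : Cyl d}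
    (hq : q.snd ≠ 0 ∧ q.fst ∈ Ioo (0 : ℝ) 1) :
    chartPull (C.sframe κ) (δ₀ * C.ρ) (δ₁ * C.ρ) (homExt (sph d) (C.extend u)) q =
      C.pull κ u q := by
  have h1 := C.inner_lt_outer
  have h2 := C.inner_mem.1
  rw [C.chartPull_extend u κ _ _ hq.1 ⟨by nlinarith [hq.2.1], by nlinarith [hq.2.2]⟩,
    C.fold_outer hq.2.1.le, C.cut_eq_one (by nlinarith [hq.2.1]), one_mul, add_sub_cancel]
  rfl

lemma chartPull_extend_half (u : C.Mbar → ℝ) (κ : C.Side) {q : Cyl d}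
    (hq : q.snd ≠ 0 ∧ q.fst ∈ Ioo (0 : ℝ) 1) :
    chartPull (C.sframe κ) (δ₀ * C.ρ) (δ₀ * C.ρ / 2) (homExt (sph d) (C.extend u)) q =
      C.mean κ u + (1 - q.fst / 1) * (C.pull κ u q - C.mean κ u) := by
  have h1 := C.inner_lt_outer
  have h2 := C.inner_mem.1
  rw [C.chartPull_extend u κ _ _ hq.1 ⟨by nlinarith [hq.2.2], by nlinarith [hq.2.1]⟩,
    C.fold_inner (by nlinarith [hq.2.1]), C.cut_half _ (Ioo_subset_Icc_self hq.2),
    sub_sub_cancel, div_one]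
  rfl

lemma chartPull_extend_core (u : C.Mbar → ℝ) (κ : C.Side) {q : Cyl d}
    (hq : q.snd ≠ 0 ∧ q.fst ∈ Ioo (0 : ℝ) 1) :
    chartPull (C.sframe κ) (δ₀ * C.ρ / 2) 0 (homExt (sph d) (C.extend u)) q = C.mean κ u := by
  have h1 := C.inner_lt_outer
  have h2 := C.inner_mem.1
  rw [C.chartPull_extend u κ _ _ hq.1 ⟨by nlinarith [hq.2.2], by nlinarith [hq.2.1]⟩,
    C.cut_eq_zero (by nlinarith [hq.2.1]), zero_mul, add_zero]

lemma homExt_extend_eventuallyEq (u : C.Mbar → ℝ) {x : Amb d} (hx : x ∈ C.M) :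
    homExt (sph d) (C.extend u) =ᶠ[𝓝 x] homExt C.Mbar u := by
  filter_upwards [C.eventually_mem_M hx] with z hz
  rw [rayConst_homExt _ _ z, rayConst_homExt _ u z, homExt_of_mem subset_rfl _ hz.1,
    homExt_of_mem C.Mbar_subset_sph u (C.M_subset_Mbar hz),
    C.extend_of_mem (x := ⟨_, hz.1⟩) (C.M_subset_Mbar hz)]

lemma ae_mem_M_compl_U : ∀ᵐ x ∂(sphVol d).restrict C.Uᶜ, x ∈ C.M := by
  filter_upwards [ae_restrict_mem C.measurableSet_U.compl, ae_restrict_of_ae (ae_mem_sph d)]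
    with x hx hxs using C.mem_M_of_notMem_U hxs hx

lemma enorm_mean_sq_le {u : C.Mbar → ℝ} (hu : Continuous u) :
    ∫⁻ _, ‖C.mean κ u‖ₑ ^ 2 ∂cylVol d ≤ ∫⁻ p, ‖C.val κ u p‖ₑ ^ 2 ∂cylVol d := by
  rw [lintegral_const]
  by_cases h0 : cylVol d univ = 0
  · simp [h0]
  have := enorm_average_sub_sq_le h0 (C.integrable_val κ hu) 0
  simp only [sub_zero] at this
  calc _ ≤ (cylVol d univ)⁻¹ * (∫⁻ p, ‖C.val κ u p‖ₑ ^ 2 ∂cylVol d) * cylVol d univ := by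
        gcongr; exact this
    _ = ((cylVol d univ)⁻¹ * cylVol d univ) * ∫⁻ p, ‖C.val κ u p‖ₑ ^ 2 ∂cylVol d := by ring
    _ = _ := by rw [ENNReal.inv_mul_cancel h0 (measure_ne_top _ _), one_mul]

omit C in
lemma exists_lintegral_val_sub_mean_le (hd2 : 2 ≤ d) : ∃ P : ℝ≥0∞, P ≠ ⊤ ∧
    ∀ (C : HandleConfig d δ₀ δ₁) (κ : C.Side) (u : C.Mbar → ℝ) (K : ℝ≥0),
      LipschitzWith K u → ∫⁻ p, ‖C.val κ u p - C.mean κ u‖ₑ ^ 2 ∂cylVol d ≤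
        P * ∫⁻ p, C.grd κ u p ∂cylVol d := by
  obtain ⟨P, hPt, hP⟩ := exists_lintegral_sub_average_le hd2
  refine ⟨P, hPt, fun C κ u K hu => ?_⟩
  have h := hP (C.pull κ u) (measurable_chartPull (C.measurable_homExt hu.continuous) _ _ _)
    (fun s hs q => ?_) ?_ ?_
  · simp only [C.pull_cylPt] at h
    exact h
  · have e : ‖s • q.snd‖⁻¹ • s • q.snd = ‖q.snd‖⁻¹ • q.snd := by
      rw [norm_smul, Real.norm_of_nonneg hs.le, smul_smul, mul_inv, mul_right_comm,
        inv_mul_cancel₀ hs.ne', one_mul]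
    rw [scaleSnd_apply, pull, chartPull, chartPull]
    simp [*]
  · obtain ⟨L, hL⟩ := C.exists_lipschitzOnWith_pull κ hu (show (0 : ℝ) < 1 / 8 by norm_num)
    exact ⟨L, hL.mono fun q hq => ⟨Ioo_subset_Icc_self hq.1, hq.2.1.le⟩⟩
  · obtain ⟨M, hM⟩ := C.exists_norm_homExt_le hu.continuous
    exact ⟨M, fun q => hM _⟩

lemma sqInt_extend_le {u : C.Mbar → ℝ} {K : ℝ≥0} (hu : LipschitzWith K u) :
    sqInt (sphereMfd d).vol (C.extend u) ≤ (1 + 4 * chartConst d δ₁) * sqInt C.mfd.vol u := by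
  obtain ⟨L, hL⟩ := C.exists_lipschitzWith_extend hu
  have hm : Measurable fun x => ‖homExt (sph d) (C.extend u) x‖ₑ ^ 2 :=
    (measurable_homExt_of_measurableSet Metric.isClosed_sphere.measurableSet
      hL.continuous).enorm.pow_const 2
  have hA := C.inner_mem.1
  have hAB := C.inner_lt_outer
  rw [sqInt_sphereMfd, C.sqInt_eq hu.continuous]
  refine (C.lintegral_sphVol_le _).trans ?_
  rw [mul_add]
  refine add_le_add ?_ ?_
  · refine (lintegral_mono_ae ?_).trans (le_mul_of_one_le_left' (self_le_add_right 1 _))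
    filter_upwards [C.ae_mem_M_compl_U] with x hx
    rw [(C.homExt_extend_eventuallyEq u hx).eq_of_nhds]
  · rw [Finset.mul_sum]
    refine Finset.sum_le_sum fun κ _ => ?_
    set V := ∫⁻ p, ‖C.val κ u p‖ₑ ^ 2 ∂cylVol d with hV
    have key : ∀ a b : ℝ, a ∈ Icc 0 (δ₁ * C.ρ) → b ∈ Icc 0 (δ₁ * C.ρ) → a ≠ b → ∀ g : _ → ℝ≥0∞,
        (∀ p, p.1 ∈ Ioo (0 : ℝ) 1 → ‖chartPull (C.sframe κ) a b (homExt (sph d) (C.extend u))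
          (cylPt p)‖ₑ ^ 2 ≤ g p) →
        ∫⁻ x in C.cone κ a b, ‖homExt (sph d) (C.extend u) x‖ₑ ^ 2 ∂sphVol d ≤
          chartConst d δ₁ * (ofReal (C.ρ ^ d) * ∫⁻ p, g p ∂cylVol d) := by
      refine fun a b ha hb hab g hg => (C.setLIntegral_cone_le κ ha hb hab hm).trans ?_
      gcongr 2
      refine lintegral_mono_ae ?_
      filter_upwards [ae_cylVol_mem] with p hp
      have := hg p hp
      rwa [chartPull_cylPt] at this
    have h1 := key (δ₀ * C.ρ) (δ₁ * C.ρ) ⟨hA.le, hAB.le⟩ ⟨(hA.trans hAB).le, le_rfl⟩ hAB.ne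
      (fun p => ‖C.val κ u p‖ₑ ^ 2) fun p hp => by
        rw [C.chartPull_extend_outer u κ ⟨cylPt_snd_ne_zero p, hp⟩, pull_cylPt]; rfl
    have h2 := key (δ₀ * C.ρ) (δ₀ * C.ρ / 2) ⟨hA.le, hAB.le⟩ ⟨by linarith, by linarith⟩
      (by linarith) (fun p => ‖C.mean κ u‖ₑ ^ 2 + ‖C.val κ u p‖ₑ ^ 2) fun p hp => by
        rw [C.chartPull_extend_half u κ ⟨cylPt_snd_ne_zero p, hp⟩, pull_cylPt,
          ← ofReal_sq_eq_enorm, ← ofReal_sq_eq_enorm, ← ofReal_sq_eq_enorm,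
          ← ENNReal.ofReal_add (sq_nonneg _) (sq_nonneg _)]
        refine ofReal_le_ofReal ?_
        change (_ + (1 - p.1 / 1) * (C.val κ u p - _)) ^ 2 ≤ _ + C.val κ u p ^ 2
        rw [div_one]
        nlinarith [mul_nonneg (mul_nonneg hp.1.le (by linarith [hp.2] : 0 ≤ 1 - p.1))
          (sq_nonneg (C.val κ u p - C.mean κ u)), sq_nonneg (C.val κ u p),
          sq_nonneg (C.mean κ u), hp.1, hp.2, mul_nonneg hp.1.le (sq_nonneg (C.val κ u p)),
          mul_nonneg (by linarith [hp.2] : 0 ≤ 1 - p.1) (sq_nonneg (C.mean κ u))]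
    have h3 := key (δ₀ * C.ρ / 2) 0 ⟨by linarith, by linarith⟩ ⟨le_rfl, (hA.trans hAB).le⟩
      (by linarith) (fun _ => ‖C.mean κ u‖ₑ ^ 2) fun p hp => by
        rw [C.chartPull_extend_core u κ ⟨cylPt_snd_ne_zero p, hp⟩]
    have hmean := C.enorm_mean_sq_le κ hu.continuous
    rw [lintegral_add_left measurable_const] at h2
    calc _ ≤ chartConst d δ₁ * (ofReal (C.ρ ^ d) * V) + (chartConst d δ₁ *
          (ofReal (C.ρ ^ d) * (V + V)) + chartConst d δ₁ * (ofReal (C.ρ ^ d) * V)) :=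
          add_le_add h1 (add_le_add (h2.trans (by gcongr)) (h3.trans (by gcongr)))
      _ = 4 * chartConst d δ₁ * (ofReal (C.ρ ^ d) * V) := by ring
      _ ≤ _ := by gcongr; exact le_add_self

lemma dirichlet_extend_le {P : ℝ≥0∞} {u : C.Mbar → ℝ} {K : ℝ≥0} (hu : LipschitzWith K u)
    (hP : ∀ κ, ∫⁻ p, ‖C.val κ u p - C.mean κ u‖ₑ ^ 2 ∂cylVol d ≤ P * ∫⁻ p, C.grd κ u p ∂cylVol d) :
    (sphereMfd d).dirichlet (C.extend u) ≤ (1 + chartConst d δ₁ *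
      ofReal ((min (δ₀ / 2) (δ₁ - δ₀) ^ 2)⁻¹) * (3 + 2 * P)) * C.mfd.dirichlet u := by
  set c := min (δ₀ / 2) (δ₁ - δ₀) with hc'
  have hc : 0 < c := lt_min (half_pos hC.pos) (sub_pos.2 hC.lt)
  have hρ := C.ρ_pos
  have hc1 : c * C.ρ ≤ δ₀ * C.ρ / 2 := by
    have : c * C.ρ ≤ δ₀ / 2 * C.ρ := by gcongr; exact min_le_left _ _
    linarith
  have hc2 : c * C.ρ ≤ δ₁ * C.ρ - δ₀ * C.ρ := by rw [← sub_mul]; gcongr; exact min_le_right _ _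
  have hA := C.inner_mem.1
  have hAB := C.inner_lt_outer
  have hray := rayConst_homExt (sph d) (C.extend u)
  rw [dirichlet_sphereMfd, C.dirichlet_eq]
  refine (C.lintegral_sphVol_le _).trans ?_
  rw [mul_add]
  refine add_le_add ?_ ?_
  · refine (lintegral_mono_ae ?_).trans (le_mul_of_one_le_left' (self_le_add_right 1 _))
    filter_upwards [C.ae_mem_M_compl_U] with x hx
    rw [(C.homExt_extend_eventuallyEq u hx).fderiv_eq]
  · rw [Finset.mul_sum]
    refine Finset.sum_le_sum fun κ _ => ?_
    set G := ∫⁻ p, C.grd κ u p ∂cylVol d with hG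
    have h1 := C.setLIntegral_fderiv_le κ hc (a := δ₀ * C.ρ) (b := δ₁ * C.ρ)
      ⟨by linarith, hAB.le⟩ ⟨by linarith, le_rfl⟩ (hc2.trans (le_abs_self _)) hray
    have h2 := C.setLIntegral_fderiv_le κ hc (a := δ₀ * C.ρ) (b := δ₀ * C.ρ / 2)
      ⟨by linarith, hAB.le⟩ ⟨by linarith, by linarith⟩
      (by rw [abs_sub_comm]; exact le_trans (by linarith) (le_abs_self _)) hray
    have e1 : ∫⁻ p, ‖fderiv ℝ (chartPull (C.sframe κ) (δ₀ * C.ρ) (δ₁ * C.ρ)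
        (homExt (sph d) (C.extend u))) (cylPt p)‖ₑ ^ 2 ∂cylVol d = G := by
      refine lintegral_congr_ae ?_
      filter_upwards [ae_cylVol_mem] with p hp
      have e : _ =ᶠ[𝓝 (cylPt p)] C.pull κ u :=
        (eventually_cylPt hp).mono fun z hz => C.chartPull_extend_outer u κ hz
      rw [grd, e.fderiv_eq]
    have e2 : ∫⁻ p, ‖fderiv ℝ (chartPull (C.sframe κ) (δ₀ * C.ρ) (δ₀ * C.ρ / 2)
        (homExt (sph d) (C.extend u))) (cylPt p)‖ₑ ^ 2 ∂cylVol d ≤ 2 * G + 2 * (P * G) := by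
      calc _ ≤ ∫⁻ p, (2 * C.grd κ u p + 2 * ‖C.val κ u p - C.mean κ u‖ₑ ^ 2) ∂cylVol d := by
            refine lintegral_mono_ae ?_
            filter_upwards [ae_cylVol_mem, C.ae_differentiableAt_pull κ hu] with p hp hdp
            have e : _ =ᶠ[𝓝 (cylPt p)] fun z : Cyl d =>
                C.mean κ u + (1 - z.fst / 1) * (C.pull κ u z - C.mean κ u) :=
              (eventually_cylPt hp).mono fun z hz => C.chartPull_extend_half u κ hz
            have := enorm_fderiv_linear_mul_sq_le one_pos (z := cylPt p)
              (Ioo_subset_Icc_self hp) (hdp.sub_const (C.mean κ u))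
            rw [fderiv_sub_const, inv_one, one_pow, ofReal_one, one_mul, pull_cylPt] at this
            rw [e.fderiv_eq, fderiv_const_add]
            exact this
        _ = 2 * G + 2 * ∫⁻ p, ‖C.val κ u p - C.mean κ u‖ₑ ^ 2 ∂cylVol d := by
            rw [lintegral_add_left ((C.measurable_grd κ u).const_mul 2),
              lintegral_const_mul' _ _ ofNat_ne_top,
              lintegral_const_mul' _ _ ofNat_ne_top]
        _ ≤ _ := by gcongr; exact hP κ
    have h3 : ∫⁻ x in C.cone κ (δ₀ * C.ρ / 2) 0,
        ‖fderiv ℝ (homExt (sph d) (C.extend u)) x‖ₑ ^ 2 ∂sphVol d = 0 := by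
      have hop : IsOpen (C.cone κ (δ₀ * C.ρ / 2) 0) :=
        isOpen_chartCone.preimage (C.sframe κ).symm.continuous
      refine setLIntegral_eq_zero hop.measurableSet fun x hx => ?_
      have e : homExt (sph d) (C.extend u) =ᶠ[𝓝 x] fun _ => C.mean κ u := by
        filter_upwards [hop.mem_nhds hx] with z hz
        rw [hray.eq_chartPull (C.sframe κ) (by linarith) hz]
        refine C.chartPull_extend_core u κ ⟨?_, hz.2.2⟩
        rw [← norm_ne_zero_iff, norm_snd_chartInv hz.2.1]
        exact norm_ne_zero_iff.2 (ne_zero_of_snd_ne_zero hz.2.1)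
      rw [e.fderiv_eq, fderiv_const_apply, ← ofReal_norm, norm_zero]; simp
    rw [h3, add_zero]
    rw [e1] at h1
    refine (add_le_add h1 (h2.trans (mul_le_mul' le_rfl (mul_le_mul' le_rfl e2)))).trans ?_
    set k := chartConst d δ₁ * ofReal ((c ^ 2)⁻¹)
    set r := ofReal ((C.ρ ^ 2)⁻¹ * C.ρ ^ d)
    calc _ = k * (3 + 2 * P) * (r * G) := by ring
      _ ≤ _ := mul_le_mul' le_add_self le_rfl

omit C in
/-- The extension operators of the condition (a2). -/
theorem exists_extension_operator (hd2 : 2 ≤ d) : ∃ c : ℝ≥0, ∀ C : HandleConfig d δ₀ δ₁,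
    ∃ π : C.mfd.L2 → (sphereMfd d).L2, (∀ u, C.mfd.MemH1 u → (sphereMfd d).MemH1 (π u) ∧
        (∀ᵐ x ∂C.mfd.vol, π u (C.incl x) = u x) ∧
        (sphereMfd d).h1Norm (π u) ≤ c * C.mfd.h1Norm u) ∧
      (∀ u v, C.mfd.MemH1 u → C.mfd.MemH1 v → π (u + v) = π u + π v) ∧
      (∀ (a : ℝ) u, C.mfd.MemH1 u → π (a • u) = a • π u) := by
  obtain ⟨P, hPt, hP⟩ := exists_lintegral_val_sub_mean_le (δ₀ := δ₀) (δ₁ := δ₁) hd2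
  have hct : chartConst d δ₁ ≠ ⊤ := ofReal_ne_top
  set K₁ := 1 + 4 * chartConst d δ₁ with hK₁
  set K₂ := 1 + chartConst d δ₁ * ofReal ((min (δ₀ / 2) (δ₁ - δ₀) ^ 2)⁻¹) * (3 + 2 * P) with hK₂
  have hK : K₁ + K₂ ≠ ⊤ := by finiteness
  refine ⟨_, fun C => C.isRegular_mfd.exists_extension (K := (K₁ + K₂).toNNReal)
    (E := C.extend) C.quasiMeasurePreserving_incl ?_ ?_ ?_ ?_ ?_ ?_⟩
  · rintro w ⟨L, hL⟩
    exact memLp_sphereMfd hL.continuous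
  · rintro u ⟨K, hu⟩
    exact C.exists_lipschitzWith_extend hu
  · rintro a b u ⟨K, hu⟩ v ⟨K', hv⟩
    exact C.extend_linear a b hu.continuous hv.continuous
  · rintro u - p
    exact C.extend_of_mem (x := C.incl p) p.2
  · rintro u ⟨K, hu⟩
    rw [ENNReal.coe_toNNReal hK]
    exact (C.sqInt_extend_le hu).trans (mul_le_mul' le_self_add le_rfl)
  · rintro u ⟨K, hu⟩
    rw [ENNReal.coe_toNNReal hK]
    exact (C.dirichlet_extend_le hu (hP C · u K hu)).trans (mul_le_mul' le_add_self le_rfl)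

end HandleConfig

instance {d : ℕ} : IsFiniteMeasure (sphVol d) := by unfold sphVol; infer_instance

namespace HandleConfig

variable {d : ℕ} {δ₀ δ₁ : ℝ} (C : HandleConfig d δ₀ δ₁) [hC : Admissible δ₀ δ₁] [NeZero d]

lemma card_mul_le (hη : C.η ≤ 1) : C.m * (cylVol d univ * ofReal ((C.η / 2) ^ d)) ≤
      ofReal √(d.factorial * 4 ^ d) * sphVol d univ := by
  set s := C.η / 2 with hs'
  have hs : 0 < s := half_pos C.η_pos
  have hs1 : s ≤ 1 / 2 := by linarith
  set c := √((d.factorial : ℝ) * 4 ^ d)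
  have hsA : s / 2 ∈ Icc 0 s := ⟨by linarith, by linarith⟩
  have hsB : s ∈ Icc 0 s := ⟨hs.le, le_rfl⟩
  have hne : s / 2 ≠ s := by linarith
  set D : Fin C.m → Set (Amb d) := fun i => (C.frame i).symm ⁻¹' chartCone d (s / 2) s ∩ sph d
  have hDm : ∀ i, MeasurableSet (D i) := fun i =>
    ((C.frame i).symm.continuous.measurable measurableSet_chartCone).inter
      Metric.isClosed_sphere.measurableSet
  have hDcap : ∀ i, D i ⊆ openCap (C.frame i (toLp 2 (1, 0))) C.η := by
    rintro i x ⟨hx, hxs⟩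
    have h1 := norm_snd_mem_of_mem_chartCone hsA hsB hne (by simpa using hxs) hx
    have hη0 := C.η_pos
    have h2 := Real.sin_gt_sub_cube hη0
    have h3 : C.η ^ 3 ≤ C.η := pow_le_of_le_one hη0.le hη three_ne_zero
    have hπ := Real.pi_gt_three
    refine ⟨hxs, ((angle_lt_arcsin_iff (C.frame i) hxs (t := Real.sin C.η)
      ⟨by linarith, (Real.sin_lt hη0).trans_le hη⟩).2 ⟨hx.1, by linarith [h1.2]⟩).trans_eq
      (Real.arcsin_sin (by linarith) (by linarith))⟩
  have key : ∀ i, cylVol d univ * ofReal (s ^ d) ≤ ofReal c * sphVol d (D i) := by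
    intro i
    have h := lintegral_chartPt_frame ⟨hsA.1, by linarith⟩ ⟨hs.le, by linarith⟩ hne (C.frame i)
      (f := fun _ => 1) measurable_const
    simp only [one_mul, lintegral_one] at h
    rw [← h, mul_comm, ← lintegral_const_mul' _ _ ofReal_ne_top,
      ← lintegral_indicator_const (hDm i)]
    refine (lintegral_mono_ae ?_).trans (setLIntegral_le_lintegral _ _)
    filter_upwards [ae_restrict_mem ((C.frame i).symm.continuous.measurable
      measurableSet_chartCone), ae_restrict_of_ae (ae_mem_sph d)] with x hx hxs
    rw [indicator_of_mem (show x ∈ D i from ⟨hx, hxs⟩), ← ofReal_mul (by positivity)]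
    have h1 := norm_snd_mem_of_mem_chartCone (a := s / 2) (b := s) ⟨le_rfl, by linarith⟩
      ⟨by linarith, le_rfl⟩ hne (by simpa using hxs) hx
    refine ofReal_le_ofReal ((chartJac_bounds (C.frame i) hs hs1 (by norm_num) hsA hsB hne
      (mem_sphere_zero_iff_norm.1 hxs) hx).2 4 (by nlinarith) ?_)
    nlinarith [h1.1]
  calc _ = ∑ _ : Fin C.m, cylVol d univ * ofReal (s ^ d) := by simp
    _ ≤ ∑ i, ofReal c * sphVol d (D i) := Finset.sum_le_sum fun i _ => key i
    _ ≤ _ := by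
      rw [← Finset.mul_sum]
      gcongr
      refine sum_measure_le_measure_univ (fun i _ => (hDm i).nullMeasurableSet)
        fun i _ j _ hij => Disjoint.aedisjoint ?_
      exact (C.packing_disjoint i j hij).mono (hDcap i) (hDcap j)

lemma measure_compl_M_le (hη : C.η ≤ 1) : sphVol d C.Mᶜ ≤
    2 * chartConst d δ₁ * (ofReal √(d.factorial * 4 ^ d) * sphVol d univ) *
      ofReal ((2 * C.ε) ^ d) := by
  have hB := C.outer_mem
  have hcov : C.Mᶜ ≤ᵐ[sphVol d] ⋃ κ, C.cone κ (δ₁ * C.ρ) 0 := by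
    filter_upwards [ae_all_iff.2 fun κ => ae_snd_ne_zero (C.sframe κ), ae_mem_sph d]
      with x h3 hx hxM
    have h : ∃ i, C.rad i x ≤ δ₀ * C.ρ := by
      by_contra! h'
      exact hxM (C.mem_M.2 ⟨hx, h'⟩)
    obtain ⟨i, hi⟩ := h
    have hAB := C.inner_lt_outer
    obtain ⟨κ, rfl, h0⟩ := C.exists_pos_of_rad_le hx (hi.trans hAB.le)
    refine mem_iUnion.2 ⟨κ, h0, h3 κ, ?_⟩
    have hpos : 0 < C.rad κ.1 x := by rw [← norm_snd_sframe]; exact norm_pos_iff.2 (h3 κ)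
    rw [norm_snd_sframe, C.norm_symm hx, inv_one, mul_one]
    refine ⟨div_pos_of_neg_of_neg (by linarith) (by linarith), ?_⟩
    rw [div_lt_one_of_neg (by linarith)]; linarith
  have hκ : ∀ κ, sphVol d (C.cone κ (δ₁ * C.ρ) 0) ≤
      chartConst d δ₁ * (ofReal (C.ρ ^ d) * cylVol d univ) := fun κ => by
    simpa using C.setLIntegral_cone_le κ ⟨hB.1.le, le_rfl⟩ ⟨le_rfl, hB.1.le⟩ hB.1.ne'
      (f := fun _ => 1) measurable_const
  have e : C.ρ ^ d = (2 * C.ε) ^ d * (C.η / 2) ^ d := by rw [← mul_pow, ρ]; ring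
  have h2ε := C.ε_pos
  calc _ ≤ _ := (measure_mono_ae hcov).trans (measure_iUnion_le _)
    _ ≤ ∑ _ : C.Side, chartConst d δ₁ * (ofReal (C.ρ ^ d) * cylVol d univ) := by
        rw [tsum_fintype]; exact Finset.sum_le_sum fun κ _ => hκ κ
    _ = 2 * chartConst d δ₁ * (C.m * (cylVol d univ * ofReal ((C.η / 2) ^ d))) *
          ofReal ((2 * C.ε) ^ d) := by
        rw [e, ofReal_mul (by positivity)]
        simp
        ring
    _ ≤ _ := mul_le_mul' (mul_le_mul' le_rfl (C.card_mul_le hη)) le_rfl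

omit C in
/-- The condition (a3). -/
theorem tendstoInMeasure_indicator_M {C : ℕ → HandleConfig d δ₀ δ₁}
    (hη : Tendsto (fun h => (C h).η) atTop (𝓝 0)) (hε : Tendsto (fun h => (C h).ε) atTop (𝓝 0)) :
    TendstoInMeasure (sphVol d) (fun h => (C h).M.indicator (fun _ => (1 : ℝ))) atTop
      (fun _ => (1 : ℝ)) := by
  intro a ha
  have lim : Tendsto (fun h => 2 * chartConst d δ₁ * (ofReal √(d.factorial * 4 ^ d) *
      sphVol d univ) * ofReal ((2 * (C h).ε) ^ d)) atTop (𝓝 0) := by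
    refine tendsto_mul_zero (by unfold chartConst; finiteness) ?_
    simpa [NeZero.ne d] using ENNReal.tendsto_ofReal ((hε.const_mul 2).pow d)
  refine tendsto_of_tendsto_of_tendsto_of_le_of_le' tendsto_const_nhds lim
    (Eventually.of_forall fun _ => zero_le) ?_
  filter_upwards [hη.eventually_le_const one_pos] with h hh
  refine (measure_mono fun x hx => ?_).trans ((C h).measure_compl_M_le hh)
  intro hxM
  simp [indicator_of_mem hxM] at hx
  exact ha.ne' hx

end HandleConfig

end

theorem mainTheorem4 (d : ℕ) (hd : 2 ≤ d) (δ₀ δ₁ : ℝ) (hδ₀ : 0 < δ₀) (hδ : δ₀ < δ₁) (hδ₁ : δ₁ < 1)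
    (C : ℕ → HandleConfig d δ₀ δ₁)
    (hη : Tendsto (fun h => (C h).η) atTop (𝓝 0))
    (hε : Tendsto (fun h => (C h).ε) atTop (𝓝 0))
    (hηε : Tendsto (fun h => (C h).η / (C h).ε) atTop (𝓝 0)) :
    -- (i) representation of `N_h` by the relaxed manifold
    (∀ h, (C h).mfd.IsRelaxedManifold (C h).T ((C h).mfd.inftyMeasure (C h).bdry) ∧
      LipRiem.IsRepresentedBy (C h).attached (C h).mfd (C h).T
        ((C h).mfd.inftyMeasure (C h).bdry)) ∧
    -- (a1) uniform comparability of the metrics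
    (∃ Λ : ℝ, 0 < Λ ∧ ∀ h, ∀ x ∈ (C h).M, ∀ ξ : Amb d, inner ℝ x ξ = 0 →
      0 ≤ Λ⁻¹ * roundMetric d x ξ ξ ∧ Λ⁻¹ * roundMetric d x ξ ξ ≤ (C h).gh x ξ ξ ∧
      (C h).gh x ξ ξ ≤ Λ * roundMetric d x ξ ξ) ∧
    -- (a2) linear extension operators from `H¹(M_h, g_h)` to `H¹(S^d, g)`, uniformly bounded
    (∃ c : ℝ≥0, ∀ h, ∃ π : (C h).mfd.L2 → (sphereMfd d).L2,
      (∀ u, (C h).mfd.MemH1 u → (sphereMfd d).MemH1 (π u) ∧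
        (∀ᵐ x ∂(C h).mfd.vol, π u ((C h).incl x) = u x) ∧
        (sphereMfd d).h1Norm (π u) ≤ c * (C h).mfd.h1Norm u) ∧
      (∀ u v, (C h).mfd.MemH1 u → (C h).mfd.MemH1 v → π (u + v) = π u + π v) ∧
      (∀ (a : ℝ) u, (C h).mfd.MemH1 u → π (a • u) = a • π u)) ∧
    -- (a3) convergence in measure of the characteristic functions
    TendstoInMeasure (sphVol d) (fun h => (C h).M.indicator (fun _ => (1 : ℝ))) atTop
      (fun _ => (1 : ℝ)) ∧
    -- (a4) invariance of the domain
    (∀ h, (fun x : Amb d => -x) '' (C h).M = (C h).M) ∧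
    -- (a5) invariance of the canonical measure
    (∀ h, Measure.map (C h).T (C h).mfd.vol = (C h).mfd.vol ∧
      ∀ᵐ x ∂(sphVol d).restrict (C h).M,
        volDensity (C h).gh x = volDensity (C h).gh (-x) * |(antipodalJacobian x).det|) ∧
    -- (a6) invariance of the metric
    (∀ h, ∀ᵐ x ∂(sphVol d).restrict (C h).M, ∀ i j,
      metricInv (C h).gh (-x) i j =
        ∑ k, ∑ l, antipodalJacobian x i l * antipodalJacobian x j k *
          metricInv (C h).gh x l k) := by
  have : HandleConfig.Admissible δ₀ δ₁ := ⟨hδ₀, hδ, hδ₁⟩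
  have : NeZero d := ⟨by omega⟩
  obtain ⟨hΛ, -⟩ := HandleConfig.compConst_props (δ₀ := δ₀) (δ₁ := δ₁)
  refine ⟨fun h => ⟨(C h).isRelaxedManifold_mfd, (C h).isRepresentedBy_mfd⟩,
    ⟨HandleConfig.compConst δ₀ δ₁, by linarith, fun h x hx ξ hξ => ?_⟩, ?_,
    HandleConfig.tendstoInMeasure_indicator_M hη hε, fun h => (C h).neg_image_M,
    fun h => ⟨(C h).map_T_vol, ?_⟩, fun h => ?_⟩
  · have h1 := (C h).gh_comparison ((C h).M_subset_Mbar hx) hξ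
    rw [roundMetric, real_inner_self_eq_norm_sq]
    exact ⟨by positivity, h1⟩
  · obtain ⟨c, hc⟩ := HandleConfig.exists_extension_operator (δ₀ := δ₀) (δ₁ := δ₁) hd
    exact ⟨c, fun h => hc (C h)⟩
  · filter_upwards [ae_restrict_mem (C h).measurableSet_M] with x hx
    exact (C h).volDensity_gh_neg ((C h).M_subset_Mbar hx)
  · filter_upwards [ae_restrict_mem (C h).measurableSet_M] with x hx
    exact (C h).metricInv_gh_neg ((C h).M_subset_Mbar hx)
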